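/- Theorem. Let $d\ge 1$ and $m>0$. On Minkowski space $\mathbb{R}^{1,d-1}$ write $x=(x^0,\vec x)$, $px=-p^0x^0+\vec p\cdot\vec x$, $x^2=-(x^0)^2+\vec x^2$, $\Box=-\partial_0^2+\partial_1^2+\dots+\partial_{d-1}^2$, $J^{\vee/\wedge}=\{x : x^2\le 0,\ \pm x^0\ge 0\}$, and let $\theta$ be the Heaviside function. All boundary values $\pm\mathrm{i}0$ are limits in the sense of tempered distributions. Let $$\mathbf{F}_\alpha(z)=\sum_{j\ge0}\frac{z^j}{\Gamma(\alpha+1+j)\,j!},$$ and let $U_\alpha$ be the principal branch on $\mathbb{C}\setminus\,]-\infty,0]$ of the analytic function given for $\operatorname{Re}z>0$ by $U_\alpha(z)=\frac1{\sqrt\pi}\int_0^\infty \mathrm{e}^{-t-z/t}\,t^{-\alpha-1}\,\mathrm{d}t$. Then the Klein--Gordon operator $m^2-\Box$ has a unique retarded and a unique advanced Green function, i.e. a unique tempered distribution $G_m^{\vee/\wedge}$ with $(m^2-\Box)G_m^{\vee/\wedge}=\delta$ and $\operatorname{supp}G_m^{\vee/\wedge}\subset J^{\vee/\wedge}$, and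 $$G_m^{\vee/\wedge}(x)=\int\frac{\mathrm{e}^{\mathrm{i}px}}{m^2+p^2\mp\mathrm{i}0\,\operatorname{sgn}p^0}\,\frac{\mathrm{d}p}{(2\pi)^d}$$ $$=\theta(\pm x^0)\,\frac{-\mathrm{i}\sqrt\pi\,m^{d-2}}{(4\pi)^{d/2}}\Big(U_{\frac d2-1}\Big(\frac{m^2x^2-\mathrm{i}0}{4}\Big)-U_{\frac d2-1}\Big(\frac{m^2x^2+\mathrm{i}0}{4}\Big)\Big)$$ $$=\theta(\pm x^0)\,\frac{2\pi}{(4\pi)^{d/2}}\Big(\frac{x^2}{4}\Big)_-^{1-\frac d2}\,\mathbf{F}_{1-\frac d2}\Big(\frac{m^2x^2}{4}\Big).$$ Here multiplication of a distribution by $\theta(\pm x^0)$ means the limit, as $R\to\infty$, of multiplication by $\chi(\pm R x^0)$, for any smooth $\chi$ equal to $0$ on $]-\infty,-1]$ and to $1$ on $[1,\infty[$. For odd $d$ the last line contains the product of the distribution $(x^2/4)_-^{1-d/2}$ with a smooth function, where for $a\notin\mathbb{Z}$ and $c>0$ $$(cx^2)_-^{a}=\frac{1}{2\mathrm{i}\sin\pi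 a}\Big(-\mathrm{e}^{-\mathrm{i}\pi a/2}(\mathrm{i}cx^2+0)^a+\mathrm{e}^{\mathrm{i}\pi a/2}(-\mathrm{i}cx^2+0)^a\Big).$$ For even $d$ it is, by definition, $m^{d-2}\,w_-^{-\alpha}\mathbf{F}_{-\alpha}(w)$ at $w=\frac{m^2x^2}{4}$, with $\alpha=\frac d2-1$ and $w_-^{-\alpha}\mathbf{F}_{-\alpha}(w):=\frac{\mathrm{i}}{2\sqrt\pi}\big(U_\alpha(w+\mathrm{i}0)-U_\alpha(w-\mathrm{i}0)\big)$. Moreover $G_m^{\vee/\wedge}=G_{m,\mathrm{sing}}^{\vee/\wedge}+G_{m,\mathrm{reg}}^{\vee/\wedge}$, where $G_{m,\mathrm{reg}}^{\vee/\wedge}$ is a regular distribution (given by a locally integrable function), as follows. For odd $d$ (for $d=1$ the second sum starts at $j=0$; the series converges whenever $x^2<0$): $$G_{m,\mathrm{sing}}^{\vee/\wedge}(x)=\frac{\theta(\pm x^0)}{2\pi^{\frac d2-1}}\sum_{j=0}^{\frac{d-5}{2}}\frac{(-1)^j}{j!\,\Gamma(2-\frac d2+j)}\Big(\frac{m^2}{4}\Big)^{j}(x^2)_-^{1-\frac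 d2+j},$$ $$G_{m,\mathrm{reg}}^{\vee/\wedge}(x)=\frac{\theta(\pm x^0)}{2\pi^{\frac d2-1}}\sum_{j=\frac{d-3}{2}}^{\infty}\frac{(-1)^j}{j!\,\Gamma(2-\frac d2+j)}\Big(\frac{m^2}{4}\Big)^{j}(-x^2)^{1-\frac d2+j}\,\theta(-x^2).$$ For even $d$: $$G_{m,\mathrm{sing}}^{\vee/\wedge}(x)=\theta(\pm x^0)\,\frac{(-1)^{\frac d2}}{2\pi^{\frac d2-1}}\sum_{j=0}^{\frac d2-2}\frac{1}{(\frac d2-2-j)!}\Big(\frac{m^2}{4}\Big)^{\frac d2-2-j}\delta^{(j)}(x^2),$$ $$G_{m,\mathrm{reg}}^{\vee/\wedge}(x)=\theta(\pm x^0)\,(-1)^{\frac d2-1}\,\frac{2\pi\,m^{d-2}}{(4\pi)^{\frac d2}}\,\mathbf{F}_{\frac d2-1}\Big(\frac{m^2x^2}{4}\Big)\theta(-x^2),$$ where $\delta^{(j)}(x^2)$ is the limit of $\rho_\varepsilon^{(j)}(x^2)$ as $\varepsilon\searrow0$, for $\rho_\varepsilon(w)=\varepsilon^{-1}\rho(w/\varepsilon)$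 and any $\rho\in C_c^\infty(\mathbb{R})$ with $\int\rho=1$. -/

import Mathlib

open MeasureTheory Filter Topology
open scoped SchwartzMap LineDeriv ContDiff

noncomputable section

namespace KleinGordon

/-! ### Minkowski space and tempered distributions on it -/

/-- The space `ℝ^{1,d-1}` as a measure and vector space; the coordinate `x 0` is the time `x⁰`. -/
abbrev Mink (d : ℕ) : Type := EuclideanSpace ℝ (Fin d)

/-- The Lorentzian product `p x = - p⁰ x⁰ + p¹ x¹ + ⋯ + p^{d-1} x^{d-1}`. -/
def lorentz {d : ℕ} [NeZero d] (p x : Mink d) : ℝ :=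
  -(p 0 * x 0) + ∑ i ∈ Finset.univ.erase (0 : Fin d), p i * x i

/-- The square `x² = - (x⁰)² + (x¹)² + ⋯ + (x^{d-1})²`. -/
def sq {d : ℕ} [NeZero d] (x : Mink d) : ℝ := lorentz x x

/-- The future cone (`s = 1`) and the past cone (`s = -1`). -/
def cone (d : ℕ) [NeZero d] (s : ℝ) : Set (Mink d) := {x | sq x ≤ 0 ∧ 0 ≤ s * x 0}

/-- The d'Alembertian `□ = - ∂₀² + ∂₁² + ⋯ + ∂_{d-1}²` on tempered distributions. -/
def box {d : ℕ} [NeZero d] (T : 𝓢'(Mink d, ℂ)) : 𝓢'(Mink d, ℂ) :=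
  -(∂_{EuclideanSpace.single (0 : Fin d) (1 : ℝ)} (∂_{EuclideanSpace.single (0 : Fin d) (1 : ℝ)} T))
    + ∑ i ∈ Finset.univ.erase (0 : Fin d),
        ∂_{EuclideanSpace.single i (1 : ℝ)} (∂_{EuclideanSpace.single i (1 : ℝ)} T)

/-- `T` is the retarded (`s = 1`) or advanced (`s = -1`) Green function of the Klein-Gordon
operator: `(m² - □) T = δ`, and `T` is supported in the future (past) cone. -/
def IsGreen {d : ℕ} [NeZero d] (m s : ℝ) (T : 𝓢'(Mink d, ℂ)) : Prop :=
  ((m : ℂ) ^ 2 • T - box T = TemperedDistribution.delta (0 : Mink d)) ∧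
    Distribution.dsupport T ⊆ cone d s

/-- The functions `f ε`, as regular distributions, converge to `T` as `ε ↘ 0`. -/
def IsDistLimit {d : ℕ} (f : ℝ → Mink d → ℂ) (T : 𝓢'(Mink d, ℂ)) : Prop :=
  ∀ φ : 𝓢(Mink d, ℂ), (∀ ε : ℝ, 0 < ε → Integrable (fun x => f ε x * φ x)) ∧
    Tendsto (fun ε : ℝ => ∫ x, f ε x * φ x) (𝓝[>] 0) (𝓝 (T φ))

/-- `T` is the regular distribution given by the locally integrable function `g`. -/
def IsRegularDist {d : ℕ} (g : Mink d → ℂ) (T : 𝓢'(Mink d, ℂ)) : Prop :=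
  LocallyIntegrable g ∧
    ∀ φ : 𝓢(Mink d, ℂ), Integrable (fun x => g x * φ x) ∧ T φ = ∫ x, g x * φ x

/-- `S = h T` for a smooth function `h` (not necessarily of moderate growth): the identity
`S(φ) = T(h φ)` holds for all compactly supported test functions `φ`. -/
def IsSmoothMul {d : ℕ} (h : Mink d → ℂ) (T S : 𝓢'(Mink d, ℂ)) : Prop :=
  ContDiff ℝ ∞ h ∧ ∀ φ ψ : 𝓢(Mink d, ℂ), HasCompactSupport φ → (∀ x, ψ x = h x * φ x) →
    S φ = T ψ

/-- `S = θ(s x⁰) T`, the product of the distribution `T` with the discontinuous function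
`θ(s x⁰)`: `S` is the limit of `χ(R s x⁰) T` as `R → ∞`, for every smooth `χ : ℝ → ℝ`
that is `0` on `]-∞,-1]` and `1` on `[1,∞[`. -/
def IsThetaMul {d : ℕ} [NeZero d] (s : ℝ) (T S : 𝓢'(Mink d, ℂ)) : Prop :=
  ∀ χ : ℝ → ℝ, ContDiff ℝ ∞ χ → (∀ t ≤ -1, χ t = 0) → (∀ t, 1 ≤ t → χ t = 1) →
    ∀ φ : 𝓢(Mink d, ℂ),
      Tendsto (fun R : ℝ =>
        (TemperedDistribution.smulLeftCLM ℂ (fun x : Mink d => ((χ (R * (s * x 0)) : ℝ) : ℂ)) T) φ)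
        atTop (𝓝 (S φ))

/-- The Heaviside function. -/
def theta (t : ℝ) : ℂ := if 0 < t then 1 else 0

/-! ### The Fourier integral with the `i0 sgn p⁰` prescription -/

/-- `G(x) = ∫ e^{ipx} / (m² + p² - s i0 sgn p⁰) dp / (2π)^d`, tested against `φ`; the boundary
value is the limit in the sense of tempered distributions of
`1 / (m² + p² - s i ε sgn p⁰)` as `ε ↘ 0`. -/
def IsFourierPropagator {d : ℕ} [NeZero d] (m s : ℝ) (G : 𝓢'(Mink d, ℂ)) : Prop :=
  ∀ φ : 𝓢(Mink d, ℂ),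
    (∀ ε : ℝ, 0 < ε → Integrable (fun p : Mink d =>
      1 / ((m : ℂ) ^ 2 + (sq p : ℂ) - (s * ε * Real.sign (p 0) : ℝ) * Complex.I) *
        ∫ x : Mink d, Complex.exp (Complex.I * (lorentz p x : ℂ)) * φ x)) ∧
    Tendsto (fun ε : ℝ => 1 / (2 * (Real.pi : ℂ)) ^ d *
      ∫ p : Mink d,
        1 / ((m : ℂ) ^ 2 + (sq p : ℂ) - (s * ε * Real.sign (p 0) : ℝ) * Complex.I) *
          ∫ x : Mink d, Complex.exp (Complex.I * (lorentz p x : ℂ)) * φ x)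
      (𝓝[>] 0) (𝓝 (G φ))

/-! ### The functions `𝐅_α` and `U_α` -/

/-- The Olver-normalized hypergeometric function `𝐅_α(z) = ∑ⱼ z^j / (Γ(α+1+j) j!)`.
(At the poles of `Γ` the Mathlib value `Γ = 0` gives the correct coefficient `1/Γ = 0`.) -/
def olverF (α z : ℂ) : ℂ :=
  ∑' j : ℕ, z ^ j / (Complex.Gamma (α + 1 + j) * (j.factorial : ℂ))

/-- The principal branch on `ℂ \ ]-∞,0]` of the solution `U_α` of the `₀F₁` equation that behaves
as `exp(-2√z) z^{-α/2-1/4}` at infinity.  For `z > 0` the substitution `t = √z u` turns the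
formula `U_α(z) = π^{-1/2} ∫₀^∞ e^{-t} e^{-z/t} t^{-α-1} dt` into the one below, whose integral
converges absolutely and is analytic on the whole slit plane (as `Re √z > 0` there). -/
def besselU (α z : ℂ) : ℂ :=
  1 / (Real.sqrt Real.pi : ℂ) * z ^ (-α / 2) *
    ∫ u in Set.Ioi (0 : ℝ),
      Complex.exp (-(z ^ (1 / 2 : ℂ)) * ((u : ℂ) + (u : ℂ)⁻¹)) * (u : ℂ) ^ (-α - 1)

/-- `W = U_{d/2-1}((m² x² + r i0)/4)`, where `r = 1` or `r = -1`. -/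
def IsUBoundaryValue {d : ℕ} [NeZero d] (m r : ℝ) (W : 𝓢'(Mink d, ℂ)) : Prop :=
  IsDistLimit (fun ε x =>
    besselU ((d : ℂ) / 2 - 1) (((m ^ 2 * sq x : ℝ) + (r * ε : ℝ) * Complex.I) / 4)) W

/-! ### The distributions `(c x²)_-^a` and `δ^{(j)}(x²)` -/

/-- The function of `w ∈ ℝ` whose limit as `ε ↘ 0` is the distribution `w_-^a`, for real `a`
that is not a negative integer:
`(2 i sin πa)⁻¹ (- e^{-iπa/2} (iw + ε)^a + e^{iπa/2} (-iw + ε)^a)`. -/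
def minusPowApprox (a ε w : ℝ) : ℂ :=
  1 / (2 * Complex.I * (Real.sin (Real.pi * a) : ℂ)) *
    (-Complex.exp (-(Complex.I * (Real.pi * a / 2 : ℝ))) *
        (Complex.I * (w : ℂ) + (ε : ℂ)) ^ (a : ℂ)
      + Complex.exp (Complex.I * (Real.pi * a / 2 : ℝ)) *
        (-(Complex.I * (w : ℂ)) + (ε : ℂ)) ^ (a : ℂ))

/-- `Q = (c x²)_-^a`, for non-integer `a`. -/
def IsMinusPow {d : ℕ} [NeZero d] (c a : ℝ) (Q : 𝓢'(Mink d, ℂ)) : Prop :=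
  IsDistLimit (fun ε x => minusPowApprox a ε (c * sq x)) Q

/-- `D = δ^{(j)}(x²)`: for every mollifier `ρ`, the functions `(ρ_ε)^{(j)}(x²)`, where
`ρ_ε(w) = ε⁻¹ ρ(w/ε)`, converge to `D`. -/
def IsDeltaSq {d : ℕ} [NeZero d] (j : ℕ) (D : 𝓢'(Mink d, ℂ)) : Prop :=
  ∀ ρ : ℝ → ℝ, ContDiff ℝ ∞ ρ → HasCompactSupport ρ → ∫ w, ρ w = 1 →
    IsDistLimit (fun ε x => ((iteratedDeriv j (fun w : ℝ => ε⁻¹ * ρ (w / ε)) (sq x) : ℝ) : ℂ)) D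

/-- `P = (x²/4)_-^{1-d/2} 𝐅_{1-d/2}(m² x²/4)`.  For odd `d` it is the product of the
distribution `(x²/4)_-^{1-d/2}` and a smooth function.  For even `d`, with `α = d/2 - 1`, the
symbol is by definition `m^{d-2} w_-^{-α} 𝐅_{-α}(w)` at `w = m² x²/4`, where
`w_-^{-α} 𝐅_{-α}(w) := i/(2√π) (U_α(w + i0) - U_α(w - i0))`. -/
def IsMinusPowF {d : ℕ} [NeZero d] (m : ℝ) (P : 𝓢'(Mink d, ℂ)) : Prop :=
  (Odd d → ∃ Q : 𝓢'(Mink d, ℂ), IsMinusPow (1 / 4) (1 - (d : ℝ) / 2) Q ∧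
    IsSmoothMul (fun x => olverF (1 - (d : ℂ) / 2) ((m ^ 2 * sq x / 4 : ℝ) : ℂ)) Q P) ∧
  (Even d → ∃ Wp Wm : 𝓢'(Mink d, ℂ), IsUBoundaryValue m 1 Wp ∧ IsUBoundaryValue m (-1) Wm ∧
    P = (((m ^ ((d : ℝ) - 2) : ℝ) : ℂ) * (Complex.I / (2 * (Real.sqrt Real.pi : ℂ)))) • (Wp - Wm))

/-! ### Singular and regular parts -/

/-- The coefficient `(-1)^j / (j! Γ(2 - d/2 + j)) (m²/4)^j`. -/
def oddCoeff (d : ℕ) (m : ℝ) (j : ℕ) : ℝ :=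
  (-1) ^ j / ((j.factorial : ℝ) * Real.Gamma (2 - (d : ℝ) / 2 + j)) * (m ^ 2 / 4) ^ j

/-- The `j`-th term `(-1)^j / (j! Γ(2 - d/2 + j)) (m²/4)^j (-x²)^{1-d/2+j}` at a point with
`x² < 0`. -/
def oddTerm {d : ℕ} [NeZero d] (m : ℝ) (x : Mink d) (j : ℕ) : ℝ :=
  oddCoeff d m j * (-(sq x)) ^ (1 - (d : ℝ) / 2 + j)

/-- `S` is the singular part for odd `d`:
`θ(s x⁰) / (2 π^{d/2-1}) ∑_{j=0}^{(d-5)/2} (-1)^j / (j! Γ(2-d/2+j)) (m²/4)^j (x²)_-^{1-d/2+j}`. -/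
def IsOddSing {d : ℕ} [NeZero d] (m s : ℝ) (S : 𝓢'(Mink d, ℂ)) : Prop :=
  ∃ Q : ℕ → 𝓢'(Mink d, ℂ),
    (∀ j < (d - 3) / 2, IsMinusPow 1 (1 - (d : ℝ) / 2 + j) (Q j)) ∧
    IsThetaMul s (((1 / (2 * Real.pi ^ ((d : ℝ) / 2 - 1)) : ℝ) : ℂ) •
      ∑ j ∈ Finset.range ((d - 3) / 2), (oddCoeff d m j : ℂ) • Q j) S

/-- `R` is the regular part for odd `d`, the regular distribution
`θ(s x⁰) θ(-x²) / (2 π^{d/2-1})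
  ∑_{j ≥ (d-3)/2} (-1)^j / (j! Γ(2-d/2+j)) (m²/4)^j (-x²)^{1-d/2+j}`;
for `d = 1` the sum starts at `j = 0`. -/
def IsOddReg {d : ℕ} [NeZero d] (m s : ℝ) (R : 𝓢'(Mink d, ℂ)) : Prop :=
  (∀ x : Mink d, sq x < 0 → Summable (fun k : ℕ => oddTerm m x ((d - 3) / 2 + k))) ∧
  IsRegularDist (fun x : Mink d => theta (s * x 0) * theta (-(sq x)) *
    ((1 / (2 * Real.pi ^ ((d : ℝ) / 2 - 1)) *
      ∑' k : ℕ, oddTerm m x ((d - 3) / 2 + k) : ℝ) : ℂ)) R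

/-- `S` is the singular part for even `d`:
`θ(s x⁰) (-1)^{d/2} / (2 π^{d/2-1}) ∑_{j=0}^{d/2-2} (m²/4)^{d/2-2-j} / (d/2-2-j)! δ^{(j)}(x²)`. -/
def IsEvenSing {d : ℕ} [NeZero d] (m s : ℝ) (S : 𝓢'(Mink d, ℂ)) : Prop :=
  ∃ D : ℕ → 𝓢'(Mink d, ℂ), (∀ j < d / 2 - 1, IsDeltaSq j (D j)) ∧
    IsThetaMul s ((((-1) ^ (d / 2) / (2 * Real.pi ^ ((d : ℝ) / 2 - 1)) : ℝ) : ℂ) •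
      ∑ j ∈ Finset.range (d / 2 - 1),
        (((m ^ 2 / 4) ^ (d / 2 - 2 - j) / ((d / 2 - 2 - j).factorial : ℝ) : ℝ) : ℂ) • D j) S

/-- `R` is the regular part for even `d`, the regular distribution
`θ(s x⁰) (-1)^{d/2-1} 2π m^{d-2} / (4π)^{d/2} 𝐅_{d/2-1}(m² x²/4) θ(-x²)`. -/
def IsEvenReg {d : ℕ} [NeZero d] (m s : ℝ) (R : 𝓢'(Mink d, ℂ)) : Prop :=
  IsRegularDist (fun x : Mink d => theta (s * x 0) * theta (-(sq x)) *
    (((-1) ^ (d / 2 - 1) * (2 * Real.pi * m ^ ((d : ℝ) - 2)) /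
      (4 * Real.pi) ^ ((d : ℝ) / 2) : ℝ) : ℂ) *
    olverF ((d : ℂ) / 2 - 1) ((m ^ 2 * sq x / 4 : ℝ) : ℂ)) R

end KleinGordon

end

open MeasureTheory Filter Topology
open scoped SchwartzMap LineDeriv ContDiff

noncomputable section

namespace KleinGordon

section
/-! ### Dilations of a subset of the coordinates and the Euler identity -/

variable {d : ℕ}

/-! Write k = ⌊(d-2)/2⌋ (with truncated subtraction), β = 1 - d/2 + k, which is 1/2 for d = 1, 0 for
even d and -1/2 for odd d ≥ 3, and u = -m²x²/4.

Singular distributions as convergent integrals. Everything in position space has the form τ(x⁰)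
h⁽ⁿ⁾(x²) with h locally integrable and n ≤ k. Since 𝐱·∂ h(x²) = 2|𝐱|² h'(x²), differentiation with
respect to x² is (2|𝐱|²)⁻¹ 𝐱·∂, and its adjoint moves all n derivatives onto the test function. What
remains, `IDist`, is an absolutely convergent integral of τ(x⁰) h(x²) |𝐱|^(-2n) against a Schwartz
function; convergence at 𝐱 = 0 is what restricts n. Only spatial derivatives occur, so τ may be
discontinuous, and every limit in position space (boundary values i0, mollifiers of δ, cutoffs
tending to θ) is dominated convergence: `tendsto_IDist`, `isDistLimit_IDist`. Integration by parts
is `IDist_succ_eq`, a case of Euler's identity `integral_euler` for dilations.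

Position space. As U_α' = -U_{α+1}, the function U_{d/2-1} = U_{k-β} is, up to a constant, the k-th
derivative of U_{-β}. Now U_{-1/2} and U_{1/2} are elementary and U_0 is an integral of U_{1/2}, so
the boundary values of U_{-β} are locally integrable functions. They agree for x² > 0, and for x² <
0 they differ by an explicit multiple of u^β times an entire function of u. The k-th derivative of
this jump is `Tdist`; with the factor θ(s x⁰) it is `Gdist`. Splitting off the lowest power of u at
each integration by parts (`IDist_jser_succ`) yields the singular and regular parts, and for odd d
also the product formula with 𝐅 (`IDist_jser_eq_hser`).

Momentum space. Euler's identity applied to log(m² + p²) expresses ∫ ψ/(m² + p²) through integrals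
of the logarithm, whose boundary values are locally integrable (`IsReg.tendsto`). Hence the limit
exists and depends only on the side from which the real axis is approached. So s ε sgn p⁰ may be
traded for the shift p⁰ → p⁰ + isη, for which the integral is a Laplace transform in time; this puts
the support into s x⁰ ≥ 0 (`propLim_ft`, `tendsto_propLim_cutoff`). On the other hand, retarded plus
advanced equals Feynman plus anti-Feynman, and the latter two are boundary values of U_{d/2-1} by a
Schwinger parametrization and a Gaussian integral (`tendsto_feynDen`). Thus the sum is `Tdist`, and
multiplication by θ(s x⁰) isolates one summand: `propLim_eq_Gdist`.

Green functions. The equation holds because (m² + p²)/(m² + p² - isε sgn p⁰) → 1 boundedly, and the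
support is visible in the kernel. For uniqueness, conjugation with e^{-s x⁰} turns m² - □ into an
operator whose symbol has no real zero, hence one that is surjective on test functions. A
homogeneous solution D supported in s x⁰ ≥ 0 ignores what happens for s x⁰ < -1, so D annihilates
e^{-s x⁰} φ, cut off in the past, for every φ, and therefore vanishes (`eq_zero_of_kg_eq_zero`). -/

/-- Multiply the coordinates in `S` by `l`. -/
def dil (S : Finset (Fin d)) (l : ℝ) (x : Mink d) : Mink d :=
  WithLp.toLp 2 fun i => if i ∈ S then l * x i else x i

lemma dil_apply (S : Finset (Fin d)) (l : ℝ) (x : Mink d) (i : Fin d) :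
    dil S l x i = if i ∈ S then l * x i else x i := rfl

lemma dil_one (S : Finset (Fin d)) (x : Mink d) : dil S 1 x = x := by
  ext i; simp [dil_apply]

lemma dil_dil (S : Finset (Fin d)) (a b : ℝ) (x : Mink d) :
    dil S a (dil S b x) = dil S (a * b) x := by
  ext i; by_cases h : i ∈ S <;> simp [dil_apply, h, mul_assoc]

lemma dil_univ (l : ℝ) (x : Mink d) : dil Finset.univ l x = l • x := by
  ext i; simp [dil_apply]

lemma continuous_dil (S : Finset (Fin d)) : Continuous fun q : ℝ × Mink d => dil S q.1 q.2 := by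
  refine (PiLp.continuous_toLp 2 _).comp (continuous_pi fun i => ?_)
  by_cases h : i ∈ S <;> simp only [h, if_true, if_false] <;> fun_prop

/-- `dil S l` as a homeomorphism. -/
def dilHomeo (S : Finset (Fin d)) (l : ℝ) (hl : 0 < l) : Mink d ≃ₜ Mink d where
  toFun := dil S l
  invFun := dil S l⁻¹
  left_inv x := by rw [dil_dil, inv_mul_cancel₀ hl.ne', dil_one]
  right_inv x := by rw [dil_dil, mul_inv_cancel₀ hl.ne', dil_one]
  continuous_toFun := (continuous_dil S).comp (by fun_prop : Continuous fun x : Mink d => (l, x))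
  continuous_invFun := (continuous_dil S).comp (by fun_prop : Continuous fun x : Mink d => (l⁻¹, x))

lemma map_dil_volume (S : Finset (Fin d)) {l : ℝ} (hl : 0 < l) :
    Measure.map (dil S l) volume = ENNReal.ofReal (l ^ S.card)⁻¹ • volume := by
  classical
  set D : Fin d → ℝ := fun i => if i ∈ S then l else 1 with hD
  have hdet : (Matrix.diagonal D).det = l ^ S.card := by
    rw [Matrix.det_diagonal, hD, Finset.prod_ite_mem, Finset.univ_inter, Finset.prod_const]
  have hne : (Matrix.diagonal D).det ≠ 0 := by rw [hdet]; positivity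
  have h1 := Real.map_matrix_volume_pi_eq_smul_volume_pi hne
  rw [hdet, abs_of_pos (by positivity)] at h1
  have hfac : dil S l = (WithLp.toLp 2) ∘ (Matrix.toLin' (Matrix.diagonal D)) ∘
      (WithLp.ofLp : Mink d → Fin d → ℝ) := by
    funext x
    ext i
    by_cases h : i ∈ S <;> simp [dil_apply, hD, Matrix.mulVec_diagonal, h]
  have hc : Measurable (Matrix.toLin' (Matrix.diagonal D)) :=
    (LinearMap.continuous_of_finiteDimensional _).measurable
  rw [hfac, ← Measure.map_map (by fun_prop) (by fun_prop), ← Measure.map_map hc (by fun_prop),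
    (PiLp.volume_preserving_ofLp (Fin d)).map_eq, h1, Measure.map_smul,
    (PiLp.volume_preserving_toLp (Fin d)).map_eq]

lemma integral_dil {F : Type*} [NormedAddCommGroup F] [NormedSpace ℝ F] (S : Finset (Fin d)) {l : ℝ} (hl : 0 < l) (f : Mink d → F) :
    ∫ x, f (dil S l x) = (l ^ S.card)⁻¹ • ∫ x, f x := by
  have := (dilHomeo S l hl).measurableEmbedding.integral_map (μ := volume) f
  rw [show ⇑(dilHomeo S l hl) = dil S l from rfl] at this
  rw [← this, map_dil_volume S hl, integral_smul_measure, ENNReal.toReal_ofReal (by positivity)]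

lemma integrable_dil {F : Type*} [NormedAddCommGroup F] (S : Finset (Fin d)) {l : ℝ} (hl : 0 < l) {f : Mink d → F}
    (hf : Integrable f) : Integrable fun x => f (dil S l x) := by
  have := integrable_map_equiv (dilHomeo S l hl).toMeasurableEquiv f (μ := volume)
  rw [show ⇑(dilHomeo S l hl).toMeasurableEquiv = dil S l from rfl] at this
  refine this.1 ?_
  rw [map_dil_volume S hl]
  exact hf.smul_measure ENNReal.ofReal_ne_top

/-- Euler's identity: if `G'` is the derivative of `G` along the dilations of the coordinates
in `S`, then `∫ G' = - |S| ∫ G`. -/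
theorem integral_euler (S : Finset (Fin d)) {G G' : Mink d → ℂ} (hG : Integrable G)
    (hG' : Integrable G') (hm : Measurable G')
    (h : ∀ᵐ x, ContinuousOn (fun l : ℝ => G (dil S l x)) (Set.Icc 1 2) ∧
      ∃ s : Set ℝ, s.Countable ∧ ∀ l ∈ Set.Ioo (1 : ℝ) 2 \ s,
        HasDerivAt (fun l : ℝ => G (dil S l x)) ((l : ℂ)⁻¹ * G' (dil S l x)) l) :
    ∫ x, G' x = -(S.card : ℂ) * ∫ x, G x := by
  set μ : Measure ℝ := volume.restrict (Set.Ioc 1 2) with hμ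
  have hint : Integrable (fun q : ℝ × Mink d => (q.1 : ℂ)⁻¹ * G' (dil S q.1 q.2))
      (μ.prod volume) := by
    have hmeas : Measurable (fun q : ℝ × Mink d => (q.1 : ℂ)⁻¹ * G' (dil S q.1 q.2)) :=
      (Complex.measurable_ofReal.comp measurable_fst).inv.mul
        (hm.comp (continuous_dil S).measurable)
    rw [integrable_prod_iff hmeas.aestronglyMeasurable]
    constructor
    · filter_upwards [ae_restrict_mem measurableSet_Ioc] with l hl
      exact (integrable_dil S (by linarith [hl.1]) hG').const_mul _
    · have : ∀ᵐ l : ℝ ∂μ, (∫ y, ‖G' y‖) * (l⁻¹ * (l ^ S.card)⁻¹) =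
          ∫ y, ‖(l : ℂ)⁻¹ * G' (dil S l y)‖ := by
        filter_upwards [ae_restrict_mem measurableSet_Ioc] with l hl
        have hl0 : 0 < l := by linarith [hl.1]
        simp only [norm_mul, norm_inv, Complex.norm_real, Real.norm_eq_abs, abs_of_pos hl0]
        rw [integral_const_mul, integral_dil S hl0 (fun y => ‖G' y‖), smul_eq_mul]
        ring
      refine Integrable.congr ?_ this
      refine Integrable.const_mul ?_ _
      have : IntegrableOn (fun l : ℝ => l⁻¹ * (l ^ S.card)⁻¹) (Set.Icc 1 2) := by
        refine ContinuousOn.integrableOn_Icc ?_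
        refine ContinuousOn.mul (continuousOn_id.inv₀ ?_) ((continuousOn_id.pow _).inv₀ ?_)
        · intro x hx; have := hx.1; simp only [id]; linarith
        · intro x hx; have : 0 < x := by linarith [hx.1]
          exact (pow_pos this _).ne'
      exact this.mono_set Set.Ioc_subset_Icc_self
  -- The fundamental theorem of calculus along the dilation orbit from l = 1 to l = 2. Integrating
  -- it over x replaces any boundary term at infinity, and finitely or countably many kinks of G on
  -- each orbit do no harm.
  have hFTC : ∀ᵐ x, ∫ l in Set.Ioc (1 : ℝ) 2, (l : ℂ)⁻¹ * G' (dil S l x) =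
      G (dil S 2 x) - G x := by
    filter_upwards [h, hint.prod_left_ae] with x hx hix
    obtain ⟨hc, s, hs, hd⟩ := hx
    have := integral_eq_of_hasDerivAt_off_countable_of_le (fun l : ℝ => G (dil S l x))
      (fun l : ℝ => (l : ℂ)⁻¹ * G' (dil S l x)) (by norm_num : (1 : ℝ) ≤ 2) hs hc hd
      ((intervalIntegrable_iff_integrableOn_Ioc_of_le (by norm_num)).2 hix)
    rw [intervalIntegral.integral_of_le (by norm_num)] at this
    rw [this, dil_one]
  have h1 : ∫ x, ∫ l in Set.Ioc (1 : ℝ) 2, (l : ℂ)⁻¹ * G' (dil S l x) =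
      (((2 : ℝ) ^ S.card)⁻¹ - 1 : ℝ) * ∫ x, G x := by
    rw [integral_congr_ae hFTC, integral_sub (integrable_dil S (by norm_num) hG) hG,
      integral_dil S (by norm_num : (0 : ℝ) < 2) G, Complex.real_smul]
    push_cast; ring
  have h2 : ∫ x, ∫ l in Set.Ioc (1 : ℝ) 2, (l : ℂ)⁻¹ * G' (dil S l x) =
      ((∫ l in (1 : ℝ)..2, l⁻¹ * (l ^ S.card)⁻¹ : ℝ) : ℂ) * ∫ x, G' x := by
    rw [← integral_integral_swap (f := fun (l : ℝ) x => (l : ℂ)⁻¹ * G' (dil S l x)) hint,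
      intervalIntegral.integral_of_le (by norm_num), ← integral_complex_ofReal,
      ← integral_mul_const]
    refine setIntegral_congr_fun measurableSet_Ioc fun l hl => ?_
    have hl0 : 0 < l := by linarith [hl.1]
    rw [integral_const_mul, integral_dil S hl0 G', Complex.real_smul]
    push_cast; ring
  rw [h1] at h2
  -- The factor ∫₁² l^(-1-|S|) dl is log 2 for empty S and (1 - 2^(-|S|))/|S| otherwise; being
  -- nonzero, it can be cancelled.
  rcases Nat.eq_zero_or_pos S.card with h0 | hpos
  · rw [h0] at h2 ⊢
    simp only [pow_zero, inv_one, sub_self, Complex.ofReal_zero, zero_mul, mul_one] at h2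
    rw [integral_inv_of_pos (by norm_num) (by norm_num)] at h2
    have : ((Real.log (2 / 1) : ℝ) : ℂ) ≠ 0 := by
      exact_mod_cast (Real.log_pos (by norm_num)).ne'
    have := (mul_eq_zero.1 h2.symm).resolve_left this
    simp [this]
  · have hI : (∫ l in (1 : ℝ)..2, l⁻¹ * (l ^ S.card)⁻¹) =
        (1 - ((2 : ℝ) ^ S.card)⁻¹) / S.card := by
      have : ∀ l ∈ Set.uIcc (1 : ℝ) 2, HasDerivAt (fun l : ℝ => -((l ^ S.card)⁻¹ / S.card))
          (l⁻¹ * (l ^ S.card)⁻¹) l := by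
        intro l hl
        rw [Set.uIcc_of_le (by norm_num)] at hl
        have hl0 : 0 < l := by linarith [hl.1]
        have := (((hasDerivAt_pow S.card l).inv (by positivity)).div_const (S.card : ℝ)).neg
        refine this.congr_deriv ?_
        obtain ⟨n, hn⟩ : ∃ n, S.card = n + 1 := ⟨S.card - 1, by omega⟩
        rw [hn]
        simp only [Nat.add_sub_cancel]
        field_simp
        ring
      rw [intervalIntegral.integral_eq_sub_of_hasDerivAt this]
      · simp; ring
      · refine ContinuousOn.intervalIntegrable ?_
        rw [Set.uIcc_of_le (by norm_num)]
        refine ContinuousOn.mul (continuousOn_id.inv₀ ?_) ((continuousOn_id.pow _).inv₀ ?_)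
        · intro x hx; have := hx.1; simp only [id]; linarith
        · intro x hx; have : 0 < x := by linarith [hx.1]
          exact (pow_pos this _).ne'
    rw [hI] at h2
    have hne : ((1 - ((2 : ℝ) ^ S.card)⁻¹ : ℝ) : ℂ) ≠ 0 := by
      have : ((2 : ℝ) ^ S.card)⁻¹ < 1 := inv_lt_one_of_one_lt₀ (one_lt_pow₀ (by norm_num) hpos.ne')
      exact_mod_cast (by linarith : (1 - ((2 : ℝ) ^ S.card)⁻¹) ≠ 0)
    have hcard : (S.card : ℂ) ≠ 0 := by exact_mod_cast hpos.ne'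
    have h3 : ((1 - ((2 : ℝ) ^ S.card)⁻¹ : ℝ) : ℂ) * (∫ x, G' x) =
        ((1 - ((2 : ℝ) ^ S.card)⁻¹ : ℝ) : ℂ) * (-(S.card : ℂ) * ∫ x, G x) := by
      rw [Complex.ofReal_div, Complex.ofReal_natCast] at h2
      have h4 : (((2 : ℝ) ^ S.card)⁻¹ - 1 : ℝ) = -(1 - ((2 : ℝ) ^ S.card)⁻¹) := by ring
      rw [h4, Complex.ofReal_neg] at h2
      generalize ((1 - ((2 : ℝ) ^ S.card)⁻¹ : ℝ) : ℂ) = u at h2 ⊢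
      field_simp at h2
      linear_combination (-1 : ℂ) * h2
    exact mul_left_cancel₀ hne h3

end

section
/-! ### Splitting off the time coordinate, and integrability of the singular weights -/

/-- The spatial square `(x¹)² + ⋯ + (x^{d-1})²`. -/
def rsq {d : ℕ} [NeZero d] (x : Mink d) : ℝ := ∑ i ∈ Finset.univ.erase (0 : Fin d), x i ^ 2

lemma sq_eq {d : ℕ} [NeZero d] (x : Mink d) : sq x = rsq x - x 0 ^ 2 := by
  simp only [sq, lorentz, rsq, pow_two]; ring

lemma rsq_nonneg {d : ℕ} [NeZero d] (x : Mink d) : 0 ≤ rsq x :=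
  Finset.sum_nonneg fun _ _ => sq_nonneg _

lemma norm_sq_eq {d : ℕ} [NeZero d] (x : Mink d) : ‖x‖ ^ 2 = x 0 ^ 2 + rsq x := by
  rw [EuclideanSpace.norm_sq_eq, rsq, Finset.add_sum_erase _ (fun i => x i ^ 2) (Finset.mem_univ 0)]
  simp

lemma continuous_rsq {d : ℕ} [NeZero d] : Continuous (rsq : Mink d → ℝ) := by
  unfold rsq; fun_prop

lemma continuous_sq {d : ℕ} [NeZero d] : Continuous (sq : Mink d → ℝ) := by
  simp only [funext sq_eq]
  exact continuous_rsq.sub (by fun_prop)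

lemma abs_sq_le {d : ℕ} [NeZero d] (x : Mink d) : |sq x| ≤ ‖x‖ ^ 2 := by
  rw [norm_sq_eq, sq_eq, abs_le]
  constructor <;> nlinarith [sq_nonneg (x 0), rsq_nonneg x]

lemma abs_time_le {d : ℕ} [NeZero d] (x : Mink d) : |x 0| ≤ ‖x‖ := by
  simpa using PiLp.norm_apply_le x 0

/-- Splitting a point into its time coordinate and its spatial part. -/
def timeSpace (n : ℕ) (x : Mink (n + 1)) : ℝ × EuclideanSpace ℝ (Fin n) :=
  (x 0, WithLp.toLp 2 fun i => x i.succ)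

lemma measurePreserving_timeSpace (n : ℕ) :
    MeasurePreserving (timeSpace n) volume (volume.prod volume) := by
  have h1 := PiLp.volume_preserving_ofLp (Fin (n + 1))
  have h2 := volume_preserving_piFinSuccAbove (fun _ : Fin (n + 1) => ℝ) 0
  have h3 : MeasurePreserving (Prod.map id (WithLp.toLp 2) : ℝ × (Fin n → ℝ) → _)
      (volume.prod volume) (volume.prod (volume : Measure (EuclideanSpace ℝ (Fin n)))) :=
    (MeasurePreserving.id volume).prod (PiLp.volume_preserving_toLp (Fin n))
  have := h3.comp (h2.comp h1)
  exact this

lemma norm_timeSpace_snd (n : ℕ) (x : Mink (n + 1)) : ‖(timeSpace n x).2‖ ^ 2 = rsq x := by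
  have h : (Finset.univ.erase (0 : Fin (n + 1))) = Finset.univ.map (Fin.succEmb n) := by
    ext i; simp [Fin.exists_succ_eq]
  rw [EuclideanSpace.norm_sq_eq, rsq, h, Finset.sum_map]
  simp [timeSpace]

lemma integrable_comp_timeSpace {n : ℕ} {f : ℝ × EuclideanSpace ℝ (Fin n) → ℝ}
    (hf : Integrable f (volume.prod volume)) : Integrable fun x => f (timeSpace n x) :=
  (measurePreserving_timeSpace n).integrable_comp_of_integrable hf

/-- For a fixed spatial part y, the equation t² = c + |y|² has at most two roots t; Fubini does the
rest. -/
lemma ae_add_sq_ne_zero {d : ℕ} [NeZero d] (c : ℝ) : ∀ᵐ x : Mink d, c + sq x ≠ 0 := by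
  obtain ⟨n, rfl⟩ : ∃ n, d = n + 1 := ⟨d - 1, by have := NeZero.pos d; omega⟩
  have h : ∀ᵐ q : ℝ × EuclideanSpace ℝ (Fin n) ∂(volume.prod volume),
      c + ‖q.2‖ ^ 2 - q.1 ^ 2 ≠ 0 := by
    have hms : MeasurableSet {q : ℝ × EuclideanSpace ℝ (Fin n) | c + ‖q.2‖ ^ 2 - q.1 ^ 2 ≠ 0} :=
      (isOpen_ne_fun (by fun_prop) (by fun_prop)).measurableSet
    rw [Measure.ae_prod_iff_ae_ae hms,
      Measure.ae_ae_comm (p := fun (t : ℝ) (y : EuclideanSpace ℝ (Fin n)) => c + ‖y‖ ^ 2 - t ^ 2 ≠ 0) hms]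
    refine Eventually.of_forall fun y => ?_
    have hfin : ({√(c + ‖y‖ ^ 2), -√(c + ‖y‖ ^ 2)} : Set ℝ).Finite := Set.toFinite _
    filter_upwards [hfin.countable.ae_notMem volume] with t ht h
    apply ht
    have : t ^ 2 = √(c + ‖y‖ ^ 2) ^ 2 := by
      rw [Real.sq_sqrt (by nlinarith [sq_nonneg t])]; linarith
    simpa using sq_eq_sq_iff_eq_or_eq_neg.1 this
  have := (measurePreserving_timeSpace n).quasiMeasurePreserving.ae h
  filter_upwards [this] with x hx
  rw [norm_timeSpace_snd] at hx
  rw [sq_eq]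
  intro h; apply hx
  simp only [timeSpace]; linarith

lemma ae_sq_ne_zero {d : ℕ} [NeZero d] : ∀ᵐ x : Mink d, sq x ≠ 0 := by
  simpa using ae_add_sq_ne_zero (d := d) 0

lemma ae_rsq_ne_zero {d : ℕ} [NeZero d] (hd : 2 ≤ d) : ∀ᵐ x : Mink d, rsq x ≠ 0 := by
  obtain ⟨n, rfl⟩ : ∃ n, d = n + 2 := ⟨d - 2, by omega⟩
  have h : ∀ᵐ y : EuclideanSpace ℝ (Fin (n + 1)), y ≠ 0 := by
    simp [ae_iff]
  have := (measurePreserving_timeSpace (n + 1)).quasiMeasurePreserving.ae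
    (Measure.quasiMeasurePreserving_snd.ae h)
  filter_upwards [this] with x hx
  rw [← norm_timeSpace_snd]
  positivity

lemma integrable_cut_rpow : Integrable (Set.indicator (Set.Icc (-1 : ℝ) 1) fun u => |u| ^ (-(1 / 2) : ℝ)) := by
  rw [integrable_indicator_iff measurableSet_Icc]
  have h : IntervalIntegrable (fun u : ℝ => |u| ^ (-(1 / 2) : ℝ)) volume 0 1 := by
    refine (intervalIntegral.intervalIntegrable_rpow' (by norm_num : (-1 : ℝ) < -(1 / 2))).congr ?_
    intro u hu
    rw [Set.uIoc_of_le (by norm_num)] at hu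
    simp only
    rw [abs_of_pos hu.1]
  have h2 : IntervalIntegrable (fun u : ℝ => |u| ^ (-(1 / 2) : ℝ)) volume (-1) 0 := by
    have := (IntervalIntegrable.iff_comp_neg (f := fun u : ℝ => |u| ^ (-(1 / 2) : ℝ)) (a := 0) (b := 1)).1 h
    simp only [abs_neg, neg_zero] at this
    exact this.symm
  rw [integrableOn_Icc_iff_integrableOn_Ioc]
  exact (intervalIntegrable_iff_integrableOn_Ioc_of_le (by norm_num)).1 (h2.trans h)

/-- The power exceeds 1 only within distance 1 of t = ±r, where it is a translate of one fixed
integrable function. The time integral of the bound therefore does not depend on r. -/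
lemma abs_sub_rpow_le (t r : ℝ) : |(|t| - r)| ^ (-(1 / 2) : ℝ) * (1 + t ^ 2)⁻¹ ≤
    (1 + t ^ 2)⁻¹ + (Set.indicator (Set.Icc (-1 : ℝ) 1) (fun u => |u| ^ (-(1 / 2) : ℝ)) (t - r) +
      Set.indicator (Set.Icc (-1 : ℝ) 1) (fun u => |u| ^ (-(1 / 2) : ℝ)) (t + r)) := by
  set g := Set.indicator (Set.Icc (-1 : ℝ) 1) (fun u => |u| ^ (-(1 / 2) : ℝ)) with hg
  have hg0 : ∀ u, 0 ≤ g u := fun u => Set.indicator_nonneg (fun u _ => by positivity) u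
  have hone : (1 + t ^ 2)⁻¹ ≤ 1 := inv_le_one_of_one_le₀ (by nlinarith)
  have hpos : 0 ≤ (1 + t ^ 2)⁻¹ := by positivity
  have key : ∀ u, |u| ^ (-(1 / 2) : ℝ) * (1 + t ^ 2)⁻¹ ≤ (1 + t ^ 2)⁻¹ + g u := by
    intro u
    by_cases hu : u ∈ Set.Icc (-1 : ℝ) 1
    · rw [hg, Set.indicator_of_mem hu]
      nlinarith [Real.rpow_nonneg (abs_nonneg u) (-(1 / 2) : ℝ)]
    · have : 1 ≤ |u| := by
        by_contra h
        exact hu (abs_le.1 (not_le.1 h).le)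
      have := Real.rpow_le_one_of_one_le_of_nonpos this (by norm_num : (-(1 / 2) : ℝ) ≤ 0)
      nlinarith [hg0 u]
  rcases le_total 0 t with ht | ht
  · rw [abs_of_nonneg ht]; linarith [key (t - r), hg0 (t + r)]
  · rw [abs_of_nonpos ht, show -t - r = -(t + r) by ring, abs_neg]
    linarith [key (t + r), hg0 (t - r)]

/-- Integrate over time first: by translation invariance the location ρ(y) of the singularity drops
out and only the integrability of q is left. -/
lemma integrable_abs_sub_rpow_mul {n : ℕ} {q ρ : EuclideanSpace ℝ (Fin n) → ℝ} (hq : Integrable q)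
    (hqm : Measurable q) (hρ : Measurable ρ) :
    Integrable (fun z : ℝ × EuclideanSpace ℝ (Fin n) =>
      |(|z.1| - ρ z.2)| ^ (-(1 / 2) : ℝ) * (1 + z.1 ^ 2)⁻¹ * q z.2) (volume.prod volume) := by
  set g := Set.indicator (Set.Icc (-1 : ℝ) 1) (fun u => |u| ^ (-(1 / 2) : ℝ)) with hg
  have hshift : ∀ σ : EuclideanSpace ℝ (Fin n) → ℝ, Measurable σ →
      Integrable (fun z : ℝ × EuclideanSpace ℝ (Fin n) => g (z.1 + σ z.2) * q z.2)
        (volume.prod volume) := by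
    intro σ hσ
    have hgm : Measurable g :=
      Measurable.indicator (measurable_norm.pow_const _) measurableSet_Icc
    rw [integrable_prod_iff' (by fun_prop)]
    constructor
    · refine Eventually.of_forall fun y => ?_
      exact (integrable_cut_rpow.comp_add_right (σ y)).mul_const (q y)
    · simp only [norm_mul]
      have : ∀ y, ∫ t, ‖g (t + σ y)‖ * ‖q y‖ = (∫ t, ‖g t‖) * ‖q y‖ := by
        intro y
        rw [integral_mul_const, integral_add_right_eq_self (fun t => ‖g t‖)]
      simp only [this]
      exact hq.norm.const_mul _
  have hmaj := ((integrable_inv_one_add_sq.mul_prod hq.norm).add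
    ((hshift (fun y => -ρ y) hρ.neg).norm.add (hshift ρ hρ).norm))
  refine hmaj.mono' (by fun_prop) (Eventually.of_forall fun z => ?_)
  have h := abs_sub_rpow_le z.1 (ρ z.2)
  have hg0 : ∀ u, 0 ≤ g u := fun u => Set.indicator_nonneg (fun u _ => by positivity) u
  rw [norm_mul, Real.norm_of_nonneg (by positivity)]
  simp only [Pi.add_apply, norm_mul, Real.norm_of_nonneg (hg0 _)]
  rw [← add_mul, ← add_mul]
  refine mul_le_mul_of_nonneg_right ?_ (norm_nonneg _)
  rw [← hg, sub_eq_add_neg z.1] at h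
  exact h

lemma integrable_inv_one_add_norm_pow (n : ℕ) :
    Integrable fun y : EuclideanSpace ℝ (Fin n) => ((1 + ‖y‖) ^ (n + 1))⁻¹ := by
  have := integrable_one_add_norm (E := EuclideanSpace ℝ (Fin n)) (μ := volume)
    (r := (n + 1 : ℕ)) (by simp)
  refine this.congr (Eventually.of_forall fun y => ?_)
  simp only
  rw [Real.rpow_neg (by positivity), Real.rpow_natCast]

lemma integrable_norm_rpow_mul {n : ℕ} {p : ℝ} (hp : -(n + 1 : ℝ) < p) (hp0 : p ≤ 0) :
    Integrable fun y : EuclideanSpace ℝ (Fin (n + 1)) => ‖y‖ ^ p * ((1 + ‖y‖) ^ (n + 2))⁻¹ := by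
  have h := integrable_fun_norm_addHaar (volume : Measure (EuclideanSpace ℝ (Fin (n + 1))))
    (f := fun r : ℝ => r ^ p * ((1 + r) ^ (n + 2))⁻¹)
  rw [h]
  simp only [finrank_euclideanSpace, Fintype.card_fin, Nat.add_sub_cancel, smul_eq_mul]
  rw [← Set.Ioc_union_Ioi_eq_Ioi (zero_le_one' ℝ)]
  have hmeas : Measurable fun y : ℝ => y ^ n * (y ^ p * ((1 + y) ^ (n + 2))⁻¹) := by fun_prop
  refine IntegrableOn.union ?_ ?_
  · have h1 : IntegrableOn (fun y : ℝ => y ^ (n + p)) (Set.Ioc 0 1) :=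
      (intervalIntegrable_iff_integrableOn_Ioc_of_le zero_le_one).1
        (intervalIntegral.intervalIntegrable_rpow' (by linarith))
    refine Integrable.mono' h1 hmeas.aestronglyMeasurable ?_
    filter_upwards [ae_restrict_mem measurableSet_Ioc] with y hy
    have hy0 : 0 < y := hy.1
    rw [Real.norm_of_nonneg (by positivity), Real.rpow_add hy0, Real.rpow_natCast, ← mul_assoc]
    refine mul_le_of_le_one_right (by positivity) (inv_le_one_of_one_le₀ ?_)
    exact one_le_pow₀ (by linarith)
  · have h1 : IntegrableOn (fun y : ℝ => y ^ (-2 : ℝ)) (Set.Ioi 1) :=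
      integrableOn_Ioi_rpow_of_lt (by norm_num) one_pos
    refine Integrable.mono' h1 hmeas.aestronglyMeasurable ?_
    filter_upwards [ae_restrict_mem measurableSet_Ioi] with y hy
    have hy0 : 0 < y := one_pos.trans hy
    rw [Real.norm_of_nonneg (by positivity), Real.rpow_neg hy0.le, Real.rpow_two]
    have h2 : y ^ p ≤ 1 := Real.rpow_le_one_of_one_le_of_nonpos (le_of_lt hy) hp0
    have h3 : y ^ (n + 2) ≤ (1 + y) ^ (n + 2) := pow_le_pow_left₀ hy0.le (by linarith) _
    calc y ^ n * (y ^ p * ((1 + y) ^ (n + 2))⁻¹) ≤ y ^ n * (1 * (y ^ (n + 2))⁻¹) := by gcongr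
      _ = (y ^ 2)⁻¹ := by rw [pow_add]; field_simp

/-- The exponent of the weight `|x²|^e`: `0` in dimension one, `-1/2` otherwise. -/
def wexp (d : ℕ) : ℝ := if d = 1 then 0 else -(1 / 2)

/-- With w = √(c + |𝐱|²) one has |c + x²| = ||t| - w| (|t| + w), and the second factor is at least
w. Two of the N + 2 inverse powers of 1 + ‖x‖ serve the time integral, the others the spatial one.
-/
lemma weight_le {n N : ℕ} {c : ℝ} (hc : 0 ≤ c) (x : Mink (n + 1)) (hx : rsq x ≠ 0 ∨ 0 < c) :
    |c + sq x| ^ (-(1 / 2) : ℝ) * ((1 + ‖x‖) ^ (N + 2))⁻¹ ≤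
      |(|(timeSpace n x).1| - √(c + ‖(timeSpace n x).2‖ ^ 2))| ^ (-(1 / 2) : ℝ) *
        (1 + (timeSpace n x).1 ^ 2)⁻¹ * ((c + ‖(timeSpace n x).2‖ ^ 2) ^ (-(1 / 4) : ℝ) *
          ((1 + ‖(timeSpace n x).2‖) ^ N)⁻¹) := by
  have hr := norm_timeSpace_snd n x
  have hn := norm_sq_eq x
  set t := (timeSpace n x).1 with ht
  have ht' : x 0 = t := rfl
  rw [ht'] at hn
  set r := ‖(timeSpace n x).2‖ with hrdef
  have hr0 : 0 ≤ r := norm_nonneg _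
  have hpos : 0 < c + r ^ 2 := by
    rcases hx with hx | hx
    · have := (rsq_nonneg x).lt_of_ne' hx; rw [hr]; linarith
    · positivity
  set w := √(c + r ^ 2) with hw
  have hw0 : 0 < w := Real.sqrt_pos.2 hpos
  have hww : w ^ 2 = c + r ^ 2 := Real.sq_sqrt hpos.le
  have h1 : |c + sq x| = |(|t| - w)| * (w + |t|) := by
    have h0 : 0 < w + |t| := by positivity
    have h4 : |c + sq x| = |(|t| - w) * (w + |t|)| := by
      rw [sq_eq, ← hr, ht', ← abs_neg, ← sq_abs t]
      congr 1
      linear_combination hww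
    rw [h4, abs_mul, abs_of_pos h0]
  have h2 : |c + sq x| ^ (-(1 / 2) : ℝ) ≤ |(|t| - w)| ^ (-(1 / 2) : ℝ) * (c + r ^ 2) ^ (-(1 / 4) : ℝ) := by
    rw [h1, Real.mul_rpow (abs_nonneg _) (by positivity), ← hww, ← Real.rpow_natCast, ← Real.rpow_mul hw0.le]
    refine mul_le_mul_of_nonneg_left ?_ (by positivity)
    rw [show ((2 : ℕ) : ℝ) * -(1 / 4) = -(1 / 2) by norm_num]
    exact Real.rpow_le_rpow_of_nonpos hw0 (by linarith [abs_nonneg t]) (by norm_num)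
  have h3 : ((1 + ‖x‖) ^ (N + 2))⁻¹ ≤ (1 + t ^ 2)⁻¹ * ((1 + r) ^ N)⁻¹ := by
    rw [← mul_inv]
    refine inv_anti₀ (by positivity) ?_
    rw [pow_add, mul_comm]
    have hrx : r ≤ ‖x‖ := by
      refine abs_le_of_sq_le_sq' ?_ (norm_nonneg _) |>.2
      nlinarith [sq_nonneg t]
    have htx : 1 + t ^ 2 ≤ (1 + ‖x‖) ^ 2 := by nlinarith [norm_nonneg x, rsq_nonneg x]
    gcongr
  calc _ ≤ (|(|t| - w)| ^ (-(1 / 2) : ℝ) * (c + r ^ 2) ^ (-(1 / 4) : ℝ)) *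
        ((1 + t ^ 2)⁻¹ * ((1 + r) ^ N)⁻¹) := by gcongr
    _ = _ := by ring

/-- Majorant for the logarithms of the regularized m² + p². Since c > 0, the factor (c +
|y|²)^(-1/4) is bounded, and d = 1 needs no separate treatment. -/
lemma integrable_massive_weight {d : ℕ} [NeZero d] {c : ℝ} (hc : 0 < c) :
    ∃ N : ℕ, Integrable fun x : Mink d => |c + sq x| ^ (-(1 / 2) : ℝ) * ((1 + ‖x‖) ^ N)⁻¹ := by
  obtain ⟨n, rfl⟩ : ∃ n, d = n + 1 := ⟨d - 1, by have := NeZero.pos d; omega⟩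
  refine ⟨n + 1 + 2, ?_⟩
  have hq : Integrable fun y : EuclideanSpace ℝ (Fin n) =>
      (c + ‖y‖ ^ 2) ^ (-(1 / 4) : ℝ) * ((1 + ‖y‖) ^ (n + 1))⁻¹ := by
    refine ((integrable_inv_one_add_norm_pow n).const_mul (c ^ (-(1 / 4) : ℝ))).mono'
      (by fun_prop) (Eventually.of_forall fun y => ?_)
    rw [Real.norm_of_nonneg (by positivity)]
    refine mul_le_mul_of_nonneg_right ?_ (by positivity)
    exact Real.rpow_le_rpow_of_nonpos hc (by nlinarith [norm_nonneg y]) (by norm_num)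
  have := integrable_comp_timeSpace (integrable_abs_sub_rpow_mul hq (by fun_prop)
    (ρ := fun y => √(c + ‖y‖ ^ 2)) (by fun_prop))
  refine this.mono' ?_ (Eventually.of_forall fun x => ?_)
  · have := continuous_sq (d := n + 1)
    exact Measurable.aestronglyMeasurable (by fun_prop)
  · rw [Real.norm_of_nonneg (by positivity)]
    exact weight_le hc.le x (Or.inr hc)

/-- The light cone costs an integrable inverse square root. At 𝐱 = 0 the exponent is -1/2 - 2n,
which is integrable in d - 1 dimensions precisely because 2n ≤ d - 2. In dimension one there is no
spatial part, and the weight is taken to be 1. -/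
lemma integrable_weight {d : ℕ} [NeZero d] {n : ℕ} (hn : n ≤ (d - 2) / 2) :
    ∃ N : ℕ, Integrable fun x : Mink d =>
      |sq x| ^ (wexp d) * (rsq x ^ n)⁻¹ * ((1 + ‖x‖) ^ N)⁻¹ := by
  have hd0 := NeZero.pos d
  rcases eq_or_ne d 1 with rfl | hd
  · have : n = 0 := by omega
    subst this
    refine ⟨2, (integrable_inv_one_add_norm_pow 1).congr (Eventually.of_forall fun x => ?_)⟩
    simp [wexp]
  obtain ⟨l, rfl⟩ : ∃ l, d = l + 1 + 1 := ⟨d - 2, by omega⟩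
  refine ⟨l + 2 + 2, ?_⟩
  have hl : 2 * (n : ℝ) ≤ l := by
    have : 2 * n ≤ l := by omega
    exact_mod_cast this
  have hq : Integrable fun y : EuclideanSpace ℝ (Fin (l + 1)) =>
      (0 + ‖y‖ ^ 2) ^ (-(1 / 4) : ℝ) * ((1 + ‖y‖) ^ (l + 2))⁻¹ * ((‖y‖ ^ 2) ^ n)⁻¹ := by
    -- The factor (|y|²)^(-1/4) contributes the exponent -1/2, the factor |y|^(-2n) the exponent
    -- -2n.
    refine (integrable_norm_rpow_mul (n := l) (p := -(1 / 2) - 2 * n) (by linarith)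
      (by linarith [Nat.cast_nonneg (α := ℝ) n])).mono' (by fun_prop) ?_
    have h : ∀ᵐ y : EuclideanSpace ℝ (Fin (l + 1)), y ≠ 0 := by simp [ae_iff]
    filter_upwards [h] with y hy
    have hy : 0 < ‖y‖ := norm_pos_iff.2 hy
    rw [Real.norm_of_nonneg (by positivity)]
    refine le_of_eq ?_
    rw [Real.rpow_sub hy, zero_add, ← Real.rpow_natCast ‖y‖ 2, ← Real.rpow_mul hy.le,
      ← Real.rpow_natCast (‖y‖ ^ ((2 : ℕ) : ℝ)) n, ← Real.rpow_mul hy.le]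
    norm_num
    ring
  have := integrable_comp_timeSpace (integrable_abs_sub_rpow_mul hq (by fun_prop)
    (ρ := fun y => √(0 + ‖y‖ ^ 2)) (by fun_prop))
  refine this.mono' ?_ ?_
  · have := continuous_sq (d := l + 1 + 1)
    have := continuous_rsq (d := l + 1 + 1)
    exact Measurable.aestronglyMeasurable (by fun_prop)
  · filter_upwards [ae_rsq_ne_zero (d := l + 1 + 1) (by omega)] with x hx
    have h := weight_le (N := l + 2) le_rfl x (Or.inl hx)
    rw [Real.norm_of_nonneg (by have := rsq_nonneg x; positivity), wexp, if_neg hd]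
    rw [zero_add] at h
    have h0 : 0 ≤ (rsq x ^ n)⁻¹ := by have := rsq_nonneg x; positivity
    have := mul_le_mul_of_nonneg_right h h0
    rw [norm_timeSpace_snd] at this ⊢
    calc _ = |sq x| ^ (-(1 / 2) : ℝ) * ((1 + ‖x‖) ^ (l + 2 + 2))⁻¹ * (rsq x ^ n)⁻¹ := by ring
      _ ≤ _ := this
      _ = _ := by ring

end

section
open LineDeriv

/-! ### Tempered distributions given by functions -/

/-- `K` is integrable against some inverse power of `1 + ‖x‖`. -/
def Tame {d : ℕ} (K : Mink d → ℂ) : Prop :=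
  AEStronglyMeasurable K ∧ ∃ N : ℕ, Integrable fun x => ‖K x‖ * ((1 + ‖x‖) ^ N)⁻¹

lemma norm_schwartz_le {d : ℕ} (φ : 𝓢(Mink d, ℂ)) (N : ℕ) (x : Mink d) :
    ‖φ x‖ ≤ 2 ^ N * (Finset.Iic (N, 0)).sup (schwartzSeminormFamily ℂ (Mink d) ℂ) φ *
      ((1 + ‖x‖) ^ N)⁻¹ := by
  have h := SchwartzMap.one_add_le_sup_seminorm_apply (𝕜 := ℂ) (m := (N, 0)) le_rfl le_rfl φ x
  rw [norm_iteratedFDeriv_zero] at h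
  rw [← div_eq_mul_inv, le_div_iff₀ (by positivity), mul_comm]
  exact h

lemma Tame.integrable_mul {d : ℕ} {K : Mink d → ℂ} (hK : Tame K) (φ : 𝓢(Mink d, ℂ)) :
    Integrable fun x => K x * φ x := by
  obtain ⟨hm, N, hN⟩ := hK
  refine (hN.mul_const (2 ^ N * (Finset.Iic (N, 0)).sup
    (schwartzSeminormFamily ℂ (Mink d) ℂ) φ)).mono' (hm.mul φ.continuous.aestronglyMeasurable)
    (Eventually.of_forall fun x => ?_)
  rw [norm_mul]
  calc _ ≤ ‖K x‖ * _ := mul_le_mul_of_nonneg_left (norm_schwartz_le φ N x) (norm_nonneg _)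
    _ = _ := by ring

lemma Tame.mono {d : ℕ} {K L : Mink d → ℂ} (hK : Tame K) (hL : AEStronglyMeasurable L) {C : ℝ}
    (h : ∀ᵐ x, ‖L x‖ ≤ C * ‖K x‖) : Tame L := by
  obtain ⟨hm, N, hN⟩ := hK
  refine ⟨hL, N, (hN.const_mul C).mono' ?_ ?_⟩
  · exact hL.norm.mul (by fun_prop)
  · filter_upwards [h] with x hx
    rw [norm_mul, norm_norm, Real.norm_of_nonneg (by positivity), ← mul_assoc]
    exact mul_le_mul_of_nonneg_right hx (by positivity)

open Classical in
/-- The tempered distribution given by a tame function (and `0` for other functions). -/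
def tdist {d : ℕ} (K : Mink d → ℂ) : 𝓢'(Mink d, ℂ) :=
  if hK : Tame K then
    ContinuousLinearMap.toPointwiseConvergenceCLM _ _ _ _ <|
      SchwartzMap.mkCLMtoNormedSpace (𝕜 := ℂ) (σ := RingHom.id ℂ) (fun φ => ∫ x, K x * φ x)
        (fun f g => by
          simp only [add_apply, mul_add]
          exact integral_add (hK.integrable_mul f) (hK.integrable_mul g))
        (fun a f => by
          simp only [smul_apply, smul_eq_mul, RingHom.id_apply]
          rw [← integral_const_mul]
          congr 1; ext x; ring)
        (by
          obtain ⟨hm, N, hN⟩ := hK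
          refine ⟨Finset.Iic (N, 0), (∫ x, ‖K x‖ * ((1 + ‖x‖) ^ N)⁻¹) * 2 ^ N, by positivity,
            fun f => ?_⟩
          rw [mul_assoc, ← integral_mul_const]
          refine norm_integral_le_of_norm_le (hN.mul_const _) (Eventually.of_forall fun x => ?_)
          rw [norm_mul]
          calc _ ≤ ‖K x‖ * _ := mul_le_mul_of_nonneg_left (norm_schwartz_le f N x) (norm_nonneg _)
            _ = _ := by ring)
  else 0

lemma tdist_apply {d : ℕ} {K : Mink d → ℂ} (hK : Tame K) (φ : 𝓢(Mink d, ℂ)) :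
    tdist K φ = ∫ x, K x * φ x := by
  rw [tdist, dif_pos hK]; rfl

/-! ### Euler operators on Schwartz functions -/

/-- The coordinate functions have temperate growth. -/
lemma hasTemperateGrowth_coord {d : ℕ} (i : Fin d) :
    (fun x : Mink d => ((x i : ℝ) : ℂ)).HasTemperateGrowth :=
  (Complex.ofRealCLM.comp (EuclideanSpace.proj i : Mink d →L[ℝ] ℝ)).hasTemperateGrowth

/-- The Euler operator `∑_{i ∈ S} x_i ∂_i`. -/
def eulerOp {d : ℕ} (S : Finset (Fin d)) : 𝓢(Mink d, ℂ) →L[ℂ] 𝓢(Mink d, ℂ) :=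
  ∑ i ∈ S, SchwartzMap.smulLeftCLM ℂ (fun x : Mink d => ((x i : ℝ) : ℂ)) ∘L
    lineDerivOpCLM ℂ 𝓢(Mink d, ℂ) (EuclideanSpace.single i (1 : ℝ))

lemma eulerOp_apply {d : ℕ} (S : Finset (Fin d)) (φ : 𝓢(Mink d, ℂ)) (x : Mink d) :
    eulerOp S φ x = ∑ i ∈ S, (x i : ℂ) * fderiv ℝ φ x (EuclideanSpace.single i (1 : ℝ)) := by
  simp only [eulerOp, sum_apply, ContinuousLinearMap.comp_apply]
  refine Finset.sum_congr rfl fun i _ => ?_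
  rw [SchwartzMap.smulLeftCLM_apply_apply (hasTemperateGrowth_coord i)]
  rfl

lemma hasDerivAt_dil {d : ℕ} (S : Finset (Fin d)) (x : Mink d) (l : ℝ) :
    HasDerivAt (fun l => dil S l x) (∑ i ∈ S, x i • EuclideanSpace.single i (1 : ℝ)) l := by
  have h : (fun l => dil S l x) = fun l : ℝ => dil S 0 x +
      l • ∑ i ∈ S, x i • EuclideanSpace.single i (1 : ℝ) := by
    funext l; ext j
    by_cases hj : j ∈ S <;>
      simp [dil_apply, hj, Finset.sum_apply, Pi.single_apply]
  rw [h]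
  simpa using ((hasDerivAt_id l).smul_const (∑ i ∈ S, x i • EuclideanSpace.single i (1 : ℝ))).const_add
    (dil S 0 x)

lemma hasDerivAt_schwartz_dil {d : ℕ} (S : Finset (Fin d)) (φ : 𝓢(Mink d, ℂ)) (x : Mink d) {l : ℝ}
    (hl : l ≠ 0) :
    HasDerivAt (fun l => φ (dil S l x)) ((l : ℂ)⁻¹ * eulerOp S φ (dil S l x)) l := by
  have h := (φ.hasFDerivAt (dil S l x)).comp_hasDerivAt l (hasDerivAt_dil S x l)
  refine h.congr_deriv ?_
  rw [eulerOp_apply, map_sum, Finset.mul_sum]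
  refine Finset.sum_congr rfl fun i hi => ?_
  rw [map_smul, dil_apply, if_pos hi, Complex.real_smul]
  have : (l : ℂ) ≠ 0 := by exact_mod_cast hl
  push_cast
  field_simp

section space
variable {d : ℕ} [NeZero d]

/-- The set of spatial coordinates. -/
abbrev spatial (d : ℕ) [NeZero d] : Finset (Fin d) := Finset.univ.erase (0 : Fin d)

lemma card_spatial : ((spatial d).card : ℂ) = d - 1 := by
  rw [Finset.card_erase_of_mem (Finset.mem_univ _), Finset.card_fin,
    Nat.cast_sub (NeZero.one_le)]; simp

lemma dil_spatial_zero (l : ℝ) (x : Mink d) : dil (spatial d) l x 0 = x 0 := by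
  simp [dil_apply]

lemma rsq_dil (l : ℝ) (x : Mink d) : rsq (dil (spatial d) l x) = l ^ 2 * rsq x := by
  rw [rsq, rsq, Finset.mul_sum]
  refine Finset.sum_congr rfl fun i hi => ?_
  rw [dil_apply, if_pos hi, mul_pow]

lemma sq_dil (l : ℝ) (x : Mink d) : sq (dil (spatial d) l x) = l ^ 2 * rsq x - x 0 ^ 2 := by
  rw [sq_eq, rsq_dil, dil_spatial_zero]

/-- The iterated adjoint of `(2|𝐱|²)⁻¹ 𝐱·∂`, without the factor `|𝐱|^{-2n}`. -/
def Bop (d : ℕ) [NeZero d] : ℕ → 𝓢(Mink d, ℂ) →L[ℂ] 𝓢(Mink d, ℂ)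
  | 0 => ContinuousLinearMap.id ℂ _
  -- The adjoint of (2|𝐱|²)⁻¹ 𝐱·∂ is -½ |𝐱|⁻² (𝐱·∂ + d - 3). Commuting it past the |𝐱|^(-2n)
  -- accumulated so far lowers the constant by 2n.
  | n + 1 => (-(1 / 2) : ℂ) • (eulerOp (spatial d) + ((d : ℂ) - 3 - 2 * n) • ContinuousLinearMap.id ℂ _) ∘L
      Bop d n

lemma Bop_succ_apply (n : ℕ) (φ : 𝓢(Mink d, ℂ)) (x : Mink d) :
    Bop d (n + 1) φ x = -(1 / 2) * (eulerOp (spatial d) (Bop d n φ) x +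
      ((d : ℂ) - 3 - 2 * n) * Bop d n φ x) := by
  simp [Bop]
  ring

/-- Spatial dilations fix x⁰, so functions of time behave as constants under the spatial Euler
operator. -/
lemma eulerOp_time_mul {g : ℝ → ℂ} {φ ψ : 𝓢(Mink d, ℂ)} (h : ∀ x, ψ x = g (x 0) * φ x) (x : Mink d) :
    eulerOp (spatial d) ψ x = g (x 0) * eulerOp (spatial d) φ x := by
  have h1 := hasDerivAt_schwartz_dil (spatial d) ψ x one_ne_zero
  have h2 := (hasDerivAt_schwartz_dil (spatial d) φ x one_ne_zero).const_mul (g (x 0))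
  have : (fun l => ψ (dil (spatial d) l x)) = fun l => g (x 0) * φ (dil (spatial d) l x) := by
    funext l; rw [h, dil_spatial_zero]
  rw [this] at h1
  simpa [dil_one] using h1.unique h2

/-- This lets a multiplier g(x⁰) of the distribution be absorbed into its time factor τ. -/
lemma Bop_time_mul {g : ℝ → ℂ} {φ ψ : 𝓢(Mink d, ℂ)} (h : ∀ x, ψ x = g (x 0) * φ x) (n : ℕ) :
    ∀ x, Bop d n ψ x = g (x 0) * Bop d n φ x := by
  induction n with
  | zero => simpa [Bop] using h
  | succ n ih =>
    intro x
    rw [Bop_succ_apply, Bop_succ_apply, eulerOp_time_mul ih, ih]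
    ring

/-- Locality of the operators, needed to read off supports from the kernel. -/
lemma eventuallyEq_zero_Bop {φ : 𝓢(Mink d, ℂ)} {U : Set (Mink d)} (hU : IsOpen U)
    (h : ∀ x ∈ U, φ x = 0) (n : ℕ) : ∀ x ∈ U, Bop d n φ x = 0 := by
  induction n with
  | zero => simpa [Bop] using h
  | succ n ih =>
    intro x hx
    have h0 : (Bop d n φ : Mink d → ℂ) =ᶠ[𝓝 x] fun _ => 0 := by
      filter_upwards [hU.mem_nhds hx] with y hy using ih y hy
    rw [Bop_succ_apply, eulerOp_apply, h0.fderiv_eq, ih x hx]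
    simp

/-! ### The distributions `τ(x⁰) h⁽ⁿ⁾(x²)` -/

/-- Admissible functions of `x²`: polynomially bounded away from `0`, with at most the weight
singularity at `0`. -/
def AdmBound (d : ℕ) (C : ℝ) (M : ℕ) (h : ℝ → ℂ) : Prop :=
  ∀ w ≠ 0, ‖h w‖ ≤ C * ((1 + |w|) ^ M * |w| ^ wexp d)

/-- Measurable functions that satisfy some admissible bound. -/
def Adm (d : ℕ) (h : ℝ → ℂ) : Prop := Measurable h ∧ ∃ C M, AdmBound d C M h

/-- Bounded measurable functions of time. -/
def BddMeas (τ : ℝ → ℂ) : Prop := Measurable τ ∧ ∃ C, ∀ t, ‖τ t‖ ≤ C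

/-- The kernel `τ(x⁰) h(x²) |𝐱|^{-2n}`. -/
def kerI (n : ℕ) (τ h : ℝ → ℂ) (x : Mink d) : ℂ :=
  τ (x 0) * h (sq x) * (((rsq x ^ n)⁻¹ : ℝ) : ℂ)

/-- The distribution `φ ↦ ∫ τ(x⁰) h(x²) |𝐱|^{-2n} (Bₙ φ)(x) dx`, that is, `τ(x⁰) h⁽ⁿ⁾(x²)`. -/
def IDist (d : ℕ) [NeZero d] (n : ℕ) (τ h : ℝ → ℂ) : 𝓢'(Mink d, ℂ) :=
  PointwiseConvergenceCLM.precomp ℂ (Bop d n) (tdist (kerI n τ h))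

lemma measurable_kerI {n : ℕ} {τ h : ℝ → ℂ} (hτ : Measurable τ) (hh : Measurable h) :
    Measurable (kerI (d := d) n τ h) := by
  have := continuous_sq (d := d)
  have := continuous_rsq (d := d)
  unfold kerI
  fun_prop

lemma norm_kerI_le {n : ℕ} {τ h : ℝ → ℂ} {D C : ℝ} {M : ℕ} (hτ : ∀ t, ‖τ t‖ ≤ D)
    (hh : AdmBound d C M h) {x : Mink d} (hx : sq x ≠ 0) :
    ‖kerI n τ h x‖ ≤ D * C * ((1 + ‖x‖) ^ (2 * M) * (|sq x| ^ wexp d * (rsq x ^ n)⁻¹)) := by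
  have hr := rsq_nonneg x
  have hD : 0 ≤ D := (norm_nonneg _).trans (hτ 0)
  have hC : 0 ≤ C := by
    have h1 := (norm_nonneg _).trans (hh 1 one_ne_zero)
    simp only [abs_one, Real.one_rpow, mul_one] at h1
    exact nonneg_of_mul_nonneg_left h1 (by positivity)
  have h1 : (1 + |sq x|) ^ M ≤ (1 + ‖x‖) ^ (2 * M) := by
    rw [pow_mul]
    refine pow_le_pow_left₀ (by positivity) ?_ M
    nlinarith [abs_sq_le x, norm_nonneg x]
  rw [kerI, norm_mul, norm_mul, Complex.norm_real, Real.norm_of_nonneg (by positivity)]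
  calc _ ≤ D * (C * ((1 + |sq x|) ^ M * |sq x| ^ wexp d)) * (rsq x ^ n)⁻¹ := by
        gcongr
        · exact hτ _
        · exact hh _ hx
    _ ≤ D * (C * ((1 + ‖x‖) ^ (2 * M) * |sq x| ^ wexp d)) * (rsq x ^ n)⁻¹ := by gcongr
    _ = _ := by ring

lemma tame_weight {n : ℕ} (hn : n ≤ (d - 2) / 2) (K : ℕ) :
    Tame fun x : Mink d =>
      (((1 + ‖x‖) ^ K * (|sq x| ^ wexp d * (rsq x ^ n)⁻¹) : ℝ) : ℂ) := by
  obtain ⟨N, hN⟩ := integrable_weight hn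
  have := continuous_sq (d := d)
  have := continuous_rsq (d := d)
  refine ⟨Measurable.aestronglyMeasurable (by fun_prop), K + N, hN.congr
    (Eventually.of_forall fun x => ?_)⟩
  have hr := rsq_nonneg x
  simp only
  rw [Complex.norm_real, Real.norm_of_nonneg (by positivity), pow_add]
  field_simp

lemma tame_kerI {n : ℕ} (hn : n ≤ (d - 2) / 2) {τ h : ℝ → ℂ} (hτ : BddMeas τ) (hh : Adm d h) :
    Tame (kerI (d := d) n τ h) := by
  obtain ⟨hτm, D, hD⟩ := hτ
  obtain ⟨hm, C, M, hC⟩ := hh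
  refine (tame_weight hn (2 * M)).mono (measurable_kerI hτm hm).aestronglyMeasurable
    (C := D * C) ?_
  filter_upwards [ae_sq_ne_zero] with x hx
  have hr := rsq_nonneg x
  rw [Complex.norm_real, Real.norm_of_nonneg (by positivity)]
  exact norm_kerI_le hD hC hx

lemma IDist_apply {n : ℕ} (hn : n ≤ (d - 2) / 2) {τ h : ℝ → ℂ} (hτ : BddMeas τ) (hh : Adm d h)
    (φ : 𝓢(Mink d, ℂ)) :
    IDist d n τ h φ = ∫ x, kerI n τ h x * Bop d n φ x :=
  tdist_apply (tame_kerI hn hτ hh) _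

/-- Dominated convergence for the distributions `τ(x⁰) h⁽ⁿ⁾(x²)`. -/
lemma tendsto_IDist {n : ℕ} (hn : n ≤ (d - 2) / 2) {ι : Type*} {l : Filter ι} [l.IsCountablyGenerated]
    {τ : ι → ℝ → ℂ} {h : ι → ℝ → ℂ} {τ₀ h₀ : ℝ → ℂ} {C D : ℝ} {M : ℕ}
    (hτ : ∀ᶠ i in l, Measurable (τ i) ∧ ∀ t, ‖τ i t‖ ≤ D) (hτ₀ : BddMeas τ₀)
    (hh : ∀ᶠ i in l, Measurable (h i) ∧ AdmBound d C M (h i)) (hh₀ : Adm d h₀)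
    (hτl : ∀ t ≠ 0, Tendsto (fun i => τ i t) l (𝓝 (τ₀ t)))
    (hhl : ∀ w ≠ 0, Tendsto (fun i => h i w) l (𝓝 (h₀ w))) (φ : 𝓢(Mink d, ℂ)) :
    Tendsto (fun i => IDist d n (τ i) (h i) φ) l (𝓝 (IDist d n τ₀ h₀ φ)) := by
  rw [IDist_apply hn hτ₀ hh₀]
  have hev : (fun i => IDist d n (τ i) (h i) φ) =ᶠ[l]
      fun i => ∫ x, kerI n (τ i) (h i) x * Bop d n φ x := by
    filter_upwards [hτ, hh] with i h1 h2
    exact IDist_apply hn ⟨h1.1, D, h1.2⟩ ⟨h2.1, C, M, h2.2⟩ φ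
  rw [tendsto_congr' hev]
  have hb := ((tame_weight (d := d) hn (2 * M)).integrable_mul (Bop d n φ)).norm.const_mul (D * C)
  have hT : ∀ᵐ x : Mink d, x 0 ≠ 0 := by
    obtain ⟨k, rfl⟩ : ∃ k, d = k + 1 := ⟨d - 1, by have := NeZero.pos d; omega⟩
    have h : ∀ᵐ t : ℝ, t ≠ 0 := by simp [ae_iff]
    exact (measurePreserving_timeSpace k).quasiMeasurePreserving.ae
      (Measure.quasiMeasurePreserving_fst.ae h)
  refine tendsto_integral_filter_of_dominated_convergence _ ?_ ?_ hb ?_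
  · filter_upwards [hτ, hh] with i h1 h2
    exact (measurable_kerI h1.1 h2.1).aestronglyMeasurable.mul
      (Bop d n φ).continuous.aestronglyMeasurable
  · filter_upwards [hτ, hh] with i h1 h2
    filter_upwards [ae_sq_ne_zero] with x hx
    have hr := rsq_nonneg x
    rw [norm_mul, norm_mul, ← mul_assoc]
    refine mul_le_mul_of_nonneg_right ?_ (norm_nonneg _)
    rw [Complex.norm_real, Real.norm_of_nonneg (by positivity)]
    exact norm_kerI_le h1.2 h2.2 hx
  · filter_upwards [ae_sq_ne_zero, hT] with x hx hx0
    exact (((hτl _ hx0).mul (hhl _ hx)).mul_const _).mul_const _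

lemma bddMeas_one : BddMeas (fun _ => (1 : ℂ)) := ⟨measurable_const, 1, fun _ => by simp⟩

lemma bddMeas_theta (s : ℝ) : BddMeas (fun t => theta (s * t)) := by
  refine ⟨Measurable.ite (measurableSet_lt measurable_const (by fun_prop)) measurable_const
    measurable_const, 1, fun t => ?_⟩
  simp only [theta]; split_ifs <;> simp

lemma bounded_cutoff {χ : ℝ → ℝ} (h : Continuous χ) (h0 : ∀ t ≤ -1, χ t = 0)
    (h1 : ∀ t, 1 ≤ t → χ t = 1) : ∃ C, ∀ t, |χ t| ≤ C := by
  obtain ⟨C, hC⟩ := (isCompact_Icc (a := (-1 : ℝ)) (b := 1)).exists_bound_of_continuousOn h.continuousOn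
  refine ⟨max C 1, fun t => ?_⟩
  rcases le_total t (-1) with ht | ht
  · simp [h0 t ht]
  rcases le_total 1 t with ht' | ht'
  · simp [h1 t ht']
  · exact (hC t ⟨ht, ht'⟩).trans (le_max_left _ _)

/-- Smooth functions that are constant outside of a compact set have temperate growth. -/
lemma hasTemperateGrowth_cutoff {χ : ℝ → ℝ} (h : ContDiff ℝ ∞ χ) (h0 : ∀ t ≤ -1, χ t = 0)
    (h1 : ∀ t, 1 ≤ t → χ t = 1) : χ.HasTemperateGrowth := by
  obtain ⟨C, hC⟩ := bounded_cutoff h.continuous h0 h1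
  refine Function.HasTemperateGrowth.of_fderiv (k := 0) (C := C) ?_ (h.differentiable (by simp))
    (fun t => by simpa using hC t)
  refine HasCompactSupport.hasTemperateGrowth ?_ (h.fderiv_right (by simp))
  refine HasCompactSupport.intro (isCompact_Icc (a := (-1 : ℝ)) (b := 1)) fun t ht => ?_
  rw [Set.mem_Icc, not_and_or, not_le, not_le] at ht
  rcases ht with ht | ht
  · have : χ =ᶠ[𝓝 t] fun _ => 0 := by
      filter_upwards [gt_mem_nhds ht] with u hu using h0 u (le_of_lt hu)
    rw [this.fderiv_eq]; simp
  · have : χ =ᶠ[𝓝 t] fun _ => 1 := by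
      filter_upwards [lt_mem_nhds ht] with u hu using h1 u (le_of_lt hu)
    rw [this.fderiv_eq]; simp

/-- The function `χ(r x⁰)` has temperate growth. -/
lemma hasTemperateGrowth_cutoff_time {χ : ℝ → ℝ} (h : ContDiff ℝ ∞ χ) (h0 : ∀ t ≤ -1, χ t = 0)
    (h1 : ∀ t, 1 ≤ t → χ t = 1) (r s : ℝ) :
    (fun x : Mink d => ((χ (r * (s * x 0)) : ℝ) : ℂ)).HasTemperateGrowth := by
  have := (Function.Complex.hasTemperateGrowth_ofReal.comp (hasTemperateGrowth_cutoff h h0 h1)).comp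
    ((r * s) • (EuclideanSpace.proj 0 : Mink d →L[ℝ] ℝ)).hasTemperateGrowth
  have h2 : (fun x : Mink d => ((χ (r * (s * x 0)) : ℝ) : ℂ)) = (Complex.ofReal ∘ χ) ∘
      ((r * s) • (EuclideanSpace.proj 0 : Mink d →L[ℝ] ℝ)) := by
    funext x; simp [mul_assoc]
  rw [h2]
  exact this

/-- Multiplication of `h⁽ⁿ⁾(x²)` by `θ(± x⁰)`. -/
lemma isThetaMul_IDist {n : ℕ} (hn : n ≤ (d - 2) / 2) {s : ℝ} (hs : s ≠ 0) {h : ℝ → ℂ}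
    (hh : Adm d h) : IsThetaMul s (IDist d n (fun _ => 1) h) (IDist d n (fun t => theta (s * t)) h) := by
  intro χ hχ h0 h1 φ
  obtain ⟨C, hC⟩ := bounded_cutoff hχ.continuous h0 h1
  have hm : ∀ R : ℝ, BddMeas fun t => ((χ (R * (s * t)) : ℝ) : ℂ) := fun R =>
    ⟨by have := hχ.continuous; fun_prop, C, fun t => by simpa using hC _⟩
  have heq : ∀ R : ℝ, (TemperedDistribution.smulLeftCLM ℂ
      (fun x : Mink d => ((χ (R * (s * x 0)) : ℝ) : ℂ)) (IDist d n (fun _ => 1) h)) φ =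
      IDist d n (fun t => ((χ (R * (s * t)) : ℝ) : ℂ)) h φ := by
    intro R
    rw [TemperedDistribution.smulLeftCLM_apply_apply, IDist_apply hn bddMeas_one hh,
      IDist_apply hn (hm R) hh]
    congr 1
    ext x
    rw [Bop_time_mul (g := fun t => ((χ (R * (s * t)) : ℝ) : ℂ)) (φ := φ) fun x => by
      rw [SchwartzMap.smulLeftCLM_apply_apply (hasTemperateGrowth_cutoff_time hχ h0 h1 R s),
        smul_eq_mul]]
    simp only [kerI]
    ring
  simp only [heq]
  obtain ⟨hmeas, C', M, hb⟩ := hh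
  -- The functions χ(R s t) are bounded uniformly in R and converge to θ(s t) for t ≠ 0, which is
  -- all that dominated convergence asks for.
  refine tendsto_IDist hn (D := C) (M := M) (C := C') (Eventually.of_forall fun R => ⟨(hm R).1, fun t => by simpa using hC _⟩)
    (bddMeas_theta s) (Eventually.of_forall fun R => ⟨hmeas, hb⟩) ⟨hmeas, C', M, hb⟩ ?_
    (fun w _ => tendsto_const_nhds) φ
  intro t ht
  have hst : s * t ≠ 0 := mul_ne_zero hs ht
  refine tendsto_const_nhds.congr' ?_
  rcases lt_or_gt_of_ne hst with hlt | hgt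
  · filter_upwards [eventually_ge_atTop (-(s * t)⁻¹)] with R hR
    rw [theta, if_neg (not_lt.2 hlt.le), h0, Complex.ofReal_zero]
    have := mul_le_mul_of_nonpos_right hR hlt.le
    rwa [neg_mul, inv_mul_cancel₀ hst] at this
  · filter_upwards [eventually_ge_atTop ((s * t)⁻¹)] with R hR
    rw [theta, if_pos hgt, h1, Complex.ofReal_one]
    have := mul_le_mul_of_nonneg_right hR hgt.le
    rwa [inv_mul_cancel₀ hst] at this

/-- Integration by parts: `τ(x⁰) ∂_w h⁽ⁿ⁾ = τ(x⁰) (h')⁽ⁿ⁾`. -/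
theorem IDist_succ_eq {n : ℕ} (hn : n + 1 ≤ (d - 2) / 2) {τ h h' : ℝ → ℂ} (hτ : BddMeas τ)
    (hh : Adm d h) (hh' : Adm d h') (hc : Continuous h) (hd : ∀ w ≠ 0, HasDerivAt h (h' w) w) :
    IDist d (n + 1) τ h = IDist d n τ h' := by
  ext φ
  have hn' : n ≤ (d - 2) / 2 := by omega
  rw [IDist_apply hn hτ hh, IDist_apply hn' hτ hh']
  set ψ := Bop d n φ with hψ
  have t1 := tame_kerI hn hτ hh
  have t0 := tame_kerI hn' hτ hh'
  set G : Mink d → ℂ := fun x => kerI (n + 1) τ h x * ψ x with hG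
  -- ψ' is the Euler derivative of |𝐱|^(-2(n+1)) ψ without its singular factor. As d - 1 - 2(n+1) =
  -- d - 3 - 2n, the combination -½ (ψ' + (d-1) ψ) is the next iterate applied to φ, and d - 1 is
  -- the number of dilated coordinates in Euler's identity.
  set ψ' : 𝓢(Mink d, ℂ) := eulerOp (spatial d) ψ - (2 * ((n : ℂ) + 1)) • ψ with hψ'
  have hψ'x : ∀ x, ψ' x = eulerOp (spatial d) ψ x - 2 * ((n : ℂ) + 1) * ψ x := fun x => by
    simp [hψ']
  set G' : Mink d → ℂ := fun x => 2 * (kerI n τ h' x * ψ x) + kerI (n + 1) τ h x * ψ' x with hG'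
  have iG : Integrable G := t1.integrable_mul ψ
  have i1 := (t0.integrable_mul ψ).const_mul 2
  have i2 := t1.integrable_mul ψ'
  have hE := integral_euler (spatial d) iG (i1.add i2) (by
    have := measurable_kerI (d := d) (n := n) hτ.1 hh'.1
    have := measurable_kerI (d := d) (n := n + 1) hτ.1 hh.1
    have := ψ.continuous.measurable
    have := ψ'.continuous.measurable
    exact ((‹Measurable (kerI n τ h')›.mul ‹_›).const_mul 2).add (Measurable.mul ‹_› ‹_›)) (by
    filter_upwards [ae_rsq_ne_zero (d := d) (by omega)] with x hx
    have hGd : (fun l => G (dil (spatial d) l x)) = fun l : ℝ =>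
        τ (x 0) * h (l ^ 2 * rsq x - x 0 ^ 2) * ((((l ^ 2 * rsq x) ^ (n + 1))⁻¹ : ℝ) : ℂ) *
          ψ (dil (spatial d) l x) := by
      funext l
      simp only [hG, kerI, rsq_dil, sq_dil, dil_spatial_zero]
    rw [hGd]
    constructor
    · refine ContinuousOn.mul (ContinuousOn.mul (Continuous.continuousOn (by fun_prop)) ?_)
        (Continuous.continuousOn ?_)
      · refine Complex.continuous_ofReal.comp_continuousOn (ContinuousOn.inv₀ (by fun_prop) ?_)
        intro l hl
        have : 0 < l := by linarith [hl.1]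
        positivity
      · exact ψ.continuous.comp ((continuous_dil _).comp (by fun_prop : Continuous fun l : ℝ => (l, x)))
    -- A dilation orbit meets the light cone, where h need not be differentiable, only if l² =
    -- (x⁰)²/|𝐱|².
    · refine ⟨{√(x 0 ^ 2 / rsq x), -√(x 0 ^ 2 / rsq x)}, (Set.toFinite _).countable, ?_⟩
      rintro l ⟨hl, hls⟩
      have hl0 : 0 < l := by linarith [hl.1]
      have hne : l ^ 2 * rsq x - x 0 ^ 2 ≠ 0 := by
        intro h0
        apply hls
        have : l ^ 2 = √(x 0 ^ 2 / rsq x) ^ 2 := by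
          rw [Real.sq_sqrt (div_nonneg (sq_nonneg _) (rsq_nonneg x))]
          field_simp; linarith
        simpa using sq_eq_sq_iff_eq_or_eq_neg.1 this
      have e1 : HasDerivAt (fun l : ℝ => l ^ 2 * rsq x - x 0 ^ 2) (2 * l * rsq x) l := by
        simpa using ((hasDerivAt_pow 2 l).mul_const (rsq x)).sub_const (x 0 ^ 2)
      have e2 := (hd _ hne).scomp l e1
      have e3 : HasDerivAt (fun l : ℝ => ((((l ^ 2 * rsq x) ^ (n + 1))⁻¹ : ℝ) : ℂ))
          (((-(2 * (n + 1)) * l⁻¹ * ((l ^ 2 * rsq x) ^ (n + 1))⁻¹ : ℝ)) : ℂ) l := by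
        refine HasDerivAt.ofReal_comp ?_
        have := ((((hasDerivAt_pow 2 l).mul_const (rsq x)).pow (n + 1)).inv
          (by positivity : ((l ^ 2 * rsq x) ^ (n + 1)) ≠ 0))
        refine this.congr_deriv ?_
        simp only [Nat.add_sub_cancel]
        push_cast
        simp only [Pi.pow_apply]
        field_simp
        ring
      have e4 := hasDerivAt_schwartz_dil (spatial d) ψ x hl0.ne'
      refine (((e2.const_mul (τ (x 0))).mul e3).mul e4).congr_deriv ?_
      have hlc : (l : ℂ) ≠ 0 := by exact_mod_cast hl0.ne'
      have hrc : (rsq x : ℂ) ≠ 0 := by exact_mod_cast hx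
      simp only [hψ'x, kerI, rsq_dil, sq_dil, dil_spatial_zero, Complex.real_smul, Function.comp,
        Pi.mul_apply, Pi.add_apply]
      push_cast
      field_simp
      ring)
  have hsum : ∫ x, ((2 * (kerI n τ h' x * ψ x)) + kerI (n + 1) τ h x * ψ' x) =
      2 * (∫ x, kerI n τ h' x * ψ x) + ∫ x, kerI (n + 1) τ h x * ψ' x := by
    rw [integral_add i1 i2, integral_const_mul]
  have hE' : 2 * (∫ x, kerI n τ h' x * ψ x) + (∫ x, kerI (n + 1) τ h x * ψ' x) =
      -((spatial d).card : ℂ) * ∫ x, G x := by rw [← hsum]; exact hE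
  rw [card_spatial] at hE'
  have hB : ∫ x, kerI (n + 1) τ h x * Bop d (n + 1) φ x =
      -(1 / 2) * ((∫ x, kerI (n + 1) τ h x * ψ' x) + ((d : ℂ) - 1) * ∫ x, G x) := by
    rw [← integral_const_mul, ← integral_add i2 (iG.const_mul _), ← integral_const_mul]
    congr 1
    ext x
    rw [Bop_succ_apply, hψ'x, hG]
    ring
  rw [hB]
  linear_combination (-1 / 2 : ℂ) * hE'

end space

end

section
/-! ### The functions `U_α` -/

/-- From eˣ ≥ xⁿ/n!. The factor e^(-B/σ) thus absorbs any negative power of σ at 0, so the integrals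
K_α converge for all real α. -/
lemma exp_neg_div_le {B : ℝ} (hB : 0 < B) (n : ℕ) {σ : ℝ} (hσ : 0 < σ) :
    Real.exp (-(B / σ)) ≤ n.factorial / B ^ n * σ ^ n := by
  have h1 := Real.pow_div_factorial_le_exp (B / σ) (by positivity) n
  rw [Real.exp_neg]
  calc (Real.exp (B / σ))⁻¹ ≤ ((B / σ) ^ n / n.factorial)⁻¹ := inv_anti₀ (by positivity) h1
    _ = _ := by rw [div_pow]; field_simp

lemma integrableOn_exp_exp_rpow {A B : ℝ} (hA : 0 < A) (hB : 0 < B) (s : ℝ) :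
    IntegrableOn (fun σ : ℝ => Real.exp (-(A * σ) - B / σ) * σ ^ s) (Set.Ioi 0) := by
  obtain ⟨n, hn⟩ := exists_nat_gt (-s)
  have h := (integrableOn_rpow_mul_exp_neg_mul_rpow (s := n + s) (p := 1) (by linarith) one_pos hA).const_mul
    (n.factorial / B ^ n)
  refine Integrable.mono' h (by fun_prop) ?_
  filter_upwards [ae_restrict_mem measurableSet_Ioi] with σ hσ
  have hσ : 0 < σ := hσ
  rw [Real.norm_of_nonneg (by positivity), sub_eq_add_neg, Real.exp_add, Real.rpow_one,
    Real.rpow_add hσ, Real.rpow_natCast]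
  have := exp_neg_div_le hB n hσ
  calc _ ≤ Real.exp (-(A * σ)) * (n.factorial / B ^ n * σ ^ n) * σ ^ s := by gcongr
    _ = _ := by rw [neg_mul]; ring

lemma integrableOn_exp_neg_div_rpow {B s : ℝ} (hB : 0 < B) (hs : s < -1) :
    IntegrableOn (fun σ : ℝ => Real.exp (-(B / σ)) * σ ^ s) (Set.Ioi 0) := by
  rw [← Set.Ioc_union_Ioi_eq_Ioi (zero_le_one' ℝ)]
  have hm : Measurable (fun σ : ℝ => Real.exp (-(B / σ)) * σ ^ s) := by fun_prop
  refine IntegrableOn.union ?_ ?_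
  · obtain ⟨n, hn⟩ := exists_nat_gt (-s)
    have h1 : IntegrableOn (fun y : ℝ => y ^ (n + s)) (Set.Ioc 0 1) :=
      (intervalIntegrable_iff_integrableOn_Ioc_of_le zero_le_one).1
        (intervalIntegral.intervalIntegrable_rpow' (by linarith))
    refine Integrable.mono' (h1.const_mul (n.factorial / B ^ n)) hm.aestronglyMeasurable ?_
    filter_upwards [ae_restrict_mem measurableSet_Ioc] with σ hσ
    have hσ0 : 0 < σ := hσ.1
    rw [Real.norm_of_nonneg (by positivity), Real.rpow_add hσ0, Real.rpow_natCast, ← mul_assoc]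
    exact mul_le_mul_of_nonneg_right (exp_neg_div_le hB n hσ0) (by positivity)
  · refine Integrable.mono' (integrableOn_Ioi_rpow_of_lt hs one_pos) hm.aestronglyMeasurable ?_
    filter_upwards [ae_restrict_mem measurableSet_Ioi] with σ hσ
    have hσ0 : 0 < σ := one_pos.trans hσ
    rw [Real.norm_of_nonneg (by positivity)]
    refine mul_le_of_le_one_left (by positivity) (Real.exp_le_one_iff.2 ?_)
    have : 0 < B / σ := by positivity
    linarith

/-- Differentiation of `∫ exp(-ζ p(σ)) q(σ) dσ` with respect to `ζ`. -/
lemma hasDerivAt_integral_exp {p : ℝ → ℝ} {q : ℝ → ℂ} (hp : Measurable p) (hq : Measurable q)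
    (hp0 : ∀ σ, 0 < σ → 0 ≤ p σ) {ζ : ℂ} {δ : ℝ} (hδ : 0 < δ)
    (h0 : IntegrableOn (fun σ => Complex.exp (-(ζ * p σ)) * q σ) (Set.Ioi 0))
    (h1 : IntegrableOn (fun σ => Real.exp (-((ζ.re - δ) * p σ)) * (p σ * ‖q σ‖)) (Set.Ioi 0)) :
    HasDerivAt (fun z : ℂ => ∫ σ in Set.Ioi (0 : ℝ), Complex.exp (-(z * p σ)) * q σ)
      (∫ σ in Set.Ioi (0 : ℝ), -(p σ : ℂ) * (Complex.exp (-(ζ * p σ)) * q σ)) ζ := by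
  refine (hasDerivAt_integral_of_dominated_loc_of_deriv_le (Metric.ball_mem_nhds ζ hδ)
    (F := fun z σ => Complex.exp (-(z * p σ)) * q σ)
    (F' := fun z σ => -(p σ : ℂ) * (Complex.exp (-(z * p σ)) * q σ))
    (bound := fun σ => Real.exp (-((ζ.re - δ) * p σ)) * (p σ * ‖q σ‖))
    (Eventually.of_forall fun z => ?_) h0 ?_ ?_ h1 ?_).2
  · exact Measurable.aestronglyMeasurable (by fun_prop)
  · exact Measurable.aestronglyMeasurable (by fun_prop)
  · filter_upwards [ae_restrict_mem measurableSet_Ioi] with σ hσ z hz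
    have hpσ := hp0 σ hσ
    rw [norm_mul, norm_mul, norm_neg, Complex.norm_real, Real.norm_of_nonneg hpσ,
      Complex.norm_exp, mul_left_comm]
    refine mul_le_mul_of_nonneg_right (Real.exp_le_exp.2 ?_) (by positivity)
    have hre : ζ.re - δ ≤ z.re := by
      have := (Complex.abs_re_le_norm (z - ζ)).trans (mem_ball_iff_norm.1 hz).le
      rw [Complex.sub_re, abs_le] at this
      linarith [this.1]
    simp only [Complex.neg_re, Complex.mul_re, Complex.ofReal_re, Complex.ofReal_im, mul_zero, sub_zero]
    nlinarith
  · refine Eventually.of_forall fun σ z _ => ?_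
    have h2 : HasDerivAt (fun z : ℂ => -(z * p σ)) (-(p σ : ℂ)) z := by
      exact ((hasDerivAt_id z).mul_const (p σ : ℂ)).fun_neg.congr_deriv (by simp)
    exact (h2.cexp.mul_const (q σ)).congr_deriv (by ring)

/-- `K_α(a,b) = ∫₀^∞ e^{-aσ - b/σ} σ^{-α-1} dσ`. -/
def besselK (α : ℝ) (a b : ℂ) : ℂ :=
  ∫ σ in Set.Ioi (0 : ℝ), Complex.exp (-(a * σ) - b / σ) * ((σ ^ (-α - 1) : ℝ) : ℂ)

lemma integrableOn_besselK (s : ℝ) {a b : ℂ} (ha : 0 < a.re) (hb : 0 < b.re) :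
    IntegrableOn (fun σ : ℝ => Complex.exp (-(a * σ) - b / σ) * ((σ ^ s : ℝ) : ℂ)) (Set.Ioi 0) := by
  refine (integrableOn_exp_exp_rpow ha hb s).mono' (by fun_prop) ?_
  filter_upwards [ae_restrict_mem measurableSet_Ioi] with σ hσ
  have hσ : 0 < σ := hσ
  rw [norm_mul, Complex.norm_exp, Complex.norm_real, Real.norm_of_nonneg (by positivity)]
  simp [Complex.div_ofReal_re]

lemma hasDerivAt_besselK_left (α : ℝ) {a b : ℂ} (ha : 0 < a.re) (hb : 0 < b.re) :
    HasDerivAt (fun a => besselK α a b) (-besselK (α - 1) a b) a := by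
  have key := hasDerivAt_integral_exp (p := fun σ => σ)
    (q := fun σ => Complex.exp (-(b / σ)) * ((σ ^ (-α - 1) : ℝ) : ℂ)) (by fun_prop) (by fun_prop)
    (fun σ h => h.le) (ζ := a) (half_pos ha) ?_ ?_
  · have e1 : (fun a => besselK α a b) = fun z : ℂ => ∫ σ in Set.Ioi (0 : ℝ),
        Complex.exp (-(z * σ)) * (Complex.exp (-(b / σ)) * ((σ ^ (-α - 1) : ℝ) : ℂ)) := by
      funext z
      simp only [besselK, sub_eq_add_neg, Complex.exp_add, mul_assoc]
    rw [e1]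
    refine key.congr_deriv ?_
    rw [besselK, ← integral_neg]
    refine setIntegral_congr_fun measurableSet_Ioi fun σ hσ => ?_
    have hσ : 0 < σ := hσ
    rw [show -(α - 1) - 1 = (-α - 1) + 1 by ring, Real.rpow_add hσ (-α - 1), Real.rpow_one, sub_eq_add_neg (-(a * (σ : ℂ))),
      Complex.exp_add]
    push_cast; ring
  · refine (integrableOn_besselK (-α - 1) ha hb).congr_fun (fun σ _ => ?_) measurableSet_Ioi
    simp only [sub_eq_add_neg, Complex.exp_add, mul_assoc]
  · refine (integrableOn_exp_exp_rpow (half_pos ha) hb (-α)).congr_fun (fun σ hσ => ?_) measurableSet_Ioi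
    have hσ : 0 < σ := hσ
    simp only
    rw [norm_mul, Complex.norm_exp, Complex.norm_real, Real.norm_of_nonneg (by positivity),
      sub_eq_add_neg, Real.exp_add, show -α = (-α - 1) + 1 by ring, Real.rpow_add hσ, Real.rpow_one]
    simp only [Complex.neg_re, Complex.div_ofReal_re]
    ring_nf

lemma hasDerivAt_besselK_right (α : ℝ) {a b : ℂ} (ha : 0 < a.re) (hb : 0 < b.re) :
    HasDerivAt (fun b => besselK α a b) (-besselK (α + 1) a b) b := by
  have key := hasDerivAt_integral_exp (p := fun σ => σ⁻¹)
    (q := fun σ => Complex.exp (-(a * σ)) * ((σ ^ (-α - 1) : ℝ) : ℂ)) (by fun_prop) (by fun_prop)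
    (fun σ h => (inv_pos.2 h).le) (ζ := b) (half_pos hb) ?_ ?_
  · have e1 : (fun b => besselK α a b) = fun z : ℂ => ∫ σ in Set.Ioi (0 : ℝ),
        Complex.exp (-(z * ((σ⁻¹ : ℝ) : ℂ))) * (Complex.exp (-(a * σ)) * ((σ ^ (-α - 1) : ℝ) : ℂ)) := by
      funext z
      simp only [besselK, sub_eq_add_neg, Complex.exp_add, Complex.ofReal_inv, div_eq_mul_inv]
      congr 1; funext σ; ring
    rw [e1]
    refine key.congr_deriv ?_
    rw [besselK, ← integral_neg]
    refine setIntegral_congr_fun measurableSet_Ioi fun σ hσ => ?_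
    have hσ : 0 < σ := hσ
    rw [show -(α + 1) - 1 = (-α - 1) - 1 by ring, Real.rpow_sub hσ (-α - 1), Real.rpow_one, sub_eq_add_neg (-(a * (σ : ℂ))),
      Complex.exp_add]
    push_cast; rw [div_eq_mul_inv b]; ring
  · refine (integrableOn_besselK (-α - 1) ha hb).congr_fun (fun σ _ => ?_) measurableSet_Ioi
    simp only [sub_eq_add_neg, Complex.exp_add, Complex.ofReal_inv, div_eq_mul_inv]
    ring
  · refine (integrableOn_exp_exp_rpow ha (half_pos hb) (-α - 2)).congr_fun (fun σ hσ => ?_) measurableSet_Ioi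
    have hσ : 0 < σ := hσ
    simp only
    rw [norm_mul, Complex.norm_exp, Complex.norm_real, Real.norm_of_nonneg (by positivity),
      sub_eq_add_neg, Real.exp_add, show -α - 2 = (-α - 1) - 1 by ring, Real.rpow_sub hσ, Real.rpow_one]
    simp only [Complex.neg_re, Complex.re_mul_ofReal]
    ring_nf

lemma differentiableAt_besselK_diag (α : ℝ) {ζ : ℂ} (hζ : 0 < ζ.re) :
    DifferentiableAt ℂ (fun z => besselK α z z) ζ := by
  have key := hasDerivAt_integral_exp (p := fun σ => σ + σ⁻¹)
    (q := fun σ => ((σ ^ (-α - 1) : ℝ) : ℂ)) (by fun_prop) (by fun_prop)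
    (fun σ h => by have := inv_pos.2 h; positivity) (ζ := ζ) (half_pos hζ) ?_ ?_
  · refine key.differentiableAt.congr_of_eventuallyEq (Eventually.of_forall fun z => ?_)
    simp only [besselK]
    congr 1; funext σ
    congr 2
    push_cast; ring
  · refine (integrableOn_besselK (-α - 1) hζ hζ).congr_fun (fun σ _ => ?_) measurableSet_Ioi
    simp only
    congr 2
    push_cast; ring
  · have h2 := (integrableOn_exp_exp_rpow (half_pos hζ) (half_pos hζ) (-α)).add
      (integrableOn_exp_exp_rpow (half_pos hζ) (half_pos hζ) (-α - 2))
    refine h2.congr_fun (fun σ hσ => ?_) measurableSet_Ioi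
    have hσ : 0 < σ := hσ
    simp only [Pi.add_apply]
    rw [Complex.norm_real, Real.norm_of_nonneg (by positivity),
      show -α - 2 = (-α - 1) - 1 by ring, Real.rpow_sub hσ, Real.rpow_one,
      show -α = (-α - 1) + 1 by ring, Real.rpow_add hσ, Real.rpow_one]
    ring_nf

lemma re_sqrt_pos {z : ℂ} (hz : z ∈ Complex.slitPlane) : 0 < (z ^ (1 / 2 : ℂ)).re := by
  have h0 : z ≠ 0 := Complex.slitPlane_ne_zero hz
  rw [Complex.cpow_def_of_ne_zero h0, Complex.exp_re]
  refine mul_pos (Real.exp_pos _) (Real.cos_pos_of_mem_Ioo ?_)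
  have him : (Complex.log z * (1 / 2)).im = z.arg / 2 := by
    rw [show (1 / 2 : ℂ) = ((1 / 2 : ℝ) : ℂ) by push_cast; rfl, Complex.im_mul_ofReal, Complex.log_im]
    ring
  rw [him]
  have h1 := Complex.neg_pi_lt_arg z
  have h2 := (Complex.arg_le_pi z).lt_of_ne (Complex.mem_slitPlane_iff_arg.1 hz).1
  constructor <;> linarith

lemma sqrt_mul_sqrt (z : ℂ) : z ^ (1 / 2 : ℂ) * z ^ (1 / 2 : ℂ) = z := by
  have := Complex.cpow_nat_inv_pow z (n := 2) (by norm_num)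
  rw [pow_two] at this
  simpa using this

lemma besselU_eq (α : ℝ) (z : ℂ) : besselU α z = 1 / (Real.sqrt Real.pi : ℂ) * z ^ (-(α : ℂ) / 2) *
    besselK α (z ^ (1 / 2 : ℂ)) (z ^ (1 / 2 : ℂ)) := by
  rw [besselU, besselK]
  congr 1
  refine setIntegral_congr_fun measurableSet_Ioi fun σ hσ => ?_
  have hσ : 0 < σ := hσ
  rw [Complex.ofReal_cpow hσ.le]
  push_cast
  congr 2
  ring

lemma differentiableAt_besselU (α : ℝ) {z : ℂ} (hz : z ∈ Complex.slitPlane) :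
    DifferentiableAt ℂ (besselU α) z := by
  rw [show besselU α = fun z => 1 / (Real.sqrt Real.pi : ℂ) * z ^ (-(α : ℂ) / 2) *
    besselK α (z ^ (1 / 2 : ℂ)) (z ^ (1 / 2 : ℂ)) from funext (besselU_eq α)]
  refine DifferentiableAt.mul (DifferentiableAt.mul (by fun_prop)
    ((hasDerivAt_id z).cpow_const hz).differentiableAt) ?_
  exact DifferentiableAt.comp (g := fun w => besselK α w w) (f := fun z : ℂ => z ^ (1 / 2 : ℂ)) z
    (differentiableAt_besselK_diag α (re_sqrt_pos hz)) ((hasDerivAt_id z).cpow_const (c := 1 / 2) hz).differentiableAt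

lemma mul_mem_slitPlane {a b : ℂ} (ha : 0 < a.re) (hb : 0 < b.re) : a * b ∈ Complex.slitPlane := by
  have ha0 : a ≠ 0 := fun h => by simp [h] at ha
  have hb0 : b ≠ 0 := fun h => by simp [h] at hb
  have h1 := Complex.abs_arg_lt_pi_div_two_iff.2 (Or.inl ha)
  have h2 := Complex.abs_arg_lt_pi_div_two_iff.2 (Or.inl hb)
  rw [abs_lt] at h1 h2
  rw [Complex.mem_slitPlane_iff_arg]
  refine ⟨?_, mul_ne_zero ha0 hb0⟩
  rw [Complex.arg_mul ha0 hb0 ⟨by linarith, by linarith⟩]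
  linarith

lemma log_mul_of_re_pos {a b : ℂ} (ha : 0 < a.re) (hb : 0 < b.re) :
    Complex.log (a * b) = Complex.log a + Complex.log b := by
  have ha0 : a ≠ 0 := fun h => by simp [h] at ha
  have hb0 : b ≠ 0 := fun h => by simp [h] at hb
  have h1 := Complex.abs_arg_lt_pi_div_two_iff.2 (Or.inl ha)
  have h2 := Complex.abs_arg_lt_pi_div_two_iff.2 (Or.inl hb)
  rw [abs_lt] at h1 h2
  exact Complex.log_mul ha0 hb0 ⟨by linarith, by linarith⟩

/-- The substitution σ → σ/√l symmetrizes the pair (lb, b) to (√l b, √l b), where the integral is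
U_α by definition. The branches fit because log(l b²) = log l + 2 log b when Re b > 0. -/
lemma besselK_ray (α : ℝ) {b : ℂ} (hb : 0 < b.re) {l : ℝ} (hl : 0 < l) :
    besselK α (l * b) b = (Real.sqrt Real.pi : ℂ) * (l * b) ^ (α : ℂ) * besselU α (l * b * b) := by
  have hb0 : b ≠ 0 := fun h => by simp [h] at hb
  have hlb : 0 < ((l : ℂ) * b).re := by rw [Complex.re_ofReal_mul]; positivity
  have hlb0 : (l : ℂ) * b ≠ 0 := fun h => by simp [h] at hlb
  have hlog1 : Complex.log (l * b) = (Real.log l : ℂ) + Complex.log b := by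
    rw [Complex.log_ofReal_mul hl hb0]
  have hlog : Complex.log (l * b * b) = (Real.log l : ℂ) + 2 * Complex.log b := by
    rw [log_mul_of_re_pos hlb hb, hlog1]; ring
  have hne : (l : ℂ) * b * b ≠ 0 := mul_ne_zero hlb0 hb0
  have hsqrt : ((l : ℂ) * b * b) ^ (1 / 2 : ℂ) = √l * b := by
    rw [Complex.cpow_def_of_ne_zero hne, hlog, show ((Real.log l : ℂ) + 2 * Complex.log b) * (1 / 2) =
      ((1 / 2 * Real.log l : ℝ) : ℂ) + Complex.log b by push_cast; ring, Complex.exp_add, Complex.exp_log hb0,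
      ← Complex.ofReal_exp, Real.sqrt_eq_rpow, Real.rpow_def_of_pos hl]
    ring_nf
  have hs : 0 < √l := Real.sqrt_pos.2 hl
  have hpi : (Real.sqrt Real.pi : ℂ) ≠ 0 := by
    exact_mod_cast (Real.sqrt_pos.2 Real.pi_pos).ne'
  rw [besselU_eq, hsqrt]
  have h1 : besselK α (l * b) b = (((√l) ^ α : ℝ) : ℂ) * besselK α (√l * b) (√l * b) := by
    rw [besselK, besselK]
    have := integral_comp_mul_left_Ioi (fun u : ℝ => Complex.exp (-(√l * b * u) - √l * b / u) *
      ((u ^ (-α - 1) : ℝ) : ℂ)) 0 hs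
    rw [mul_zero] at this
    rw [eq_inv_smul_iff₀ hs.ne', Complex.real_smul] at this
    rw [← this, ← mul_assoc, ← Complex.ofReal_mul, ← integral_const_mul]
    refine setIntegral_congr_fun measurableSet_Ioi fun σ hσ => ?_
    have hσ : 0 < σ := hσ
    have hl2 : (√l : ℂ) * √l = l := by exact_mod_cast Real.mul_self_sqrt hl.le
    have hs0 : (√l : ℂ) ≠ 0 := by exact_mod_cast hs.ne'
    have hσ0 : (σ : ℂ) ≠ 0 := by exact_mod_cast hσ.ne'
    rw [mul_left_comm, ← Complex.ofReal_mul]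
    have e1 : (-(↑√l * b * ((√l * σ : ℝ) : ℂ)) - ↑√l * b / ((√l * σ : ℝ) : ℂ)) = -(l * b * σ) - b / σ := by
      push_cast
      rw [← hl2]; field_simp
    have e2 : √l ^ α * √l * (√l * σ) ^ (-α - 1) = σ ^ (-α - 1) := by
      rw [Real.mul_rpow hs.le hσ.le, ← mul_assoc, ← Real.rpow_add_one hs.ne', ← Real.rpow_add hs]
      ring_nf
      simp
    rw [e1, e2]
  rw [h1]
  have h2 : ((l : ℂ) * b) ^ (α : ℂ) * (l * b * b) ^ (-(α : ℂ) / 2) = (((√l) ^ α : ℝ) : ℂ) := by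
    rw [Complex.cpow_def_of_ne_zero hlb0, Complex.cpow_def_of_ne_zero hne, hlog, hlog1, ← Complex.exp_add,
      Real.rpow_def_of_pos hs, Real.log_sqrt hl.le, Complex.ofReal_exp]
    congr 1
    push_cast; ring
  rw [← h2]
  field_simp

/-- `K_α(a,b) = √π a^α U_α(ab)` for `Re a, Re b > 0`. -/
theorem besselK_eq (α : ℝ) {a b : ℂ} (ha : 0 < a.re) (hb : 0 < b.re) :
    besselK α a b = (Real.sqrt Real.pi : ℂ) * a ^ (α : ℂ) * besselU α (a * b) := by
  have hopen : IsOpen {z : ℂ | 0 < z.re} := isOpen_lt continuous_const Complex.continuous_re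
  have hconn : IsPreconnected {z : ℂ | 0 < z.re} := (convex_halfSpace_re_gt 0).isPreconnected
  have hf : AnalyticOnNhd ℂ (fun a => besselK α a b) {z : ℂ | 0 < z.re} :=
    DifferentiableOn.analyticOnNhd (fun z hz =>
      (hasDerivAt_besselK_left α hz hb).differentiableAt.differentiableWithinAt) hopen
  have hg : AnalyticOnNhd ℂ (fun a => (Real.sqrt Real.pi : ℂ) * a ^ (α : ℂ) * besselU α (a * b))
      {z : ℂ | 0 < z.re} := by
    refine DifferentiableOn.analyticOnNhd (fun z hz => DifferentiableAt.differentiableWithinAt ?_) hopen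
    refine DifferentiableAt.mul (DifferentiableAt.mul (by fun_prop)
      ((hasDerivAt_id z).cpow_const (Or.inl hz)).differentiableAt) ?_
    exact (differentiableAt_besselU α (mul_mem_slitPlane hz hb)).comp (𝕜 := ℂ) z (f := fun a => a * b) (by fun_prop)
  -- Identity theorem in a: both sides are analytic in the right half plane and agree on the points
  -- a = l b, l > 0, which accumulate at b.
  refine hf.eqOn_of_preconnected_of_frequently_eq hg hconn (z₀ := b) hb ?_ ha
  have hb0 : b ≠ 0 := fun h => by simp [h] at hb
  have ht : Tendsto (fun l : ℝ => (l : ℂ) * b) (𝓝[>] 1) (𝓝[≠] b) := by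
    refine tendsto_nhdsWithin_iff.2 ⟨?_, ?_⟩
    · have : Continuous fun l : ℝ => (l : ℂ) * b := by fun_prop
      simpa using (this.tendsto 1).mono_left nhdsWithin_le_nhds
    · filter_upwards [self_mem_nhdsWithin] with l hl
      have hl : 1 < l := hl
      intro h
      have : ((l : ℂ) - 1) * b = 0 := by
        have h' : (l : ℂ) * b = b := h
        linear_combination h'
      rcases mul_eq_zero.1 this with h | h
      · have : l - 1 = 0 := by exact_mod_cast h
        linarith
      · exact hb0 h
  refine ht.frequently (Eventually.frequently ?_)
  filter_upwards [self_mem_nhdsWithin] with l hl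
  exact besselK_ray α hb (one_pos.trans hl)

/-- `U_α' = - U_{α+1}`. -/
lemma hasDerivAt_besselU (α : ℝ) {z : ℂ} (hz : z ∈ Complex.slitPlane) :
    HasDerivAt (besselU α) (-besselU ((α + 1 : ℝ) : ℂ) z) z := by
  set a := z ^ (1 / 2 : ℂ) with ha
  have hre : 0 < a.re := re_sqrt_pos hz
  have ha0 : a ≠ 0 := fun h => by simp [h] at hre
  have hz2 : z / a = a := by rw [div_eq_iff ha0, ha, sqrt_mul_sqrt]
  have hpi : (Real.sqrt Real.pi : ℂ) ≠ 0 := by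
    exact_mod_cast (Real.sqrt_pos.2 Real.pi_pos).ne'
  have hb : 0 < (z / a).re := by rwa [hz2]
  have haα : a ^ (α : ℂ) ≠ 0 := by simp [Complex.cpow_eq_zero_iff, ha0]
  -- Freeze a = √z and let only the second argument w/a of K_α move. The derivative then falls on
  -- e^(-b/σ) and raises the index by one.
  have hev : besselU α =ᶠ[𝓝 z] fun w => besselK α a (w / a) / ((Real.sqrt Real.pi : ℂ) * a ^ (α : ℂ)) := by
    have : ∀ᶠ w in 𝓝 z, 0 < (w / a).re := by
      have hc : Continuous fun w : ℂ => (w / a).re := by fun_prop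
      exact hc.continuousAt.eventually (lt_mem_nhds hb)
    filter_upwards [this] with w hw
    rw [besselK_eq α hre hw, mul_div_cancel₀ _ ha0]
    field_simp
  refine HasDerivAt.congr_of_eventuallyEq ?_ hev
  have h1 := ((hasDerivAt_besselK_right α hre hb).comp z ((hasDerivAt_id z).div_const a)).div_const
    ((Real.sqrt Real.pi : ℂ) * a ^ (α : ℂ))
  refine h1.congr_deriv ?_
  rw [besselK_eq (α + 1) hre hb, mul_div_cancel₀ _ ha0]
  push_cast
  rw [Complex.cpow_add _ _ ha0, Complex.cpow_one]
  field_simp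

end

/-! ### The functions U of index -1/2, 1/2 and 0 -/

section
lemma sqrt_pi_ne_zero : (Real.sqrt Real.pi : ℂ) ≠ 0 := by
  exact_mod_cast (Real.sqrt_pos.2 Real.pi_pos).ne'

/-- The symmetry `K_{-α}(a,b) = K_α(b,a)`. -/
lemma besselK_neg (α : ℝ) (a b : ℂ) : besselK (-α) a b = besselK α b a := by
  rw [besselK, besselK, ← integral_comp_rpow_Ioi _ (show (-1 : ℝ) ≠ 0 by norm_num)]
  refine setIntegral_congr_fun measurableSet_Ioi fun σ hσ => ?_
  have hσ : 0 < σ := hσ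
  have h1 : σ ^ ((-1 : ℝ) - 1) * (σ ^ (-1 : ℝ)) ^ (- -α - 1) = σ ^ (-α - 1) := by
    rw [← Real.rpow_mul hσ.le, ← Real.rpow_add hσ]; ring_nf
  rw [← h1, Complex.real_smul, Real.rpow_neg_one]
  push_cast
  rw [abs_neg, abs_one]
  have : (σ : ℂ) ≠ 0 := by exact_mod_cast hσ.ne'
  have h2 : -(a * (σ : ℂ)⁻¹) - b / (σ : ℂ)⁻¹ = -(b * σ) - a / σ := by field_simp; ring
  rw [h2]
  push_cast
  ring

/-- The inversion σ → 1/σ shows that K_α(a,a) is even in α; the power of z is the difference of the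
prefactors. -/
lemma besselU_neg (α : ℝ) {z : ℂ} (hz : z ∈ Complex.slitPlane) :
    besselU α z = z ^ (-(α : ℂ)) * besselU ((-α : ℝ) : ℂ) z := by
  have hz0 := Complex.slitPlane_ne_zero hz
  rw [besselU_eq, besselU_eq, besselK_neg]
  have : z ^ (-(α : ℂ) / 2) = z ^ (-(α : ℂ)) * z ^ (-((-α : ℝ) : ℂ) / 2) := by
    rw [← Complex.cpow_add _ _ hz0]; push_cast; ring_nf
  rw [this]; ring

lemma hasDerivAt_sqrt {z : ℂ} (hz : z ∈ Complex.slitPlane) :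
    HasDerivAt (fun z : ℂ => z ^ (1 / 2 : ℂ)) (1 / 2 * (z ^ (1 / 2 : ℂ))⁻¹) z := by
  refine ((hasDerivAt_id z).cpow_const (c := 1 / 2) hz).congr_deriv ?_
  rw [← Complex.cpow_neg]; norm_num

/-- As b ↘ 0 the integral tends to Γ(1/2). This fixes the constant of integration in the closed form
of U_{-1/2}. -/
lemma tendsto_besselK_neg_half :
    Tendsto (fun b : ℝ => besselK (-(1 / 2)) 1 b) (𝓝[>] 0) (𝓝 (Real.sqrt Real.pi : ℂ)) := by
  have hlim : (∫ σ in Set.Ioi (0 : ℝ), Complex.exp (-σ) * ((σ ^ (-(1 / 2) : ℝ) : ℝ) : ℂ)) =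
      (Real.sqrt Real.pi : ℂ) := by
    rw [← Real.Gamma_one_half_eq, Real.Gamma_eq_integral (by norm_num), ← integral_complex_ofReal]
    refine setIntegral_congr_fun measurableSet_Ioi fun σ _ => ?_
    norm_num
  rw [← hlim]
  have hint : IntegrableOn (fun σ : ℝ => Real.exp (-σ) * σ ^ (-(1 / 2) : ℝ)) (Set.Ioi 0) := by
    have := Real.GammaIntegral_convergent (s := 1 / 2) (by norm_num)
    norm_num at this ⊢
    exact this
  refine tendsto_integral_filter_of_dominated_convergence _ ?_ ?_ hint ?_
  · exact Eventually.of_forall fun b => Measurable.aestronglyMeasurable (by fun_prop)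
  · filter_upwards [self_mem_nhdsWithin] with b hb
    have hb : 0 < b := hb
    filter_upwards [ae_restrict_mem measurableSet_Ioi] with σ hσ
    have hσ : 0 < σ := hσ
    rw [norm_mul, Complex.norm_exp, Complex.norm_real, Real.norm_of_nonneg (by positivity)]
    have e : - - (1 / 2 : ℝ) - 1 = -(1 / 2) := by norm_num
    rw [e]
    refine mul_le_mul_of_nonneg_right (Real.exp_le_exp.2 ?_) (by positivity)
    have : 0 < b / σ := by positivity
    simp [Complex.div_ofReal_re]
    exact this.le
  · filter_upwards [ae_restrict_mem measurableSet_Ioi] with σ hσ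
    have e : - - (1 / 2 : ℝ) - 1 = -(1 / 2) := by norm_num
    rw [e]
    refine Tendsto.mul_const _ ?_
    have : Continuous fun b : ℝ => Complex.exp (-(1 * (σ : ℂ)) - b / σ) := by fun_prop
    have := this.tendsto 0
    simp only [one_mul, Complex.ofReal_zero, zero_div, sub_zero] at this
    simpa only [one_mul] using this.mono_left nhdsWithin_le_nhds

/-- `U_{-1/2}(z) = e^{-2√z}`. -/
theorem besselU_neg_half {z : ℂ} (hz : z ∈ Complex.slitPlane) :
    besselU ((-(1 / 2) : ℝ) : ℂ) z = Complex.exp (-2 * z ^ (1 / 2 : ℂ)) := by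
  set f : ℂ → ℂ := fun z => besselU ((-(1 / 2) : ℝ) : ℂ) z * Complex.exp (2 * z ^ (1 / 2 : ℂ)) with hf
  -- By the derivative rule and the symmetry in α, U_{-1/2}' = -U_{1/2} = -z^(-1/2) U_{-1/2}. This
  -- is the equation solved by e^(-2√z), so the quotient f is constant.
  have hd : ∀ z ∈ Complex.slitPlane, HasDerivAt f 0 z := by
    intro z hz
    have h1 := (hasDerivAt_besselU (-(1 / 2)) hz).mul ((hasDerivAt_sqrt hz).const_mul 2).cexp
    refine h1.congr_deriv ?_
    have h2 := besselU_neg (1 / 2) hz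
    rw [show (-(1 / 2) + 1 : ℝ) = 1 / 2 by norm_num, h2, Complex.cpow_neg]
    push_cast
    ring
  have hconst : ∀ z ∈ Complex.slitPlane, f z = f 1 := by
    intro z hz
    have hpre : IsPreconnected Complex.slitPlane :=
      (Complex.starConvex_one_slitPlane.isPathConnected
        Complex.one_mem_slitPlane).isConnected.isPreconnected
    refine Complex.isOpen_slitPlane.is_const_of_deriv_eq_zero hpre
      (fun z hz => (hd z hz).differentiableAt.differentiableWithinAt) (fun z hz => (hd z hz).deriv) hz
      Complex.one_mem_slitPlane
  have h1 : f 1 = 1 := by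
    have ht : Tendsto (fun b : ℝ => f b) (𝓝[>] 0) (𝓝 1) := by
      have ha : Tendsto (fun b : ℝ => (Real.sqrt Real.pi : ℂ)⁻¹ * besselK (-(1 / 2)) 1 b *
          Complex.exp (2 * ((√b : ℝ) : ℂ))) (𝓝[>] 0) (𝓝 ((Real.sqrt Real.pi : ℂ)⁻¹ * (Real.sqrt Real.pi : ℂ) *
          Complex.exp (2 * ((√0 : ℝ) : ℂ)))) := by
        refine (tendsto_besselK_neg_half.const_mul _).mul ?_
        have : Continuous fun b : ℝ => Complex.exp (2 * ((√b : ℝ) : ℂ)) := by fun_prop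
        exact (this.tendsto 0).mono_left nhdsWithin_le_nhds
      rw [inv_mul_cancel₀ sqrt_pi_ne_zero, one_mul, Real.sqrt_zero] at ha
      simp only [Complex.ofReal_zero, mul_zero, Complex.exp_zero] at ha
      refine ha.congr' ?_
      filter_upwards [self_mem_nhdsWithin] with b hb
      have hb : 0 < b := hb
      rw [besselK_eq _ (by simp) (by simpa using hb), Complex.one_cpow, one_mul, hf]
      have : ((b : ℂ)) ^ (1 / 2 : ℂ) = ((√b : ℝ) : ℂ) := by
        rw [Real.sqrt_eq_rpow, Complex.ofReal_cpow hb.le]; push_cast; rfl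
      simp only [this]
      have := sqrt_pi_ne_zero
      field_simp
    have hc : Tendsto (fun b : ℝ => f b) (𝓝[>] 0) (𝓝 (f 1)) := by
      refine tendsto_const_nhds.congr' ?_
      filter_upwards [self_mem_nhdsWithin] with b hb
      exact (hconst b (Complex.ofReal_mem_slitPlane.2 hb)).symm
    exact tendsto_nhds_unique hc ht
  have h2 := hconst z hz
  rw [h1, hf] at h2
  simp only at h2
  rw [neg_mul, Complex.exp_neg]
  exact eq_inv_of_mul_eq_one_left h2

/-- `U_{1/2}(z) = z^{-1/2} e^{-2√z}`. -/
theorem besselU_half {z : ℂ} (hz : z ∈ Complex.slitPlane) :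
    besselU ((1 / 2 : ℝ) : ℂ) z = (z ^ (1 / 2 : ℂ))⁻¹ * Complex.exp (-2 * z ^ (1 / 2 : ℂ)) := by
  rw [besselU_neg (1 / 2) hz, besselU_neg_half hz, Complex.cpow_neg]
  push_cast; rfl

lemma ofReal_mul_cpow {x : ℝ} (hx : 0 < x) {z : ℂ} (hz : z ≠ 0) (c : ℂ) :
    ((x : ℂ) * z) ^ c = (x : ℂ) ^ c * z ^ c := by
  have hx0 : (x : ℂ) ≠ 0 := by exact_mod_cast hx.ne'
  rw [Complex.cpow_def_of_ne_zero (mul_ne_zero hx0 hz), Complex.cpow_def_of_ne_zero hx0,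
    Complex.cpow_def_of_ne_zero hz, Complex.log_ofReal_mul hx hz, ← Complex.ofReal_log hx.le,
    ← Complex.exp_add, add_mul]

lemma ofReal_cpow_half {x : ℝ} (hx : 0 ≤ x) : (x : ℂ) ^ (1 / 2 : ℂ) = ((√x : ℝ) : ℂ) := by
  rw [Real.sqrt_eq_rpow, Complex.ofReal_cpow hx]; push_cast; rfl

lemma inv_re_pos {a : ℂ} (ha : 0 < a.re) : 0 < (a⁻¹).re := by
  have ha0 : a ≠ 0 := fun h => by simp [h] at ha
  rw [Complex.inv_re]
  exact div_pos ha (Complex.normSq_pos.2 ha0)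

lemma integral_gaussian_div {a : ℂ} (ha : 0 < a.re) {σ : ℝ} (hσ : 0 < σ) :
    ∫ y : ℝ, Complex.exp (-(y ^ 2 / a / σ)) = (Real.sqrt Real.pi : ℂ) * a ^ (1 / 2 : ℂ) * ((√σ : ℝ) : ℂ) := by
  have ha0 : a ≠ 0 := fun h => by simp [h] at ha
  have hσ0 : (σ : ℂ) ≠ 0 := by exact_mod_cast hσ.ne'
  have h := integral_gaussian_complex (b := (a * σ)⁻¹) (inv_re_pos (by
    rw [Complex.re_mul_ofReal]; positivity))
  have e : (fun y : ℝ => Complex.exp (-(y ^ 2 / a / σ))) = fun y : ℝ => Complex.exp (-(a * σ)⁻¹ * y ^ 2) := by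
    funext y; congr 1; field_simp
  rw [e, h, div_inv_eq_mul, mul_comm a, ofReal_mul_cpow Real.pi_pos (mul_ne_zero hσ0 ha0),
    ofReal_mul_cpow hσ ha0, ofReal_cpow_half hσ.le, ofReal_cpow_half Real.pi_pos.le]
  ring

lemma integrable_gaussian_div {B σ : ℝ} (hB : 0 < B) (hσ : 0 < σ) :
    Integrable fun y : ℝ => Real.exp (-(y ^ 2 * B / σ)) := by
  refine (integrable_exp_neg_mul_sq (b := B / σ) (by positivity)).congr (Eventually.of_forall fun y => ?_)
  simp only; congr 1; ring

/-- `U_0(z) = π^{-1/2} ∫ U_{1/2}(z + y²) dy`. -/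
theorem besselU_zero_eq {z : ℂ} (hz : z ∈ Complex.slitPlane) :
    besselU ((0 : ℝ) : ℂ) z = (Real.sqrt Real.pi : ℂ)⁻¹ * ∫ y : ℝ, besselU ((1 / 2 : ℝ) : ℂ) (z + y ^ 2) := by
  set a := z ^ (1 / 2 : ℂ) with ha
  have hre : 0 < a.re := re_sqrt_pos hz
  have ha0 : a ≠ 0 := fun h => by simp [h] at hre
  have hz2 : a * a = z := by rw [ha, sqrt_mul_sqrt]
  have hinv := inv_re_pos hre
  set B := (a⁻¹).re with hB
  have hreb : ∀ y : ℝ, 0 < (a + y ^ 2 / a).re := fun y => by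
    rw [Complex.add_re, div_eq_mul_inv, ← Complex.ofReal_pow, Complex.re_ofReal_mul]
    positivity
  have h1 : ∀ y : ℝ, besselK (1 / 2) a (a + y ^ 2 / a) =
      (Real.sqrt Real.pi : ℂ) * a ^ (1 / 2 : ℂ) * besselU ((1 / 2 : ℝ) : ℂ) (z + y ^ 2) := fun y => by
    rw [besselK_eq _ hre (hreb y), mul_add, hz2, mul_div_cancel₀ _ ha0]
    push_cast; rfl
  -- Method of descent: integrating e^(-y²/(aσ)) over y gives √(πaσ), which turns σ^(-3/2) into σ⁻¹
  -- and hence index 1/2 into index 0. The Fubini argument uses Re(1/a) > 0.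
  set F : ℝ → ℝ → ℂ := fun y σ => Complex.exp (-(a * σ) - (a + y ^ 2 / a) / σ) *
    ((σ ^ (-(1 / 2) - 1 : ℝ) : ℝ) : ℂ) with hF
  have hnorm : ∀ y σ : ℝ, 0 < σ → ‖F y σ‖ = Real.exp (-(a.re * σ) - a.re / σ) *
      σ ^ (-(1 / 2) - 1 : ℝ) * Real.exp (-(y ^ 2 * B / σ)) := fun y σ hσ => by
    rw [hF]
    simp only
    rw [norm_mul, Complex.norm_exp, Complex.norm_real, Real.norm_of_nonneg (by positivity), mul_right_comm,
      ← Real.exp_add]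
    congr 2
    simp only [Complex.sub_re, Complex.neg_re, Complex.re_mul_ofReal, Complex.div_ofReal_re, Complex.add_re]
    rw [div_eq_mul_inv (_ ^ 2 : ℂ), ← Complex.ofReal_pow, Complex.re_ofReal_mul]
    ring
  have hGint : ∀ σ : ℝ, 0 < σ → ∫ y : ℝ, Real.exp (-(y ^ 2 * B / σ)) = √(Real.pi / B) * √σ := fun σ hσ => by
    have := integral_gaussian (B / σ)
    rw [← Real.sqrt_mul (by positivity), show Real.pi / B * σ = Real.pi / (B / σ) by field_simp, ← this]
    congr 1; funext y; congr 1; ring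
  have hint : Integrable (fun q : ℝ × ℝ => F q.2 q.1) ((volume.restrict (Set.Ioi 0)).prod volume) := by
    rw [integrable_prod_iff (Measurable.aestronglyMeasurable (by fun_prop))]
    refine ⟨?_, ?_⟩
    · filter_upwards [ae_restrict_mem measurableSet_Ioi] with σ hσ
      have hσ : 0 < σ := hσ
      refine ((integrable_gaussian_div hinv hσ).const_mul (Real.exp (-(a.re * σ) - a.re / σ) *
        σ ^ (-(1 / 2) - 1 : ℝ))).mono' (Measurable.aestronglyMeasurable (by fun_prop))
        (Eventually.of_forall fun y => (hnorm y σ hσ).le)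
    · refine ((integrableOn_exp_exp_rpow hre hre (-1)).const_mul (√(Real.pi / B))).congr ?_
      filter_upwards [ae_restrict_mem measurableSet_Ioi] with σ hσ
      have hσ : 0 < σ := hσ
      simp only [hnorm _ σ hσ]
      rw [integral_const_mul, hGint σ hσ, Real.sqrt_eq_rpow σ, show (-1 : ℝ) = (-(1 / 2) - 1) + 1 / 2 by norm_num,
        Real.rpow_add hσ]
      ring
  have hswap := integral_integral_swap (f := fun σ y => F y σ) hint
  have hl : ∀ σ ∈ Set.Ioi (0 : ℝ), ∫ y : ℝ, F y σ = (Real.sqrt Real.pi : ℂ) * a ^ (1 / 2 : ℂ) *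
      (Complex.exp (-(a * σ) - a / σ) * ((σ ^ (-(0 : ℝ) - 1 : ℝ) : ℝ) : ℂ)) := fun σ hσ => by
    have hσ : 0 < σ := hσ
    have : (fun y => F y σ) = fun y : ℝ => Complex.exp (-(a * σ) - a / σ) *
        ((σ ^ (-(1 / 2) - 1 : ℝ) : ℝ) : ℂ) * Complex.exp (-(y ^ 2 / a / σ)) := by
      funext y
      rw [hF]
      simp only
      rw [mul_right_comm, ← Complex.exp_add]
      congr 2; ring
    rw [this, integral_const_mul, integral_gaussian_div hre hσ, Real.sqrt_eq_rpow σ,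
      show (-(0 : ℝ) - 1) = (-(1 / 2) - 1) + 1 / 2 by norm_num, Real.rpow_add hσ]
    push_cast; ring
  rw [setIntegral_congr_fun measurableSet_Ioi hl, integral_const_mul] at hswap
  have h2 : ∫ y : ℝ, besselK (1 / 2) a (a + y ^ 2 / a) = (Real.sqrt Real.pi : ℂ) * a ^ (1 / 2 : ℂ) * besselK 0 a a := by
    rw [besselK, hswap]; rfl
  simp only [h1] at h2
  rw [integral_const_mul, besselK_eq 0 hre hre, hz2] at h2
  have h3 := mul_left_cancel₀ (mul_ne_zero sqrt_pi_ne_zero (by simp [Complex.cpow_eq_zero_iff, ha0])) h2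
  rw [h3]
  simp [inv_mul_cancel_left₀ sqrt_pi_ne_zero]

/-! ### Boundary values of the square root -/

/-- The boundary values of `√z` on the real line. -/
def bsqrt (r w : ℝ) : ℂ := if 0 < w then ((√w : ℝ) : ℂ) else Complex.I * ((r * √(-w) : ℝ) : ℂ)

lemma tendsto_sqrt {r : ℝ} (hr : r = 1 ∨ r = -1) {w : ℝ} (hw : w ≠ 0) {z : ℝ → ℂ}
    (hz : Tendsto z (𝓝[>] 0) (𝓝 w)) (him : ∀ ε, 0 < ε → 0 < r * (z ε).im) :
    Tendsto (fun ε => z ε ^ (1 / 2 : ℂ)) (𝓝[>] 0) (𝓝 (bsqrt r w)) := by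
  rcases hw.lt_or_gt with hw | hw
  · rw [bsqrt, if_neg hw.not_gt]
    have hlog : Tendsto (fun ε => Complex.log (z ε)) (𝓝[>] 0) (𝓝 (Real.log ‖(w : ℂ)‖ + (r * Real.pi : ℝ) * Complex.I)) := by
      rcases hr with rfl | rfl
      · have h1 := Complex.tendsto_log_nhdsWithin_im_nonneg_of_re_neg_of_im_zero (z := w) (by simpa) (by simp)
        rw [one_mul]
        refine h1.comp (tendsto_nhdsWithin_iff.2 ⟨hz, ?_⟩)
        filter_upwards [self_mem_nhdsWithin] with ε hε
        simpa using (him ε hε).le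
      · have h1 := Complex.tendsto_log_nhdsWithin_im_neg_of_re_neg_of_im_zero (z := w) (by simpa) (by simp)
        rw [neg_one_mul, Complex.ofReal_neg, neg_mul, ← sub_eq_add_neg]
        refine h1.comp (tendsto_nhdsWithin_iff.2 ⟨hz, ?_⟩)
        filter_upwards [self_mem_nhdsWithin] with ε hε
        simpa using him ε hε
    have h2 := (hlog.mul_const (1 / 2 : ℂ)).cexp
    have h3 : Complex.exp ((Real.log ‖(w : ℂ)‖ + (r * Real.pi : ℝ) * Complex.I) * (1 / 2)) =
        Complex.I * ((r * √(-w) : ℝ) : ℂ) := by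
      have hw' : 0 < -w := by linarith
      rw [show (Real.log ‖(w : ℂ)‖ + (r * Real.pi : ℝ) * Complex.I) * (1 / 2) =
        ((Real.log (-w) * (1 / 2) : ℝ) : ℂ) + ((r * (Real.pi / 2) : ℝ) : ℂ) * Complex.I by
          rw [Complex.norm_real, Real.norm_eq_abs, abs_of_neg hw]; push_cast; ring, Complex.exp_add,
        ← Complex.ofReal_exp, ← Real.rpow_def_of_pos hw', ← Real.sqrt_eq_rpow]
      rcases hr with rfl | rfl
      · simp [Complex.exp_pi_div_two_mul_I]; ring
      · rw [show ((-1 * (Real.pi / 2) : ℝ) : ℂ) * Complex.I = -Real.pi / 2 * Complex.I by push_cast; ring,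
          Complex.exp_neg_pi_div_two_mul_I]
        push_cast; ring
    rw [h3] at h2
    refine h2.congr' ?_
    filter_upwards [self_mem_nhdsWithin] with ε hε
    have hne : z ε ≠ 0 := fun h => by simpa [h] using him ε hε
    rw [Complex.cpow_def_of_ne_zero hne]
  · rw [bsqrt, if_pos hw, ← ofReal_cpow_half hw.le]
    have : ContinuousAt (fun z : ℂ => z ^ (1 / 2 : ℂ)) w :=
      (hasDerivAt_sqrt (Complex.ofReal_mem_slitPlane.2 hw)).continuousAt
    exact this.tendsto.comp hz

lemma bsqrt_ne_zero {r : ℝ} (hr : r = 1 ∨ r = -1) {w : ℝ} (hw : w ≠ 0) : bsqrt r w ≠ 0 := by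
  have hr0 : r ≠ 0 := by rcases hr with rfl | rfl <;> norm_num
  rw [bsqrt]
  split_ifs with h
  · exact_mod_cast (Real.sqrt_pos.2 h).ne'
  · have : 0 < -w := by rcases hw.lt_or_gt with h' | h' <;> [linarith; exact absurd h' h]
    refine mul_ne_zero Complex.I_ne_zero ?_
    exact_mod_cast mul_ne_zero hr0 (Real.sqrt_pos.2 this).ne'

/-! ### Bounds up to the cut, uniform in the imaginary part -/

lemma sqrt_re_le {z : ℂ} (hz : z ∈ Complex.slitPlane) : √z.re ≤ (z ^ (1 / 2 : ℂ)).re := by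
  refine Real.sqrt_le_iff.2 ⟨(re_sqrt_pos hz).le, ?_⟩
  have h := congrArg Complex.re (sqrt_mul_sqrt z)
  rw [Complex.mul_re] at h
  nlinarith [sq_nonneg (z ^ (1 / 2 : ℂ)).im]

lemma norm_sqrt (z : ℂ) : ‖z ^ (1 / 2 : ℂ)‖ = √‖z‖ := by
  rw [eq_comm, Real.sqrt_eq_iff_mul_self_eq (norm_nonneg _) (norm_nonneg _), ← norm_mul, sqrt_mul_sqrt]

lemma norm_besselU_neg_half_le {z : ℂ} (hz : z ∈ Complex.slitPlane) :
    ‖besselU ((-(1 / 2) : ℝ) : ℂ) z‖ ≤ 1 := by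
  rw [besselU_neg_half hz, Complex.norm_exp]
  refine Real.exp_le_one_iff.2 ?_
  have := re_sqrt_pos hz
  simp only [neg_mul, Complex.neg_re, Complex.mul_re, Complex.re_ofNat, Complex.im_ofNat]
  linarith

/-- The real square root of a negative number is 0, so the exponential factor in the bound is 1 for
Re z < 0 and gives decay for Re z > 0. -/
lemma norm_besselU_half_le {z : ℂ} (hz : z ∈ Complex.slitPlane) (hre : z.re ≠ 0) :
    ‖besselU ((1 / 2 : ℝ) : ℂ) z‖ ≤ (√|z.re|)⁻¹ * Real.exp (-√z.re) := by
  rw [besselU_half hz, norm_mul, norm_inv, norm_sqrt, Complex.norm_exp]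
  have h1 : 0 < √|z.re| := Real.sqrt_pos.2 (abs_pos.2 hre)
  have h2 := sqrt_re_le hz
  have h3 := re_sqrt_pos hz
  refine mul_le_mul (inv_anti₀ h1 (Real.sqrt_le_sqrt (Complex.abs_re_le_norm z)))
    (Real.exp_le_exp.2 ?_) (by positivity) (by positivity)
  simp only [neg_mul, Complex.neg_re, Complex.mul_re, Complex.re_ofNat, Complex.im_ofNat]
  linarith

/-- Dominating function for the boundary values of `U_0`. -/
def domU (w y : ℝ) : ℝ := (√|w + y ^ 2|)⁻¹ * Real.exp (-√(w + y ^ 2))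

/-- Integrable majorant of the scaled dominating function. -/
def domUg (u : ℝ) : ℝ := 5 * (|(|u| - 1)| ^ (-(1 / 2) : ℝ) * (1 + u ^ 2)⁻¹) + 2 * (1 + u ^ 2)⁻¹

lemma integrable_domUg : Integrable domUg := by
  refine Integrable.add (Integrable.const_mul ?_ _) (integrable_inv_one_add_sq.const_mul _)
  refine (integrable_inv_one_add_sq.add ((integrable_cut_rpow.comp_sub_right 1).add
    (integrable_cut_rpow.comp_add_right 1))).mono' (Measurable.aestronglyMeasurable (by fun_prop))
    (Eventually.of_forall fun u => ?_)
  rw [Real.norm_of_nonneg (by positivity)]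
  exact abs_sub_rpow_le u 1

/-- With y = √|w| u the singularities sit at most at u = ±1. For |u| ≤ 2 the exponential is dropped;
for |u| > 2 it is bounded by the inverse of its exponent, which produces u⁻² decay at the price of
one more |w|^(-1/2). -/
lemma domU_scaled_le {w : ℝ} (hw : w ≠ 0) {u : ℝ} (hu : u ^ 2 ≠ 1) :
    √|w| * domU w (√|w| * u) ≤ (1 + (√|w|)⁻¹) * domUg u := by
  have hw0 : 0 < |w| := abs_pos.2 hw
  set t := √|w| with ht
  have hs : 0 < t := Real.sqrt_pos.2 hw0
  have hsq : t ^ 2 = |w| := Real.sq_sqrt hw0.le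
  have hu0 : 0 < |u ^ 2 - 1| := abs_pos.2 (sub_ne_zero.2 hu)
  set q := √|u ^ 2 - 1| with hq
  have hq0 : 0 < q := Real.sqrt_pos.2 hu0
  have hqsq : q ^ 2 = |u ^ 2 - 1| := Real.sq_sqrt hu0.le
  have hv : (t * q) ^ 2 ≤ |w + (t * u) ^ 2| := by
    rw [mul_pow, mul_pow, hsq, hqsq]
    rcases hw.lt_or_gt with h | h
    · rw [abs_of_neg h, show w + -w * u ^ 2 = (-w) * (u ^ 2 - 1) by ring, abs_mul, abs_of_pos (neg_pos.2 h)]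
    · rw [abs_of_pos h, abs_of_pos (show 0 < w + w * u ^ 2 by positivity)]
      have : |u ^ 2 - 1| ≤ u ^ 2 + 1 := abs_le.2 ⟨by nlinarith [sq_nonneg u], by linarith⟩
      nlinarith
  have hsv : t * q ≤ √|w + (t * u) ^ 2| := Real.le_sqrt_of_sq_le hv
  have h1 : (√|w + (t * u) ^ 2|)⁻¹ ≤ (t * q)⁻¹ := inv_anti₀ (by positivity) hsv
  have hA : 0 ≤ |(|u| - 1)| ^ (-(1 / 2) : ℝ) * (1 + u ^ 2)⁻¹ := by positivity
  have hB : 0 ≤ (1 + u ^ 2)⁻¹ := by positivity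
  have hti : 0 ≤ t⁻¹ := by positivity
  rw [domU, domUg]
  rcases le_or_gt |u| 2 with h2 | h2
  · have hE : Real.exp (-√(w + (t * u) ^ 2)) ≤ 1 := Real.exp_le_one_iff.2 (by simp)
    have hqi : q⁻¹ ≤ |(|u| - 1)| ^ (-(1 / 2) : ℝ) := by
      have hne : |(|u| - 1)| ≠ 0 := by
        intro h
        have : |u| = 1 := by linarith [abs_eq_zero.1 h]
        exact hu (by rw [← sq_abs, this]; norm_num)
      have hpos : 0 < |(|u| - 1)| := lt_of_le_of_ne (abs_nonneg _) hne.symm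
      rw [Real.rpow_neg hpos.le, ← Real.sqrt_eq_rpow]
      refine inv_anti₀ (Real.sqrt_pos.2 hpos) (Real.sqrt_le_sqrt ?_)
      rw [← sq_abs u, show |u| ^ 2 - 1 = (|u| - 1) * (|u| + 1) by ring, abs_mul,
        abs_of_pos (show 0 < |u| + 1 by positivity)]
      nlinarith [abs_nonneg u]
    -- Since u² ≤ 4 here, 1 + u² ≤ 5; this is the constant 5 in `domUg`.
    have h5 : 1 ≤ 5 * (1 + u ^ 2)⁻¹ := by
      rw [← div_eq_mul_inv, le_div_iff₀ (by positivity)]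
      nlinarith [abs_le.1 h2]
    calc t * ((√|w + (t * u) ^ 2|)⁻¹ * Real.exp (-√(w + (t * u) ^ 2)))
        ≤ t * ((t * q)⁻¹ * 1) := by gcongr
      _ = q⁻¹ := by field_simp
      _ ≤ |(|u| - 1)| ^ (-(1 / 2) : ℝ) * (5 * (1 + u ^ 2)⁻¹) := by
          refine hqi.trans (le_mul_of_one_le_right (by positivity) h5)
      _ ≤ _ := by nlinarith [mul_nonneg hti hA, mul_nonneg hti hB]
  · have hu4 : 4 < u ^ 2 := by rw [← sq_abs]; nlinarith
    have hq2 : q ^ 2 = u ^ 2 - 1 := by rw [hqsq, abs_of_pos (by linarith)]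
    have hE : Real.exp (-√(w + (t * u) ^ 2)) ≤ (t * q)⁻¹ := by
      have hv' : t * q ≤ √(w + (t * u) ^ 2) := by
        refine Real.le_sqrt_of_sq_le ?_
        rw [mul_pow, mul_pow, hsq, hq2]
        nlinarith [neg_abs_le w]
      rw [Real.exp_neg]
      refine inv_anti₀ (by positivity) (hv'.trans ?_)
      linarith [Real.add_one_le_exp (√(w + (t * u) ^ 2))]
    calc t * ((√|w + (t * u) ^ 2|)⁻¹ * Real.exp (-√(w + (t * u) ^ 2)))
        ≤ t * ((t * q)⁻¹ * (t * q)⁻¹) := by gcongr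
      _ = t⁻¹ * (q ^ 2)⁻¹ := by field_simp
      -- The constant 2 in `domUg`: (u² - 1)⁻¹ ≤ 2 (1 + u²)⁻¹ as soon as u² ≥ 3.
      _ ≤ t⁻¹ * (2 * (1 + u ^ 2)⁻¹) := by
          refine mul_le_mul_of_nonneg_left ?_ hti
          rw [hq2, ← div_eq_mul_inv, inv_eq_one_div, div_le_div_iff₀ (by linarith) (by positivity)]
          linarith
      _ ≤ _ := by nlinarith [mul_nonneg hti hA, mul_nonneg hti hB]

lemma domU_nonneg (w y : ℝ) : 0 ≤ domU w y := by unfold domU; positivity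

lemma ae_sq_ne (c : ℝ) : ∀ᵐ u : ℝ, u ^ 2 ≠ c := by
  have : {u : ℝ | u ^ 2 = c}.Finite := by
    refine (Set.toFinite ({√c, -√c} : Set ℝ)).subset fun u hu => ?_
    have hu : u ^ 2 = c := hu
    rw [← hu, Real.sqrt_sq_eq_abs]
    rcases abs_choice u with h | h <;> simp [h]
  exact measure_eq_zero_iff_ae_notMem.1 (this.measure_zero volume)

lemma integrable_domU {w : ℝ} (hw : w ≠ 0) :
    Integrable (domU w) ∧ ∫ y, domU w y ≤ (1 + (√|w|)⁻¹) * ∫ u, domUg u := by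
  have hw0 : 0 < √|w| := Real.sqrt_pos.2 (abs_pos.2 hw)
  have hm : Measurable (domU w) := by unfold domU; fun_prop
  have hae : ∀ᵐ u : ℝ, √|w| * domU w (√|w| * u) ≤ (1 + (√|w|)⁻¹) * domUg u := by
    filter_upwards [ae_sq_ne 1] with u hu using domU_scaled_le hw hu
  have h1 : Integrable fun u => √|w| * domU w (√|w| * u) := by
    refine (integrable_domUg.const_mul (1 + (√|w|)⁻¹)).mono'
      (((hm.comp (measurable_const_mul _)).const_mul _).aestronglyMeasurable) ?_
    filter_upwards [hae] with u hu
    rwa [Real.norm_of_nonneg (mul_nonneg hw0.le (domU_nonneg _ _))]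
  have h2 : Integrable fun u => domU w (√|w| * u) :=
    (h1.const_mul (√|w|)⁻¹).congr (Eventually.of_forall fun u => by
      simp only; rw [inv_mul_cancel_left₀ hw0.ne'])
  refine ⟨(integrable_comp_mul_left_iff _ hw0.ne').1 h2, ?_⟩
  have h3 := Measure.integral_comp_mul_left (domU w) (√|w|)
  rw [abs_of_pos (inv_pos.2 hw0), smul_eq_mul, eq_inv_mul_iff_mul_eq₀ hw0.ne'] at h3
  rw [← h3, ← integral_const_mul, ← integral_const_mul]
  exact integral_mono_ae h1 (integrable_domUg.const_mul _) hae

lemma norm_besselU_half_add_le {z : ℂ} (hz : z.im ≠ 0) {y : ℝ} (hy : z.re + y ^ 2 ≠ 0) :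
    ‖besselU ((1 / 2 : ℝ) : ℂ) (z + y ^ 2)‖ ≤ domU z.re y := by
  have h1 : (z + (y : ℂ) ^ 2).re = z.re + y ^ 2 := by
    rw [Complex.add_re, ← Complex.ofReal_pow, Complex.ofReal_re]
  have h2 : (z + (y : ℂ) ^ 2).im = z.im := by
    rw [Complex.add_im, ← Complex.ofReal_pow, Complex.ofReal_im, add_zero]
  have := norm_besselU_half_le (z := z + y ^ 2) (Or.inr (by rwa [h2])) (by rwa [h1])
  rwa [h1] at this

lemma ae_add_sq_ne_zero_real (w : ℝ) : ∀ᵐ y : ℝ, w + y ^ 2 ≠ 0 := by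
  filter_upwards [ae_sq_ne (-w)] with y hy h
  exact hy (by linarith)

/-- The bound depends on Re z alone and has only an inverse square root singularity there, so it
majorizes U_0 uniformly as the cut is approached. -/
lemma norm_besselU_zero_le {z : ℂ} (hz : z.im ≠ 0) (hre : z.re ≠ 0) :
    ‖besselU ((0 : ℝ) : ℂ) z‖ ≤ (√Real.pi)⁻¹ * ((1 + (√|z.re|)⁻¹) * ∫ u, domUg u) := by
  rw [besselU_zero_eq (Or.inr hz), norm_mul, norm_inv, Complex.norm_real,
    Real.norm_of_nonneg (Real.sqrt_nonneg _)]
  refine mul_le_mul_of_nonneg_left ?_ (by positivity)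
  refine le_trans (norm_integral_le_of_norm_le (integrable_domU hre).1 ?_) (integrable_domU hre).2
  filter_upwards [ae_add_sq_ne_zero_real z.re] with y hy using norm_besselU_half_add_le hz hy

end

section
/-! ### Boundary values of `U_{±1/2}` and `U_0` and their jumps -/

/-- The boundary values of `U_{1/2}`. -/
def bdryHalf (r w : ℝ) : ℂ := (bsqrt r w)⁻¹ * Complex.exp (-2 * bsqrt r w)

section
variable {r w : ℝ} {z : ℝ → ℂ}

lemma mem_slitPlane_of_mul_im_pos {r : ℝ} {z : ℂ} (h : 0 < r * z.im) : z ∈ Complex.slitPlane :=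
  Or.inr fun h0 => by simp [h0] at h

lemma tendsto_besselU_neg_half (hr : r = 1 ∨ r = -1) (hw : w ≠ 0)
    (hz : Tendsto z (𝓝[>] 0) (𝓝 w)) (him : ∀ ε, 0 < ε → 0 < r * (z ε).im) :
    Tendsto (fun ε => besselU ((-(1 / 2) : ℝ) : ℂ) (z ε)) (𝓝[>] 0) (𝓝 (Complex.exp (-2 * bsqrt r w))) := by
  refine ((tendsto_sqrt hr hw hz him).const_mul (-2)).cexp.congr' ?_
  filter_upwards [self_mem_nhdsWithin] with ε hε
  rw [besselU_neg_half (mem_slitPlane_of_mul_im_pos (him ε hε))]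

lemma tendsto_besselU_half (hr : r = 1 ∨ r = -1) (hw : w ≠ 0)
    (hz : Tendsto z (𝓝[>] 0) (𝓝 w)) (him : ∀ ε, 0 < ε → 0 < r * (z ε).im) :
    Tendsto (fun ε => besselU ((1 / 2 : ℝ) : ℂ) (z ε)) (𝓝[>] 0) (𝓝 (bdryHalf r w)) := by
  have h := tendsto_sqrt hr hw hz him
  refine ((h.inv₀ (bsqrt_ne_zero hr hw)).mul (h.const_mul (-2)).cexp).congr' ?_
  filter_upwards [self_mem_nhdsWithin] with ε hε
  rw [besselU_half (mem_slitPlane_of_mul_im_pos (him ε hε))]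

/-- Dominated convergence in the representation of U_0 by U_{1/2}; the real part of the argument is
kept fixed so that one majorant serves all ε. -/
lemma integrable_bdryHalf (hr : r = 1 ∨ r = -1) (hw : w ≠ 0)
    (hz : Tendsto z (𝓝[>] 0) (𝓝 w)) (him : ∀ ε, 0 < ε → 0 < r * (z ε).im) (hre : ∀ ε, (z ε).re = w) :
    Integrable (fun y => bdryHalf r (w + y ^ 2)) ∧
    Tendsto (fun ε => besselU ((0 : ℝ) : ℂ) (z ε)) (𝓝[>] 0)
      (𝓝 ((Real.sqrt Real.pi : ℂ)⁻¹ * ∫ y : ℝ, bdryHalf r (w + y ^ 2))) := by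
  have hz' : ∀ y : ℝ, Tendsto (fun ε => z ε + (y : ℂ) ^ 2) (𝓝[>] 0) (𝓝 ((w + y ^ 2 : ℝ) : ℂ)) := fun y => by
    push_cast; exact hz.add_const _
  have him' : ∀ y ε : ℝ, 0 < ε → 0 < r * (z ε + (y : ℂ) ^ 2).im := fun y ε hε => by
    rw [Complex.add_im, ← Complex.ofReal_pow, Complex.ofReal_im, add_zero]; exact him ε hε
  have hlim : ∀ᵐ y : ℝ, Tendsto (fun ε => besselU ((1 / 2 : ℝ) : ℂ) (z ε + y ^ 2)) (𝓝[>] 0)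
      (𝓝 (bdryHalf r (w + y ^ 2))) := by
    filter_upwards [ae_add_sq_ne_zero_real w] with y hy
    exact tendsto_besselU_half hr hy (hz' y) (him' y)
  have him0 : ∀ ε, 0 < ε → (z ε).im ≠ 0 := fun ε hε h => by simpa [h] using him ε hε
  have hmeas : ∀ ε, 0 < ε → Continuous fun y : ℝ => besselU ((1 / 2 : ℝ) : ℂ) (z ε + y ^ 2) := fun ε hε => by
    refine continuous_iff_continuousAt.2 fun y => ?_
    exact ContinuousAt.comp (g := besselU ((1 / 2 : ℝ) : ℂ)) (f := fun y : ℝ => z ε + (y : ℂ) ^ 2)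
      (differentiableAt_besselU _ (mem_slitPlane_of_mul_im_pos (him' y ε hε))).continuousAt
      (by fun_prop)
  have hbd : ∀ ε, 0 < ε → ∀ᵐ y : ℝ, ‖besselU ((1 / 2 : ℝ) : ℂ) (z ε + y ^ 2)‖ ≤ domU w y := fun ε hε => by
    filter_upwards [ae_add_sq_ne_zero_real w] with y hy
    have := norm_besselU_half_add_le (him0 ε hε) (y := y) (by rwa [hre])
    rwa [hre] at this
  constructor
  -- Along the sequence ε = 1/(n+1) the limit inherits measurability and the majorant.
  · have hseq := (tendsto_nhdsWithin_of_tendsto_nhds_of_eventually_within (s := Set.Ioi 0) _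
      (tendsto_one_div_add_atTop_nhds_zero_nat (𝕜 := ℝ)) (Eventually.of_forall fun n => by
        show (0 : ℝ) < 1 / ((n : ℝ) + 1); positivity))
    have hpos : ∀ n : ℕ, (0 : ℝ) < 1 / ((n : ℝ) + 1) := fun n => by positivity
    have hm : AEStronglyMeasurable (fun y : ℝ => bdryHalf r (w + y ^ 2)) volume := by
      refine aestronglyMeasurable_of_tendsto_ae atTop (fun n : ℕ => (hmeas _ (hpos n)).aestronglyMeasurable) ?_
      filter_upwards [hlim] with y hy using hy.comp hseq
    refine (integrable_domU hw).1.mono' hm ?_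
    have hb : ∀ᵐ y : ℝ, ∀ n : ℕ, ‖besselU ((1 / 2 : ℝ) : ℂ) (z (1 / ((n : ℝ) + 1)) + y ^ 2)‖ ≤ domU w y :=
      ae_all_iff.2 fun n => hbd _ (hpos n)
    filter_upwards [hlim, hb] with y hy hb
    exact le_of_tendsto (hy.comp hseq).norm (Eventually.of_forall hb)
  · have h := tendsto_integral_filter_of_dominated_convergence (l := 𝓝[>] (0 : ℝ)) (domU w)
      (F := fun (ε : ℝ) (y : ℝ) => besselU ((1 / 2 : ℝ) : ℂ) (z ε + (y : ℂ) ^ 2))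
      (by filter_upwards [self_mem_nhdsWithin] with ε hε using (hmeas ε hε).aestronglyMeasurable)
      (by filter_upwards [self_mem_nhdsWithin] with ε hε using hbd ε hε) (integrable_domU hw).1 hlim
    refine (h.const_mul _).congr' ?_
    filter_upwards [self_mem_nhdsWithin] with ε hε
    rw [besselU_zero_eq (mem_slitPlane_of_mul_im_pos (him ε hε))]

end

/-- The entire function `∑ (-v)^i / (i! Γ(β+1+i))` on the real line. -/
def besselJs (β v : ℝ) : ℝ := ∑' i : ℕ, (-v) ^ i / (i.factorial * Real.Gamma (β + 1 + i))

/-- A case of the duplication formula for Γ. Together with its companion for index 1/2 it identifies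
the series of index ∓1/2 with the cosine and sine series. -/
lemma factorial_mul_Gamma_half (i : ℕ) :
    (i.factorial : ℝ) * Real.Gamma (-(1 / 2) + 1 + i) = √Real.pi * (2 * i).factorial / 4 ^ i := by
  induction i with
  | zero => norm_num [Real.Gamma_one_half_eq]
  | succ i ih =>
    rw [show (-(1 / 2) + 1 + ((i + 1 : ℕ) : ℝ)) = (-(1 / 2) + 1 + (i : ℝ)) + 1 by push_cast; ring,
      Real.Gamma_add_one (by positivity), Nat.factorial_succ, show 2 * (i + 1) = 2 * i + 1 + 1 by ring,
      Nat.factorial_succ, Nat.factorial_succ]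
    push_cast
    rw [show ((i : ℝ) + 1) * i.factorial * ((-(1 / 2) + 1 + i) * Real.Gamma (-(1 / 2) + 1 + i)) =
      (i + 1) * (-(1 / 2) + 1 + i) * (i.factorial * Real.Gamma (-(1 / 2) + 1 + i)) by ring, ih, pow_succ]
    ring

lemma factorial_mul_Gamma_three_half (i : ℕ) :
    (i.factorial : ℝ) * Real.Gamma (1 / 2 + 1 + i) = √Real.pi * (2 * i + 1).factorial / (2 * 4 ^ i) := by
  have h := factorial_mul_Gamma_half i
  rw [show (1 / 2 + 1 + (i : ℝ)) = (-(1 / 2) + 1 + (i : ℝ)) + 1 by ring,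
    Real.Gamma_add_one (by positivity), mul_left_comm, h, Nat.factorial_succ]
  push_cast
  ring

lemma besselJs_neg_half {ρ : ℝ} : √Real.pi * besselJs (-(1 / 2)) (ρ ^ 2) = Real.cos (2 * ρ) := by
  rw [(Real.hasSum_cos (2 * ρ)).tsum_eq.symm, besselJs, ← tsum_mul_left]
  refine tsum_congr fun i => ?_
  rw [factorial_mul_Gamma_half]
  have : √Real.pi ≠ 0 := (Real.sqrt_pos.2 Real.pi_pos).ne'
  rw [neg_pow (ρ ^ 2), mul_pow, pow_mul 2 2 i, pow_mul ρ 2 i]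
  field_simp
  norm_num

lemma besselJs_half {ρ : ℝ} : √Real.pi * (ρ * besselJs (1 / 2) (ρ ^ 2)) = Real.sin (2 * ρ) := by
  rw [(Real.hasSum_sin (2 * ρ)).tsum_eq.symm, besselJs, ← tsum_mul_left, ← tsum_mul_left]
  refine tsum_congr fun i => ?_
  rw [factorial_mul_Gamma_three_half]
  have : √Real.pi ≠ 0 := (Real.sqrt_pos.2 Real.pi_pos).ne'
  rw [neg_pow (ρ ^ 2), mul_pow, pow_succ _ (2 * i), pow_succ _ (2 * i), pow_mul 2 2 i, pow_mul ρ 2 i]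
  field_simp
  norm_num

lemma integral_sin_pow_even_eq (i : ℕ) : ∫ θ in (0 : ℝ)..Real.pi, Real.sin θ ^ (2 * i) =
    Real.pi * (2 * i).factorial / (4 ^ i * (i.factorial : ℝ) ^ 2) := by
  rw [integral_sin_pow_even, mul_div_assoc]
  congr 1
  induction i with
  | zero => simp
  | succ i ih =>
    rw [Finset.prod_range_succ, ih, show 2 * (i + 1) = 2 * i + 1 + 1 by ring,
      Nat.factorial_succ, Nat.factorial_succ, Nat.factorial_succ]
    push_cast
    field_simp
    ring

/-- Expand the cosine and integrate termwise; the Wallis integrals ∫ sin²ⁱ supply the second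
factorial of the series of index 0. -/
lemma integral_cos_sin (ρ : ℝ) : ∫ θ in (0 : ℝ)..Real.pi, Real.cos (2 * (ρ * Real.sin θ)) =
    Real.pi * besselJs 0 (ρ ^ 2) := by
  have h := intervalIntegral.hasSum_integral_of_dominated_convergence (μ := volume) (a := 0) (b := Real.pi)
    (F := fun (i : ℕ) θ => (-1) ^ i * (2 * (ρ * Real.sin θ)) ^ (2 * i) / (2 * i).factorial)
    (f := fun θ => Real.cos (2 * (ρ * Real.sin θ)))
    (fun i _ => (2 * |ρ|) ^ (2 * i) / (2 * i).factorial) (fun i => by fun_prop)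
    (fun i => Eventually.of_forall fun θ _ => ?_) (Eventually.of_forall fun θ _ => ?_) ?_
    (Eventually.of_forall fun θ _ => Real.hasSum_cos _)
  · rw [← h.tsum_eq, besselJs, ← tsum_mul_left]
    refine tsum_congr fun i => ?_
    have e : (fun θ : ℝ => (-1) ^ i * (2 * (ρ * Real.sin θ)) ^ (2 * i) / ((2 * i).factorial : ℝ)) =
        fun θ => ((-1) ^ i * (2 * ρ) ^ (2 * i) / (2 * i).factorial) * Real.sin θ ^ (2 * i) := by
      funext θ; rw [← mul_assoc, mul_pow]; ring
    rw [e, intervalIntegral.integral_const_mul, integral_sin_pow_even_eq, show (0 : ℝ) + 1 + i = i + 1 by ring,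
      Real.Gamma_nat_eq_factorial, neg_pow (ρ ^ 2), mul_pow, pow_mul 2 2 i, pow_mul ρ 2 i]
    field_simp
    norm_num [mul_comm]
  · rw [norm_div, norm_mul, norm_pow, norm_pow]
    simp only [norm_neg, norm_one, one_pow, one_mul, Real.norm_natCast]
    gcongr
    rw [norm_mul, norm_mul, Real.norm_ofNat, Real.norm_eq_abs, Real.norm_eq_abs]
    nlinarith [Real.abs_sin_le_one θ, abs_nonneg ρ]
  · exact (Real.summable_pow_div_factorial (2 * |ρ|)).comp_injective (mul_right_injective₀ two_ne_zero)
  · exact intervalIntegrable_const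

/-- The substitution y = -ρ cos θ cancels the singular denominator against its Jacobian ρ sin θ. -/
lemma integral_cos_div_sqrt {ρ : ℝ} (hρ : 0 < ρ) :
    ∫ y in Set.Ioo (-ρ) ρ, Real.cos (2 * √(ρ ^ 2 - y ^ 2)) / √(ρ ^ 2 - y ^ 2) = Real.pi * besselJs 0 (ρ ^ 2) := by
  have himg : (fun θ => -(ρ * Real.cos θ)) '' Set.Ioo 0 Real.pi = Set.Ioo (-ρ) ρ := by
    ext y
    constructor
    · rintro ⟨θ, ⟨h0, h1⟩, rfl⟩
      have h2 : Real.cos θ < 1 := by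
        simpa using Real.strictAntiOn_cos ⟨le_rfl, Real.pi_pos.le⟩ ⟨h0.le, h1.le⟩ h0
      have h3 : -1 < Real.cos θ := by
        simpa using Real.strictAntiOn_cos ⟨h0.le, h1.le⟩ ⟨Real.pi_pos.le, le_rfl⟩ h1
      constructor <;> simp only <;> nlinarith
    · rintro ⟨h0, h1⟩
      have h2 : -1 < -y / ρ := by rw [lt_div_iff₀ hρ]; linarith
      have h3 : -y / ρ < 1 := by rw [div_lt_iff₀ hρ]; linarith
      refine ⟨Real.arccos (-y / ρ), ⟨Real.arccos_pos.2 h3, ?_⟩, ?_⟩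
      · refine lt_of_le_of_ne (Real.arccos_le_pi _) fun h => ?_
        rw [Real.arccos_eq_pi] at h; linarith
      · simp only
        rw [Real.cos_arccos h2.le h3.le]; field_simp
  have hinj : Set.InjOn (fun θ => -(ρ * Real.cos θ)) (Set.Ioo 0 Real.pi) := by
    intro a ha b hb h
    refine Real.injOn_cos ⟨ha.1.le, ha.2.le⟩ ⟨hb.1.le, hb.2.le⟩ ?_
    have h : -(ρ * Real.cos a) = -(ρ * Real.cos b) := h
    exact mul_left_cancel₀ hρ.ne' (neg_injective h)
  have hder : ∀ θ ∈ Set.Ioo 0 Real.pi, HasDerivWithinAt (fun θ => -(ρ * Real.cos θ)) (ρ * Real.sin θ)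
      (Set.Ioo 0 Real.pi) θ := fun θ _ => by
    refine (((Real.hasDerivAt_cos θ).const_mul ρ).neg.congr_deriv (by ring)).hasDerivWithinAt
  rw [← himg, integral_image_eq_integral_abs_deriv_smul measurableSet_Ioo hder hinj, ← integral_cos_sin,
    intervalIntegral.integral_of_le Real.pi_pos.le, integral_Ioc_eq_integral_Ioo]
  refine setIntegral_congr_fun measurableSet_Ioo fun θ hθ => ?_
  have hs : 0 < ρ * Real.sin θ := mul_pos hρ (Real.sin_pos_of_mem_Ioo hθ)
  have h1 : ρ ^ 2 - (-(ρ * Real.cos θ)) ^ 2 = (ρ * Real.sin θ) ^ 2 := by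
    have := Real.sin_sq_add_cos_sq θ
    linear_combination (-ρ ^ 2) * this
  rw [h1, Real.sqrt_sq hs.le, abs_of_pos hs, smul_eq_mul, mul_div_cancel₀ _ hs.ne']

lemma bsqrt_of_pos (r : ℝ) {w : ℝ} (hw : 0 < w) : bsqrt r w = ((√w : ℝ) : ℂ) := if_pos hw

lemma bsqrt_of_neg (r : ℝ) {w : ℝ} (hw : w < 0) : bsqrt r w = Complex.I * ((r * √(-w) : ℝ) : ℂ) :=
  if_neg hw.not_gt

/-- The jump of `U_{-1/2}` across the cut. -/
lemma jump_neg_half {w : ℝ} (hw : w < 0) :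
    Complex.exp (-2 * bsqrt (-1) w) - Complex.exp (-2 * bsqrt 1 w) =
      2 * Complex.I * (√Real.pi * ((-w) ^ (1 / 2 : ℝ) * besselJs (1 / 2) (-w)) : ℝ) := by
  have h := besselJs_half (ρ := √(-w))
  rw [Real.sq_sqrt (by linarith)] at h
  rw [← Real.sqrt_eq_rpow, h, bsqrt_of_neg _ hw, bsqrt_of_neg _ hw]
  push_cast
  rw [Complex.sin]
  have e1 : -2 * (Complex.I * (-1 * (√(-w) : ℂ))) = 2 * (√(-w) : ℂ) * Complex.I := by ring
  have e2 : -2 * (Complex.I * (1 * (√(-w) : ℂ))) = -(2 * (√(-w) : ℂ)) * Complex.I := by ring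
  rw [e1, e2]
  linear_combination (Complex.exp (2 * (√(-w) : ℂ) * Complex.I) - Complex.exp (-(2 * (√(-w) : ℂ)) * Complex.I)) * Complex.I_sq

/-- The jump of `U_{1/2}` across the cut. -/
lemma jump_half_aux {w : ℝ} (hw : w < 0) :
    bdryHalf (-1) w - bdryHalf 1 w = 2 * Complex.I * (Real.cos (2 * √(-w)) / √(-w) : ℝ) := by
  have hs : (√(-w) : ℂ) ≠ 0 := by
    exact_mod_cast (Real.sqrt_pos.2 (by linarith : 0 < -w)).ne'
  rw [bdryHalf, bdryHalf, bsqrt_of_neg _ hw, bsqrt_of_neg _ hw]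
  push_cast
  rw [Complex.cos]
  have e1 : -2 * (Complex.I * (-1 * (√(-w) : ℂ))) = 2 * (√(-w) : ℂ) * Complex.I := by ring
  have e2 : -2 * (Complex.I * (1 * (√(-w) : ℂ))) = -(2 * (√(-w) : ℂ)) * Complex.I := by ring
  rw [e1, e2, mul_inv, mul_inv, Complex.inv_I]
  field_simp
  ring_nf
  rw [Complex.I_sq]
  ring

lemma jump_half {w : ℝ} (hw : w < 0) : bdryHalf (-1) w - bdryHalf 1 w =
    2 * Complex.I * (√Real.pi * ((-w) ^ (-(1 / 2) : ℝ) * besselJs (-(1 / 2)) (-w)) : ℝ) := by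
  have h := besselJs_neg_half (ρ := √(-w))
  have h0 : 0 ≤ -w := by linarith
  rw [Real.sq_sqrt h0] at h
  rw [jump_half_aux hw, ← h, Real.rpow_neg h0, ← Real.sqrt_eq_rpow]
  push_cast
  ring

/-- The jump of `U_0` across the cut. -/
lemma jump_zero {w : ℝ} (hw : w < 0) (h1 : Integrable fun y : ℝ => bdryHalf 1 (w + y ^ 2))
    (h2 : Integrable fun y : ℝ => bdryHalf (-1) (w + y ^ 2)) :
    (Real.sqrt Real.pi : ℂ)⁻¹ * (∫ y : ℝ, bdryHalf (-1) (w + y ^ 2)) -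
      (Real.sqrt Real.pi : ℂ)⁻¹ * (∫ y : ℝ, bdryHalf 1 (w + y ^ 2)) =
      2 * Complex.I * (√Real.pi * besselJs 0 (-w) : ℝ) := by
  have hw' : 0 < -w := by linarith
  set ρ := √(-w) with hρ
  have hρ0 : 0 < ρ := Real.sqrt_pos.2 hw'
  have hρ2 : ρ ^ 2 = -w := Real.sq_sqrt hw'.le
  rw [← mul_sub, ← integral_sub h2 h1]
  -- Only |y| < ρ contributes to the jump: beyond it w + y² > 0, and the two boundary values
  -- coincide.
  have key : (fun y : ℝ => bdryHalf (-1) (w + y ^ 2) - bdryHalf 1 (w + y ^ 2)) =ᵐ[volume]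
      Set.indicator (Set.Ioo (-ρ) ρ) fun y =>
        2 * Complex.I * ((Real.cos (2 * √(ρ ^ 2 - y ^ 2)) / √(ρ ^ 2 - y ^ 2) : ℝ) : ℂ) := by
    filter_upwards [ae_add_sq_ne_zero_real w] with y hy
    by_cases hmem : y ∈ Set.Ioo (-ρ) ρ
    · have : w + y ^ 2 < 0 := by nlinarith [hmem.1, hmem.2]
      rw [Set.indicator_of_mem hmem, jump_half_aux this, show -(w + y ^ 2) = ρ ^ 2 - y ^ 2 by rw [hρ2]; ring]
    · have : 0 < w + y ^ 2 := by
        refine lt_of_le_of_ne ?_ hy.symm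
        have : ρ ≤ |y| := by
          by_contra h
          exact hmem (abs_lt.1 (not_le.1 h))
        nlinarith [sq_abs y]
      rw [Set.indicator_of_notMem hmem, bdryHalf, bdryHalf, bsqrt_of_pos _ this, bsqrt_of_pos _ this, sub_self]
  rw [integral_congr_ae key, integral_indicator measurableSet_Ioo, integral_const_mul, integral_complex_ofReal,
    integral_cos_div_sqrt hρ0, hρ2]
  have h3 : (Real.pi : ℂ) = Real.sqrt Real.pi * Real.sqrt Real.pi := by
    exact_mod_cast (Real.mul_self_sqrt Real.pi_pos.le).symm
  have := sqrt_pi_ne_zero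
  push_cast
  rw [h3]
  field_simp

end

section
/-! ### The boundary values entering the position space formulas -/

/-- The exponent `1 - d/2 + ⌊d/2 - 1⌋`, which is `1/2` for `d = 1`, `0` for even `d`, and `-1/2` for
odd `d ≥ 3`. -/
def bet (d : ℕ) : ℝ := 1 - (d : ℝ) / 2 + ((d - 2) / 2 : ℕ)

/-- For d = 1 the truncated quotient (d-2)/2 is 0, which is why that dimension has its own exponent
1/2. -/
lemma bet_cases (d : ℕ) [NeZero d] : (d = 1 ∧ bet d = 1 / 2) ∨ (Even d ∧ d ≠ 1 ∧ bet d = 0) ∨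
    (Odd d ∧ 3 ≤ d ∧ d ≠ 1 ∧ bet d = -(1 / 2)) := by
  have hd : d ≠ 0 := NeZero.ne d
  rcases Nat.even_or_odd' d with ⟨k, rfl | rfl⟩
  · right; left
    refine ⟨⟨k, by ring⟩, by omega, ?_⟩
    obtain ⟨j, rfl⟩ : ∃ j, k = j + 1 := ⟨k - 1, by omega⟩
    rw [bet, show (2 * (j + 1) - 2) / 2 = j by omega]
    push_cast; ring
  · rcases Nat.eq_zero_or_pos k with rfl | hk
    · left; norm_num [bet]
    · right; right
      refine ⟨⟨k, rfl⟩, by omega, by omega, ?_⟩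
      obtain ⟨j, rfl⟩ : ∃ j, k = j + 1 := ⟨k - 1, by omega⟩
      rw [bet, show (2 * (j + 1) + 1 - 2) / 2 = j by omega]
      push_cast; ring

/-- The argument `(m² w + i r ε) / 4`. -/
def bdryArg (m r ε w : ℝ) : ℂ := (((m ^ 2 * w : ℝ) : ℂ) + ((r * ε : ℝ) : ℂ) * Complex.I) / 4

lemma bdryArg_re (m r ε w : ℝ) : (bdryArg m r ε w).re = m ^ 2 / 4 * w := by
  rw [bdryArg, show (4 : ℂ) = ((4 : ℝ) : ℂ) by norm_num, Complex.div_ofReal_re]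
  simp only [Complex.add_re, Complex.ofReal_re, Complex.re_ofReal_mul, Complex.I_re]; ring

lemma bdryArg_im (m r ε w : ℝ) : (bdryArg m r ε w).im = r * ε / 4 := by
  rw [bdryArg, show (4 : ℂ) = ((4 : ℝ) : ℂ) by norm_num, Complex.div_ofReal_im]
  simp only [Complex.add_im, Complex.ofReal_im, Complex.im_ofReal_mul, Complex.I_im]; ring

lemma mul_bdryArg_im_pos {m r ε w : ℝ} (hr : r = 1 ∨ r = -1) (hε : 0 < ε) :
    0 < r * (bdryArg m r ε w).im := by
  rw [bdryArg_im]; rcases hr with rfl | rfl <;> linarith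

lemma bdryArg_mem {m r ε w : ℝ} (hr : r = 1 ∨ r = -1) (hε : 0 < ε) :
    bdryArg m r ε w ∈ Complex.slitPlane := mem_slitPlane_of_mul_im_pos (mul_bdryArg_im_pos hr hε)

lemma tendsto_bdryArg (m r w : ℝ) :
    Tendsto (fun ε => bdryArg m r ε w) (𝓝[>] 0) (𝓝 ((m ^ 2 / 4 * w : ℝ) : ℂ)) := by
  have h : Continuous fun ε => bdryArg m r ε w := by unfold bdryArg; fun_prop
  have := h.tendsto 0
  have e : bdryArg m r 0 w = ((m ^ 2 / 4 * w : ℝ) : ℂ) := by rw [bdryArg]; push_cast; simp; ring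
  rw [e] at this
  exact this.mono_left nhdsWithin_le_nhds

variable {d : ℕ} [NeZero d] {m : ℝ}

/-- The boundary values of `U_{-β}` at `m² w / 4 ± i0`. -/
def Ubdry (d : ℕ) (m r w : ℝ) : ℂ :=
  if w = 0 then 0 else limUnder (𝓝[>] 0) fun ε => besselU ((-bet d : ℝ) : ℂ) (bdryArg m r ε w)

/-- The jump of `U_{-β}` over the cut, without a factor `2i√π`. -/
def Ujump (d : ℕ) (m w : ℝ) : ℝ :=
  if w < 0 then (-(m ^ 2 / 4 * w)) ^ bet d * besselJs (bet d) (-(m ^ 2 / 4 * w)) else 0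

/-- Existence of the limits and the value of the jump are proved for one common L, case by case in
the parity of d. Uniqueness of limits later transfers both to `Ubdry`, and the parity of d no longer
matters. -/
lemma tendsto_Ubdry_aux (hm : 0 < m) {w : ℝ} (hw : w ≠ 0) : ∃ L : ℝ → ℂ,
    (∀ r, r = 1 ∨ r = -1 →
      Tendsto (fun ε => besselU ((-bet d : ℝ) : ℂ) (bdryArg m r ε w)) (𝓝[>] 0) (𝓝 (L r))) ∧
    L (-1) - L 1 = 2 * Complex.I * (√Real.pi * Ujump d m w : ℝ) := by
  have hc : 0 < m ^ 2 / 4 := by positivity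
  have hcw : m ^ 2 / 4 * w ≠ 0 := mul_ne_zero hc.ne' hw
  have him : ∀ r, r = 1 ∨ r = -1 → ∀ ε, 0 < ε → 0 < r * (bdryArg m r ε w).im :=
    fun r hr ε hε => mul_bdryArg_im_pos hr hε
  have hpos : ∀ {b : ℝ}, ¬ b < 0 → b ≠ 0 → 0 < b := fun h1 h2 => lt_of_le_of_ne (not_lt.1 h1) h2.symm
  have hcneg : w < 0 → m ^ 2 / 4 * w < 0 := fun h => by nlinarith
  have hcpos : ¬ w < 0 → 0 < m ^ 2 / 4 * w := fun h => mul_pos hc (hpos h hw)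
  have hbs : ¬ w < 0 → bsqrt (-1) (m ^ 2 / 4 * w) = bsqrt 1 (m ^ 2 / 4 * w) := fun h => by
    rw [bsqrt_of_pos _ (hcpos h), bsqrt_of_pos _ (hcpos h)]
  rcases bet_cases d with ⟨-, h⟩ | ⟨-, -, h⟩ | ⟨-, -, -, h⟩
  · refine ⟨fun r => Complex.exp (-2 * bsqrt r (m ^ 2 / 4 * w)), fun r hr => ?_, ?_⟩
    · rw [h]
      exact tendsto_besselU_neg_half hr hcw (tendsto_bdryArg m r w) (him r hr)
    · rw [Ujump, h]
      split_ifs with hw'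
      · exact jump_neg_half (hcneg hw')
      · simp [hbs hw']
  · have hI := fun r hr => integrable_bdryHalf hr hcw (tendsto_bdryArg m r w) (him r hr)
      (fun ε => bdryArg_re m r ε w)
    refine ⟨fun r => (Real.sqrt Real.pi : ℂ)⁻¹ * ∫ y : ℝ, bdryHalf r (m ^ 2 / 4 * w + y ^ 2), fun r hr => ?_, ?_⟩
    · rw [h, neg_zero]
      exact (hI r hr).2
    · rw [Ujump, h]
      split_ifs with hw'
      · rw [Real.rpow_zero, one_mul]
        exact jump_zero (hcneg hw') (hI 1 (Or.inl rfl)).1 (hI (-1) (Or.inr rfl)).1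
      · have : ∀ y : ℝ, bdryHalf (-1) (m ^ 2 / 4 * w + y ^ 2) = bdryHalf 1 (m ^ 2 / 4 * w + y ^ 2) := fun y => by
          have h1 := hcpos hw'
          rw [bdryHalf, bdryHalf, bsqrt_of_pos _ (by positivity), bsqrt_of_pos _ (by positivity)]
        simp [this]
  · refine ⟨fun r => bdryHalf r (m ^ 2 / 4 * w), fun r hr => ?_, ?_⟩
    · rw [h, neg_neg]
      exact tendsto_besselU_half hr hcw (tendsto_bdryArg m r w) (him r hr)
    · rw [Ujump, h]
      split_ifs with hw'
      · exact jump_half (hcneg hw')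
      · simp [bdryHalf, hbs hw']

lemma tendsto_Ubdry (hm : 0 < m) {r : ℝ} (hr : r = 1 ∨ r = -1) {w : ℝ} (hw : w ≠ 0) :
    Tendsto (fun ε => besselU ((-bet d : ℝ) : ℂ) (bdryArg m r ε w)) (𝓝[>] 0) (𝓝 (Ubdry d m r w)) := by
  obtain ⟨L, hL, -⟩ := tendsto_Ubdry_aux (d := d) hm hw
  rw [Ubdry, if_neg hw]
  exact tendsto_nhds_limUnder ⟨_, hL r hr⟩

lemma Ubdry_sub (hm : 0 < m) {w : ℝ} (hw : w ≠ 0) :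
    Ubdry d m (-1) w - Ubdry d m 1 w = 2 * Complex.I * (√Real.pi * Ujump d m w : ℝ) := by
  obtain ⟨L, hL, h⟩ := tendsto_Ubdry_aux (d := d) hm hw
  rw [← h, tendsto_nhds_unique (tendsto_Ubdry hm (Or.inr rfl) hw) (hL (-1) (Or.inr rfl)),
    tendsto_nhds_unique (tendsto_Ubdry hm (Or.inl rfl) hw) (hL 1 (Or.inl rfl))]

lemma continuous_besselU_bdryArg (α : ℝ) {r ε : ℝ} (hr : r = 1 ∨ r = -1) (hε : 0 < ε) :
    Continuous fun w => besselU α (bdryArg m r ε w) := by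
  refine continuous_iff_continuousAt.2 fun w => ?_
  exact ContinuousAt.comp (g := besselU α) (f := fun w => bdryArg m r ε w)
    (differentiableAt_besselU _ (bdryArg_mem hr hε)).continuousAt
    (by unfold bdryArg; fun_prop)

/-- One constant for both sides of the cut and for all ε > 0; this is the majorant in the passage to
the boundary values. -/
lemma exists_admBound_besselU (hm : 0 < m) : ∃ C, ∀ r ε : ℝ, r = 1 ∨ r = -1 → 0 < ε →
    AdmBound d C 1 fun w => besselU ((-bet d : ℝ) : ℂ) (bdryArg m r ε w) := by
  have hc : 0 < m ^ 2 / 4 := by positivity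
  have him : ∀ r ε w, r = 1 ∨ r = -1 → 0 < ε → (bdryArg m r ε w).im ≠ 0 := fun r ε w hr hε h => by
    have := mul_bdryArg_im_pos (m := m) (w := w) hr hε
    simp [h] at this
  have hre : ∀ r ε w, w ≠ 0 → (bdryArg m r ε w).re ≠ 0 := fun r ε w hw => by
    rw [bdryArg_re]; exact mul_ne_zero hc.ne' hw
  have hsq : ∀ r ε w, √|(bdryArg m r ε w).re| = √(m ^ 2 / 4) * √|w| := fun r ε w => by
    rw [bdryArg_re, abs_mul, abs_of_pos hc, Real.sqrt_mul hc.le]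
  have hsc : 0 < √(m ^ 2 / 4) := Real.sqrt_pos.2 hc
  have hpow : ∀ w : ℝ, |w| ^ (-(1 / 2) : ℝ) = (√|w|)⁻¹ := fun w => by
    rw [Real.rpow_neg (abs_nonneg _), Real.sqrt_eq_rpow]
  rcases bet_cases d with ⟨h1, h⟩ | ⟨-, h1, h⟩ | ⟨-, -, h1, h⟩
  · refine ⟨1, fun r ε hr hε w hw => ?_⟩
    rw [h, wexp, if_pos h1, Real.rpow_zero, one_mul, mul_one, pow_one]
    have := norm_besselU_neg_half_le (bdryArg_mem (m := m) (w := w) hr hε)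
    linarith [abs_nonneg w]
  · set D := ∫ u, domUg u with hD
    have hD0 : 0 ≤ D := integral_nonneg fun u => by unfold domUg; positivity
    refine ⟨(√Real.pi)⁻¹ * ((1 + (√(m ^ 2 / 4))⁻¹) * D), fun r ε hr hε w hw => ?_⟩
    have hw0 : 0 < √|w| := Real.sqrt_pos.2 (abs_pos.2 hw)
    rw [h, neg_zero, wexp, if_neg h1, hpow, pow_one]
    refine (norm_besselU_zero_le (him r ε w hr hε) (hre r ε w hw)).trans ?_
    rw [hsq, mul_assoc, mul_assoc]
    refine mul_le_mul_of_nonneg_left ?_ (by positivity)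
    rw [mul_comm D, ← mul_assoc]
    refine mul_le_mul_of_nonneg_right ?_ hD0
    have e : (1 + |w|) * (√|w|)⁻¹ = (√|w|)⁻¹ + √|w| := by
      rw [add_mul, one_mul]; nth_rewrite 2 [← Real.mul_self_sqrt (abs_nonneg w)]; field_simp
    have e2 : 1 ≤ (√|w|)⁻¹ + √|w| := by
      have := inv_pos.2 hw0
      rcases le_total 1 (√|w|) with h | h
      · linarith
      · have := (one_le_inv₀ hw0).2 h; linarith
    rw [e, mul_inv, add_mul, one_mul]
    have hsci := inv_pos.2 hsc
    nlinarith [mul_pos hsci hw0]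
  · refine ⟨(√(m ^ 2 / 4))⁻¹, fun r ε hr hε w hw => ?_⟩
    have hw0 : 0 < √|w| := Real.sqrt_pos.2 (abs_pos.2 hw)
    rw [h, neg_neg, wexp, if_neg h1, hpow, pow_one]
    refine (norm_besselU_half_le (bdryArg_mem hr hε) (hre r ε w hw)).trans ?_
    rw [hsq, mul_inv, mul_assoc]
    refine mul_le_mul_of_nonneg_left ?_ (by positivity)
    rw [mul_comm]
    refine mul_le_mul_of_nonneg_right ?_ (by positivity)
    have : Real.exp (-√(bdryArg m r ε w).re) ≤ 1 := Real.exp_le_one_iff.2 (by simp)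
    linarith [abs_nonneg w]

lemma measurable_Ubdry (hm : 0 < m) {r : ℝ} (hr : r = 1 ∨ r = -1) : Measurable (Ubdry d m r) := by
  have hpos : ∀ n : ℕ, (0 : ℝ) < 1 / ((n : ℝ) + 1) := fun n => by positivity
  have hseq := (tendsto_nhdsWithin_of_tendsto_nhds_of_eventually_within (s := Set.Ioi 0) _
      (tendsto_one_div_add_atTop_nhds_zero_nat (𝕜 := ℝ)) (Eventually.of_forall fun n => hpos n))
  -- The indicator of the complement of 0 matches the value 0 prescribed for `Ubdry` at w = 0, so
  -- that convergence holds at every w.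
  refine measurable_of_tendsto_metrizable (f := fun (n : ℕ) w => Set.indicator {0}ᶜ
    (fun w => besselU ((-bet d : ℝ) : ℂ) (bdryArg m r (1 / ((n : ℝ) + 1)) w)) w) (fun n =>
      ((continuous_besselU_bdryArg _ hr (hpos n)).measurable.indicator (measurableSet_singleton 0).compl)) ?_
  refine tendsto_pi_nhds.2 fun w => ?_
  by_cases hw : w = 0
  · simp [hw, Ubdry]
  · simp only [Set.indicator_of_mem (show w ∈ ({0} : Set ℝ)ᶜ from hw)]
    exact (tendsto_Ubdry hm hr hw).comp hseq

lemma adm_Ubdry (hm : 0 < m) {r : ℝ} (hr : r = 1 ∨ r = -1) : Adm d (Ubdry d m r) := by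
  obtain ⟨C, hC⟩ := exists_admBound_besselU (d := d) hm
  refine ⟨measurable_Ubdry hm hr, C, 1, fun w hw => ?_⟩
  refine le_of_tendsto (tendsto_Ubdry hm hr hw).norm ?_
  filter_upwards [self_mem_nhdsWithin] with ε hε using hC r ε hr hε w hw

end

section
/-! ### Limits of derivatives of functions of `x²` -/

variable {d : ℕ}

/-- The weight |w|^(-1/2) is small at infinity; one factor 1 + |w| compensates, so polynomially
bounded functions are admissible. -/
lemma one_le_adm_weight {w : ℝ} (hw : w ≠ 0) : 1 ≤ (1 + |w|) * |w| ^ wexp d := by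
  have hw0 : 0 < |w| := abs_pos.2 hw
  rw [wexp]
  split_ifs
  · simp
  · rw [Real.rpow_neg hw0.le, ← Real.sqrt_eq_rpow, ← div_eq_mul_inv, le_div_iff₀ (Real.sqrt_pos.2 hw0), one_mul]
    refine Real.sqrt_le_iff.2 ⟨by positivity, by nlinarith⟩

lemma admBound_of_le {C : ℝ} {M : ℕ} {h : ℝ → ℂ} (hC : 0 ≤ C) (hh : ∀ w ≠ 0, ‖h w‖ ≤ C * (1 + |w|) ^ M) :
    AdmBound d C (M + 1) h := fun w hw => by
  refine (hh w hw).trans (mul_le_mul_of_nonneg_left ?_ hC)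
  rw [pow_succ, mul_assoc]
  exact le_mul_of_one_le_right (by positivity) (one_le_adm_weight hw)

lemma AdmBound.add {C D : ℝ} {M N : ℕ} {g h : ℝ → ℂ} (hg : AdmBound d C M g) (hh : AdmBound d D N h)
    (hC : 0 ≤ C) (hD : 0 ≤ D) : AdmBound d (C + D) (M + N) fun w => g w + h w := fun w hw => by
  refine (norm_add_le _ _).trans ((add_le_add (hg w hw) (hh w hw)).trans ?_)
  rw [add_mul]
  have h1 : (1 : ℝ) ≤ 1 + |w| := by linarith [abs_nonneg w]
  refine add_le_add (mul_le_mul_of_nonneg_left ?_ hC) (mul_le_mul_of_nonneg_left ?_ hD) <;>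
  refine mul_le_mul_of_nonneg_right (pow_le_pow_right₀ h1 (by omega)) (by positivity)

lemma AdmBound.nonneg {C : ℝ} {M : ℕ} {h : ℝ → ℂ} (hh : AdmBound d C M h) : 0 ≤ C := by
  have h1 := (norm_nonneg _).trans (hh 1 one_ne_zero)
  simp only [abs_one, Real.one_rpow, mul_one] at h1
  exact nonneg_of_mul_nonneg_left h1 (by positivity)

lemma Adm.add {g h : ℝ → ℂ} (hg : Adm d g) (hh : Adm d h) : Adm d fun w => g w + h w := by
  obtain ⟨h1, C, M, h2⟩ := hg
  obtain ⟨h3, D, N, h4⟩ := hh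
  exact ⟨h1.add h3, _, _, h2.add h4 h2.nonneg h4.nonneg⟩

lemma AdmBound.const_mul {C : ℝ} {M : ℕ} {h : ℝ → ℂ} (hh : AdmBound d C M h) (a : ℂ) :
    AdmBound d (‖a‖ * C) M fun w => a * h w := fun w hw => by
  rw [norm_mul, mul_assoc]
  exact mul_le_mul_of_nonneg_left (hh w hw) (norm_nonneg _)

lemma Adm.const_mul {h : ℝ → ℂ} (hh : Adm d h) (a : ℂ) : Adm d fun w => a * h w := by
  obtain ⟨h1, C, M, h2⟩ := hh
  exact ⟨h1.const_mul a, _, _, h2.const_mul a⟩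

variable [NeZero d]

lemma IDist_const_mul {n : ℕ} (hn : n ≤ (d - 2) / 2) {τ h : ℝ → ℂ} (hτ : BddMeas τ) (hh : Adm d h) (a : ℂ) :
    IDist d n τ (fun w => a * h w) = a • IDist d n τ h := by
  ext φ
  rw [IDist_apply hn hτ (hh.const_mul a), smul_apply, IDist_apply hn hτ hh, smul_eq_mul, ← integral_const_mul]
  congr 1; funext x
  simp only [kerI]; ring

lemma IDist_add {n : ℕ} (hn : n ≤ (d - 2) / 2) {τ g h : ℝ → ℂ} (hτ : BddMeas τ) (hg : Adm d g) (hh : Adm d h) :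
    IDist d n τ (fun w => g w + h w) = IDist d n τ g + IDist d n τ h := by
  ext φ
  rw [IDist_apply hn hτ (hg.add hh), add_apply, IDist_apply hn hτ hg, IDist_apply hn hτ hh,
    ← integral_add ((tame_kerI hn hτ hg).integrable_mul _) ((tame_kerI hn hτ hh).integrable_mul _)]
  congr 1; funext x
  simp only [kerI]; ring

/-- The values of `h` at `0` do not matter. -/
lemma IDist_congr {n : ℕ} (hn : n ≤ (d - 2) / 2) {τ g h : ℝ → ℂ} (hτ : BddMeas τ) (hg : Adm d g) (hh : Adm d h)
    (he : ∀ w ≠ 0, g w = h w) : IDist d n τ g = IDist d n τ h := by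
  ext φ
  rw [IDist_apply hn hτ hg, IDist_apply hn hτ hh]
  refine integral_congr_ae ?_
  filter_upwards [ae_sq_ne_zero] with x hx
  simp only [kerI, he _ hx]

lemma IDist_zero_apply {τ h : ℝ → ℂ} (hτ : BddMeas τ) (hh : Adm d h) (φ : 𝓢(Mink d, ℂ)) :
    Integrable (fun x => τ (x 0) * h (sq x) * φ x) ∧ IDist d 0 τ h φ = ∫ x, τ (x 0) * h (sq x) * φ x := by
  have h1 := (tame_kerI (n := 0) (Nat.zero_le _) hτ hh).integrable_mul φ
  have h2 := IDist_apply (n := 0) (Nat.zero_le _) hτ hh φ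
  simp only [kerI, pow_zero, inv_one, Complex.ofReal_one, mul_one, Bop, ContinuousLinearMap.id_apply] at h1 h2
  exact ⟨h1, h2⟩

/-- Iterated integration by parts. The last function g n may be discontinuous at w = 0, all earlier
ones must be continuous. -/
lemma IDist_chain {n : ℕ} {τ : ℝ → ℂ} (hτ : BddMeas τ) {g : ℕ → ℝ → ℂ}
    (hadm : ∀ j ≤ n, Adm d (g j)) (hcont : ∀ j < n, Continuous (g j))
    (hder : ∀ j < n, ∀ w ≠ 0, HasDerivAt (g j) (g (j + 1) w) w) :
    ∀ l, n + l ≤ (d - 2) / 2 → IDist d (n + l) τ (g 0) = IDist d l τ (g n) := by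
  induction n with
  | zero => intro l _; rw [zero_add]
  | succ n ih =>
    intro l hl
    rw [show n + 1 + l = n + (l + 1) by ring, ih (fun j hj => hadm j (by omega)) (fun j hj => hcont j (by omega))
      (fun j hj => hder j (by omega)) (l + 1) (by omega)]
    exact IDist_succ_eq (by omega) hτ (hadm n (by omega)) (hadm (n + 1) le_rfl) (hcont n (by omega))
      (hder n (by omega))

/-- Convergence of `g_ε` implies convergence of the derivatives `g_ε⁽ⁿ⁾(x²)`. -/
theorem isDistLimit_IDist {n : ℕ} (hn : n ≤ (d - 2) / 2) {g : ℝ → ℕ → ℝ → ℂ} {h : ℝ → ℂ} {C : ℝ} {M : ℕ}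
    (hadm : ∀ ε, 0 < ε → ∀ j ≤ n, Adm d (g ε j)) (hcont : ∀ ε, 0 < ε → ∀ j < n, Continuous (g ε j))
    (hder : ∀ ε, 0 < ε → ∀ j < n, ∀ w ≠ 0, HasDerivAt (g ε j) (g ε (j + 1) w) w)
    (hbd : ∀ ε, 0 < ε → ε ≤ 1 → AdmBound d C M (g ε 0)) (hh : Adm d h)
    (hlim : ∀ w ≠ 0, Tendsto (fun ε => g ε 0 w) (𝓝[>] 0) (𝓝 (h w))) :
    IsDistLimit (fun ε x => g ε n (sq x)) (IDist d n (fun _ => 1) h) := by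
  intro φ
  have h0 : ∀ ε, 0 < ε → Integrable (fun x => g ε n (sq x) * φ x) ∧
      IDist d n (fun _ => 1) (g ε 0) φ = ∫ x, g ε n (sq x) * φ x := fun ε hε => by
    have := IDist_zero_apply bddMeas_one (hadm ε hε n le_rfl) φ
    simp only [one_mul] at this
    refine ⟨this.1, ?_⟩
    -- For fixed ε all n derivatives are moved onto the test function. Bounds on the derivatives may
    -- therefore depend on ε; only g ε 0 needs a uniform majorant.
    rw [← this.2, ← IDist_chain bddMeas_one (hadm ε hε) (hcont ε hε) (hder ε hε) 0 hn]
    rfl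
  refine ⟨fun ε hε => (h0 ε hε).1, ?_⟩
  have hmem : ∀ᶠ ε : ℝ in 𝓝[>] 0, 0 < ε := self_mem_nhdsWithin
  have hmem1 : ∀ᶠ ε : ℝ in 𝓝[>] 0, ε ≤ 1 := nhdsWithin_le_nhds (Iic_mem_nhds one_pos)
  have := tendsto_IDist (d := d) hn (l := 𝓝[>] (0 : ℝ)) (τ := fun _ _ => 1) (h := fun ε => g ε 0) (D := 1)
    (Eventually.of_forall fun _ => ⟨measurable_const, fun _ => by simp⟩) bddMeas_one
    ((hmem.and hmem1).mono fun ε hε => ⟨(hadm ε hε.1 0 (Nat.zero_le _)).1, hbd ε hε.1 hε.2⟩) hh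
    (fun _ _ => tendsto_const_nhds) hlim φ
  exact this.congr' (hmem.mono fun ε hε => (h0 ε hε).2)

/-! ### The boundary values of `U_{d/2-1}` -/

/-- For `α > 0` the function `U_α` is bounded on horizontal lines. -/
lemma exists_norm_besselU_le {α : ℝ} (hα : 0 < α) {y : ℝ} (hy : 0 < y) :
    ∃ C, 0 ≤ C ∧ ∀ r : ℝ, r = 1 ∨ r = -1 → ∀ z : ℂ, r * z.im = y → ‖besselU α z‖ ≤ C := by
  refine ⟨(√Real.pi)⁻¹ * ∫ σ in Set.Ioi (0 : ℝ), Real.exp (-(y / 4 / σ)) * σ ^ (-α - 1), ?_, ?_⟩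
  · exact mul_nonneg (by positivity) (setIntegral_nonneg measurableSet_Ioi fun σ (hσ : 0 < σ) => by positivity)
  intro r hr z hz
  have hr2 : r * r = 1 := by rcases hr with rfl | rfl <;> norm_num
  set w := z.re with hw
  -- The ray of integration is rotated to the direction a = δ + ir. Then Re(z/a) = (wδ + y)/(δ² +
  -- 1), and this δ gives |w| δ ≤ y/2 and δ ≤ 1, hence Re(z/a) ≥ y/4 for every w. The remaining
  -- integral of e^(-y/(4σ)) σ^(-α-1) converges at infinity because α > 0.
  set δ := y / (2 * (|w| + y)) with hδ
  have hδ0 : 0 < δ := by positivity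
  have hδ1 : δ ≤ 1 := by
    rw [hδ, div_le_one (by positivity)]
    linarith [abs_nonneg w]
  have hδw : |w| * δ ≤ y / 2 := by
    rw [hδ, mul_div_assoc', div_le_div_iff₀ (by positivity) two_pos]
    nlinarith [abs_nonneg w]
  set a : ℂ := ⟨δ, r⟩ with ha
  have hre : 0 < a.re := hδ0
  have ha0 : a ≠ 0 := fun h => by simp [h] at hre
  have hns : Complex.normSq a = δ ^ 2 + 1 := by rw [Complex.normSq_apply, ha]; simp only; rw [hr2]; ring
  have hbre : (z / a).re = (w * δ + y) / (δ ^ 2 + 1) := by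
    rw [Complex.div_re, hns, ← hz]
    simp only [ha, ← hw]
    field_simp
  have hb4 : y / 4 ≤ (z / a).re := by
    rw [hbre, div_le_div_iff₀ (by norm_num) (by positivity)]
    have h1 : -(|w| * δ) ≤ w * δ := by nlinarith [neg_abs_le w]
    have h2 : δ ^ 2 ≤ 1 := by nlinarith
    nlinarith [mul_le_mul_of_nonneg_left h2 hy.le]
  have hb : 0 < (z / a).re := by linarith
  have hK := besselK_eq α hre hb
  rw [mul_div_cancel₀ _ ha0] at hK
  have haα : a ^ (α : ℂ) ≠ 0 := by simp [Complex.cpow_eq_zero_iff, ha0]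
  have hU : besselU α z = (Real.sqrt Real.pi : ℂ)⁻¹ * ((a ^ (α : ℂ))⁻¹ * besselK α a (z / a)) := by
    rw [hK]; have := sqrt_pi_ne_zero; field_simp
  rw [hU, norm_mul, norm_inv, Complex.norm_real, Real.norm_of_nonneg (Real.sqrt_nonneg _), norm_mul, norm_inv,
    Complex.norm_cpow_real]
  refine mul_le_mul_of_nonneg_left ?_ (by positivity)
  have hna : 1 ≤ ‖a‖ := by
    have : 1 ≤ ‖a‖ ^ 2 := by rw [← Complex.normSq_eq_norm_sq, hns]; nlinarith
    nlinarith [norm_nonneg a]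
  have h1 : (‖a‖ ^ α)⁻¹ ≤ 1 := inv_le_one_of_one_le₀ (Real.one_le_rpow hna hα.le)
  refine (mul_le_of_le_one_left (norm_nonneg _) h1).trans ?_
  refine norm_integral_le_of_norm_le (integrableOn_exp_neg_div_rpow (by positivity) (by linarith)) ?_
  filter_upwards [ae_restrict_mem measurableSet_Ioi] with σ hσ
  have hσ : 0 < σ := hσ
  rw [norm_mul, Complex.norm_exp, Complex.norm_real, Real.norm_of_nonneg (by positivity)]
  refine mul_le_mul_of_nonneg_right (Real.exp_le_exp.2 ?_) (by positivity)
  simp only [Complex.sub_re, Complex.neg_re, Complex.re_mul_ofReal, Complex.div_ofReal_re]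
  have : y / 4 / σ ≤ (z / a).re / σ := by gcongr
  nlinarith

lemma bet_le_half (d : ℕ) [NeZero d] : bet d ≤ 1 / 2 := by
  rcases bet_cases d with ⟨-, h⟩ | ⟨-, -, h⟩ | ⟨-, -, -, h⟩ <;> rw [h] <;> norm_num

lemma hasDerivAt_besselU_bdryArg (α : ℝ) {m r ε w : ℝ} (hr : r = 1 ∨ r = -1) (hε : 0 < ε) :
    HasDerivAt (fun w => besselU α (bdryArg m r ε w))
      (-((m ^ 2 / 4 : ℝ) : ℂ) * besselU ((α + 1 : ℝ) : ℂ) (bdryArg m r ε w)) w := by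
  have h1 : HasDerivAt (fun w : ℝ => bdryArg m r ε w) ((m ^ 2 / 4 : ℝ) : ℂ) w := by
    have e : (fun w : ℝ => bdryArg m r ε w) = fun w : ℝ => ((m ^ 2 / 4 * w : ℝ) : ℂ) + ((r * ε : ℝ) : ℂ) * Complex.I / 4 := by
      funext w; rw [bdryArg]; push_cast; ring
    rw [e]
    refine HasDerivAt.add_const _ ?_
    exact (((hasDerivAt_id w).const_mul (m ^ 2 / 4)).congr_deriv (by simp)).ofReal_comp
  refine (HasDerivAt.comp (h₂ := besselU α) w (hasDerivAt_besselU α (bdryArg_mem hr hε)) h1).congr_deriv ?_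
  ring

/-- The boundary value of `U_{d/2-1}(m²x²/4 ± i0)`. -/
def Wdist (d : ℕ) [NeZero d] (m r : ℝ) : 𝓢'(Mink d, ℂ) :=
  IDist d ((d - 2) / 2) (fun _ => 1) fun w => ((-((m ^ 2 / 4 : ℝ) : ℂ))⁻¹ ^ ((d - 2) / 2)) * Ubdry d m r w

/-- With c = -m²/4 the functions c^(j-k) U_{-β+j} form a chain of derivatives in w from c^(-k)
U_{-β} to U_{-β+k} = U_{d/2-1}. The first member has uniformly majorized boundary values, and the
chain carries its limit to the k-th derivative. -/
theorem isUBoundaryValue_Wdist {m : ℝ} (hm : 0 < m) {r : ℝ} (hr : r = 1 ∨ r = -1) :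
    IsUBoundaryValue m r (Wdist d m r) := by
  set k := (d - 2) / 2 with hk
  set c : ℂ := -((m ^ 2 / 4 : ℝ) : ℂ) with hc
  have hc0 : c ≠ 0 := neg_ne_zero.2 (by exact_mod_cast (by positivity : (0 : ℝ) < m ^ 2 / 4).ne')
  obtain ⟨C, hC⟩ := exists_admBound_besselU (d := d) hm
  have key := isDistLimit_IDist (d := d) (n := k) le_rfl
    (g := fun ε j w => c⁻¹ ^ k * (c ^ j * besselU ((-bet d + j : ℝ) : ℂ) (bdryArg m r ε w)))
    (h := fun w => c⁻¹ ^ k * Ubdry d m r w) (C := ‖c⁻¹ ^ k‖ * C) (M := 1) ?_ ?_ ?_ ?_ ?_ ?_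
  · have e : (fun (ε : ℝ) (x : Mink d) => c⁻¹ ^ k * (c ^ k * besselU ((-bet d + k : ℝ) : ℂ) (bdryArg m r ε (sq x)))) =
        fun ε x => besselU ((d : ℂ) / 2 - 1) (((m ^ 2 * sq x : ℝ) + (r * ε : ℝ) * Complex.I) / 4) := by
      funext ε x
      rw [← mul_assoc, ← mul_pow, inv_mul_cancel₀ hc0, one_pow, one_mul, bdryArg]
      congr 1
      rw [bet]; push_cast; ring
    rw [e] at key
    exact key
  · intro ε hε j hj
    refine Adm.const_mul (Adm.const_mul ⟨(continuous_besselU_bdryArg _ hr hε).measurable, ?_⟩ _) _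
    rcases Nat.eq_zero_or_pos j with rfl | hj0
    · refine ⟨C, 1, ?_⟩
      simpa using hC r ε hr hε
    · have hα : 0 < -bet d + j := by
        have := bet_le_half d
        have : (1 : ℝ) ≤ j := by exact_mod_cast hj0
        linarith
      -- The constant D depends on ε, which suffices: it serves only to make the intermediate
      -- integrals converge.
      obtain ⟨D, hD, hD'⟩ := exists_norm_besselU_le hα (show 0 < ε / 4 by positivity)
      refine ⟨D, 1, admBound_of_le (M := 0) hD fun w _ => ?_⟩
      rw [pow_zero, mul_one]
      refine hD' r hr _ ?_
      rw [bdryArg_im]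
      rcases hr with rfl | rfl <;> ring
  · intro ε hε j hj
    exact continuous_const.mul (continuous_const.mul (continuous_besselU_bdryArg _ hr hε))
  · intro ε hε j hj w _
    refine (((hasDerivAt_besselU_bdryArg (-bet d + j) hr hε).const_mul (c ^ j)).const_mul (c⁻¹ ^ k)).congr_deriv ?_
    rw [← hc, pow_succ]
    push_cast
    rw [← add_assoc]
    ring
  · intro ε hε _
    have := (hC r ε hr hε).const_mul (c⁻¹ ^ k)
    simpa using this
  · exact (adm_Ubdry hm hr).const_mul _
  · intro w hw
    have := (tendsto_Ubdry (d := d) hm hr hw).const_mul (c⁻¹ ^ k)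
    simpa using this

end

section
/-! ### Entire series -/

/-- By the functional equation the values |1/Γ(z+j)| no longer increase once |z + j| ≥ 1, and
finitely many j remain. At poles of Γ both the true reciprocal and the value by convention are 0. -/
lemma exists_norm_inv_Gamma_le (z : ℂ) : ∃ C, ∀ j : ℕ, ‖(Complex.Gamma (z + j))⁻¹‖ ≤ C := by
  obtain ⟨N, hN⟩ := exists_nat_gt (‖z‖ + 1)
  obtain ⟨C, hC⟩ := ((Finset.range (N + 1)).image fun j : ℕ => ‖(Complex.Gamma (z + j))⁻¹‖).bddAbove
  have hle : ∀ j ≤ N, ‖(Complex.Gamma (z + j))⁻¹‖ ≤ C := fun j hj =>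
    hC (Finset.mem_coe.2 (Finset.mem_image_of_mem _ (Finset.mem_range.2 (by omega))))
  refine ⟨C, fun j => ?_⟩
  rcases le_total j N with hj | hj
  · exact hle j hj
  · induction j, hj using Nat.le_induction with
    | base => exact hle N le_rfl
    | succ j hj ih =>
      have h1 : 1 ≤ ‖z + j‖ := by
        have h2 : (N : ℝ) ≤ j := by exact_mod_cast hj
        have h3 := norm_sub_norm_le (j : ℂ) (-z)
        rw [norm_neg, Complex.norm_natCast, sub_neg_eq_add, add_comm] at h3
        linarith
      have h0 : z + j ≠ 0 := fun h => by rw [h, norm_zero] at h1; linarith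
      rw [show z + ((j + 1 : ℕ) : ℂ) = z + j + 1 by push_cast; ring, Complex.Gamma_add_one _ h0, mul_inv, norm_mul,
        norm_inv]
      exact (mul_le_of_le_one_left (norm_nonneg _) (inv_le_one_of_one_le₀ h1)).trans ih

lemma exists_abs_inv_Gamma_le (x : ℝ) : ∃ C, ∀ j : ℕ, |(Real.Gamma (x + j))⁻¹| ≤ C := by
  obtain ⟨C, hC⟩ := exists_norm_inv_Gamma_le x
  refine ⟨C, fun j => (le_of_eq ?_).trans (hC j)⟩
  rw [show (x : ℂ) + j = ((x + j : ℝ) : ℂ) by push_cast; rfl, Complex.Gamma_ofReal, ← Complex.ofReal_inv,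
    Complex.norm_real, Real.norm_eq_abs]

section
variable {𝕜 : Type*} [RCLike 𝕜]

/-- Coefficients of entire series of exponential growth. -/
def FactBound (a : ℕ → 𝕜) : Prop := ∃ C, ∀ i, ‖a i‖ ≤ C / i.factorial

lemma FactBound.summable_norm {a : ℕ → 𝕜} (ha : FactBound a) (u : 𝕜) : Summable fun i => ‖a i * u ^ i‖ := by
  obtain ⟨C, hC⟩ := ha
  refine Summable.of_nonneg_of_le (fun i => norm_nonneg _) (fun i => ?_)
    ((Real.summable_pow_div_factorial ‖u‖).mul_left C)
  rw [norm_mul, norm_pow]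
  calc _ ≤ C / i.factorial * ‖u‖ ^ i := by gcongr; exact hC i
    _ = _ := by ring

lemma FactBound.summable {a : ℕ → 𝕜} (ha : FactBound a) (u : 𝕜) : Summable fun i => a i * u ^ i :=
  (ha.summable_norm u).of_norm

lemma FactBound.shift {a : ℕ → 𝕜} (ha : FactBound a) : FactBound fun i => ((i : 𝕜) + 1) * a (i + 1) := by
  obtain ⟨C, hC⟩ := ha
  refine ⟨C, fun i => ?_⟩
  rw [norm_mul, show ((i : 𝕜) + 1) = ((i + 1 : ℕ) : 𝕜) by push_cast; rfl, RCLike.norm_natCast]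
  calc _ ≤ ((i + 1 : ℕ) : ℝ) * (C / (i + 1).factorial) := by gcongr; exact hC _
    _ = _ := by rw [Nat.factorial_succ]; push_cast; field_simp

lemma FactBound.hasDerivAt {a : ℕ → 𝕜} (ha : FactBound a) (u : 𝕜) :
    HasDerivAt (fun u => ∑' i, a i * u ^ i) (∑' i : ℕ, ((i : 𝕜) + 1) * a (i + 1) * u ^ i) u := by
  obtain ⟨C, hC⟩ := ha.shift
  have hsum : Summable fun i : ℕ => C * ((‖u‖ + 1) ^ i / i.factorial) :=
    (Real.summable_pow_div_factorial (‖u‖ + 1)).mul_left C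
  have hsum' : Summable fun i : ℕ => if i = 0 then 0 else C * ((‖u‖ + 1) ^ (i - 1) / (i - 1).factorial) := by
    rw [← summable_nat_add_iff 1]
    simpa using hsum
  have hball : IsPreconnected (Metric.ball (0 : 𝕜) (‖u‖ + 1)) := by
    have : NormedSpace ℝ 𝕜 := NormedSpace.restrictScalars ℝ 𝕜 𝕜
    exact (convex_ball (0 : 𝕜) _).isPreconnected
  have hu : u ∈ Metric.ball (0 : 𝕜) (‖u‖ + 1) := by simp
  have h := hasDerivAt_tsum_of_isPreconnected (g := fun i u => a i * u ^ i)
    (g' := fun i u => a i * (i * u ^ (i - 1))) hsum' Metric.isOpen_ball hball (fun i y _ =>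
      (hasDerivAt_pow i y).const_mul (a i)) (fun i y hy => ?_) hu (ha.summable u) hu
  · refine h.congr_deriv ?_
    have hs : Summable fun i => a i * ((i : 𝕜) * u ^ (i - 1)) := by
      rw [← summable_nat_add_iff 1]
      refine (ha.shift.summable u).congr fun i => ?_
      rw [Nat.add_sub_cancel]; push_cast; ring
    rw [hs.tsum_eq_zero_add]
    simp only [Nat.cast_zero, zero_mul, mul_zero, zero_add, add_tsub_cancel_right]
    exact tsum_congr fun i => by push_cast; ring
  · rcases i with _ | i
    · simp
    · have hy : ‖y‖ ≤ ‖u‖ + 1 := by simpa using (mem_ball_zero_iff.1 hy).le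
      simp only [Nat.succ_ne_zero, if_false, add_tsub_cancel_right]
      rw [show a (i + 1) * (((i + 1 : ℕ) : 𝕜) * y ^ i) = ((i : 𝕜) + 1) * a (i + 1) * y ^ i by push_cast; ring,
        norm_mul, norm_pow]
      have h0 : 0 ≤ C / i.factorial := (norm_nonneg _).trans (hC i)
      calc _ ≤ C / i.factorial * (‖u‖ + 1) ^ i := mul_le_mul (hC i) (by gcongr) (by positivity) h0
        _ = _ := by ring

lemma FactBound.contDiff {a : ℕ → 𝕜} (ha : FactBound a) (n : ℕ) : ContDiff 𝕜 n fun u => ∑' i, a i * u ^ i := by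
  induction n generalizing a with
  | zero =>
    rw [Nat.cast_zero, contDiff_zero]
    exact continuous_iff_continuousAt.2 fun u => (ha.hasDerivAt u).continuousAt
  | succ n ih =>
    push_cast
    rw [contDiff_succ_iff_deriv]
    refine ⟨fun u => (ha.hasDerivAt u).differentiableAt, by simp, ?_⟩
    rw [show deriv (fun u => ∑' i, a i * u ^ i) = fun u => ∑' i : ℕ, ((i : 𝕜) + 1) * a (i + 1) * u ^ i from
      funext fun u => (ha.hasDerivAt u).deriv]
    exact ih ha.shift

lemma FactBound.contDiff_infty {a : ℕ → 𝕜} (ha : FactBound a) : ContDiff 𝕜 ∞ fun u => ∑' i, a i * u ^ i :=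
  _root_.contDiff_infty.2 ha.contDiff

lemma FactBound.eq_add {a : ℕ → 𝕜} (ha : FactBound a) (u : 𝕜) :
    ∑' i, a i * u ^ i = a 0 + u * ∑' i, a (i + 1) * u ^ i := by
  rw [(ha.summable u).tsum_eq_zero_add, ← tsum_mul_left]
  simp only [pow_zero, mul_one, pow_succ]
  congr 1
  exact tsum_congr fun i => by ring

end

/-- The coefficients of `∑ (-u)^{n+i} / ((n+i)! Γ(β+1+i))`, up to sign, as a series in `u`. -/
def jcoef (β : ℝ) (n i : ℕ) : ℝ := (-1) ^ (n + i) / ((n + i).factorial * Real.Gamma (β + 1 + i))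

lemma factBound_jcoef (β : ℝ) (n : ℕ) : FactBound (jcoef β n) := by
  obtain ⟨C, hC⟩ := exists_abs_inv_Gamma_le (β + 1)
  refine ⟨C, fun i => ?_⟩
  have hC0 : 0 ≤ C := (abs_nonneg _).trans (hC 0)
  rw [jcoef, norm_div, norm_mul, norm_pow, norm_neg, norm_one, one_pow, Real.norm_natCast, ← div_div, one_div,
    div_eq_mul_inv, ← norm_inv, Real.norm_eq_abs, mul_comm, div_eq_mul_inv]
  refine mul_le_mul (hC i) (inv_anti₀ (by positivity) ?_) (by positivity) hC0
  exact_mod_cast Nat.factorial_le (by omega)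

/-- The entire functions `∑ᵢ (-1)^{n+i} u^i / ((n+i)! Γ(β+1+i))`. -/
def jser (β : ℝ) (n : ℕ) (u : ℝ) : ℝ := ∑' i, jcoef β n i * u ^ i

lemma jser_zero (β u : ℝ) : jser β 0 u = besselJs β u := by
  refine tsum_congr fun i => ?_
  rw [jcoef, zero_add, neg_pow u]; ring

lemma continuous_jser (β : ℝ) (n : ℕ) : Continuous (jser β n) :=
  (factBound_jcoef β n).contDiff_infty.continuous

/-- `(u^{n+1} J_{n+1}(u))' = - u^n J_n(u)`. -/
lemma hasDerivAt_pow_mul_jser (β : ℝ) (n : ℕ) (u : ℝ) :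
    HasDerivAt (fun u => u ^ (n + 1) * jser β (n + 1) u) (-(u ^ n * jser β n u)) u := by
  have h := (hasDerivAt_pow (n + 1) u).mul ((factBound_jcoef β (n + 1)).hasDerivAt u)
  refine h.congr_deriv ?_
  have hs := (factBound_jcoef β (n + 1)).summable u
  have hs' := (factBound_jcoef β (n + 1)).shift.summable u
  have e : jser β n u = -(((n + 1 : ℕ) : ℝ) * (∑' i, jcoef β (n + 1) i * u ^ i) +
      u * ∑' i : ℕ, ((i : ℝ) + 1) * jcoef β (n + 1) (i + 1) * u ^ i) := by
    have h2 : u * ∑' i : ℕ, ((i : ℝ) + 1) * jcoef β (n + 1) (i + 1) * u ^ i =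
        ∑' i : ℕ, (i : ℝ) * jcoef β (n + 1) i * u ^ i := by
      have hss : Summable fun i : ℕ => (i : ℝ) * jcoef β (n + 1) i * u ^ i := by
        rw [← summable_nat_add_iff 1]
        refine (hs'.mul_left u).congr fun i => ?_
        push_cast; ring
      rw [hss.tsum_eq_zero_add, ← tsum_mul_left]
      simp only [Nat.cast_zero, zero_mul, zero_add]
      exact tsum_congr fun i => by push_cast; ring
    have hss : Summable fun i : ℕ => (i : ℝ) * jcoef β (n + 1) i * u ^ i := by
      rw [← summable_nat_add_iff 1]
      refine (hs'.mul_left u).congr fun i => ?_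
      push_cast; ring
    rw [h2, ← tsum_mul_left, ← (hs.mul_left _).tsum_add hss, ← tsum_neg, jser]
    refine tsum_congr fun i => ?_
    rw [jcoef, jcoef, show n + 1 + i = (n + i) + 1 by ring, Nat.factorial_succ, pow_succ]
    push_cast
    have : ((n : ℝ) + i + 1) ≠ 0 := by positivity
    field_simp
    ring
  rw [e]
  simp only [add_tsub_cancel_right]
  ring

/-- `(u^β (J_n(u) - J_n(0)))' = u^β J_{n+1}(u)`. -/
lemma hasDerivAt_rpow_mul_jser {β : ℝ} (hβ : -1 < β) (n : ℕ) {u : ℝ} (hu : 0 < u) :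
    HasDerivAt (fun u => u ^ β * (jser β n u - jcoef β n 0)) (u ^ β * jser β (n + 1) u) u := by
  have h := (Real.hasDerivAt_rpow_const (p := β) (Or.inl hu.ne')).mul
    (((factBound_jcoef β n).hasDerivAt u).sub_const (jcoef β n 0))
  refine h.congr_deriv ?_
  have e1 : (∑' i, jcoef β n i * u ^ i) - jcoef β n 0 = u * ∑' i, jcoef β n (i + 1) * u ^ i := by
    rw [(factBound_jcoef β n).eq_add]; ring
  have hs : Summable fun i : ℕ => jcoef β n (i + 1) * u ^ i := by
    have hs0 := (summable_nat_add_iff 1).2 ((factBound_jcoef β n).summable u)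
    refine (hs0.mul_left u⁻¹).congr fun i => ?_
    rw [pow_succ]; field_simp
  rw [e1, Real.rpow_sub_one hu.ne']
  -- Termwise (β + 1 + i)/Γ(β + 2 + i) = 1/Γ(β + 1 + i). Subtracting the constant coefficient
  -- removes the one power u^(β-1) that is not integrable at 0 when β ≤ 0.
  have e2 : β * (∑' i : ℕ, jcoef β n (i + 1) * u ^ i) + ∑' i : ℕ, ((i : ℝ) + 1) * jcoef β n (i + 1) * u ^ i =
      jser β (n + 1) u := by
    rw [← tsum_mul_left, ← (hs.mul_left _).tsum_add ((factBound_jcoef β n).shift.summable u), jser]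
    refine tsum_congr fun i => ?_
    have hne : β + 1 + i ≠ 0 := by have : (0 : ℝ) ≤ i := by positivity
                                   linarith
    rw [jcoef, jcoef, show β + 1 + ((i + 1 : ℕ) : ℝ) = (β + 1 + i) + 1 by push_cast; ring, Real.Gamma_add_one hne,
      show n + (i + 1) = n + 1 + i by ring]
    field_simp
    ring
  rw [← e2]
  field_simp

end

section
/-! ### The expansion of the jump into singular and regular terms -/

lemma FactBound.succ {a : ℕ → ℝ} (ha : FactBound a) : FactBound fun i => a (i + 1) := by
  obtain ⟨C, hC⟩ := ha
  have hC0 : 0 ≤ C := by simpa using (norm_nonneg _).trans (hC 0)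
  refine ⟨C, fun i => (hC (i + 1)).trans ?_⟩
  have : (i.factorial : ℝ) ≤ (i + 1).factorial := by exact_mod_cast Nat.factorial_le (by omega)
  gcongr

/-- `u_+^β J(u)` at `u = -m² w / 4`. -/
def cutPow (d : ℕ) (m : ℝ) (J : ℝ → ℝ) (w : ℝ) : ℂ :=
  ((if w < 0 then (-(m ^ 2 / 4 * w)) ^ bet d * J (-(m ^ 2 / 4 * w)) else 0 : ℝ) : ℂ)

variable {d : ℕ} {m : ℝ}

lemma measurable_cutPow {J : ℝ → ℝ} (hJ : Measurable J) : Measurable (cutPow d m J) := by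
  refine Complex.measurable_ofReal.comp (Measurable.ite measurableSet_Iio ?_ measurable_const)
  fun_prop

lemma cutPow_jser_zero (w : ℝ) : cutPow d m (jser (bet d) 0) w = (Ujump d m w : ℂ) := by
  rw [cutPow, Ujump]
  simp only [jser_zero]

variable [NeZero d]

lemma rpow_bet_le {w : ℝ} (hw : w ≠ 0) : |w| ^ bet d ≤ (1 + |w|) * |w| ^ wexp d := by
  have hw0 : 0 < |w| := abs_pos.2 hw
  rcases bet_cases d with ⟨h1, h⟩ | ⟨-, h1, h⟩ | ⟨-, -, h1, h⟩
  · rw [h, wexp, if_pos h1, Real.rpow_zero, mul_one, ← Real.sqrt_eq_rpow]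
    exact Real.sqrt_le_iff.2 ⟨by positivity, by nlinarith⟩
  · rw [h, Real.rpow_zero]; exact one_le_adm_weight hw
  · rw [h, wexp, if_neg h1]
    exact le_mul_of_one_le_left (by positivity) (by linarith)

lemma adm_cutPow (hm : 0 < m) {J : ℝ → ℝ} (hJ : Measurable J) {C : ℝ} {M : ℕ}
    (hC : ∀ u, 0 < u → |J u| ≤ C * (1 + u) ^ M) : Adm d (cutPow d m J) := by
  have hc : 0 < m ^ 2 / 4 := by positivity
  have hC0 : 0 ≤ C := nonneg_of_mul_nonneg_left ((abs_nonneg _).trans (hC 1 one_pos)) (by positivity)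
  refine ⟨measurable_cutPow hJ, (m ^ 2 / 4) ^ bet d * (C * (1 + m ^ 2 / 4) ^ M), M + 1, fun w hw => ?_⟩
  rw [cutPow, Complex.norm_real]
  split_ifs with h
  · have hu : 0 < -(m ^ 2 / 4 * w) := by nlinarith
    have hu' : -(m ^ 2 / 4 * w) = m ^ 2 / 4 * |w| := by rw [abs_of_neg h]; ring
    rw [norm_mul, Real.norm_of_nonneg (by positivity), Real.norm_eq_abs]
    refine (mul_le_mul_of_nonneg_left (hC _ hu) (by positivity)).trans ?_
    rw [hu', Real.mul_rpow hc.le (abs_nonneg w)]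
    have h2 : (1 + m ^ 2 / 4 * |w|) ^ M ≤ ((1 + m ^ 2 / 4) * (1 + |w|)) ^ M := by
      gcongr; nlinarith [abs_nonneg w]
    rw [mul_pow] at h2
    calc (m ^ 2 / 4) ^ bet d * |w| ^ bet d * (C * (1 + m ^ 2 / 4 * |w|) ^ M)
        ≤ (m ^ 2 / 4) ^ bet d * ((1 + |w|) * |w| ^ wexp d) * (C * ((1 + m ^ 2 / 4) ^ M * (1 + |w|) ^ M)) := by
          gcongr
          exact rpow_bet_le hw
      _ = _ := by rw [pow_succ]; ring
  · rw [norm_zero]; positivity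

/-- The alternating series gives no growth bound directly. But u^β times it is the jump of U_{-β},
whose boundary values are already known to be polynomially bounded; near u = 0 continuity is enough.
-/
lemma exists_jser_zero_le (hm : 0 < m) : ∃ C M, ∀ u, 0 ≤ u → |jser (bet d) 0 u| ≤ C * (1 + u) ^ M := by
  have hc : 0 < m ^ 2 / 4 := by positivity
  have hadm : Adm d fun w => (2 * Complex.I * (√Real.pi : ℂ))⁻¹ * (Ubdry d m (-1) w + (-1) * Ubdry d m 1 w) :=
    ((adm_Ubdry hm (Or.inr rfl)).add ((adm_Ubdry hm (Or.inl rfl)).const_mul _)).const_mul _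
  obtain ⟨-, C, M, hC⟩ := hadm
  have hC0 := hC.nonneg
  have h1 : ∀ w : ℝ, w < 0 → |Ujump d m w| ≤ C * ((1 + |w|) ^ M * |w| ^ wexp d) := fun w hw => by
    have h2 := hC w hw.ne
    simp only [neg_one_mul, ← sub_eq_add_neg, Ubdry_sub hm hw.ne] at h2
    have hpi := sqrt_pi_ne_zero
    rw [show (2 * Complex.I * (√Real.pi : ℂ))⁻¹ * (2 * Complex.I * ((√Real.pi * Ujump d m w : ℝ) : ℂ)) =
      (Ujump d m w : ℂ) by push_cast; field_simp, Complex.norm_real, Real.norm_eq_abs] at h2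
    exact h2
  obtain ⟨D, hD⟩ := (isCompact_Icc (a := (0 : ℝ)) (b := 1)).exists_bound_of_continuousOn
    (continuous_jser (bet d) 0).continuousOn
  set c := m ^ 2 / 4 with hcdef
  have hD0 : 0 ≤ D := (norm_nonneg _).trans (hD 0 (by simp))
  refine ⟨D + C * (1 + c⁻¹) ^ M * (1 + c), M + 1, fun u hu => ?_⟩
  have hone : (1 : ℝ) ≤ (1 + u) ^ (M + 1) := one_le_pow₀ (by linarith)
  have hnn : 0 ≤ C * (1 + c⁻¹) ^ M * (1 + c) := by positivity
  rcases le_or_gt u 1 with h | h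
  · have := hD u ⟨hu, h⟩
    rw [Real.norm_eq_abs] at this
    nlinarith
  · have hu0 : 0 < u := by linarith
    set w := -(u / c) with hw
    have hwneg : w < 0 := neg_neg_of_pos (by positivity)
    have hwabs : |w| = u / c := by rw [abs_of_neg hwneg, hw, neg_neg]
    have huw : -(c * w) = u := by rw [hw]; field_simp
    have h3 := h1 w hwneg
    rw [Ujump, if_pos hwneg, ← hcdef, huw, abs_mul, abs_of_pos (Real.rpow_pos_of_pos hu0 _), hwabs, ← jser_zero] at h3
    have h4 : |jser (bet d) 0 u| ≤ u ^ (-bet d) * (C * ((1 + u / c) ^ M * (u / c) ^ wexp d)) := by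
      rw [Real.rpow_neg hu, ← div_eq_inv_mul, le_div_iff₀ (Real.rpow_pos_of_pos hu0 _), mul_comm]
      exact h3
    have h5 : u ^ (-bet d) ≤ 1 + u := by
      have hb : -bet d ≤ 1 := by rcases bet_cases d with ⟨-, h⟩ | ⟨-, -, h⟩ | ⟨-, -, -, h⟩ <;> rw [h] <;> norm_num
      calc u ^ (-bet d) ≤ u ^ (1 : ℝ) := Real.rpow_le_rpow_of_exponent_le h.le hb
        _ ≤ 1 + u := by rw [Real.rpow_one]; linarith
    have h6 : (u / c) ^ wexp d ≤ 1 + c := by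
      rw [wexp]
      split_ifs
      · rw [Real.rpow_zero]; linarith
      · rw [Real.rpow_neg (by positivity), ← Real.inv_rpow (by positivity), inv_div, ← Real.sqrt_eq_rpow]
        refine Real.sqrt_le_iff.2 ⟨by positivity, ?_⟩
        have : c / u ≤ c := div_le_self hc.le h.le
        nlinarith
    have h7 : (1 + u / c) ^ M ≤ (1 + c⁻¹) ^ M * (1 + u) ^ M := by
      rw [← mul_pow]
      refine pow_le_pow_left₀ (by positivity) ?_ M
      have : 0 < c⁻¹ := by positivity
      rw [div_eq_mul_inv]
      nlinarith
    calc |jser (bet d) 0 u| ≤ u ^ (-bet d) * (C * ((1 + u / c) ^ M * (u / c) ^ wexp d)) := h4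
      _ ≤ (1 + u) * (C * (((1 + c⁻¹) ^ M * (1 + u) ^ M) * (1 + c))) := by gcongr
      _ = C * (1 + c⁻¹) ^ M * (1 + c) * (1 + u) ^ (M + 1) := by rw [pow_succ]; ring
      _ ≤ _ := by gcongr; linarith

/-- By (u^(n+1) J_{n+1})' = -u^n J_n and the mean value inequality on [0,u], the bound for J_0
passes to all J_n with the same constants. -/
lemma exists_jser_le (hm : 0 < m) : ∃ C M, ∀ n, ∀ u, 0 < u → |jser (bet d) n u| ≤ C * (1 + u) ^ M := by
  obtain ⟨C, M, hC⟩ := exists_jser_zero_le (d := d) hm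
  have hC0 : 0 ≤ C := nonneg_of_mul_nonneg_left ((abs_nonneg _).trans (hC 1 one_pos.le)) (by positivity)
  have key : ∀ n, ∀ u, 0 ≤ u → |u ^ n * jser (bet d) n u| ≤ C * u ^ n * (1 + u) ^ M := by
    intro n
    induction n with
    | zero => intro u hu; simpa using hC u hu
    | succ n ih =>
      intro u hu
      have h := (convex_Icc (0 : ℝ) u).norm_image_sub_le_of_norm_hasDerivWithin_le
        (C := C * u ^ n * (1 + u) ^ M) (fun x _ => (hasDerivAt_pow_mul_jser (bet d) n x).hasDerivWithinAt)
        (fun x hx => ?_) (Set.left_mem_Icc.2 hu) (Set.right_mem_Icc.2 hu)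
      · simp only [ne_eq, Nat.add_eq_zero_iff, one_ne_zero, and_false, not_false_eq_true, zero_pow, zero_mul,
          sub_zero, Real.norm_eq_abs, abs_of_nonneg hu] at h
        rw [pow_succ u n] at h ⊢
        linarith
      · rw [norm_neg, Real.norm_eq_abs]
        refine (ih x hx.1).trans ?_
        have := hx.1
        have := hx.2
        gcongr
  refine ⟨C, M, fun n u hu => ?_⟩
  have h := key n u hu.le
  rw [abs_mul, abs_of_pos (pow_pos hu n)] at h
  refine le_of_mul_le_mul_left ?_ (pow_pos hu n)
  linarith

lemma adm_cutPow_jser (hm : 0 < m) (n : ℕ) : Adm d (cutPow d m (jser (bet d) n)) := by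
  obtain ⟨C, M, h⟩ := exists_jser_le (d := d) hm
  exact adm_cutPow hm (continuous_jser _ _).measurable (h n)

lemma adm_cutPow_one (hm : 0 < m) : Adm d (cutPow d m fun _ => 1) :=
  adm_cutPow hm measurable_const (C := 1) (M := 0) fun u _ => by simp

lemma neg_one_lt_bet (d : ℕ) [NeZero d] : -1 < bet d := by
  rcases bet_cases d with ⟨-, h⟩ | ⟨-, -, h⟩ | ⟨-, -, -, h⟩ <;> rw [h] <;> norm_num

/-- The recursion that splits off the most singular term. -/
lemma IDist_jser_succ (hm : 0 < m) {N : ℕ} (hN : N + 1 ≤ (d - 2) / 2) {τ : ℝ → ℂ} (hτ : BddMeas τ) (n : ℕ) :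
    IDist d (N + 1) τ (cutPow d m (jser (bet d) n)) =
      (jcoef (bet d) n 0 : ℂ) • IDist d (N + 1) τ (cutPow d m fun _ => 1) +
        (-((m ^ 2 / 4 : ℝ) : ℂ)) • IDist d N τ (cutPow d m (jser (bet d) (n + 1))) := by
  have hN' : N ≤ (d - 2) / 2 := by omega
  set c := m ^ 2 / 4 with hc
  have hc0 : 0 < c := by positivity
  -- Here u = -m²w/4. Without its constant term, J_n leaves u₊^(β+1) times an entire function, which
  -- is continuous across w = 0 since β + 1 > 0. So one integration by parts is allowed, with du/dw
  -- = -m²/4.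
  set g : ℝ → ℂ := fun w => cutPow d m (jser (bet d) n) w + (-(jcoef (bet d) n 0 : ℂ)) * cutPow d m (fun _ => 1) w with hg
  have a1 := adm_cutPow_jser (d := d) hm n
  have a2 := adm_cutPow_jser (d := d) hm (n + 1)
  have a3 := adm_cutPow_one (d := d) hm
  have hgadm : Adm d g := a1.add (a3.const_mul _)
  have hgeq : ∀ w, g w = (((max (-(c * w)) 0) ^ (bet d + 1) *
      ∑' i, jcoef (bet d) n (i + 1) * (-(c * w)) ^ i : ℝ) : ℂ) := fun w => by
    rw [hg]
    simp only [cutPow]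
    split_ifs with h
    · have hu : 0 < -(c * w) := by nlinarith
      rw [max_eq_left hu.le, Real.rpow_add_one hu.ne', ← hc, jser, (factBound_jcoef _ _).eq_add]
      push_cast; ring
    · rw [max_eq_right (by nlinarith), Real.zero_rpow (by linarith [neg_one_lt_bet d])]
      simp
  have hcont : Continuous g := by
    rw [show g = _ from funext hgeq]
    have h1 : Continuous fun u : ℝ => ∑' i, jcoef (bet d) n (i + 1) * u ^ i :=
      (factBound_jcoef _ _).succ.contDiff_infty.continuous
    have h2 : Continuous fun w : ℝ => (max (-(c * w)) 0) ^ (bet d + 1) :=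
      Continuous.rpow_const (by fun_prop) fun w => Or.inr (by linarith [neg_one_lt_bet d])
    have h3 : Continuous fun w : ℝ => ∑' i, jcoef (bet d) n (i + 1) * (-(c * w)) ^ i :=
      h1.comp (by fun_prop : Continuous fun w : ℝ => -(c * w))
    exact Complex.continuous_ofReal.comp (h2.mul h3)
  have hder : ∀ w ≠ 0, HasDerivAt g ((-(c : ℂ)) * cutPow d m (jser (bet d) (n + 1)) w) w := fun w hw => by
    rcases hw.lt_or_gt with hw | hw
    · have hu : 0 < -(c * w) := by nlinarith
      have h1 : HasDerivAt (fun w : ℝ => -(c * w)) (-c) w := by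
        exact ((hasDerivAt_id w).const_mul c).neg.congr_deriv (by simp)
      have h2 := (HasDerivAt.comp w (hasDerivAt_rpow_mul_jser (neg_one_lt_bet d) n hu) h1).ofReal_comp
      refine (h2.congr_deriv ?_).congr_of_eventuallyEq ?_
      · rw [cutPow, if_pos hw]; push_cast; ring
      · filter_upwards [gt_mem_nhds hw] with v hv
        simp only [hg, cutPow, if_pos hv, Function.comp, ← hc]
        push_cast; ring
    · rw [cutPow, if_neg hw.not_gt]
      simp only [Complex.ofReal_zero, mul_zero]
      refine (hasDerivAt_const w (0 : ℂ)).congr_of_eventuallyEq ?_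
      filter_upwards [lt_mem_nhds hw] with v hv
      simp [hg, cutPow, if_neg hv.not_gt]
  have h1 := IDist_succ_eq hN hτ hgadm (a2.const_mul _) hcont hder
  rw [IDist_const_mul hN' hτ a2, hg, IDist_add hN hτ a1 (a3.const_mul _), IDist_const_mul hN hτ a3] at h1
  rw [← h1]
  ext φ
  simp only [add_apply, smul_apply, smul_eq_mul]
  ring

/-- The splitting into singular and regular parts. -/
lemma IDist_jser_eq_sum (hm : 0 < m) {τ : ℝ → ℂ} (hτ : BddMeas τ) : ∀ N n, N ≤ (d - 2) / 2 →
    IDist d N τ (cutPow d m (jser (bet d) n)) =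
      ∑ j ∈ Finset.range N, ((-((m ^ 2 / 4 : ℝ) : ℂ)) ^ j * (jcoef (bet d) (n + j) 0 : ℂ)) •
        IDist d (N - j) τ (cutPow d m fun _ => 1) +
      (-((m ^ 2 / 4 : ℝ) : ℂ)) ^ N • IDist d 0 τ (cutPow d m (jser (bet d) (n + N))) := by
  intro N
  induction N with
  | zero => intro n _; simp
  | succ N ih =>
    intro n hN
    rw [IDist_jser_succ hm hN hτ, ih (n + 1) (by omega), Finset.sum_range_succ', smul_add, Finset.smul_sum,
      smul_smul, ← pow_succ', show n + 1 + N = n + (N + 1) by ring]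
    simp only [pow_zero, one_mul, Nat.sub_zero, add_zero]
    rw [add_comm (Finset.sum _ _) ((jcoef (bet d) n 0 : ℂ) • _), add_assoc]
    congr 2
    refine Finset.sum_congr rfl fun j hj => ?_
    rw [smul_smul, show n + 1 + j = n + (j + 1) by ring, Nat.add_sub_add_right, pow_succ' _ j, mul_assoc]

end

section
/-! ### The distributions `(c x²)_-^a` and `δ^{(j)}(x²)` -/

lemma I_mul_cpow {t : ℝ} (ht : 0 < t) (a : ℝ) :
    (Complex.I * (t : ℂ)) ^ (a : ℂ) = ((t ^ a : ℝ) : ℂ) * Complex.exp (Complex.I * (Real.pi * a / 2 : ℝ)) := by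
  rw [mul_comm Complex.I, ofReal_mul_cpow ht Complex.I_ne_zero, Complex.ofReal_cpow ht.le,
    Complex.cpow_def_of_ne_zero Complex.I_ne_zero, Complex.log_I]
  congr 2; push_cast; ring

lemma neg_I_mul_cpow {t : ℝ} (ht : 0 < t) (a : ℝ) :
    (-(Complex.I * (t : ℂ))) ^ (a : ℂ) = ((t ^ a : ℝ) : ℂ) * Complex.exp (-(Complex.I * (Real.pi * a / 2 : ℝ))) := by
  rw [mul_comm Complex.I, ← mul_neg, ofReal_mul_cpow ht (neg_ne_zero.2 Complex.I_ne_zero), Complex.ofReal_cpow ht.le,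
    Complex.cpow_def_of_ne_zero (neg_ne_zero.2 Complex.I_ne_zero), Complex.log_neg_I]
  congr 2; push_cast; ring

lemma I_mul_add_mem {w ε : ℝ} (h : w ≠ 0 ∨ 0 < ε) :
    Complex.I * (w : ℂ) + (ε : ℂ) ∈ Complex.slitPlane ∧ -(Complex.I * (w : ℂ)) + (ε : ℂ) ∈ Complex.slitPlane := by
  rcases h with h | h
  · exact ⟨Or.inr (by simpa using h), Or.inr (by simpa using h)⟩
  · exact ⟨Or.inl (by simpa using h), Or.inl (by simpa using h)⟩

/-- One has (±iw)^a = |w|^a exp(±iπa sgn(w)/2). For w > 0 the two terms cancel; for w < 0 they add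
up to 2i sin(πa) |w|^a. -/
lemma tendsto_minusPowApprox {a : ℝ} (ha : Real.sin (Real.pi * a) ≠ 0) {w : ℝ} (hw : w ≠ 0) :
    Tendsto (fun ε => minusPowApprox a ε w) (𝓝[>] 0) (𝓝 ((if w < 0 then (-w) ^ a else 0 : ℝ) : ℂ)) := by
  have hmem := I_mul_add_mem (w := w) (ε := 0) (Or.inl hw)
  have h1 : Tendsto (fun ε : ℝ => (Complex.I * (w : ℂ) + (ε : ℂ)) ^ (a : ℂ)) (𝓝[>] 0)
      (𝓝 ((Complex.I * (w : ℂ)) ^ (a : ℂ))) := by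
    have h := ((hasDerivAt_id _).cpow_const (c := (a : ℂ)) hmem.1).continuousAt
    have h2 : Continuous fun ε : ℝ => Complex.I * (w : ℂ) + (ε : ℂ) := by fun_prop
    have := (h.tendsto.comp (h2.tendsto 0)).mono_left (nhdsWithin_le_nhds (s := Set.Ioi 0))
    simpa [Function.comp_def] using this
  have h2 : Tendsto (fun ε : ℝ => (-(Complex.I * (w : ℂ)) + (ε : ℂ)) ^ (a : ℂ)) (𝓝[>] 0)
      (𝓝 ((-(Complex.I * (w : ℂ))) ^ (a : ℂ))) := by
    have h := ((hasDerivAt_id _).cpow_const (c := (a : ℂ)) hmem.2).continuousAt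
    have h2 : Continuous fun ε : ℝ => -(Complex.I * (w : ℂ)) + (ε : ℂ) := by fun_prop
    have := (h.tendsto.comp (h2.tendsto 0)).mono_left (nhdsWithin_le_nhds (s := Set.Ioi 0))
    simpa [Function.comp_def] using this
  have h3 := ((h1.const_mul (-Complex.exp (-(Complex.I * (Real.pi * a / 2 : ℝ))))).add
    (h2.const_mul (Complex.exp (Complex.I * (Real.pi * a / 2 : ℝ))))).const_mul
    (1 / (2 * Complex.I * (Real.sin (Real.pi * a) : ℂ)))
  have hsin : (Real.sin (Real.pi * a) : ℂ) ≠ 0 := by exact_mod_cast ha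
  have e : 1 / (2 * Complex.I * (Real.sin (Real.pi * a) : ℂ)) *
      (-Complex.exp (-(Complex.I * (Real.pi * a / 2 : ℝ))) * (Complex.I * (w : ℂ)) ^ (a : ℂ) +
        Complex.exp (Complex.I * (Real.pi * a / 2 : ℝ)) * (-(Complex.I * (w : ℂ))) ^ (a : ℂ)) =
      ((if w < 0 then (-w) ^ a else 0 : ℝ) : ℂ) := by
    split_ifs with h
    · obtain ⟨t, rfl⟩ : ∃ t, w = -t := ⟨-w, by ring⟩
      have ht : 0 < t := by linarith
      have h1 := neg_I_mul_cpow ht a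
      have h2 := I_mul_cpow ht a
      rw [show Complex.I * ((-t : ℝ) : ℂ) = -(Complex.I * (t : ℂ)) by push_cast; ring, neg_neg, h1, h2, neg_neg]
      have h3 : (Real.sin (Real.pi * a) : ℂ) = (Complex.exp (-(Complex.I * (Real.pi * a / 2 : ℝ))) ^ 2 -
          Complex.exp (Complex.I * (Real.pi * a / 2 : ℝ)) ^ 2) * Complex.I / 2 := by
        rw [Complex.ofReal_sin, Complex.sin, ← Complex.exp_nat_mul, ← Complex.exp_nat_mul]
        congr 4 <;> push_cast <;> ring_nf
      have h4 : 2 * Complex.I * (Real.sin (Real.pi * a) : ℂ) ≠ 0 :=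
        mul_ne_zero (mul_ne_zero two_ne_zero Complex.I_ne_zero) hsin
      rw [one_div, inv_mul_eq_iff_eq_mul₀ h4, h3]
      linear_combination (-((t ^ a : ℝ) : ℂ) * (Complex.exp (-(Complex.I * (Real.pi * a / 2 : ℝ))) ^ 2 -
          Complex.exp (Complex.I * (Real.pi * a / 2 : ℝ)) ^ 2)) * Complex.I_sq
    · have hw' : 0 < w := lt_of_le_of_ne (not_lt.1 h) hw.symm
      rw [I_mul_cpow hw', neg_I_mul_cpow hw', Complex.ofReal_zero]
      ring
  rw [← e]
  exact h3

/-- Lowering a by 1 changes the sign of sin πa and multiplies the two phases by ±i, exactly as the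
chain rule does. -/
lemma hasDerivAt_minusPowApprox (a : ℝ) {ε : ℝ} (hε : 0 < ε) (w : ℝ) :
    HasDerivAt (minusPowApprox a ε) (-(a : ℂ) * minusPowApprox (a - 1) ε w) w := by
  have hmem := I_mul_add_mem (w := w) (Or.inr hε)
  have e1 : HasDerivAt (fun w : ℝ => Complex.I * (w : ℂ) + (ε : ℂ)) Complex.I w := by
    exact ((Complex.ofRealCLM.hasDerivAt (x := w)).const_mul Complex.I |>.add_const (ε : ℂ)).congr_deriv (by simp)
  have e2 : HasDerivAt (fun w : ℝ => -(Complex.I * (w : ℂ)) + (ε : ℂ)) (-Complex.I) w := by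
    exact ((Complex.ofRealCLM.hasDerivAt (x := w)).const_mul Complex.I |>.fun_neg |>.add_const (ε : ℂ)).congr_deriv (by simp)
  have d1 : HasDerivAt (fun w : ℝ => (Complex.I * (w : ℂ) + (ε : ℂ)) ^ (a : ℂ)) _ w :=
    HasDerivAt.comp (h₂ := fun z : ℂ => z ^ (a : ℂ)) w ((hasDerivAt_id' _).cpow_const (c := (a : ℂ)) hmem.1) e1
  have d2 : HasDerivAt (fun w : ℝ => (-(Complex.I * (w : ℂ)) + (ε : ℂ)) ^ (a : ℂ)) _ w :=
    HasDerivAt.comp (h₂ := fun z : ℂ => z ^ (a : ℂ)) w ((hasDerivAt_id' _).cpow_const (c := (a : ℂ)) hmem.2) e2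
  have h := ((d1.const_mul (-Complex.exp (-(Complex.I * (Real.pi * a / 2 : ℝ))))).add
    (d2.const_mul (Complex.exp (Complex.I * (Real.pi * a / 2 : ℝ))))).const_mul
    (1 / (2 * Complex.I * (Real.sin (Real.pi * a) : ℂ)))
  refine h.congr_deriv ?_
  have s1 : Real.sin (Real.pi * (a - 1)) = -Real.sin (Real.pi * a) := by rw [mul_sub, mul_one, Real.sin_sub_pi]
  have s2 : Complex.exp (-(Complex.I * (Real.pi * (a - 1) / 2 : ℝ))) =
      Complex.I * Complex.exp (-(Complex.I * (Real.pi * a / 2 : ℝ))) := by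
    nth_rewrite 2 [← Complex.exp_pi_div_two_mul_I]
    rw [← Complex.exp_add]; congr 1; push_cast; ring
  have s3 : Complex.exp (Complex.I * (Real.pi * (a - 1) / 2 : ℝ)) =
      -Complex.I * Complex.exp (Complex.I * (Real.pi * a / 2 : ℝ)) := by
    rw [show -Complex.I = Complex.exp (-Real.pi / 2 * Complex.I) from Complex.exp_neg_pi_div_two_mul_I.symm,
      ← Complex.exp_add]; congr 1; push_cast; ring
  rw [minusPowApprox, s1, s2, s3]
  push_cast
  rw [show 2 * Complex.I * -Complex.sin (Real.pi * a) = -(2 * Complex.I * Complex.sin (Real.pi * a)) from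
    mul_neg _ _, div_neg]
  ring

lemma norm_minusPowApprox_le (a : ℝ) {ε w B : ℝ} (hB : √(w ^ 2 + ε ^ 2) ^ a ≤ B) :
    ‖minusPowApprox a ε w‖ ≤ |Real.sin (Real.pi * a)|⁻¹ * B := by
  have hn : ‖Complex.I * (w : ℂ) + (ε : ℂ)‖ = √(w ^ 2 + ε ^ 2) ∧ ‖-(Complex.I * (w : ℂ)) + (ε : ℂ)‖ = √(w ^ 2 + ε ^ 2) := by
    constructor <;> rw [Complex.norm_def, Complex.normSq_apply] <;> simp <;> ring_nf
  have he1 : ‖Complex.exp (Complex.I * (Real.pi * a / 2 : ℝ))‖ = 1 := by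
    rw [mul_comm]; exact Complex.norm_exp_ofReal_mul_I _
  have he2 : ‖Complex.exp (-(Complex.I * (Real.pi * a / 2 : ℝ)))‖ = 1 := by
    rw [Complex.exp_neg, norm_inv, he1, inv_one]
  rw [minusPowApprox, norm_mul]
  have h1 : ‖1 / (2 * Complex.I * (Real.sin (Real.pi * a) : ℂ))‖ = |Real.sin (Real.pi * a)|⁻¹ / 2 := by
    rw [norm_div, norm_mul, norm_mul, Complex.norm_real, Complex.norm_I, norm_one, Complex.norm_ofNat, Real.norm_eq_abs]
    field_simp
  rw [h1]
  have h2 : ‖-Complex.exp (-(Complex.I * (Real.pi * a / 2 : ℝ))) * (Complex.I * (w : ℂ) + (ε : ℂ)) ^ (a : ℂ)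
      + Complex.exp (Complex.I * (Real.pi * a / 2 : ℝ)) * (-(Complex.I * (w : ℂ)) + (ε : ℂ)) ^ (a : ℂ)‖ ≤ B + B := by
    refine (norm_add_le _ _).trans (add_le_add ?_ ?_)
    · rw [norm_mul, norm_neg, he2, one_mul, Complex.norm_cpow_real, hn.1]; exact hB
    · rw [norm_mul, he1, one_mul, Complex.norm_cpow_real, hn.2]; exact hB
  calc _ ≤ |Real.sin (Real.pi * a)|⁻¹ / 2 * (B + B) := mul_le_mul_of_nonneg_left h2 (by positivity)
    _ = _ := by ring

variable {d : ℕ} [NeZero d] {m : ℝ}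

lemma bet_of_odd (hd : Odd d) : bet d = 1 / 2 ∨ bet d = -(1 / 2) := by
  rcases bet_cases d with ⟨-, h⟩ | ⟨h1, -, h⟩ | ⟨-, -, -, h⟩
  · exact Or.inl h
  · exact absurd hd (Nat.not_odd_iff_even.2 h1)
  · exact Or.inr h

lemma two_mul_bet_sub (hd : Odd d) (j : ℕ) : ∃ n : ℤ, bet d - j = n + 1 / 2 := by
  rcases bet_of_odd hd with h | h
  · exact ⟨-j, by rw [h]; push_cast; ring⟩
  · exact ⟨-j - 1, by rw [h]; push_cast; ring⟩

lemma bet_sub_ne_intCast (hd : Odd d) (j : ℕ) (n : ℤ) : bet d - j ≠ n := by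
  obtain ⟨l, hl⟩ := two_mul_bet_sub hd j
  intro h
  rw [hl] at h
  have : ((2 * l + 1 : ℤ) : ℝ) = ((2 * n : ℤ) : ℝ) := by push_cast; linarith
  have := Int.cast_injective this
  omega

lemma sin_pi_mul_ne_zero {a : ℝ} (h : ∀ n : ℤ, a ≠ n) : Real.sin (Real.pi * a) ≠ 0 := by
  intro h0
  obtain ⟨n, hn⟩ := Real.sin_eq_zero_iff.1 h0
  refine h n ?_
  have := Real.pi_pos.ne'
  rw [mul_comm] at hn
  exact (mul_left_cancel₀ this hn).symm

lemma Gamma_bet_ne_zero (hd : Odd d) (j : ℕ) : Real.Gamma (bet d + 1 - j) ≠ 0 := by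
  refine Real.Gamma_ne_zero fun n h => bet_sub_ne_intCast hd j (-n - 1) ?_
  push_cast; linarith

/-- `(c x²)_-^{β-N}` as the `N`-th derivative of a locally integrable function. -/
lemma isMinusPow_IDist (hm : 0 < m) (hd : Odd d) {N : ℕ} (hN : N ≤ (d - 2) / 2) {c : ℝ} (hc : 0 < c) :
    IsMinusPow c (bet d - N) ((((-1) ^ N * c ^ (bet d - N) * (m ^ 2 / 4) ^ (-bet d) * Real.Gamma (bet d + 1 - N) /
      Real.Gamma (bet d + 1) : ℝ) : ℂ) • IDist d N (fun _ => 1) (cutPow d m fun _ => 1)) := by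
  -- κ solves κ_{j+1} = -c (β - j) κ_j with κ_N = 1, so the scaled approximants form a chain of
  -- derivatives ending at the power β - N. The quotients of Γ are finite and nonzero because β is
  -- not an integer.
  set κ : ℕ → ℝ := fun j => (-1) ^ N * (c ^ N)⁻¹ * (-c) ^ j * Real.Gamma (bet d + 1 - N) / Real.Gamma (bet d + 1 - j) with hκ
  have hG := Gamma_bet_ne_zero hd
  have hsin : ∀ j : ℕ, Real.sin (Real.pi * (bet d - j)) ≠ 0 := fun j => sin_pi_mul_ne_zero (bet_sub_ne_intCast hd j)
  have hκN : κ N = 1 := by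
    rw [hκ]; simp only
    rw [mul_div_assoc, div_self (hG N), mul_one, mul_assoc, neg_pow c, mul_left_comm _ ((-1) ^ N), ← mul_assoc, ← mul_pow,
      inv_mul_cancel₀ (by positivity)]
    simp
  have hder : ∀ ε, 0 < ε → ∀ j w, HasDerivAt (fun w => (κ j : ℂ) * minusPowApprox (bet d - j) ε (c * w))
      ((κ (j + 1) : ℂ) * minusPowApprox (bet d - (j + 1 : ℕ)) ε (c * w)) w := fun ε hε j w => by
    have h1 : HasDerivAt (fun w : ℝ => c * w) c w := by simpa using (hasDerivAt_id w).const_mul c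
    have h2 := (HasDerivAt.scomp w (hasDerivAt_minusPowApprox (bet d - j) hε (c * w)) h1).const_mul (κ j : ℂ)
    refine h2.congr_deriv ?_
    have h3 : κ (j + 1) = -(κ j * c * (bet d - j)) := by
      rw [hκ]; simp only
      have hne : bet d - j ≠ 0 := by simpa using bet_sub_ne_intCast hd j 0
      have h4 : Real.Gamma (bet d + 1 - j) = (bet d - j) * Real.Gamma (bet d + 1 - (j + 1 : ℕ)) := by
        rw [show bet d + 1 - (j : ℝ) = (bet d - j) + 1 by ring, Real.Gamma_add_one hne]
        congr 2; push_cast; ring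
      have h5 := hG (j + 1)
      rw [h4, pow_succ]
      field_simp
    rw [h3, show bet d - ((j + 1 : ℕ) : ℝ) = bet d - j - 1 by push_cast; ring, Complex.real_smul]
    push_cast; ring
  have hbase : ∀ ε w : ℝ, 0 < ε → w ≠ 0 → √((c * w) ^ 2 + ε ^ 2) ^ bet d ≤
      (1 + ε + c + (√c)⁻¹) * ((1 + |w|) ^ 1 * |w| ^ wexp d) := fun ε w hε hw => by
    have hw0 : 0 < |w| := abs_pos.2 hw
    have hcw : √((c * w) ^ 2 + ε ^ 2) ≤ c * |w| + ε := by
      refine Real.sqrt_le_iff.2 ⟨by positivity, ?_⟩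
      rw [mul_pow, ← sq_abs w]
      have : 0 ≤ c * |w| * ε := by positivity
      nlinarith
    have hcw' : c * |w| ≤ √((c * w) ^ 2 + ε ^ 2) := by
      refine Real.le_sqrt_of_sq_le ?_
      rw [mul_pow, mul_pow, sq_abs]; nlinarith
    rw [pow_one]
    rcases bet_cases d with ⟨h1, h⟩ | ⟨h1, -, h⟩ | ⟨-, -, h1, h⟩
    · rw [h, wexp, if_pos h1, Real.rpow_zero, mul_one, ← Real.sqrt_eq_rpow]
      refine Real.sqrt_le_iff.2 ⟨by positivity, hcw.trans ?_⟩
      have h2 : c * |w| + ε ≤ (1 + ε + c + (√c)⁻¹) * (1 + |w|) := by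
        have : 0 ≤ (√c)⁻¹ := by positivity
        nlinarith [mul_nonneg this hw0.le, mul_pos hε hw0]
      have h3 : 1 ≤ (1 + ε + c + (√c)⁻¹) * (1 + |w|) := by
        have : 0 ≤ (√c)⁻¹ := by positivity
        nlinarith [mul_nonneg this hw0.le, mul_pos hε hw0, mul_pos hc hw0]
      nlinarith
    · exact absurd hd (Nat.not_odd_iff_even.2 h1)
    · rw [h, wexp, if_neg h1]
      have h2 : √((c * w) ^ 2 + ε ^ 2) ^ (-(1 / 2) : ℝ) ≤ (c * |w|) ^ (-(1 / 2) : ℝ) :=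
        Real.rpow_le_rpow_of_nonpos (by positivity) hcw' (by norm_num)
      refine h2.trans ?_
      rw [Real.mul_rpow hc.le hw0.le, Real.rpow_neg hc.le, ← Real.sqrt_eq_rpow]
      have h3 : 0 ≤ |w| ^ (-(1 / 2) : ℝ) := by positivity
      have h4 : (√c)⁻¹ ≤ (1 + ε + c + (√c)⁻¹) * (1 + |w|) := by
        have : 0 ≤ (√c)⁻¹ := by positivity
        nlinarith [mul_nonneg this hw0.le, mul_pos hε hw0, mul_pos hc hw0]
      rw [← mul_assoc]
      exact mul_le_mul_of_nonneg_right h4 h3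
  have hb0 : ∀ ε, 0 < ε → AdmBound d (‖(κ 0 : ℂ)‖ * (|Real.sin (Real.pi * bet d)|⁻¹ * (1 + ε + c + (√c)⁻¹))) 1
      fun w => (κ 0 : ℂ) * minusPowApprox (bet d - (0 : ℕ)) ε (c * w) := fun ε hε => by
    refine AdmBound.const_mul (fun w hw => ?_) _
    rw [Nat.cast_zero, sub_zero, mul_assoc]
    exact norm_minusPowApprox_le _ (hbase ε w hε hw)
  have key := isDistLimit_IDist (d := d) hN (g := fun ε j w => (κ j : ℂ) * minusPowApprox (bet d - j) ε (c * w))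
    (h := fun w => (κ 0 * (c ^ bet d * (m ^ 2 / 4) ^ (-bet d)) : ℝ) * cutPow d m (fun _ => 1) w)
    (C := ‖(κ 0 : ℂ)‖ * (|Real.sin (Real.pi * bet d)|⁻¹ * (1 + 1 + c + (√c)⁻¹))) (M := 1) ?_ ?_ ?_ ?_ ?_ ?_
  · rw [IDist_const_mul hN bddMeas_one (adm_cutPow_one hm)] at key
    have e1 : κ 0 * (c ^ bet d * (m ^ 2 / 4) ^ (-bet d)) = (-1) ^ N * c ^ (bet d - N) * (m ^ 2 / 4) ^ (-bet d) *
        Real.Gamma (bet d + 1 - N) / Real.Gamma (bet d + 1) := by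
      rw [hκ, Real.rpow_sub hc, Real.rpow_natCast]
      simp only [pow_zero, mul_one, Nat.cast_zero, sub_zero]
      ring
    rw [← e1]
    simp only [hκN, Complex.ofReal_one, one_mul] at key
    exact key
  · intro ε hε j hj
    refine ⟨(continuous_iff_continuousAt.2 fun w => (hder ε hε j w).continuousAt).measurable, ?_⟩
    rcases Nat.eq_zero_or_pos j with rfl | hj0
    · exact ⟨_, _, hb0 ε hε⟩
    · refine ⟨_, 0 + 1, (admBound_of_le (C := |Real.sin (Real.pi * (bet d - j))|⁻¹ * ε ^ (bet d - j)) (by positivity)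
        fun w _ => ?_).const_mul _⟩
      rw [pow_zero, mul_one]
      refine norm_minusPowApprox_le _ (Real.rpow_le_rpow_of_nonpos hε (Real.le_sqrt_of_sq_le (by nlinarith [sq_nonneg (c * w)])) ?_)
      have := bet_le_half d
      have : (1 : ℝ) ≤ j := by exact_mod_cast hj0
      linarith
  · intro ε hε j hj
    exact continuous_iff_continuousAt.2 fun w => (hder ε hε j w).continuousAt
  · intro ε hε j hj w _
    exact hder ε hε j w
  · intro ε hε h1 w hw
    refine (hb0 ε hε w hw).trans (mul_le_mul_of_nonneg_right ?_ (by positivity))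
    gcongr
  · exact (adm_cutPow_one hm).const_mul _
  · intro w hw
    have h1 := (tendsto_minusPowApprox (a := bet d) (by simpa using hsin 0) (mul_ne_zero hc.ne' hw)).const_mul (κ 0 : ℂ)
    simp only [Nat.cast_zero, sub_zero]
    have e : (κ 0 : ℂ) * ((if c * w < 0 then (-(c * w)) ^ bet d else 0 : ℝ) : ℂ) =
        (κ 0 * (c ^ bet d * (m ^ 2 / 4) ^ (-bet d)) : ℝ) * cutPow d m (fun _ => 1) w := by
      rw [cutPow, ← Complex.ofReal_mul, ← Complex.ofReal_mul]
      congr 1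
      by_cases h : w < 0
      · have h2 : 0 < -w := by linarith
        have h3 : 0 < m ^ 2 / 4 := by positivity
        have h4 : (m ^ 2 / 4) ^ (-bet d) * (m ^ 2 / 4) ^ bet d = 1 := by rw [← Real.rpow_add h3]; simp
        rw [if_pos h, if_pos (mul_neg_of_pos_of_neg hc h), ← mul_neg, ← mul_neg, Real.mul_rpow hc.le h2.le,
          Real.mul_rpow h3.le h2.le]
        linear_combination (-κ 0 * c ^ bet d * (-w) ^ bet d) * h4
      · rw [if_neg h, if_neg (by nlinarith [not_lt.1 h]), mul_zero, mul_zero]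
    rw [← e]
    exact h1

/-! ### The distributions `δ^{(j)}(x²)` -/

lemma iteratedDeriv_bounded {ρ : ℝ → ℝ} (h : ContDiff ℝ ∞ ρ) (hc : HasCompactSupport ρ) (j : ℕ) :
    Continuous (iteratedDeriv j ρ) ∧ ∃ C, ∀ w, ‖iteratedDeriv j ρ w‖ ≤ C := by
  have h1 : Continuous (iteratedDeriv j ρ) := h.continuous_iteratedDeriv j (by exact_mod_cast le_top)
  refine ⟨h1, ?_⟩
  have h2 : HasCompactSupport (iteratedDeriv j ρ) := by
    induction j with
    | zero => simpa using hc
    | succ j ih =>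
      rw [iteratedDeriv_succ]
      exact (ih (h.continuous_iteratedDeriv j (by exact_mod_cast le_top))).deriv
  exact h2.exists_bound_of_continuous h1

/-- δ^(j) is the (j+1)-st derivative of minus the indicator of w < 0. This primitive, rather than
the Heaviside function, vanishes outside the light cone and so matches the Green functions. -/
lemma isDeltaSq_IDist {j : ℕ} (hj : j + 1 ≤ (d - 2) / 2) :
    IsDeltaSq j (IDist d (j + 1) (fun _ => 1) fun w => if w < 0 then -1 else 0) := by
  intro ρ hρ hc hint
  obtain ⟨R, hR⟩ := hc.isCompact.isBounded.subset_closedBall 0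
  have hsupp : ∀ w, |R| < |w| → ρ w = 0 := fun w hw => by
    by_contra h
    have := hR (subset_tsupport _ h)
    rw [mem_closedBall_zero_iff, Real.norm_eq_abs] at this
    linarith [le_abs_self R]
  -- The primitive of ρ that is -1 to the left of the support of ρ and 0 to the right. Thus A(w/ε)
  -- is bounded in ε and tends to the indicator above for w ≠ 0.
  set A : ℝ → ℝ := fun t => (∫ w in (-|R|)..t, ρ w) - 1 with hA
  have hAder : ∀ t, HasDerivAt A (ρ t) t := fun t =>
    (intervalIntegral.integral_hasDerivAt_right (hρ.continuous.intervalIntegrable _ _)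
      (hρ.continuous.stronglyMeasurableAtFilter _ _) hρ.continuous.continuousAt).sub_const 1
  have hAneg : ∀ t, t < -|R| → A t = -1 := fun t ht => by
    have : ∫ w in (-|R|)..t, ρ w = 0 := by
      rw [intervalIntegral.integral_symm, neg_eq_zero, intervalIntegral.integral_of_le ht.le,
        integral_Ioc_eq_integral_Ioo]
      refine setIntegral_eq_zero_of_forall_eq_zero fun w hw => hsupp w ?_
      have := abs_nonneg R
      rw [abs_of_neg (show w < 0 by linarith [hw.2])]; linarith [hw.2]
    rw [hA]; simp only; rw [this]; ring
  have hApos : ∀ t, |R| < t → A t = 0 := fun t ht => by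
    have h1 : ∫ w in (-|R|)..t, ρ w = ∫ w, ρ w := by
      rw [intervalIntegral.integral_of_le (by linarith [abs_nonneg R])]
      refine setIntegral_eq_integral_of_ae_compl_eq_zero ?_
      have hne : ∀ᵐ w : ℝ, w ≠ -|R| := by simp [ae_iff, measure_singleton]
      filter_upwards [hne] with w hw hw'
      rw [Set.mem_Ioc, not_and_or, not_lt, not_le] at hw'
      refine hsupp w ?_
      rcases hw' with h | h
      · have : w < -|R| := lt_of_le_of_ne h hw
        rw [abs_of_neg (show w < 0 by linarith [abs_nonneg R])]; linarith
      · exact (ht.trans h).trans_le (le_abs_self w)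
    rw [hA]; simp only; rw [h1, hint]; ring
  have hAcont : Continuous A := continuous_iff_continuousAt.2 fun t => (hAder t).continuousAt
  obtain ⟨B, hB⟩ : ∃ B, ∀ t, ‖A t‖ ≤ B := by
    obtain ⟨B, hB⟩ := (isCompact_Icc (a := -|R|) (b := |R|)).exists_bound_of_continuousOn hAcont.continuousOn
    refine ⟨max B 1, fun t => ?_⟩
    rcases lt_or_ge t (-|R|) with h | h
    · rw [hAneg t h]; simp
    rcases lt_or_ge |R| t with h' | h'
    · rw [hApos t h']; simp
    · exact (hB t ⟨h, h'⟩).trans (le_max_left _ _)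
  have hB0 : 0 ≤ B := (norm_nonneg _).trans (hB 0)
  have hscale : ∀ ε : ℝ, 0 < ε → ContDiff ℝ ∞ (fun w : ℝ => ε⁻¹ * ρ (w / ε)) ∧
      HasCompactSupport (fun w : ℝ => ε⁻¹ * ρ (w / ε)) := fun ε hε => by
    refine ⟨by fun_prop, HasCompactSupport.mul_left ?_⟩
    exact hc.comp_homeomorph (Homeomorph.mulRight₀ ε⁻¹ (inv_ne_zero hε.ne'))
  -- The chain of derivatives starts with A(w/ε) at index 0; index i + 1 is the i-th derivative of
  -- ρ_ε.
  refine isDistLimit_IDist hj (g := fun ε i w => ((Nat.casesOn i (A (w / ε))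
    (fun i => iteratedDeriv i (fun w : ℝ => ε⁻¹ * ρ (w / ε)) w) : ℝ) : ℂ)) (C := B) (M := 0 + 1) ?_ ?_ ?_ ?_ ?_ ?_
  · intro ε hε i _
    rcases i with _ | i
    · exact ⟨Complex.measurable_ofReal.comp (hAcont.comp (continuous_id.div_const ε)).measurable, B, 0 + 1,
        admBound_of_le hB0 fun w _ => by simpa using hB _⟩
    · obtain ⟨h1, C, hC⟩ := iteratedDeriv_bounded (hscale ε hε).1 (hscale ε hε).2 i
      exact ⟨Complex.measurable_ofReal.comp h1.measurable, C, 0 + 1,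
        admBound_of_le ((norm_nonneg _).trans (hC 0)) fun w _ => by simpa using hC w⟩
  · intro ε hε i _
    rcases i with _ | i
    · exact Complex.continuous_ofReal.comp (hAcont.comp (continuous_id.div_const ε))
    · exact Complex.continuous_ofReal.comp (iteratedDeriv_bounded (hscale ε hε).1 (hscale ε hε).2 i).1
  · intro ε hε i _ w _
    rcases i with _ | i
    · have h1 : HasDerivAt (fun w : ℝ => w / ε) ε⁻¹ w := by
        simpa [one_div] using (hasDerivAt_id w).div_const ε
      have h2 := (HasDerivAt.comp w (hAder (w / ε)) h1).ofReal_comp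
      refine h2.congr_deriv ?_
      simp only [iteratedDeriv_zero]
      push_cast; ring
    · have h1 := (hscale ε hε).1.differentiable_iteratedDeriv i (by exact_mod_cast WithTop.coe_lt_top _)
      have h2 := (h1 w).hasDerivAt.ofReal_comp
      refine h2.congr_deriv ?_
      simp only [iteratedDeriv_succ]
  · intro ε hε _
    exact admBound_of_le hB0 fun w _ => by simpa using hB _
  · refine ⟨Measurable.ite measurableSet_Iio measurable_const measurable_const, 1, 0 + 1,
      admBound_of_le zero_le_one fun w _ => ?_⟩
    split_ifs <;> simp
  · intro w hw
    simp only
    have hR1 : 0 < |R| + 1 := by positivity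
    rcases hw.lt_or_gt with h | h
    · rw [if_pos h]
      refine tendsto_const_nhds.congr' ?_
      have : ∀ᶠ ε : ℝ in 𝓝[>] 0, ε < -w / (|R| + 1) :=
        nhdsWithin_le_nhds (gt_mem_nhds (div_pos (by linarith) hR1))
      filter_upwards [this, self_mem_nhdsWithin] with ε h1 h2
      have h2 : 0 < ε := h2
      rw [lt_div_iff₀ hR1] at h1
      rw [hAneg _ (by rw [div_lt_iff₀ h2]; nlinarith)]
      simp
    · rw [if_neg h.not_gt]
      refine tendsto_const_nhds.congr' ?_
      have : ∀ᶠ ε : ℝ in 𝓝[>] 0, ε < w / (|R| + 1) :=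
        nhdsWithin_le_nhds (gt_mem_nhds (div_pos h hR1))
      filter_upwards [this, self_mem_nhdsWithin] with ε h1 h2
      have h2 : 0 < ε := h2
      rw [lt_div_iff₀ hR1] at h1
      rw [hApos _ (by rw [lt_div_iff₀ h2]; nlinarith)]
      simp

end

section
variable {d : ℕ} [NeZero d] {m : ℝ}

/-! ### The position space formulas -/

/-- The constant `(-1)^k c^{-β} / (2 π^{d/2-1})`. -/
def Gconst (d : ℕ) (m : ℝ) : ℝ :=
  (-1) ^ ((d - 2) / 2) * (m ^ 2 / 4) ^ (-bet d) / (2 * Real.pi ^ ((d : ℝ) / 2 - 1))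

/-- The retarded (`s = 1`) or advanced (`s = -1`) Green function. -/
def Gdist (d : ℕ) [NeZero d] (m s : ℝ) : 𝓢'(Mink d, ℂ) :=
  (Gconst d m : ℂ) • IDist d ((d - 2) / 2) (fun t => theta (s * t)) (cutPow d m (jser (bet d) 0))

/-- The difference of the retarded and the advanced Green functions, up to the sign of `x⁰`. -/
def Tdist (d : ℕ) [NeZero d] (m : ℝ) : 𝓢'(Mink d, ℂ) :=
  (Gconst d m : ℂ) • IDist d ((d - 2) / 2) (fun _ => 1) (cutPow d m (jser (bet d) 0))

lemma IsThetaMul.const_smul {s : ℝ} {T S : 𝓢'(Mink d, ℂ)} (h : IsThetaMul s T S) (a : ℂ) :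
    IsThetaMul s (a • T) (a • S) := by
  intro χ hχ h0 h1 φ
  have := (h χ hχ h0 h1 φ).const_mul a
  simpa [TemperedDistribution.smulLeftCLM_apply_apply] using this

lemma IsThetaMul.sum {s : ℝ} {ι : Type*} {I : Finset ι} {T S : ι → 𝓢'(Mink d, ℂ)}
    (h : ∀ i ∈ I, IsThetaMul s (T i) (S i)) : IsThetaMul s (∑ i ∈ I, T i) (∑ i ∈ I, S i) := by
  intro χ hχ h0 h1 φ
  have := tendsto_finsetSum I fun i hi => h i hi χ hχ h0 h1 φ
  simpa [TemperedDistribution.smulLeftCLM_apply_apply, sum_apply] using this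

lemma isThetaMul_Tdist (hm : 0 < m) {s : ℝ} (hs : s ≠ 0) : IsThetaMul s (Tdist d m) (Gdist d m s) :=
  (isThetaMul_IDist le_rfl hs (adm_cutPow_jser hm 0)).const_smul _

lemma half_sub_one_eq (d : ℕ) : (d : ℝ) / 2 - 1 = ((d - 2) / 2 : ℕ) - bet d := by rw [bet]; ring

lemma two_pi_div_eq (d : ℕ) {m : ℝ} (hm : 0 < m) : 2 * Real.pi * m ^ ((d : ℝ) - 2) / (4 * Real.pi) ^ ((d : ℝ) / 2) =
    (m ^ 2 / 4) ^ (((d - 2) / 2 : ℕ) - bet d) / (2 * Real.pi ^ ((d : ℝ) / 2 - 1)) := by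
  have hpi := Real.pi_pos
  rw [← half_sub_one_eq, Real.div_rpow (by positivity) (by norm_num), ← Real.rpow_natCast m 2, ← Real.rpow_mul hm.le,
    Real.mul_rpow (by norm_num) hpi.le, show ((2 : ℕ) : ℝ) * ((d : ℝ) / 2 - 1) = d - 2 by push_cast; ring]
  have h1 : (4 : ℝ) ^ ((d : ℝ) / 2) = 4 ^ ((d : ℝ) / 2 - 1) * 4 := by
    rw [← Real.rpow_add_one (by norm_num)]; ring_nf
  have h2 : Real.pi ^ ((d : ℝ) / 2) = Real.pi ^ ((d : ℝ) / 2 - 1) * Real.pi := by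
    rw [← Real.rpow_add_one hpi.ne']; ring_nf
  rw [h1, h2]
  field_simp
  norm_num

lemma Gconst_eq {d : ℕ} (hm : 0 < m) : Gconst d m = 2 * Real.pi * m ^ ((d : ℝ) - 2) / (4 * Real.pi) ^ ((d : ℝ) / 2) *
    (-(m ^ 2 / 4))⁻¹ ^ ((d - 2) / 2) := by
  have hc : 0 < m ^ 2 / 4 := by positivity
  rw [two_pi_div_eq d hm, Gconst, show (((d - 2) / 2 : ℕ) : ℝ) - bet d = (((d - 2) / 2 : ℕ) : ℝ) + -bet d from sub_eq_add_neg _ _, Real.rpow_add hc, Real.rpow_natCast, ← neg_inv, neg_pow (m ^ 2 / 4)⁻¹,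
    inv_pow]
  field_simp

/-- The two boundary values coincide for x² > 0, so their difference is the k-th derivative of the
jump alone and lives in the cone. -/
lemma Wdist_sub (hm : 0 < m) : Wdist d m (-1) - Wdist d m 1 =
    (2 * Complex.I * (√Real.pi : ℂ) * ((-((m ^ 2 / 4 : ℝ) : ℂ))⁻¹ ^ ((d - 2) / 2))) •
      IDist d ((d - 2) / 2) (fun _ => 1) (cutPow d m (jser (bet d) 0)) := by
  have a1 := adm_Ubdry (d := d) hm (Or.inr rfl : (-1 : ℝ) = 1 ∨ (-1 : ℝ) = -1)
  have a2 := adm_Ubdry (d := d) hm (Or.inl rfl : (1 : ℝ) = 1 ∨ (1 : ℝ) = -1)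
  have a3 := adm_cutPow_jser (d := d) hm 0
  have h := IDist_congr (d := d) (n := (d - 2) / 2) le_rfl bddMeas_one (a1.add (a2.const_mul (-1)))
    (a3.const_mul (2 * Complex.I * (√Real.pi : ℂ))) (fun w hw => by
      rw [neg_one_mul, ← sub_eq_add_neg, Ubdry_sub hm hw, cutPow_jser_zero]; push_cast; ring)
  rw [IDist_add le_rfl bddMeas_one a1 (a2.const_mul _), IDist_const_mul le_rfl bddMeas_one a2,
    IDist_const_mul le_rfl bddMeas_one a3] at h
  rw [Wdist, Wdist, IDist_const_mul le_rfl bddMeas_one a1, IDist_const_mul le_rfl bddMeas_one a2]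
  ext φ
  have h2 := DFunLike.congr_fun h φ
  simp only [add_apply, smul_apply, smul_eq_mul, sub_apply] at h2 ⊢
  linear_combination ((-((m ^ 2 / 4 : ℝ) : ℂ))⁻¹ ^ ((d - 2) / 2)) * h2

/-- Comparison of constants: -i √π times the 2i √π of the jump is 2π. -/
lemma smul_Wdist_sub (hm : 0 < m) : (-Complex.I * ((Real.sqrt Real.pi * m ^ ((d : ℝ) - 2) /
      (4 * Real.pi) ^ ((d : ℝ) / 2) : ℝ) : ℂ)) • (Wdist d m (-1) - Wdist d m 1) = Tdist d m := by
  rw [Wdist_sub hm, Tdist, Gconst_eq hm, smul_smul]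
  congr 1
  have h3 : (Real.pi : ℂ) = Real.sqrt Real.pi * Real.sqrt Real.pi := by
    exact_mod_cast (Real.mul_self_sqrt Real.pi_pos.le).symm
  generalize (m ^ ((d : ℝ) - 2)) = A
  generalize ((4 * Real.pi) ^ ((d : ℝ) / 2)) = B
  push_cast
  rw [h3]
  linear_combination (-2 * (Real.sqrt Real.pi : ℂ) * Real.sqrt Real.pi * A / B *
    (-((m : ℂ) ^ 2 / 4))⁻¹ ^ ((d - 2) / 2)) * Complex.I_sq

/-! ### Multiplication by `x²` -/

lemma hasTemperateGrowth_rsq : (fun x : Mink d => ((rsq x : ℝ) : ℂ)).HasTemperateGrowth := by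
  have : (fun x : Mink d => ((rsq x : ℝ) : ℂ)) = fun x => ∑ i ∈ spatial d, (x i : ℂ) * (x i : ℂ) := by
    funext x; rw [rsq]; push_cast; exact Finset.sum_congr rfl fun i _ => by ring
  rw [this]
  exact Function.HasTemperateGrowth.sum fun i _ => (hasTemperateGrowth_coord i).mul (hasTemperateGrowth_coord i)

lemma hasTemperateGrowth_sq : (fun x : Mink d => ((sq x : ℝ) : ℂ)).HasTemperateGrowth := by
  have : (fun x : Mink d => ((sq x : ℝ) : ℂ)) = fun x => ((rsq x : ℝ) : ℂ) - (x 0 : ℂ) * (x 0 : ℂ) := by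
    funext x; rw [sq_eq]; push_cast; ring
  rw [this]
  exact hasTemperateGrowth_rsq.sub ((hasTemperateGrowth_coord 0).mul (hasTemperateGrowth_coord 0))

/-- Multiplication by `x²`. -/
def mulSq (d : ℕ) [NeZero d] : 𝓢(Mink d, ℂ) →L[ℂ] 𝓢(Mink d, ℂ) :=
  SchwartzMap.smulLeftCLM ℂ fun x : Mink d => ((sq x : ℝ) : ℂ)

/-- Multiplication by `|𝐱|²`. -/
def mulRsq (d : ℕ) [NeZero d] : 𝓢(Mink d, ℂ) →L[ℂ] 𝓢(Mink d, ℂ) :=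
  SchwartzMap.smulLeftCLM ℂ fun x : Mink d => ((rsq x : ℝ) : ℂ)

lemma mulSq_apply (φ : 𝓢(Mink d, ℂ)) (x : Mink d) : mulSq d φ x = sq x * φ x :=
  SchwartzMap.smulLeftCLM_apply_apply hasTemperateGrowth_sq _ _

lemma mulRsq_apply (φ : 𝓢(Mink d, ℂ)) (x : Mink d) : mulRsq d φ x = rsq x * φ x :=
  SchwartzMap.smulLeftCLM_apply_apply hasTemperateGrowth_rsq _ _

lemma eulerOp_mulRsq (φ : 𝓢(Mink d, ℂ)) :
    eulerOp (spatial d) (mulRsq d φ) = mulRsq d (eulerOp (spatial d) φ) + (2 : ℂ) • mulRsq d φ := by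
  ext x
  have h1 := hasDerivAt_schwartz_dil (spatial d) (mulRsq d φ) x one_ne_zero
  have h2 := hasDerivAt_schwartz_dil (spatial d) φ x one_ne_zero
  have h3 : HasDerivAt (fun l : ℝ => ((l ^ 2 * rsq x : ℝ) : ℂ)) ((2 * rsq x : ℝ) : ℂ) 1 :=
    (((hasDerivAt_pow 2 (1 : ℝ)).mul_const (rsq x)).congr_deriv (by norm_num)).ofReal_comp
  have e : (fun l => mulRsq d φ (dil (spatial d) l x)) =
      fun l => ((l ^ 2 * rsq x : ℝ) : ℂ) * φ (dil (spatial d) l x) := by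
    funext l; rw [mulRsq_apply, rsq_dil]
  rw [e] at h1
  have h4 := h1.unique (h3.mul h2)
  simp only [dil_one, Complex.ofReal_one, inv_one, one_mul, one_pow] at h4
  rw [h4, add_apply, smul_apply, mulRsq_apply, mulRsq_apply, smul_eq_mul]
  push_cast; ring

lemma eulerOp_mulSq (φ : 𝓢(Mink d, ℂ)) :
    eulerOp (spatial d) (mulSq d φ) = mulSq d (eulerOp (spatial d) φ) + (2 : ℂ) • mulRsq d φ := by
  ext x
  have h1 := hasDerivAt_schwartz_dil (spatial d) (mulSq d φ) x one_ne_zero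
  have h2 := hasDerivAt_schwartz_dil (spatial d) φ x one_ne_zero
  have h3 : HasDerivAt (fun l : ℝ => ((l ^ 2 * rsq x - x 0 ^ 2 : ℝ) : ℂ)) ((2 * rsq x : ℝ) : ℂ) 1 :=
    ((((hasDerivAt_pow 2 (1 : ℝ)).mul_const (rsq x)).sub_const (x 0 ^ 2)).congr_deriv (by norm_num)).ofReal_comp
  have e : (fun l => mulSq d φ (dil (spatial d) l x)) =
      fun l => ((l ^ 2 * rsq x - x 0 ^ 2 : ℝ) : ℂ) * φ (dil (spatial d) l x) := by
    funext l; rw [mulSq_apply, sq_dil]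
  rw [e] at h1
  have h4 := h1.unique (h3.mul h2)
  simp only [dil_one, Complex.ofReal_one, inv_one, one_mul, one_pow] at h4
  rw [h4, add_apply, smul_apply, mulSq_apply, mulRsq_apply, smul_eq_mul, sq_eq]
  push_cast; ring

lemma Bop_succ (n : ℕ) (φ : 𝓢(Mink d, ℂ)) : Bop d (n + 1) φ =
    (-(1 / 2) : ℂ) • (eulerOp (spatial d) (Bop d n φ) + ((d : ℂ) - 3 - 2 * n) • Bop d n φ) := rfl

/-- A Leibniz rule for the iterated adjoint: the spatial Euler operator maps the factor x² to 2|𝐱|²,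
and the correction term already carries the |𝐱|² that lowers the order n + 1 to n. -/
lemma Bop_mulSq (n : ℕ) (φ : 𝓢(Mink d, ℂ)) :
    Bop d (n + 1) (mulSq d φ) = mulSq d (Bop d (n + 1) φ) - ((n : ℂ) + 1) • mulRsq d (Bop d n φ) := by
  induction n with
  | zero =>
    rw [Bop_succ, Bop_succ]
    simp only [Bop, ContinuousLinearMap.id_apply, eulerOp_mulSq, map_smul, map_add]
    ext x
    simp only [add_apply, smul_apply, sub_apply, smul_eq_mul]
    push_cast; ring
  | succ n ih =>
    rw [Bop_succ (n + 1) (mulSq d φ), ih, Bop_succ (n + 1) φ, map_sub, map_smul, eulerOp_mulSq, eulerOp_mulRsq,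
      map_smul, map_add, map_smul, Bop_succ n φ]
    simp only [map_smul, map_add]
    ext x
    simp only [add_apply, smul_apply, sub_apply, smul_eq_mul]
    push_cast; ring

/-- The Leibniz rule `x² h⁽ⁿ⁺¹⁾(x²) = (w h)⁽ⁿ⁺¹⁾(x²) - (n+1) h⁽ⁿ⁾(x²)`. -/
lemma IDist_mulSq {n : ℕ} (hn : n + 1 ≤ (d - 2) / 2) {τ h : ℝ → ℂ} (hτ : BddMeas τ) (hh : Adm d h)
    (hwh : Adm d fun w => (w : ℂ) * h w) (φ : 𝓢(Mink d, ℂ)) :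
    IDist d (n + 1) τ h (mulSq d φ) = IDist d (n + 1) τ (fun w => (w : ℂ) * h w) φ - ((n : ℂ) + 1) * IDist d n τ h φ := by
  have hn' : n ≤ (d - 2) / 2 := by omega
  rw [IDist_apply hn hτ hh, IDist_apply hn hτ hwh, IDist_apply hn' hτ hh, Bop_mulSq, ← integral_const_mul,
    ← integral_sub ((tame_kerI hn hτ hwh).integrable_mul _) (((tame_kerI hn' hτ hh).integrable_mul _).const_mul _)]
  refine integral_congr_ae ?_
  -- Off 𝐱 = 0 the factor |𝐱|² of the correction cancels one inverse power in the kernel.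
  filter_upwards [ae_rsq_ne_zero (d := d) (by omega)] with x hx
  have hx' : (rsq x : ℂ) ≠ 0 := by exact_mod_cast hx
  simp only [kerI, sub_apply, smul_apply, mulSq_apply, mulRsq_apply, smul_eq_mul, pow_succ]
  push_cast
  field_simp

end

section
variable {d : ℕ} [NeZero d] {m : ℝ}

/-! ### The formula in terms of `𝐅` -/

/-- Coefficients of the Olver-normalized series. -/
def hcoef (z : ℂ) (n i : ℕ) : ℂ := 1 / (Complex.Gamma (z + i) * ((n + i).factorial : ℂ))

/-- The entire functions `∑ᵢ y^i / (Γ(z+i) (n+i)!)`. -/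
def hser (z : ℂ) (n : ℕ) (y : ℂ) : ℂ := ∑' i, hcoef z n i * y ^ i

lemma factBound_hcoef (z : ℂ) (n : ℕ) : FactBound (hcoef z n) := by
  obtain ⟨C, hC⟩ := exists_norm_inv_Gamma_le z
  refine ⟨C, fun i => ?_⟩
  have hC0 : 0 ≤ C := (norm_nonneg _).trans (hC 0)
  rw [hcoef, one_div, mul_inv, norm_mul, div_eq_mul_inv, norm_inv (_ : ℂ), norm_inv ((n + i).factorial : ℂ),
    Complex.norm_natCast, ← norm_inv]
  refine mul_le_mul (hC i) (inv_anti₀ (by positivity) ?_) (by positivity) hC0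
  exact_mod_cast Nat.factorial_le (by omega)

lemma olverF_eq (a y : ℂ) : olverF a y = hser (a + 1) 0 y :=
  tsum_congr fun i => by rw [hcoef, zero_add]; ring

/-- Splitting off the constant term; the counterpart, on the side of the smooth factor, of the
recursion `IDist_jser_succ`. -/
lemma hser_eq_add (z : ℂ) (n : ℕ) (y : ℂ) : hser z n y = hcoef z n 0 + y * hser (z + 1) (n + 1) y := by
  rw [hser, (factBound_hcoef z n).eq_add]
  congr 2
  refine tsum_congr fun i => ?_
  rw [hcoef, hcoef]
  push_cast
  rw [add_assoc z 1, add_comm (1 : ℂ) i, show n + (i + 1) = n + 1 + i by ring]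

lemma contDiff_hser_sq (z : ℂ) (n : ℕ) (c : ℝ) : ContDiff ℝ ∞ fun x : Mink d => hser z n ((c * sq x : ℝ) : ℂ) := by
  have h1 : ContDiff ℝ ∞ (hser z n) := (factBound_hcoef z n).contDiff_infty.restrict_scalars ℝ
  have h2 : ContDiff ℝ ∞ fun x : Mink d => ((c * sq x : ℝ) : ℂ) := by
    refine Complex.ofRealCLM.contDiff.comp ?_
    refine ContDiff.mul contDiff_const ?_
    unfold sq lorentz
    fun_prop
  exact h1.comp h2

lemma exists_schwartz_mul {d : ℕ} {h : Mink d → ℂ} (hh : ContDiff ℝ ∞ h) {φ : 𝓢(Mink d, ℂ)} (hφ : HasCompactSupport φ) :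
    ∃ ψ : 𝓢(Mink d, ℂ), ∀ x, ψ x = h x * φ x :=
  ⟨HasCompactSupport.toSchwartzMap (f := fun x => h x * φ x) hφ.mul_left (hh.mul φ.smooth'), fun _ => rfl⟩

/-- `x² (x²)_-^{β-N-1} = -(x²)_-^{β-N}`. -/
lemma IDist_one_mulSq (hm : 0 < m) {N : ℕ} (hN : N + 1 ≤ (d - 2) / 2) (φ : 𝓢(Mink d, ℂ)) :
    IDist d (N + 1) (fun _ => 1) (cutPow d m fun _ => 1) (mulSq d φ) =
      (bet d - N : ℝ) * IDist d N (fun _ => 1) (cutPow d m fun _ => 1) φ := by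
  have hN' : N ≤ (d - 2) / 2 := by omega
  set c := m ^ 2 / 4 with hc
  have hc0 : 0 < c := by positivity
  have hb := neg_one_lt_bet d
  have a1 := adm_cutPow_one (d := d) hm
  -- This function is -(4/m²) u₊^(β+1), continuous at 0, with derivative (β + 1) u₊^β. The Leibniz
  -- rule subtracts N + 1 and leaves β - N.
  set g : ℝ → ℂ := fun w => (w : ℂ) * cutPow d m (fun _ => 1) w with hg
  have hgeq : ∀ w, g w = ((-(1 / c) * (max (-(c * w)) 0) ^ (bet d + 1) : ℝ) : ℂ) := fun w => by
    rw [hg]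
    simp only [cutPow]
    split_ifs with h
    · have hu : 0 < -(c * w) := by nlinarith
      rw [max_eq_left hu.le, Real.rpow_add_one hu.ne', ← hc]
      have : (c : ℂ) ≠ 0 := by exact_mod_cast hc0.ne'
      push_cast
      field_simp
    · rw [max_eq_right (by nlinarith), Real.zero_rpow (by linarith)]
      simp
  have hcont : Continuous g := by
    rw [show g = _ from funext hgeq]
    have h2 : Continuous fun w : ℝ => (max (-(c * w)) 0) ^ (bet d + 1) :=
      Continuous.rpow_const (by fun_prop) fun w => Or.inr (by linarith)
    exact Complex.continuous_ofReal.comp (continuous_const.mul h2)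
  have hgadm : Adm d g := by
    have h := adm_cutPow (d := d) hm (J := fun u => -(1 / c) * u) (by fun_prop) (C := 1 / c) (M := 1) (fun u hu => by
      rw [abs_mul, abs_neg, abs_of_pos (by positivity), abs_of_pos hu, pow_one]
      gcongr; linarith)
    refine (funext fun w => ?_ : g = _) ▸ h
    rw [hg]
    simp only [cutPow, ← hc]
    split_ifs
    · have : (c : ℂ) ≠ 0 := by exact_mod_cast hc0.ne'
      push_cast; field_simp
    · simp
  have hder : ∀ w ≠ 0, HasDerivAt g (((bet d + 1 : ℝ) : ℂ) * cutPow d m (fun _ => 1) w) w := fun w hw => by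
    rcases hw.lt_or_gt with hw | hw
    · have hu : 0 < -(c * w) := by nlinarith
      have h1 : HasDerivAt (fun w : ℝ => -(c * w)) (-c) w := by
        exact ((hasDerivAt_id w).const_mul c).neg.congr_deriv (by simp)
      have h2 := ((h1.rpow_const (p := bet d + 1) (Or.inl hu.ne')).const_mul (-(1 / c))).ofReal_comp
      refine (h2.congr_deriv ?_).congr_of_eventuallyEq ?_
      · rw [cutPow, if_pos hw, add_sub_cancel_right, ← hc]
        have : (c : ℂ) ≠ 0 := by exact_mod_cast hc0.ne'
        push_cast; field_simp
      · filter_upwards [gt_mem_nhds hw] with v hv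
        rw [hgeq, max_eq_left (by nlinarith)]
    · rw [cutPow, if_neg hw.not_gt]
      simp only [Complex.ofReal_zero, mul_zero]
      refine (hasDerivAt_const w (0 : ℂ)).congr_of_eventuallyEq ?_
      filter_upwards [lt_mem_nhds hw] with v hv
      simp [hg, cutPow, if_neg hv.not_gt]
  rw [IDist_mulSq hN bddMeas_one a1 hgadm, IDist_succ_eq hN bddMeas_one hgadm (a1.const_mul _) hcont hder,
    IDist_const_mul hN' bddMeas_one a1]
  simp only [smul_apply, smul_eq_mul]
  push_cast; ring

/-- Induction on N. On the left the recursion splits off J_n(0) and passes to J_{n+1} with one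
derivative fewer; on the right the entire factor splits into its constant term and x² times the next
one, and x² lowers the order of the power singularity by one. The quotient of Γ-values must be
finite and nonzero, which for N > 0 requires odd d. Test functions have compact support because the
entire factor may grow exponentially for x² > 0. -/
lemma IDist_jser_eq_hser (hm : 0 < m) : ∀ N n, N ≤ (d - 2) / 2 → (0 < N → Odd d) → ∀ φ ψ : 𝓢(Mink d, ℂ),
    HasCompactSupport φ → (∀ x, ψ x = hser ((bet d + 1 - N : ℝ) : ℂ) n ((m ^ 2 / 4 * sq x : ℝ) : ℂ) * φ x) →
    IDist d N (fun _ => 1) (cutPow d m (jser (bet d) n)) φ =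
      (((-1) ^ n * Real.Gamma (bet d + 1 - N) / Real.Gamma (bet d + 1) : ℝ) : ℂ) *
        IDist d N (fun _ => 1) (cutPow d m fun _ => 1) ψ := by
  intro N
  have hb := neg_one_lt_bet d
  have hG1 : Real.Gamma (bet d + 1) ≠ 0 := (Real.Gamma_pos_of_pos (by linarith)).ne'
  induction N with
  | zero =>
    intro n _ _ φ ψ hφ hψ
    rw [(IDist_zero_apply bddMeas_one (adm_cutPow_jser hm n) φ).2, (IDist_zero_apply bddMeas_one (adm_cutPow_one hm) ψ).2,
      ← integral_const_mul]
    refine integral_congr_ae (ae_of_all _ fun x => ?_)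
    simp only [hψ, cutPow, Nat.cast_zero, sub_zero, mul_div_assoc, div_self hG1, mul_one]
    split_ifs
    · have : (jser (bet d) n (-(m ^ 2 / 4 * sq x)) : ℂ) =
          (-1) ^ n * hser ((bet d + 1 : ℝ) : ℂ) n ((m ^ 2 / 4 * sq x : ℝ) : ℂ) := by
        rw [jser, hser, Complex.ofReal_tsum, ← tsum_mul_left]
        refine tsum_congr fun i => ?_
        rw [jcoef, hcoef, neg_pow (m ^ 2 / 4 * sq x), show ((bet d + 1 : ℝ) : ℂ) + i = ((bet d + 1 + i : ℝ) : ℂ) by push_cast; ring,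
          Complex.Gamma_ofReal]
        push_cast
        have h1 : ((-1 : ℂ) ^ i) * (-1) ^ i = 1 := by rw [← mul_pow]; simp
        rw [pow_add]
        linear_combination ((-1 : ℂ) ^ n / (((n + i).factorial : ℂ) * (Real.Gamma (bet d + 1 + i) : ℂ)) *
          ((m : ℂ) ^ 2 / 4 * sq x) ^ i) * h1
      rw [Complex.ofReal_mul, this]
      push_cast; ring
    · simp
  | succ N ih =>
    intro n hN hodd φ ψ hφ hψ
    have hd := hodd (Nat.succ_pos _)
    have hGN := Gamma_bet_ne_zero hd (N + 1)
    obtain ⟨χ, hχ⟩ := exists_schwartz_mul (contDiff_hser_sq ((bet d + 1 - N : ℝ) : ℂ) (n + 1) (m ^ 2 / 4)) hφ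
    -- The series with parameter β + 1 - (N+1) equals its constant term plus m²x²/4 times the series
    -- with parameter β + 1 - N and index n + 1.
    have hψ2 : ψ = (hcoef ((bet d + 1 - (N + 1 : ℕ) : ℝ) : ℂ) n 0) • φ + ((m ^ 2 / 4 : ℝ) : ℂ) • mulSq d χ := by
      ext x
      simp only [add_apply, smul_apply, smul_eq_mul, mulSq_apply, hψ, hχ]
      rw [hser_eq_add, show ((bet d + 1 - (N + 1 : ℕ) : ℝ) : ℂ) + 1 = ((bet d + 1 - N : ℝ) : ℂ) by push_cast; ring]
      push_cast; ring
    have hGr : Real.Gamma (bet d + 1 - N) = (bet d - N) * Real.Gamma (bet d + 1 - (N + 1 : ℕ)) := by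
      have h0 : bet d - N ≠ 0 := by simpa using bet_sub_ne_intCast hd N 0
      rw [show bet d + 1 - (N : ℝ) = (bet d - N) + 1 by ring, Real.Gamma_add_one h0,
        show bet d + 1 - ((N + 1 : ℕ) : ℝ) = bet d - N by push_cast; ring]
    rw [IDist_jser_succ hm hN bddMeas_one, hψ2, map_add, map_smul, map_smul, IDist_one_mulSq hm hN]
    simp only [add_apply, smul_apply, smul_eq_mul]
    rw [ih (n + 1) (by omega) (fun _ => hd) φ χ hφ hχ, hGr, jcoef, hcoef, Nat.cast_zero, Nat.cast_zero, add_zero, add_zero,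
      add_zero, Complex.Gamma_ofReal]
    generalize Real.Gamma (bet d + 1 - ((N + 1 : ℕ) : ℝ)) = X at *
    generalize Real.Gamma (bet d + 1) = Y at *
    have hX : (X : ℂ) ≠ 0 := by exact_mod_cast hGN
    have hY : (Y : ℂ) ≠ 0 := by exact_mod_cast hG1
    have hf : ((n.factorial : ℕ) : ℂ) ≠ 0 := by exact_mod_cast n.factorial_ne_zero
    push_cast
    field_simp
    ring

lemma four_pi_rpow (d : ℕ) : (4 * Real.pi) ^ ((d : ℝ) / 2) =
    4 ^ (((d - 2) / 2 : ℕ) - bet d) * (2 * Real.pi) * (2 * Real.pi ^ ((d : ℝ) / 2 - 1)) := by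
  have hpi := Real.pi_pos
  rw [← half_sub_one_eq, Real.mul_rpow (by norm_num) hpi.le]
  have h1 : (4 : ℝ) ^ ((d : ℝ) / 2) = 4 ^ ((d : ℝ) / 2 - 1) * 4 := by
    rw [← Real.rpow_add_one (by norm_num)]; ring_nf
  have h2 : Real.pi ^ ((d : ℝ) / 2) = Real.pi ^ ((d : ℝ) / 2 - 1) * Real.pi := by
    rw [← Real.rpow_add_one hpi.ne']; ring_nf
  rw [h1, h2]
  ring

/-- P is `Tdist` divided by the prefactor of the formula. For odd d it must be recognized as a
product, for even d the symbol is defined by boundary values of U and only constants are compared.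
-/
theorem exists_isMinusPowF (hm : 0 < m) : ∃ P : 𝓢'(Mink d, ℂ), IsMinusPowF m P ∧
    ((2 * Real.pi / (4 * Real.pi) ^ ((d : ℝ) / 2) : ℝ) : ℂ) • P = Tdist d m := by
  have hpi := Real.pi_pos
  set A : ℝ := 2 * Real.pi / (4 * Real.pi) ^ ((d : ℝ) / 2) with hA
  have hA0 : A ≠ 0 := by positivity
  refine ⟨((A⁻¹ : ℝ) : ℂ) • Tdist d m, ⟨fun hd => ?_, fun hd => ?_⟩, ?_⟩
  · have hk := isMinusPow_IDist hm hd (N := (d - 2) / 2) le_rfl (c := 1 / 4) (by norm_num)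
    have hb : bet d - ((d - 2) / 2 : ℕ) = 1 - (d : ℝ) / 2 := by rw [bet]; ring
    refine ⟨_, hb ▸ hk, ?_, fun φ ψ hφ hψ => ?_⟩
    · simp only [olverF_eq, mul_div_right_comm]
      exact contDiff_hser_sq _ _ _
    · rw [Tdist, smul_apply, smul_apply, smul_apply, IDist_jser_eq_hser hm _ 0 le_rfl (fun _ => hd) φ ψ hφ]
      · simp only [smul_eq_mul, ← mul_assoc]
        congr 1
        rw [← hb, hA, Gconst, four_pi_rpow, ← neg_sub, Real.rpow_neg (by norm_num), one_div, Real.inv_rpow (by norm_num)]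
        have e : (2 * Real.pi ^ ((d : ℝ) / 2 - 1)) ≠ 0 := by positivity
        generalize 2 * Real.pi ^ ((d : ℝ) / 2 - 1) = E at *
        rw [pow_zero, ← Complex.ofReal_mul, ← Complex.ofReal_mul]
        congr 1
        have := hpi.ne'
        field_simp
      · intro x
        rw [hψ]
        simp only [olverF_eq]
        rw [show (bet d + 1 - ((d - 2) / 2 : ℕ) : ℝ) = 1 - (d : ℝ) / 2 + 1 by rw [← hb]; ring, mul_div_right_comm]
        push_cast; rfl
  · refine ⟨_, _, isUBoundaryValue_Wdist hm (Or.inl rfl), isUBoundaryValue_Wdist hm (Or.inr rfl), ?_⟩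
    rw [← smul_Wdist_sub hm, hA]
    have h3 : (Real.pi : ℂ) = Real.sqrt Real.pi * Real.sqrt Real.pi := by
      exact_mod_cast (Real.mul_self_sqrt hpi.le).symm
    have h4 := sqrt_pi_ne_zero
    have h5 : ((4 * Real.pi) ^ ((d : ℝ) / 2)) ≠ 0 := by positivity
    generalize (m ^ ((d : ℝ) - 2)) = M
    generalize ((4 * Real.pi) ^ ((d : ℝ) / 2)) = B at *
    have h5' : (B : ℂ) ≠ 0 := by exact_mod_cast h5
    ext φ
    simp only [smul_apply, sub_apply, smul_eq_mul]
    push_cast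
    rw [h3]
    field_simp
    ring
  · rw [smul_smul, ← Complex.ofReal_mul, mul_inv_cancel₀ hA0, Complex.ofReal_one, one_smul]

end

section
variable {d : ℕ} [NeZero d] {m : ℝ}

/-! ### The decomposition into singular and regular parts -/

/-- The singular part of the Green function. -/
def singDist (d : ℕ) [NeZero d] (m s : ℝ) : 𝓢'(Mink d, ℂ) :=
  (Gconst d m : ℂ) • ∑ j ∈ Finset.range ((d - 2) / 2), ((-((m ^ 2 / 4 : ℝ) : ℂ)) ^ j * (jcoef (bet d) j 0 : ℂ)) •
    IDist d ((d - 2) / 2 - j) (fun t => theta (s * t)) (cutPow d m fun _ => 1)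

/-- The regular part of the Green function. -/
def regDist (d : ℕ) [NeZero d] (m s : ℝ) : 𝓢'(Mink d, ℂ) :=
  ((Gconst d m : ℂ) * (-((m ^ 2 / 4 : ℝ) : ℂ)) ^ ((d - 2) / 2)) •
    IDist d 0 (fun t => theta (s * t)) (cutPow d m (jser (bet d) ((d - 2) / 2)))

lemma Gdist_eq_add (hm : 0 < m) (s : ℝ) : Gdist d m s = singDist d m s + regDist d m s := by
  rw [Gdist, IDist_jser_eq_sum hm (bddMeas_theta s) _ _ le_rfl, smul_add, smul_smul, singDist, regDist]
  simp only [zero_add]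

lemma isRegularDist_IDist_zero {τ h : ℝ → ℂ} (hτ : BddMeas τ) (hh : Adm d h) (a : ℂ) :
    IsRegularDist (fun x : Mink d => a * (τ (x 0) * h (sq x))) (a • IDist d 0 τ h) := by
  have e : (fun x : Mink d => τ (x 0) * h (sq x)) = kerI 0 τ h := by funext x; simp [kerI]
  have ht : Tame (fun x : Mink d => τ (x 0) * h (sq x)) := e ▸ tame_kerI (Nat.zero_le _) hτ hh
  refine ⟨LocallyIntegrable.smul (f := fun x : Mink d => τ (x 0) * h (sq x)) ?_ a, fun φ => ?_⟩
  · obtain ⟨h1, N, h2⟩ := ht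
    rw [locallyIntegrable_iff]
    intro K hK
    have h3 : Continuous fun x : Mink d => (1 + ‖x‖) ^ N := by fun_prop
    have h4 := (h2.locallyIntegrable.integrableOn_isCompact hK).continuousOn_mul h3.continuousOn hK
    refine Integrable.mono' h4 h1.restrict (ae_of_all _ fun x => le_of_eq ?_)
    have : (1 + ‖x‖) ^ N ≠ 0 := by positivity
    field_simp
  · obtain ⟨h1, h2⟩ := IDist_zero_apply hτ hh φ
    refine ⟨by simpa only [mul_assoc] using h1.const_mul a, ?_⟩
    rw [smul_apply, h2, smul_eq_mul, ← integral_const_mul]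
    simp only [mul_assoc]

lemma isOddSing_singDist (hm : 0 < m) {s : ℝ} (hs : s ≠ 0) (hd : Odd d) : IsOddSing m s (singDist d m s) := by
  -- For odd d ≥ 3 both quotients are (d-3)/2; for d = 1 both subtractions truncate to 0 and the
  -- singular part is empty.
  have hk : (d - 3) / 2 = (d - 2) / 2 := by obtain ⟨r, rfl⟩ := hd; omega
  have hG1 : Real.Gamma (bet d + 1) ≠ 0 := (Real.Gamma_pos_of_pos (by linarith [neg_one_lt_bet d])).ne'
  rw [IsOddSing, hk]
  set k := (d - 2) / 2 with hkdef
  have hb : bet d = 1 - (d : ℝ) / 2 + k := rfl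
  have hcast : ∀ j < k, bet d - ((k - j : ℕ) : ℝ) = 1 - (d : ℝ) / 2 + j := fun j hj => by
    rw [Nat.cast_sub hj.le, hb]; ring
  refine ⟨fun j => (((-1) ^ (k - j) * 1 ^ (bet d - (k - j : ℕ)) * (m ^ 2 / 4) ^ (-bet d) *
    Real.Gamma (bet d + 1 - (k - j : ℕ)) / Real.Gamma (bet d + 1) : ℝ) : ℂ) • IDist d (k - j) (fun _ => 1)
      (cutPow d m fun _ => 1), fun j hj => ?_, ?_⟩
  · exact hcast j hj ▸ isMinusPow_IDist hm hd (N := k - j) (by omega) one_pos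
  · have h := IsThetaMul.const_smul (IsThetaMul.sum (I := Finset.range k) fun j hj =>
      ((isThetaMul_IDist (n := k - j) (by omega) hs (adm_cutPow_one (d := d) hm)).const_smul
        (((-1) ^ (k - j) * 1 ^ (bet d - (k - j : ℕ)) * (m ^ 2 / 4) ^ (-bet d) *
          Real.Gamma (bet d + 1 - (k - j : ℕ)) / Real.Gamma (bet d + 1) : ℝ) : ℂ)).const_smul
        (oddCoeff d m j : ℂ)) ((1 / (2 * Real.pi ^ ((d : ℝ) / 2 - 1)) : ℝ) : ℂ)
    convert h using 1
    rw [singDist, Finset.smul_sum, Finset.smul_sum]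
    refine Finset.sum_congr rfl fun j hj => ?_
    have hj' := Finset.mem_range.1 hj
    rw [smul_smul, smul_smul, smul_smul]
    congr 1
    have hΓ := Gamma_bet_ne_zero hd (k - j)
    have e1 : 2 - (d : ℝ) / 2 + j = bet d + 1 - ((k - j : ℕ) : ℝ) := by linarith [hcast j hj']
    have e2 : ((-1 : ℝ)) ^ k = (-1) ^ j * (-1) ^ (k - j) := by rw [← pow_add]; congr 1; omega
    have e3 : ((-1 : ℝ)) ^ j * (-1) ^ j = 1 := by rw [← mul_pow]; simp
    rw [oddCoeff, e1, Gconst, jcoef, ← hkdef, e2, Real.one_rpow, add_zero, Nat.cast_zero, add_zero]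
    generalize Real.Gamma (bet d + 1 - ((k - j : ℕ) : ℝ)) = X at *
    generalize Real.Gamma (bet d + 1) = Y at *
    have e : (2 * Real.pi ^ ((d : ℝ) / 2 - 1)) ≠ 0 := by positivity
    generalize 2 * Real.pi ^ ((d : ℝ) / 2 - 1) = E at *
    generalize (m ^ 2 / 4) ^ (-bet d) = F at *
    rw [← Complex.ofReal_neg, ← Complex.ofReal_pow, ← Complex.ofReal_mul, ← Complex.ofReal_mul, ← Complex.ofReal_mul,
      ← Complex.ofReal_mul]
    congr 1
    have hf : (j.factorial : ℝ) ≠ 0 := by exact_mod_cast j.factorial_ne_zero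
    rw [neg_pow (m ^ 2 / 4)]
    field_simp
    linear_combination F * e3

/-- With j = k + i the exponent 1 - d/2 + j is β + i and the argument 2 - d/2 + j of Γ is β + 1 + i.
-/
lemma oddTerm_eq (hm : 0 < m) (hd : Odd d) {x : Mink d} (hx : sq x < 0) (i : ℕ) :
    oddTerm m x ((d - 3) / 2 + i) = (m ^ 2 / 4) ^ ((d - 2) / 2) * (m ^ 2 / 4) ^ (-bet d) *
      ((-(m ^ 2 / 4 * sq x)) ^ bet d * (jcoef (bet d) ((d - 2) / 2) i * (-(m ^ 2 / 4 * sq x)) ^ i)) := by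
  have hk : (d - 3) / 2 = (d - 2) / 2 := by obtain ⟨r, rfl⟩ := hd; omega
  have hc : 0 < m ^ 2 / 4 := by positivity
  have hx' : 0 < -sq x := by linarith
  rw [hk, oddTerm, oddCoeff, jcoef, show 1 - (d : ℝ) / 2 + (((d - 2) / 2 + i : ℕ) : ℝ) = bet d + i by
      rw [bet]; push_cast; ring, show 2 - (d : ℝ) / 2 + (((d - 2) / 2 + i : ℕ) : ℝ) = bet d + 1 + i by
      rw [bet]; push_cast; ring, ← mul_neg, Real.mul_rpow hc.le hx'.le, Real.rpow_add hx', Real.rpow_natCast,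
    Real.rpow_neg hc.le, mul_pow, pow_add (m ^ 2 / 4)]
  have : (m ^ 2 / 4) ^ bet d ≠ 0 := by positivity
  field_simp

lemma isOddReg_regDist (hm : 0 < m) (s : ℝ) (hd : Odd d) : IsOddReg m s (regDist d m s) := by
  refine ⟨fun x hx => ?_, ?_⟩
  · simp only [oddTerm_eq hm hd hx]
    exact (((factBound_jcoef _ _).summable _).mul_left _).mul_left _
  · have h := isRegularDist_IDist_zero (bddMeas_theta s) (adm_cutPow_jser (d := d) hm ((d - 2) / 2))
      ((Gconst d m : ℂ) * (-((m ^ 2 / 4 : ℝ) : ℂ)) ^ ((d - 2) / 2))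
    unfold regDist
    convert h using 1
    funext x
    rw [theta, theta, cutPow]
    by_cases hx : sq x < 0
    · rw [if_pos hx, if_pos (by linarith : 0 < -sq x)]
      simp only [oddTerm_eq hm hd hx]
      rw [tsum_mul_left, tsum_mul_left, ← jser, Gconst]
      have e3 : ((-1 : ℂ)) ^ ((d - 2) / 2) * (-1) ^ ((d - 2) / 2) = 1 := by rw [← mul_pow]; simp
      generalize (m ^ 2 / 4) ^ (-bet d) = F
      generalize (-(m ^ 2 / 4 * sq x)) ^ bet d = F'
      generalize 2 * Real.pi ^ ((d : ℝ) / 2 - 1) = E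
      rw [neg_pow ((m ^ 2 / 4 : ℝ) : ℂ)]
      push_cast
      linear_combination (-(if 0 < s * x 0 then 1 else 0) * (1 / E * (((m : ℂ) ^ 2 / 4) ^ ((d - 2) / 2) * F *
        (F' * (jser (bet d) ((d - 2) / 2) (-(m ^ 2 / 4 * sq x)))))) : ℂ) * e3
    · rw [if_neg hx, if_neg (by linarith : ¬ 0 < -sq x)]
      simp

lemma bet_of_even (hd : Even d) : bet d = 0 := by
  rcases bet_cases d with ⟨h, -⟩ | ⟨-, -, h⟩ | ⟨h, -⟩
  · subst h; exact absurd hd (by decide)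
  · exact h
  · exact absurd hd (Nat.not_even_iff_odd.2 h)

/-- Here β = 0, so u₊^β is the indicator of x² < 0, and its derivative of order j + 1 is -δ^(j). The
expansion lists derivatives from high to low order, whence the reflection of the sum. -/
lemma isEvenSing_singDist (hm : 0 < m) {s : ℝ} (hs : s ≠ 0) (hd : Even d) : IsEvenSing m s (singDist d m s) := by
  have hd0 : 0 < d := Nat.pos_of_ne_zero (NeZero.ne d)
  have hk : d / 2 = (d - 2) / 2 + 1 := by obtain ⟨r, rfl⟩ := hd; omega
  have hk1 : d / 2 - 1 = (d - 2) / 2 := by omega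
  rw [IsEvenSing, hk1]
  set k := (d - 2) / 2 with hkdef
  set h : ℝ → ℂ := fun w => if w < 0 then -1 else 0 with hh
  have hcut : ∀ w, cutPow d m (fun _ => 1) w = (-1) * h w := fun w => by
    rw [cutPow, bet_of_even hd, hh]
    simp only [Real.rpow_zero]
    split_ifs <;> simp
  have hadm : Adm d h := by
    have := (adm_cutPow_one (d := d) hm).const_mul (-1)
    simp only [hcut] at this
    simpa using this
  refine ⟨fun j => IDist d (j + 1) (fun _ => 1) h, fun j hj => isDeltaSq_IDist (by omega), ?_⟩
  have h1 := IsThetaMul.const_smul (IsThetaMul.sum (I := Finset.range k) fun j (hj : j ∈ Finset.range k) =>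
      (isThetaMul_IDist (n := j + 1) (by have := Finset.mem_range.1 hj; omega) hs hadm).const_smul
        (((m ^ 2 / 4) ^ (d / 2 - 2 - j) / ((d / 2 - 2 - j).factorial : ℝ) : ℝ) : ℂ))
        (((-1) ^ (d / 2) / (2 * Real.pi ^ ((d : ℝ) / 2 - 1)) : ℝ) : ℂ)
  convert h1 using 1
  rw [singDist, ← Finset.sum_range_reflect, Finset.smul_sum, Finset.smul_sum]
  refine Finset.sum_congr rfl fun j hj => ?_
  have hj' := Finset.mem_range.1 hj
  rw [show k - (k - 1 - j) = j + 1 by omega, show d / 2 - 2 - j = k - 1 - j by omega, funext hcut,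
    IDist_const_mul (by omega) (bddMeas_theta s) hadm, smul_smul, smul_smul, smul_smul]
  congr 1
  rw [Gconst, jcoef, bet_of_even hd, hk, ← hkdef, neg_pow ((m ^ 2 / 4 : ℝ) : ℂ), neg_zero, Real.rpow_zero,
    Nat.cast_zero, zero_add, add_zero, add_zero, Real.Gamma_one]
  have e3 : ((-1 : ℂ)) ^ (k - 1 - j) * (-1) ^ (k - 1 - j) = 1 := by rw [← mul_pow]; simp
  generalize 2 * Real.pi ^ ((d : ℝ) / 2 - 1) = E
  push_cast
  rw [pow_succ]
  linear_combination (-(-1) ^ k / E * (((m : ℂ) ^ 2 / 4) ^ (k - 1 - j) / (k - 1 - j).factorial)) * e3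

lemma isEvenReg_regDist (hm : 0 < m) (s : ℝ) (hd : Even d) : IsEvenReg m s (regDist d m s) := by
  have hd0 : 0 < d := Nat.pos_of_ne_zero (NeZero.ne d)
  have hk1 : d / 2 - 1 = (d - 2) / 2 := by omega
  have hdk : (d : ℂ) / 2 - 1 = ((d - 2) / 2 : ℕ) := by
    have : d = 2 * ((d - 2) / 2 + 1) := by obtain ⟨r, rfl⟩ := hd; omega
    conv_lhs => rw [this]
    push_cast; ring
  have h := isRegularDist_IDist_zero (bddMeas_theta s) (adm_cutPow_jser (d := d) hm ((d - 2) / 2))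
      ((Gconst d m : ℂ) * (-((m ^ 2 / 4 : ℝ) : ℂ)) ^ ((d - 2) / 2))
  rw [IsEvenReg, regDist]
  convert h using 1
  funext x
  rw [theta, theta, cutPow, hk1, hdk, mul_div_assoc, two_pi_div_eq d hm, Gconst, bet_of_even hd]
  set k := (d - 2) / 2
  by_cases hx : sq x < 0
  · have hser : (jser 0 k (-(m ^ 2 / 4 * sq x)) : ℂ) = (-1) ^ k * olverF k ((m ^ 2 * sq x / 4 : ℝ) : ℂ) := by
      rw [jser, olverF, Complex.ofReal_tsum, ← tsum_mul_left]
      refine tsum_congr fun i => ?_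
      rw [jcoef, show (k : ℂ) + 1 + i = ((k + i : ℕ) : ℂ) + 1 by push_cast; ring, Complex.Gamma_nat_eq_factorial,
        show (0 : ℝ) + 1 + i = i + 1 by ring, Real.Gamma_nat_eq_factorial, neg_pow (m ^ 2 / 4 * sq x),
        mul_div_right_comm (m ^ 2)]
      have e3 : ((-1 : ℂ)) ^ i * (-1) ^ i = 1 := by rw [← mul_pow]; simp
      push_cast
      rw [pow_add]
      linear_combination ((-1) ^ k / ((k + i).factorial * i.factorial) * ((m : ℂ) ^ 2 / 4 * sq x) ^ i) * e3
    rw [if_pos hx, if_pos (by linarith : 0 < -sq x), sub_zero, neg_zero, Real.rpow_zero, Real.rpow_natCast, Real.rpow_zero,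
      one_mul, hser]
    have e3 : ((-1 : ℂ)) ^ k * (-1) ^ k = 1 := by rw [← mul_pow]; simp
    generalize 2 * Real.pi ^ ((d : ℝ) / 2 - 1) = E
    rw [neg_pow ((m ^ 2 / 4 : ℝ) : ℂ)]
    push_cast
    linear_combination (-(if 0 < s * x 0 then 1 else 0) * (-1) ^ k / E * ((m : ℂ) ^ 2 / 4) ^ k *
      olverF k ((m : ℂ) ^ 2 * sq x / 4)) * e3
  · rw [if_neg hx, if_neg (by linarith : ¬ 0 < -sq x)]
    simp

end

section
open LineDeriv FourierTransform

variable {d : ℕ} [NeZero d] {m : ℝ}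

/-! ### The Lorentzian Fourier transform -/

/-- The map `p ↦ (p⁰, -𝐩) / 2π`. -/
def lorentzEquiv (d : ℕ) [NeZero d] : Mink d ≃L[ℝ] Mink d :=
  (ℝ ∙ (EuclideanSpace.single (0 : Fin d) (1 : ℝ))).reflection.toContinuousLinearEquiv.trans
    (ContinuousLinearEquiv.smulLeft (Units.mk0 (2 * Real.pi)⁻¹ (by positivity)))

lemma lorentz_eq (p x : Mink d) : lorentz p x = inner ℝ x p - 2 * (p 0 * x 0) := by
  rw [lorentz, PiLp.inner_apply, ← Finset.add_sum_erase _ _ (Finset.mem_univ (0 : Fin d))]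
  simp only [RCLike.inner_apply, conj_trivial]
  ring

lemma inner_lorentzEquiv (x p : Mink d) : inner ℝ x (lorentzEquiv d p) = -(2 * Real.pi)⁻¹ * lorentz p x := by
  have h : lorentzEquiv d p = (2 * Real.pi)⁻¹ •
    (ℝ ∙ (EuclideanSpace.single (0 : Fin d) (1 : ℝ))).reflection p := rfl
  rw [h, Submodule.reflection_singleton_apply, inner_smul_right, inner_sub_right, lorentz_eq, ← Nat.cast_smul_eq_nsmul ℝ,
    inner_smul_right, inner_smul_right]
  simp [EuclideanSpace.inner_single_left, EuclideanSpace.inner_single_right]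
  ring

/-- The Fourier transform `p ↦ ∫ e^{ipx} φ(x) dx`. -/
def ft (d : ℕ) [NeZero d] : 𝓢(Mink d, ℂ) →L[ℂ] 𝓢(Mink d, ℂ) :=
  (SchwartzMap.compCLMOfContinuousLinearEquiv ℂ (lorentzEquiv d)).comp (SchwartzMap.fourierTransformCLM ℂ)

lemma ft_eq (φ : 𝓢(Mink d, ℂ)) (p : Mink d) : ft d φ p = 𝓕 φ (lorentzEquiv d p) := rfl

lemma ft_apply (φ : 𝓢(Mink d, ℂ)) (p : Mink d) :
    ft d φ p = ∫ x, Complex.exp (Complex.I * (lorentz p x : ℂ)) * φ x := by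
  rw [ft_eq, SchwartzMap.fourier_coe, Real.fourier_eq']
  refine integral_congr_ae (ae_of_all _ fun x => ?_)
  simp only [inner_lorentzEquiv, smul_eq_mul]
  congr 2
  have : (Real.pi : ℂ) ≠ 0 := by exact_mod_cast Real.pi_ne_zero
  push_cast; field_simp

/-- Fourier inversion at the origin; the rescaling of momenta by 2π supplies the Jacobian. -/
lemma integral_ft (φ : 𝓢(Mink d, ℂ)) : ∫ p, ft d φ p = (2 * (Real.pi : ℂ)) ^ d * φ 0 := by
  set ρ := (ℝ ∙ (EuclideanSpace.single (0 : Fin d) (1 : ℝ))).reflection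
  have h1 : ∀ p, ft d φ p = (fun q => 𝓕 φ ((2 * Real.pi)⁻¹ • q)) (ρ p) := fun p => rfl
  simp only [h1]
  refine (ρ.measurePreserving.integral_comp ρ.toHomeomorph.measurableEmbedding
    fun q => 𝓕 φ ((2 * Real.pi)⁻¹ • q)).trans ?_
  rw [Measure.integral_comp_smul volume (fun q => 𝓕 φ q)]
  have h2 : ∫ q, 𝓕 φ q = φ 0 := by
    have h := DFunLike.congr_fun (FourierPair.fourierInv_fourier_eq (F := 𝓢(Mink d, ℂ)) φ) 0
    rw [SchwartzMap.fourierInv_coe, Real.fourierInv_eq'] at h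
    simpa using h
  rw [h2, inv_pow, inv_inv, finrank_euclideanSpace_fin, abs_of_nonneg (by positivity), Complex.real_smul]
  push_cast; rfl

lemma ft_lineDeriv (φ : 𝓢(Mink d, ℂ)) (v p : Mink d) :
    ft d (∂_{v} φ) p = -(Complex.I * (lorentz p v : ℂ)) * ft d φ p := by
  have ht : (inner ℝ · v : Mink d → ℝ).HasTemperateGrowth := by fun_prop
  rw [ft_eq, SchwartzMap.fourier_lineDerivOp_eq, smul_apply, SchwartzMap.smulLeftCLM_apply_apply ht, ← ft_eq,
    real_inner_comm, inner_lorentzEquiv, Complex.real_smul, smul_eq_mul]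
  have : (Real.pi : ℂ) ≠ 0 := by exact_mod_cast Real.pi_ne_zero
  push_cast; field_simp

/-- Multiplication by the time coordinate. -/
def mulTime (d : ℕ) [NeZero d] : 𝓢(Mink d, ℂ) →L[ℂ] 𝓢(Mink d, ℂ) :=
  SchwartzMap.smulLeftCLM ℂ fun x : Mink d => (x 0 : ℂ)

lemma mulTime_apply (φ : 𝓢(Mink d, ℂ)) (x : Mink d) : mulTime d φ x = x 0 * φ x :=
  SchwartzMap.smulLeftCLM_apply_apply (hasTemperateGrowth_coord 0) _ _

lemma lineDeriv_ft (φ : 𝓢(Mink d, ℂ)) :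
    ∂_{EuclideanSpace.single (0 : Fin d) (1 : ℝ)} (ft d φ) = -Complex.I • ft d (mulTime d φ) := by
  set v := EuclideanSpace.single (0 : Fin d) (1 : ℝ)
  have ht : (inner ℝ · (lorentzEquiv d v) : Mink d → ℝ).HasTemperateGrowth := by fun_prop
  have h1 : ∀ ψ, ft d ψ = SchwartzMap.compCLMOfContinuousLinearEquiv ℂ (lorentzEquiv d) (𝓕 ψ) := fun _ => rfl
  rw [← map_smul, h1, h1, SchwartzMap.lineDerivOp_compCLMOfContinuousLinearEquiv, SchwartzMap.lineDerivOp_fourier_eq]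
  congr 2
  ext x
  rw [smul_apply, SchwartzMap.smulLeftCLM_apply_apply ht, inner_lorentzEquiv, smul_apply, mulTime_apply, lorentz_eq]
  have h3 : (Real.pi : ℂ) ≠ 0 := by exact_mod_cast Real.pi_ne_zero
  simp [v, EuclideanSpace.inner_single_right]
  field_simp
  ring

/-- The Klein-Gordon operator on test functions. -/
def kgOp (m : ℝ) (φ : 𝓢(Mink d, ℂ)) : 𝓢(Mink d, ℂ) :=
  (m : ℂ) ^ 2 • φ - (-(∂_{EuclideanSpace.single (0 : Fin d) (1 : ℝ)} (∂_{EuclideanSpace.single (0 : Fin d) (1 : ℝ)} φ))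
    + ∑ i ∈ Finset.univ.erase (0 : Fin d),
        ∂_{EuclideanSpace.single i (1 : ℝ)} (∂_{EuclideanSpace.single i (1 : ℝ)} φ))

lemma kg_apply (T : 𝓢'(Mink d, ℂ)) (φ : 𝓢(Mink d, ℂ)) : ((m : ℂ) ^ 2 • T - box T) φ = T (kgOp m φ) := by
  simp [box, kgOp, sub_apply, smul_apply, add_apply, sum_apply, neg_apply, TemperedDistribution.lineDerivOp_apply_apply,
    lineDerivOp_neg]

lemma ft_kgOp (φ : 𝓢(Mink d, ℂ)) (p : Mink d) : ft d (kgOp m φ) p = ((m : ℂ) ^ 2 + (sq p : ℂ)) * ft d φ p := by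
  have h0 : ∀ i : Fin d, i ≠ 0 → lorentz p (EuclideanSpace.single i (1 : ℝ)) = p i := fun i hi => by
    rw [lorentz_eq]; simp [EuclideanSpace.inner_single_left, hi.symm]
  have h1 : lorentz p (EuclideanSpace.single (0 : Fin d) (1 : ℝ)) = -p 0 := by
    rw [lorentz_eq]; simp [EuclideanSpace.inner_single_left]; ring
  rw [kgOp, map_sub, map_add, map_neg, map_sum, map_smul, sub_apply, add_apply, neg_apply, sum_apply, smul_apply,
    ft_lineDeriv, ft_lineDeriv, h1, sq, lorentz]
  have h2 : ∀ i ∈ Finset.univ.erase (0 : Fin d), ft d (∂_{EuclideanSpace.single i (1 : ℝ)}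
      (∂_{EuclideanSpace.single i (1 : ℝ)} φ)) p = -((p i : ℂ) * p i) * ft d φ p := fun i hi => by
    rw [ft_lineDeriv, ft_lineDeriv, h0 i (Finset.ne_of_mem_erase hi)]
    linear_combination ((p i : ℂ) * p i * ft d φ p) * Complex.I_sq
  rw [Finset.sum_congr rfl h2, ← Finset.sum_mul, Finset.sum_neg_distrib, smul_eq_mul]
  push_cast
  linear_combination ((p 0 : ℂ) * p 0 * ft d φ p) * Complex.I_sq

end

section
variable {d : ℕ} [NeZero d] {m : ℝ}

/-! ### The boundary values of the resolvent -/

lemma ae_time_ne_zero : ∀ᵐ x : Mink d, x 0 ≠ 0 := by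
  set K : Submodule ℝ (Mink d) := (LinearMap.ker (EuclideanSpace.proj (𝕜 := ℝ) (0 : Fin d)).toLinearMap)
  have hK : K ≠ ⊤ := fun h => by
    have : EuclideanSpace.single (0 : Fin d) (1 : ℝ) ∈ K := h ▸ Submodule.mem_top
    simp [K] at this
  have := Measure.addHaar_submodule volume K hK
  rw [ae_iff]
  convert this using 2
  ext x
  simp [K]

lemma Tame.add {d : ℕ} {K L : Mink d → ℂ} (hK : Tame K) (hL : Tame L) : Tame fun x => K x + L x := by
  obtain ⟨hKm, N, hN⟩ := hK
  obtain ⟨hLm, N', hN'⟩ := hL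
  refine ⟨hKm.add hLm, N + N', (hN.add hN').mono' ((hKm.add hLm).norm.mul (by fun_prop)) (ae_of_all _ fun x => ?_)⟩
  have h1 : (1 : ℝ) ≤ (1 + ‖x‖) ^ N := one_le_pow₀ (by linarith [norm_nonneg x])
  have h2 : (1 : ℝ) ≤ (1 + ‖x‖) ^ N' := one_le_pow₀ (by linarith [norm_nonneg x])
  simp only [Pi.add_apply]
  rw [norm_mul, norm_norm, Real.norm_of_nonneg (by positivity), pow_add]
  refine (mul_le_mul_of_nonneg_right (norm_add_le _ _) (by positivity)).trans ?_
  rw [add_mul]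
  gcongr
  · nlinarith
  · nlinarith

lemma tame_one_add_norm_pow {d : ℕ} (n : ℕ) : Tame fun x : Mink d => (((1 + ‖x‖) ^ n : ℝ) : ℂ) := by
  refine ⟨(by fun_prop : Continuous fun x : Mink d => (1 + ‖x‖) ^ n).measurable.complex_ofReal.aestronglyMeasurable, n + (d + 1), ?_⟩
  refine (integrable_inv_one_add_norm_pow d).congr (ae_of_all _ fun x => ?_)
  have h1 : (1 + ‖x‖) ≠ 0 := by positivity
  simp only
  rw [Complex.norm_real, Real.norm_of_nonneg (by positivity), pow_add _ n]
  field_simp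

/-- Apply log t ≤ t to |z| for large and to |z|^(-1/2) for small arguments. -/
lemma norm_log_le {z : ℂ} (hz : z ≠ 0) : ‖Complex.log z‖ ≤ Real.pi + ‖z‖ + 2 * ‖z‖ ^ (-(1 / 2) : ℝ) := by
  have h0 : 0 < ‖z‖ := norm_pos_iff.2 hz
  have h1 := Complex.norm_le_abs_re_add_abs_im (Complex.log z)
  rw [Complex.log_re, Complex.log_im] at h1
  have h2 := Complex.abs_arg_le_pi z
  have h3 : |Real.log ‖z‖| ≤ ‖z‖ + 2 * ‖z‖ ^ (-(1 / 2) : ℝ) := by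
    rw [abs_le]
    have h4 := Real.log_le_self (x := ‖z‖ ^ (-(1 / 2) : ℝ)) (by positivity)
    rw [Real.log_rpow h0] at h4
    have h5 := Real.log_le_self h0.le
    have : 0 ≤ ‖z‖ ^ (-(1 / 2) : ℝ) := by positivity
    constructor <;> linarith
  linarith

/-- A majorant of the logarithms of the regularized denominators. -/
def logWeight (C M : ℝ) (p : Mink d) : ℂ :=
  (C : ℂ) * (((1 + ‖p‖) ^ 2 : ℝ) : ℂ) + 2 * ((|M + sq p| ^ (-(1 / 2) : ℝ) : ℝ) : ℂ)

lemma tame_logWeight (C : ℝ) {M : ℝ} (hM : 0 < M) : Tame (logWeight (d := d) C M) := by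
  have h1 : Tame fun p : Mink d => (C : ℂ) * (((1 + ‖p‖) ^ 2 : ℝ) : ℂ) :=
    (tame_one_add_norm_pow 2).mono (C := ‖(C : ℂ)‖) ((tame_one_add_norm_pow 2).1.const_mul _)
      (ae_of_all _ fun x => (norm_mul _ _).le)
  refine h1.add ?_
  obtain ⟨N, hN⟩ := integrable_massive_weight (d := d) hM
  have hm : Measurable fun p : Mink d => (2 : ℂ) * ((|M + sq p| ^ (-(1 / 2) : ℝ) : ℝ) : ℂ) :=
    ((((continuous_sq.const_add M).abs.measurable).pow_const _).complex_ofReal).const_mul _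
  refine ⟨hm.aestronglyMeasurable, N, (hN.const_mul 2).congr (ae_of_all _ fun x => ?_)⟩
  simp only
  rw [norm_mul, Complex.norm_real, Real.norm_of_nonneg (by positivity), Complex.norm_ofNat, mul_assoc]

/-- Regularizations `a ε` of `M + p²`, with the error term `e` in Euler's identity. -/
structure IsReg (M : ℝ) (a e : ℝ → Mink d → ℂ) (L : Mink d → ℂ) : Prop where
  slit : ∀ ε > 0, ∀ p, p 0 ≠ 0 → a ε p ∈ Complex.slitPlane
  meas : ∀ ε > 0, Measurable (a ε)
  meas_err : ∀ ε > 0, Measurable (e ε)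
  -- If a were exactly M plus a function homogeneous of degree 2, its dilation derivative would be
  -- 2(a - M)/l; e measures the failure.
  deriv : ∀ ε > 0, ∀ p, p 0 ≠ 0 → ∀ l : ℝ, 0 < l →
    HasDerivAt (fun l : ℝ => a ε (l • p)) ((l : ℂ)⁻¹ * (2 * a ε (l • p) - 2 * M + 2 * e ε (l • p))) l
  le_norm : ∀ ε > 0, ∀ p, |M + sq p| ≤ ‖a ε p‖
  norm_le : ∃ C, 0 ≤ C ∧ ∀ ε ∈ Set.Ioc (0 : ℝ) 1, ∀ p, ‖a ε p‖ ≤ C * (1 + ‖p‖) ^ 2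
  lower : ∀ ε > 0, ∃ δ > 0, ∀ p, p 0 ≠ 0 → δ ≤ ‖a ε p‖
  err_le : ∀ ε > 0, ∀ p, p 0 ≠ 0 → ‖e ε p‖ ≤ ‖a ε p‖
  err_tendsto : ∀ p, Tendsto (fun ε => e ε p) (𝓝[>] 0) (𝓝 0)
  log_tendsto : ∀ᵐ p, Tendsto (fun ε => Complex.log (a ε p)) (𝓝[>] 0) (𝓝 (L p))

namespace IsReg
variable {M : ℝ} {a e : ℝ → Mink d → ℂ} {L : Mink d → ℂ}

lemma integrable (h : IsReg M a e L) {ε : ℝ} (hε : 0 < ε) (ψ : 𝓢(Mink d, ℂ)) :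
    Integrable fun p => 1 / a ε p * ψ p := by
  obtain ⟨δ, hδ, hb⟩ := h.lower ε hε
  refine ψ.integrable.bdd_mul (c := δ⁻¹) ((h.meas ε hε).const_div 1).aestronglyMeasurable ?_
  filter_upwards [ae_time_ne_zero] with p hp
  rw [norm_div, norm_one, one_div]
  exact inv_anti₀ hδ (hb p hp)

/-- Euler's identity for log(a) ψ under dilations of all d coordinates. The derivative of log a
along dilations is 2 - 2M/a + 2e/a, so the term with 1/a can be solved for since M ≠ 0, leaving only
the integrable singularity of the logarithm. -/
lemma integral_eq (h : IsReg M a e L) (hM : 0 < M) {C : ℝ}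
    (hC : ∀ ε ∈ Set.Ioc (0 : ℝ) 1, ∀ p, p 0 ≠ 0 → M + sq p ≠ 0 → ‖Complex.log (a ε p)‖ ≤ ‖logWeight C M p‖) {ε : ℝ}
    (hε : ε ∈ Set.Ioc (0 : ℝ) 1) (ψ : 𝓢(Mink d, ℂ)) :
    2 * M * ∫ p, 1 / a ε p * ψ p = 2 * (∫ p, ψ p) + 2 * (∫ p, e ε p / a ε p * ψ p) +
      ∫ p, Complex.log (a ε p) * (eulerOp Finset.univ ψ + (d : ℂ) • ψ) p := by
  have hlogm : Measurable fun p => Complex.log (a ε p) := (h.meas ε hε.1).clog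
  have hlog : ∀ χ : 𝓢(Mink d, ℂ), Integrable fun p => Complex.log (a ε p) * χ p := fun χ => by
    refine ((tame_logWeight C hM).mono (C := 1) hlogm.aestronglyMeasurable ?_).integrable_mul χ
    filter_upwards [ae_time_ne_zero, ae_add_sq_ne_zero M] with p hp hp'
    rw [one_mul]; exact hC ε hε p hp hp'
  have i1 := h.integrable hε.1 ψ
  have i2 : Integrable fun p => e ε p / a ε p * ψ p := by
    refine ψ.integrable.bdd_mul (c := 1) ((h.meas_err ε hε.1).div (h.meas ε hε.1)).aestronglyMeasurable ?_
    filter_upwards [ae_time_ne_zero] with p hp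
    rw [norm_div]
    exact div_le_one_of_le₀ (h.err_le ε hε.1 p hp) (norm_nonneg _)
  set G : Mink d → ℂ := fun p => Complex.log (a ε p) * ψ p with hG
  set G' : Mink d → ℂ := fun p => Complex.log (a ε p) * eulerOp Finset.univ ψ p +
    (2 * ψ p - 2 * M * (1 / a ε p * ψ p) + 2 * (e ε p / a ε p * ψ p)) with hG'
  have j1 : Integrable fun p => 2 * ψ p - 2 * M * (1 / a ε p * ψ p) + 2 * (e ε p / a ε p * ψ p) :=
    ((ψ.integrable.const_mul 2).sub (i1.const_mul _)).add (i2.const_mul 2)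
  have hG'm : Measurable G' := by
    have := h.meas ε hε.1
    have := h.meas_err ε hε.1
    have := ψ.continuous.measurable
    have := (eulerOp Finset.univ ψ).continuous.measurable
    fun_prop
  have key := integral_euler Finset.univ (hlog ψ) ((hlog _).add j1 : Integrable G') hG'm (by
    filter_upwards [ae_time_ne_zero] with p hp
    have hd : ∀ l : ℝ, 0 < l → HasDerivAt (fun l : ℝ => G (dil Finset.univ l p)) ((l : ℂ)⁻¹ * G' (dil Finset.univ l p)) l :=
      fun l hl => by
      have hlp : (l • p) 0 ≠ 0 := by simp [hl.ne', hp]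
      have hs := h.slit ε hε.1 _ hlp
      have h1 := (h.deriv ε hε.1 p hp l hl).clog_real hs
      have h2 := hasDerivAt_schwartz_dil Finset.univ ψ p hl.ne'
      simp only [dil_univ] at h2 ⊢
      refine (h1.mul h2).congr_deriv ?_
      have h3 := Complex.slitPlane_ne_zero hs
      have h4 : (l : ℂ) ≠ 0 := by exact_mod_cast hl.ne'
      rw [hG']
      simp only
      field_simp
      ring
    exact ⟨fun l hl => (hd l (by linarith [hl.1])).continuousAt.continuousWithinAt, ∅, Set.countable_empty,
      fun l hl => hd l (by linarith [hl.1.1])⟩)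
  rw [hG', integral_add (hlog _) j1, integral_add (f := fun p => 2 * ψ p - 2 * M * (1 / a ε p * ψ p)) ((ψ.integrable.const_mul 2).sub (i1.const_mul _))
    (i2.const_mul 2), integral_sub (ψ.integrable.const_mul 2) (i1.const_mul _), integral_const_mul, integral_const_mul, integral_const_mul,
    Finset.card_univ, Fintype.card_fin] at key
  have e1 : ∫ p, Complex.log (a ε p) * (eulerOp Finset.univ ψ + (d : ℂ) • ψ) p =
      (∫ p, Complex.log (a ε p) * eulerOp Finset.univ ψ p) + d * ∫ p, Complex.log (a ε p) * ψ p := by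
    rw [← integral_const_mul, ← integral_add (hlog _) ((hlog _).const_mul _)]
    refine integral_congr_ae (ae_of_all _ fun p => ?_)
    simp only [add_apply, smul_apply, smul_eq_mul]
    ring
  rw [e1]
  linear_combination -key

/-- Dominated convergence in Euler's identity; the error term drops out since |e| ≤ |a| and e → 0.
The limit depends only on M and on the boundary value L of the logarithm, so two regularizations
with the same L have the same limit. -/
theorem tendsto (h : IsReg M a e L) (hM : 0 < M) (ψ : 𝓢(Mink d, ℂ)) :
    Tendsto (fun ε => ∫ p, 1 / a ε p * ψ p) (𝓝[>] 0) (𝓝 (1 / M * ((∫ p, ψ p) +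
      1 / 2 * ∫ p, L p * (eulerOp Finset.univ ψ + (d : ℂ) • ψ) p))) := by
  obtain ⟨C, hC0, hC⟩ := h.norm_le
  have hne : ∀ ε > 0, ∀ p, M + sq p ≠ 0 → a ε p ≠ 0 := fun ε hε p hp h0 => by
    have := h.le_norm ε hε p
    rw [h0, norm_zero] at this
    exact hp (abs_eq_zero.1 (le_antisymm this (abs_nonneg _)))
  have hlog : ∀ ε ∈ Set.Ioc (0 : ℝ) 1, ∀ p, p 0 ≠ 0 → M + sq p ≠ 0 →
      ‖Complex.log (a ε p)‖ ≤ ‖logWeight (Real.pi + C) M p‖ := fun ε hε p _ hp => by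
    refine (norm_log_le (hne ε hε.1 p hp)).trans ?_
    have h1 : ‖a ε p‖ ^ (-(1 / 2) : ℝ) ≤ |M + sq p| ^ (-(1 / 2) : ℝ) :=
      Real.rpow_le_rpow_of_nonpos (abs_pos.2 hp) (h.le_norm ε hε.1 p) (by norm_num)
    have h2 := hC ε hε p
    have h3 : (1 : ℝ) ≤ (1 + ‖p‖) ^ 2 := one_le_pow₀ (by linarith [norm_nonneg p])
    have h4 : logWeight (Real.pi + C) M p = ((((Real.pi + C) * (1 + ‖p‖) ^ 2 + 2 * |M + sq p| ^ (-(1 / 2) : ℝ)) : ℝ) : ℂ) := by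
      rw [logWeight]; push_cast; ring
    rw [h4, Complex.norm_real, Real.norm_of_nonneg (by positivity)]
    nlinarith [Real.pi_pos]
  have hev : ∀ᶠ ε in 𝓝[>] (0 : ℝ), ε ∈ Set.Ioc (0 : ℝ) 1 := Ioc_mem_nhdsGT one_pos
  have t1 : Tendsto (fun ε => ∫ p, e ε p / a ε p * ψ p) (𝓝[>] 0) (𝓝 0) := by
    rw [← integral_zero (Mink d) ℂ]
    refine tendsto_integral_filter_of_dominated_convergence (fun p => ‖ψ p‖) ?_ ?_ ψ.integrable.norm ?_
    · filter_upwards [hev] with ε hε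
      exact (((h.meas_err ε hε.1).div (h.meas ε hε.1)).mul ψ.continuous.measurable).aestronglyMeasurable
    · filter_upwards [hev] with ε hε
      filter_upwards [ae_time_ne_zero] with p hp
      rw [norm_mul, norm_div]
      exact mul_le_of_le_one_left (norm_nonneg _) (div_le_one_of_le₀ (h.err_le ε hε.1 p hp) (norm_nonneg _))
    · filter_upwards [ae_add_sq_ne_zero M] with p hp
      rw [← zero_mul (ψ p)]
      refine Tendsto.mul_const _ (squeeze_zero_norm' (a := fun ε => ‖e ε p‖ / |M + sq p|) ?_ ?_)
      · filter_upwards [hev] with ε hε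
        rw [norm_div]
        exact div_le_div_of_nonneg_left (norm_nonneg _) (abs_pos.2 hp) (h.le_norm ε hε.1 p)
      · simpa using ((h.err_tendsto p).norm.div_const |M + sq p|)
  have t2 : ∀ χ : 𝓢(Mink d, ℂ), Tendsto (fun ε => ∫ p, Complex.log (a ε p) * χ p) (𝓝[>] 0) (𝓝 (∫ p, L p * χ p)) := fun χ => by
    refine tendsto_integral_filter_of_dominated_convergence (fun p => ‖logWeight (Real.pi + C) M p * χ p‖) ?_ ?_
      ((tame_logWeight _ hM).integrable_mul χ).norm ?_
    · filter_upwards [hev] with ε hε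
      exact ((h.meas ε hε.1).clog.mul χ.continuous.measurable).aestronglyMeasurable
    · filter_upwards [hev] with ε hε
      filter_upwards [ae_time_ne_zero, ae_add_sq_ne_zero M] with p hp hp'
      rw [norm_mul, norm_mul]
      exact mul_le_mul_of_nonneg_right (hlog ε hε p hp hp') (norm_nonneg _)
    · filter_upwards [h.log_tendsto] with p hp
      exact hp.mul_const _
  have hM' : (M : ℂ) ≠ 0 := by exact_mod_cast hM.ne'
  have t3 := (((tendsto_const_nhds (x := 2 * (∫ p, ψ p))).add (t1.const_mul 2)).add
    (t2 (eulerOp Finset.univ ψ + (d : ℂ) • ψ))).const_mul (1 / (2 * (M : ℂ)))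
  refine (t3.congr' ?_).trans (le_of_eq ?_)
  · filter_upwards [hev] with ε hε
    rw [← h.integral_eq hM hlog hε ψ]
    field_simp
  · congr 1; field_simp; ring

end IsReg

end

/-! ### Two regularizations of the resolvent with the same limit -/

section
variable {d : ℕ} [NeZero d] {m : ℝ}

/-- The boundary value of the logarithm from the side `τ` of the real axis. -/
def logLim (τ x : ℝ) : ℂ := (Real.log |x| : ℂ) + if 0 < x then 0 else (τ * Real.pi : ℝ) * Complex.I

lemma tendsto_clog_logLim {τ x : ℝ} (hτ : τ = 1 ∨ τ = -1) (hx : x ≠ 0) {a : ℝ → ℂ} (ha : Tendsto a (𝓝[>] 0) (𝓝 x))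
    (him : ∀ᶠ ε in 𝓝[>] 0, 0 < τ * (a ε).im) : Tendsto (fun ε => Complex.log (a ε)) (𝓝[>] 0) (𝓝 (logLim τ x)) := by
  rw [logLim]
  rcases hx.lt_or_gt with hx | hx
  · rw [if_neg hx.not_gt]
    rcases hτ with rfl | rfl
    · have h := Complex.tendsto_log_nhdsWithin_im_nonneg_of_re_neg_of_im_zero (z := x) (by simpa using hx) (by simp)
      rw [Complex.norm_real, Real.norm_eq_abs] at h
      simp only [one_mul] at him ⊢
      exact h.comp (tendsto_nhdsWithin_iff.2 ⟨ha, him.mono fun _ h => h.le⟩)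
    · have h := Complex.tendsto_log_nhdsWithin_im_neg_of_re_neg_of_im_zero (z := x) (by simpa using hx) (by simp)
      rw [Complex.norm_real, Real.norm_eq_abs, sub_eq_add_neg] at h
      simp only [neg_mul, one_mul, Complex.ofReal_neg] at him ⊢
      exact h.comp (tendsto_nhdsWithin_iff.2 ⟨ha, him.mono fun _ h => by simpa using h⟩)
  · rw [if_pos hx, add_zero, abs_of_pos hx, Complex.ofReal_log hx.le]
    exact ha.clog (Or.inl (by simpa using hx))

lemma sign_smul {l t : ℝ} (hl : 0 < l) : Real.sign (l * t) = Real.sign t := by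
  rcases lt_trichotomy t 0 with h | h | h
  · rw [Real.sign_of_neg h, Real.sign_of_neg (mul_neg_of_pos_of_neg hl h)]
  · rw [h, mul_zero]
  · rw [Real.sign_of_pos h, Real.sign_of_pos (mul_pos hl h)]

lemma measurable_sign : Measurable Real.sign := by
  unfold Real.sign
  exact Measurable.ite measurableSet_Iio measurable_const (Measurable.ite measurableSet_Ioi measurable_const measurable_const)

lemma sq_smul (l : ℝ) (p : Mink d) : sq (l • p) = l ^ 2 * sq p := by
  rw [← dil_univ, sq, lorentz, sq, lorentz, mul_add, Finset.mul_sum]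
  congr 1
  · simp [dil_apply]; ring
  · exact Finset.sum_congr rfl fun i _ => by simp [dil_apply]; ring

lemma hasDerivAt_sq_smul (p : Mink d) (l : ℝ) : HasDerivAt (fun l : ℝ => ((sq (l • p) : ℝ) : ℂ)) ((2 * l * sq p : ℝ) : ℂ) l := by
  simp only [sq_smul]
  exact ((((hasDerivAt_pow 2 l).mul_const (sq p))).congr_deriv (by simp)).ofReal_comp

lemma sq_abs_one {s : ℝ} (hs : s = 1 ∨ s = -1) : s ^ 2 = 1 := by rcases hs with rfl | rfl <;> norm_num

lemma abs_sign {t : ℝ} (ht : t ≠ 0) : |Real.sign t| = 1 := by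
  rcases Real.sign_apply_eq_of_ne_zero t ht with h | h <;> rw [h] <;> norm_num

/-- The denominator `m² + p² - s i ε sgn p⁰`. -/
def signDen (m s ε : ℝ) (p : Mink d) : ℂ := (m : ℂ) ^ 2 + (sq p : ℂ) - (s * ε * Real.sign (p 0) : ℝ) * Complex.I

/-- The denominator `ω² - (p⁰ + s i η)²`. -/
def shiftDen (m s η : ℝ) (p : Mink d) : ℂ := ((m ^ 2 + sq p + η ^ 2 : ℝ) : ℂ) - (2 * s * η * p 0 : ℝ) * Complex.I

/-- The common boundary value of the logarithms of the denominators. -/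
def signLog (m s : ℝ) (p : Mink d) : ℂ := logLim (-(s * Real.sign (p 0))) (m ^ 2 + sq p)

lemma signDen_re (m s ε : ℝ) (p : Mink d) : (signDen m s ε p).re = m ^ 2 + sq p := by
  simp [signDen, ← Complex.ofReal_pow]

lemma signDen_im (m s ε : ℝ) (p : Mink d) : (signDen m s ε p).im = -(s * ε * Real.sign (p 0)) := by
  simp [signDen, ← Complex.ofReal_pow]

lemma shiftDen_re (m s ε : ℝ) (p : Mink d) : (shiftDen m s ε p).re = m ^ 2 + sq p + ε ^ 2 := by
  simp only [shiftDen, Complex.sub_re, Complex.ofReal_re, Complex.re_ofReal_mul, Complex.I_re, mul_zero, sub_zero]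

lemma shiftDen_im (m s ε : ℝ) (p : Mink d) : (shiftDen m s ε p).im = -(2 * s * ε * p 0) := by
  simp only [shiftDen, Complex.sub_im, Complex.ofReal_im, Complex.im_ofReal_mul, Complex.I_im, mul_one, zero_sub]

lemma sign_side {s t : ℝ} (hs : s = 1 ∨ s = -1) (ht : t ≠ 0) : -(s * Real.sign t) = 1 ∨ -(s * Real.sign t) = -1 := by
  rcases hs with rfl | rfl <;> rcases Real.sign_apply_eq_of_ne_zero t ht with h | h <;> rw [h] <;> norm_num

lemma norm_mink_bound (p : Mink d) : |m ^ 2 + sq p| ≤ m ^ 2 + (1 + ‖p‖) ^ 2 := by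
  have h1 := abs_le.1 (abs_sq_le p)
  have := norm_nonneg p
  have := sq_nonneg m
  rw [abs_le]
  constructor <;> nlinarith

/-- The sign of p⁰ is invariant under positive dilations, so the error term is exactly the imaginary
regularization. It jumps at p⁰ = 0, a null set. -/
theorem isReg_signDen (hm : 0 < m) {s : ℝ} (hs : s = 1 ∨ s = -1) :
    IsReg (m ^ 2) (signDen (d := d) m s) (fun ε p => (s * ε * Real.sign (p 0) : ℝ) * Complex.I) (signLog m s) := by
  have hs1 : |s| = 1 := by rcases hs with rfl | rfl <;> norm_num
  have hs0 : s ≠ 0 := by rcases hs with rfl | rfl <;> norm_num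
  have habs : ∀ ε > 0, ∀ p : Mink d, p 0 ≠ 0 → |s * ε * Real.sign (p 0)| = ε := fun ε hε p hp => by
    rw [abs_mul, abs_mul, hs1, abs_sign hp, abs_of_pos hε, one_mul, mul_one]
  have hms : Measurable fun p : Mink d => Real.sign (p 0) := measurable_sign.comp (by fun_prop)
  have hme : ∀ ε : ℝ, Measurable fun p : Mink d => ((s * ε * Real.sign (p 0) : ℝ) : ℂ) * Complex.I := fun ε =>
    (hms.const_mul (s * ε)).complex_ofReal.mul_const _
  refine ⟨fun ε hε p hp => ?_, fun ε hε => ?_, fun ε hε => hme ε, fun ε hε p hp l hl => ?_, fun ε hε p => ?_,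
    ⟨m ^ 2 + 2, by positivity, fun ε hε p => ?_⟩, fun ε hε => ⟨ε, hε, fun p hp => ?_⟩, fun ε hε p hp => ?_,
    fun p => ?_, ?_⟩
  · refine Complex.mem_slitPlane_iff.2 (Or.inr ?_)
    rw [signDen_im, neg_ne_zero]
    exact mul_ne_zero (mul_ne_zero hs0 hε.ne') (by simpa [Real.sign_eq_zero_iff] using hp)
  · exact (continuous_sq.measurable.complex_ofReal.const_add _).sub (hme ε)
  · have h1 : (fun l : ℝ => signDen m s ε (l • p)) =ᶠ[𝓝 l]
        fun l => (m : ℂ) ^ 2 + ((sq (l • p) : ℝ) : ℂ) - (s * ε * Real.sign (p 0) : ℝ) * Complex.I := by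
      filter_upwards [lt_mem_nhds hl] with l hl
      rw [signDen, PiLp.smul_apply, smul_eq_mul, sign_smul hl]
    refine ((((hasDerivAt_sq_smul p l).const_add _).sub_const _).congr_of_eventuallyEq h1).congr_deriv ?_
    rw [signDen, sq_smul, PiLp.smul_apply, smul_eq_mul, sign_smul hl]
    have : (l : ℂ) ≠ 0 := by exact_mod_cast hl.ne'
    push_cast
    field_simp
    ring
  · rw [← signDen_re m s ε p]; exact Complex.abs_re_le_norm _
  · refine (Complex.norm_le_abs_re_add_abs_im _).trans ?_
    rw [signDen_re, signDen_im, abs_neg]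
    have h1 : |s * ε * Real.sign (p 0)| ≤ 1 := by
      by_cases hp : p 0 = 0
      · simp [hp]
      · rw [habs ε hε.1 p hp]; exact hε.2
    have h2 : (1 : ℝ) ≤ (1 + ‖p‖) ^ 2 := one_le_pow₀ (by linarith [norm_nonneg p])
    nlinarith [norm_mink_bound (m := m) p, sq_nonneg m]
  · have := Complex.abs_im_le_norm (signDen m s ε p)
    rwa [signDen_im, abs_neg, habs ε hε p hp] at this
  · have := Complex.abs_im_le_norm (signDen m s ε p)
    rw [signDen_im, abs_neg] at this
    rwa [norm_mul, Complex.norm_I, mul_one, Complex.norm_real, Real.norm_eq_abs]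
  · have : Continuous fun ε : ℝ => ((s * ε * Real.sign (p 0) : ℝ) : ℂ) * Complex.I := by fun_prop
    simpa using (this.tendsto 0).mono_left nhdsWithin_le_nhds
  · filter_upwards [ae_time_ne_zero, ae_add_sq_ne_zero (m ^ 2)] with p hp hp'
    refine tendsto_clog_logLim (sign_side hs hp) hp' ?_ ?_
    · have : Continuous fun ε : ℝ => signDen m s ε p := by unfold signDen; fun_prop
      simpa [signDen] using (this.tendsto 0).mono_left nhdsWithin_le_nhds
    · filter_upwards [self_mem_nhdsWithin] with ε (hε : 0 < ε)
      rw [signDen_im]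
      have : (s * Real.sign (p 0)) ^ 2 = 1 := by rw [← sq_abs, abs_mul, hs1, abs_sign hp]; norm_num
      nlinarith

lemma sq_ge_neg (p : Mink d) : -(p 0) ^ 2 ≤ sq p := by
  rw [sq_eq]; linarith [rsq_nonneg p]

lemma norm_le_norm_of_sq {z w : ℂ} (h : z.re * z.re + z.im * z.im ≤ w.re * w.re + w.im * w.im) : ‖z‖ ≤ ‖w‖ := by
  rw [← Complex.normSq_apply, ← Complex.normSq_apply, Complex.normSq_eq_norm_sq, Complex.normSq_eq_norm_sq] at h
  exact (pow_le_pow_iff_left₀ (norm_nonneg _) (norm_nonneg _) two_ne_zero).1 h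

/-- The shifted denominator approaches the real axis from the side -s sgn p⁰, as `signDen` does, so
its logarithm has the same boundary value. -/
theorem isReg_shiftDen (hm : 0 < m) {s : ℝ} (hs : s = 1 ∨ s = -1) :
    IsReg (m ^ 2) (shiftDen (d := d) m s) (fun η p => ((-η ^ 2 : ℝ) : ℂ) + (s * η * p 0 : ℝ) * Complex.I) (signLog m s) := by
  have hs1 := sq_abs_one hs
  have hs0 : s ≠ 0 := by rcases hs with rfl | rfl <;> norm_num
  -- With X = m² + p² ≥ -(p⁰)², the square of the modulus is (X + η²)² + 4η²(p⁰)² ≥ X² + η⁴ +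
  -- 2η²(p⁰)². This single estimate gives the lower bounds by |X|, by η² and by the error term.
  have key : ∀ (η : ℝ) (p : Mink d) (b : ℝ), b * b ≤ max ((m ^ 2 + sq p) ^ 2) (η ^ 2 * η ^ 2) ∨
      b * b = η ^ 2 * η ^ 2 + (η * p 0) ^ 2 → b * b ≤ (shiftDen m s η p).re * (shiftDen m s η p).re +
      (shiftDen m s η p).im * (shiftDen m s η p).im := fun η p b hb => by
    rw [shiftDen_re, shiftDen_im]
    have h1 := sq_ge_neg p
    have h2 : -(p 0) ^ 2 * η ^ 2 ≤ (m ^ 2 + sq p) * η ^ 2 :=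
      mul_le_mul_of_nonneg_right (by nlinarith [sq_nonneg m]) (sq_nonneg η)
    have h3 : (-(2 * s * η * p 0)) * (-(2 * s * η * p 0)) = 4 * (η * p 0) ^ 2 := by
      linear_combination (4 * (η * p 0) ^ 2) * hs1
    rw [h3]
    have h4 := sq_nonneg (m ^ 2 + sq p)
    have h5 := sq_nonneg (η ^ 2)
    rcases hb with hb | hb
    · rcases le_max_iff.1 hb with hb | hb <;> nlinarith [sq_nonneg (η * p 0)]
    · rw [hb]; nlinarith [sq_nonneg (η * p 0)]
  have hnorm : ∀ (η : ℝ) (p : Mink d) (b : ℝ), 0 ≤ b → b * b ≤ max ((m ^ 2 + sq p) ^ 2) (η ^ 2 * η ^ 2) →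
      b ≤ ‖shiftDen m s η p‖ := fun η p b hb0 hb => by
    have := norm_le_norm_of_sq (z := b) (w := shiftDen m s η p) (by simpa using key η p b (Or.inl hb))
    rwa [Complex.norm_real, Real.norm_of_nonneg hb0] at this
  have hmt : Measurable fun p : Mink d => p 0 := by fun_prop
  refine ⟨fun η hη p hp => ?_, fun η hη => ?_, fun η hη => ?_, fun η hη p hp l hl => ?_, fun η hη p => ?_,
    ⟨m ^ 2 + 4, by positivity, fun η hη p => ?_⟩, fun η hη => ⟨η ^ 2, by positivity, fun p hp => ?_⟩, fun η hη p hp => ?_,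
    fun p => ?_, ?_⟩
  · refine Complex.mem_slitPlane_iff.2 (Or.inr ?_)
    rw [shiftDen_im, neg_ne_zero]
    exact mul_ne_zero (mul_ne_zero (mul_ne_zero two_ne_zero hs0) hη.ne') hp
  · exact (((continuous_sq.measurable.const_add _).add_const _).complex_ofReal).sub ((hmt.const_mul _).complex_ofReal.mul_const _)
  · exact ((hmt.const_mul _).complex_ofReal.mul_const _).const_add _
  · have h1 : (fun l : ℝ => shiftDen m s η (l • p)) =
        fun l : ℝ => (m : ℂ) ^ 2 + (η : ℂ) ^ 2 + ((sq (l • p) : ℝ) : ℂ) - ((2 * s * η * p 0 : ℝ) * Complex.I) * (l : ℂ) := by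
      funext l
      rw [shiftDen, PiLp.smul_apply, smul_eq_mul]; push_cast; ring
    have h2 : HasDerivAt (fun l : ℝ => ((2 * s * η * p 0 : ℝ) * Complex.I) * (l : ℂ)) ((2 * s * η * p 0 : ℝ) * Complex.I) l := by
      simpa using (hasDerivAt_id l).ofReal_comp.const_mul (((2 * s * η * p 0 : ℝ) : ℂ) * Complex.I)
    rw [h1]
    refine (((hasDerivAt_sq_smul p l).const_add _).sub h2).congr_deriv ?_
    rw [shiftDen, sq_smul, PiLp.smul_apply, smul_eq_mul]
    have : (l : ℂ) ≠ 0 := by exact_mod_cast hl.ne'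
    push_cast
    field_simp
    ring
  · refine hnorm η p _ (abs_nonneg _) (le_max_of_le_left ?_)
    exact (abs_mul_abs_self _).le.trans (pow_two _).ge
  · refine (Complex.norm_le_abs_re_add_abs_im _).trans ?_
    rw [shiftDen_re, shiftDen_im, abs_neg]
    have h1 : |2 * s * η * p 0| ≤ 2 * ‖p‖ := by
      rw [abs_mul, abs_mul, abs_mul, abs_of_pos hη.1, abs_two, ← Real.sqrt_sq_eq_abs s, hs1, Real.sqrt_one]
      nlinarith [abs_time_le p, hη.2, hη.1, abs_nonneg (p 0), norm_nonneg p]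
    have h2 : (1 : ℝ) ≤ (1 + ‖p‖) ^ 2 := one_le_pow₀ (by linarith [norm_nonneg p])
    have h3 := abs_add_le (m ^ 2 + sq p) (η ^ 2)
    rw [abs_of_nonneg (sq_nonneg η)] at h3
    have h4 : η ^ 2 ≤ 1 := by nlinarith [hη.1, hη.2]
    have h5 : 2 * ‖p‖ ≤ (1 + ‖p‖) ^ 2 := by nlinarith [sq_nonneg ‖p‖]
    have h6 := norm_mink_bound (m := m) p
    have h7 : m ^ 2 ≤ m ^ 2 * (1 + ‖p‖) ^ 2 := le_mul_of_one_le_right (sq_nonneg m) h2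
    linarith
  · exact hnorm η p _ (by positivity) (le_max_right _ _)
  · refine norm_le_norm_of_sq ?_
    refine le_trans (le_of_eq ?_) (key η p √(η ^ 2 * η ^ 2 + (η * p 0) ^ 2) (Or.inr (Real.mul_self_sqrt (by positivity))))
    rw [Real.mul_self_sqrt (by positivity)]
    simp only [Complex.add_re, Complex.add_im, Complex.ofReal_re, Complex.ofReal_im, Complex.re_ofReal_mul,
      Complex.im_ofReal_mul, Complex.I_re, Complex.I_im]
    linear_combination ((η * p 0) ^ 2) * hs1
  · have : Continuous fun η : ℝ => ((-η ^ 2 : ℝ) : ℂ) + (s * η * p 0 : ℝ) * Complex.I := by fun_prop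
    simpa using (this.tendsto 0).mono_left nhdsWithin_le_nhds
  · filter_upwards [ae_time_ne_zero, ae_add_sq_ne_zero (m ^ 2)] with p hp hp'
    refine tendsto_clog_logLim (sign_side hs hp) hp' ?_ ?_
    · have : Continuous fun η : ℝ => shiftDen m s η p := by unfold shiftDen; fun_prop
      simpa [shiftDen] using (this.tendsto 0).mono_left nhdsWithin_le_nhds
    · filter_upwards [self_mem_nhdsWithin] with η (hη : 0 < η)
      rw [shiftDen_im]
      have h1 := Real.sign_mul_pos_of_ne_zero (p 0) hp
      have h2 : -(s * Real.sign (p 0)) * -(2 * s * η * p 0) = 2 * η * (Real.sign (p 0) * p 0) := by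
        linear_combination (2 * η * (Real.sign (p 0) * p 0)) * hs1
      rw [h2]; positivity

end

section
open LineDeriv

/-! ### Hadamard quotients -/

lemma iteratedDeriv_of_hasDerivAt {f : ℕ → ℝ → ℂ} (hf : ∀ n u, HasDerivAt (f n) (f (n + 1) u) u) (n : ℕ) :
    iteratedDeriv n (f 0) = f n := by
  induction n with
  | zero => simp
  | succ n ih => rw [iteratedDeriv_succ, ih]; exact funext fun u => (hf n u).deriv

lemma hasTemperateGrowth_of_hasDerivAt {f : ℕ → ℝ → ℂ} (hf : ∀ n u, HasDerivAt (f n) (f (n + 1) u) u)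
    (hb : ∀ n, ∃ (k : ℕ) (C : ℝ), ∀ u, ‖f n u‖ ≤ C * (1 + ‖u‖) ^ k) : (f 0).HasTemperateGrowth := by
  refine ⟨contDiff_of_differentiable_iteratedDeriv fun n _ u => ?_, fun n => ?_⟩
  · rw [iteratedDeriv_of_hasDerivAt hf]; exact (hf n u).differentiableAt
  · obtain ⟨k, C, h⟩ := hb n
    exact ⟨k, C, fun u => by rw [norm_iteratedFDeriv_eq_norm_iteratedDeriv, iteratedDeriv_of_hasDerivAt hf]; exact h u⟩

/-- Hadamard's lemma for functions of temperate growth. -/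
lemma exists_hadamard {g : ℝ → ℂ} (hg : g.HasTemperateGrowth) (τ : ℝ) :
    ∃ q : ℝ → ℂ, q.HasTemperateGrowth ∧ ∀ u, g u = g τ + ((u - τ : ℝ) : ℂ) * q u := by
  have hder : ∀ n v, HasDerivAt (iteratedDeriv n g) (iteratedDeriv (n + 1) g v) v := fun n v => by
    rw [iteratedDeriv_succ]
    exact ((hg.1.differentiable_iteratedDeriv n (by exact_mod_cast WithTop.coe_lt_top _)).differentiableAt).hasDerivAt
  have hcont : ∀ n, Continuous (iteratedDeriv n g) := fun n =>
    continuous_iff_continuousAt.2 fun v => (hder n v).continuousAt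
  -- q 0 is the quotient ∫₀¹ g'(τ + θ(u-τ)) dθ, and q n is its n-th derivative, with the chain rule
  -- factor θⁿ.
  set q : ℕ → ℝ → ℂ := fun n u => ∫ θ in (0 : ℝ)..1, (θ : ℂ) ^ n * iteratedDeriv (n + 1) g (τ + θ * (u - τ)) with hq
  have hF : ∀ n k u, Continuous fun θ : ℝ => (θ : ℂ) ^ k * iteratedDeriv n g (τ + θ * (u - τ)) := fun n k u =>
    (Complex.continuous_ofReal.pow k).mul ((hcont n).comp (by fun_prop))
  have hle : ∀ θ ∈ Set.uIoc (0 : ℝ) 1, ∀ u, ‖τ + θ * (u - τ)‖ ≤ |τ| + |u| := fun θ hθ u => by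
    rw [Set.uIoc_of_le zero_le_one] at hθ
    rw [show τ + θ * (u - τ) = (1 - θ) * τ + θ * u by ring, Real.norm_eq_abs]
    refine (abs_add_le _ _).trans ?_
    rw [abs_mul, abs_mul, abs_of_nonneg (by linarith [hθ.2] : 0 ≤ 1 - θ), abs_of_pos hθ.1]
    exact add_le_add (mul_le_of_le_one_left (abs_nonneg _) (by linarith [hθ.1])) (mul_le_of_le_one_left (abs_nonneg _) hθ.2)
  have hpow : ∀ θ ∈ Set.uIoc (0 : ℝ) 1, ∀ n : ℕ, ‖(θ : ℂ) ^ n‖ ≤ 1 := fun θ hθ n => by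
    rw [Set.uIoc_of_le zero_le_one] at hθ
    rw [norm_pow, Complex.norm_real, Real.norm_of_nonneg hθ.1.le]
    exact pow_le_one₀ hθ.1.le hθ.2
  have hbd : ∀ n, ∃ (k : ℕ) (C : ℝ), 0 ≤ C ∧ ∀ i, ∀ θ ∈ Set.uIoc (0 : ℝ) 1, ∀ u,
      ‖(θ : ℂ) ^ i * iteratedDeriv n g (τ + θ * (u - τ))‖ ≤ C * (1 + (|τ| + |u|)) ^ k := fun n => by
    obtain ⟨k, C, h⟩ := hg.2 n
    have hC : 0 ≤ C := by simpa using (norm_nonneg _).trans (h 0)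
    refine ⟨k, C, hC, fun i θ hθ u => ?_⟩
    rw [norm_mul]
    refine (mul_le_of_le_one_left (norm_nonneg _) (hpow θ hθ i)).trans ?_
    rw [← norm_iteratedFDeriv_eq_norm_iteratedDeriv]
    refine (h _).trans ?_
    gcongr
    exact hle θ hθ u
  refine ⟨q 0, hasTemperateGrowth_of_hasDerivAt (f := q) (fun n u => ?_) (fun n => ?_), fun u => ?_⟩
  · obtain ⟨k, C, hC, h⟩ := hbd (n + 2)
    refine (intervalIntegral.hasDerivAt_integral_of_dominated_loc_of_deriv_le (s := Metric.ball u 1)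
      (F' := fun u θ => (θ : ℂ) ^ (n + 1) * iteratedDeriv (n + 2) g (τ + θ * (u - τ)))
      (bound := fun _ => C * (1 + (|τ| + (|u| + 1))) ^ k) (Metric.ball_mem_nhds u one_pos)
      (Eventually.of_forall fun v => (hF _ _ v).aestronglyMeasurable) ((hF _ _ u).intervalIntegrable _ _)
      (hF _ _ u).aestronglyMeasurable (ae_of_all _ fun θ hθ v hv => (h _ θ hθ v).trans ?_) intervalIntegrable_const
      (ae_of_all _ fun θ hθ v hv => ?_)).2
    · have : |v| ≤ |u| + 1 := by
        have h1 : |v - u| < 1 := by simpa [Real.dist_eq] using hv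
        have h2 := abs_add_le (v - u) u
        rw [sub_add_cancel] at h2
        linarith
      gcongr
    · have h1 : HasDerivAt (fun v : ℝ => τ + θ * (v - τ)) θ v := by
        simpa using (((hasDerivAt_id v).sub_const τ).const_mul θ).const_add τ
      refine ((HasDerivAt.scomp v (hder (n + 1) _) h1).const_mul ((θ : ℂ) ^ n)).congr_deriv ?_
      rw [Complex.real_smul, pow_succ]; ring
  · obtain ⟨k, C, hC, h⟩ := hbd (n + 1)
    refine ⟨k, C * (1 + |τ|) ^ k, fun u => ?_⟩
    refine (intervalIntegral.norm_integral_le_of_norm_le_const fun θ hθ => h n θ hθ u).trans ?_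
    rw [sub_zero, abs_one, mul_one, mul_assoc, ← mul_pow, Real.norm_eq_abs]
    gcongr
    nlinarith [abs_nonneg τ, abs_nonneg u]
  · have h1 : ∀ θ : ℝ, HasDerivAt (fun θ : ℝ => g (τ + θ * (u - τ))) (((u - τ : ℝ) : ℂ) *
        ((θ : ℂ) ^ 0 * iteratedDeriv 1 g (τ + θ * (u - τ)))) θ := fun θ => by
      have h1 : HasDerivAt (fun θ : ℝ => τ + θ * (u - τ)) (u - τ) θ := by
        simpa using ((hasDerivAt_id θ).mul_const (u - τ)).const_add τ
      refine (HasDerivAt.scomp θ (hder 0 _) h1).congr_deriv ?_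
      rw [Complex.real_smul, pow_zero, one_mul]
    have h2 := intervalIntegral.integral_eq_sub_of_hasDerivAt (fun θ _ => h1 θ)
      (((hF 1 0 u).const_mul _).intervalIntegrable 0 1)
    rw [intervalIntegral.integral_const_mul] at h2
    simp only [one_mul, zero_mul, add_zero, add_sub_cancel] at h2
    rw [hq]
    simp only [zero_add]
    rw [h2]; ring

variable {d : ℕ} [NeZero d] {m : ℝ}

/-! ### The propagator as a Laplace transform in time -/

/-- The energy `√(m² + 𝐩²)`. -/
def energy (m : ℝ) (p : Mink d) : ℝ := √(m ^ 2 + rsq p)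

lemma energy_sq (p : Mink d) : energy m p ^ 2 = m ^ 2 + rsq p :=
  Real.sq_sqrt (add_nonneg (sq_nonneg _) (rsq_nonneg p))

lemma le_energy (p : Mink d) : m ≤ energy m p :=
  Real.le_sqrt_of_sq_le (by linarith [rsq_nonneg p])

lemma continuous_energy : Continuous (energy m : Mink d → ℝ) := by
  unfold energy
  have := continuous_rsq (d := d)
  fun_prop

/-- The kernel `e^{s i p⁰ t} sin(ω t) / ω`. -/
def waveKer (m s t : ℝ) (p : Mink d) : ℂ :=
  Complex.exp (Complex.I * (s * t * p 0 : ℝ)) * ((Real.sin (energy m p * t) / energy m p : ℝ) : ℂ)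

lemma norm_waveKer_le (hm : 0 < m) (s t : ℝ) (p : Mink d) : ‖waveKer m s t p‖ ≤ m⁻¹ := by
  have h := le_energy (m := m) p
  rw [waveKer, norm_mul, mul_comm Complex.I, Complex.norm_exp_ofReal_mul_I, one_mul, Complex.norm_real, Real.norm_eq_abs,
    abs_div, abs_of_pos (hm.trans_le h), div_eq_mul_inv]
  have h1 := Real.abs_sin_le_one (energy m p * t)
  have h2 : (energy m p)⁻¹ ≤ m⁻¹ := inv_anti₀ hm h
  calc _ ≤ 1 * m⁻¹ := mul_le_mul h1 h2 (inv_nonneg.2 (hm.le.trans h)) zero_le_one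
    _ = _ := one_mul _

lemma continuous_waveKer (hm : 0 < m) (s : ℝ) : Continuous fun q : ℝ × Mink d => waveKer m s q.1 q.2 := by
  have h1 : Continuous fun q : ℝ × Mink d => energy m q.2 := continuous_energy.comp continuous_snd
  have h2 : ∀ q : ℝ × Mink d, energy m q.2 ≠ 0 := fun q => (hm.trans_le (le_energy _)).ne'
  unfold waveKer
  have h3 : Continuous fun q : ℝ × Mink d => Real.sin (energy m q.2 * q.1) / energy m q.2 := by fun_prop (disch := exact h2)
  fun_prop

/-- `∫ e^{s i p⁰ t} sin(ω t) / ω ψ(p) dp`. -/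
def wave (m s : ℝ) (ψ : 𝓢(Mink d, ℂ)) (t : ℝ) : ℂ := ∫ p, waveKer m s t p * ψ p

lemma integrable_waveKer_mul (hm : 0 < m) (s t : ℝ) (ψ : 𝓢(Mink d, ℂ)) : Integrable fun p => waveKer m s t p * ψ p :=
  ψ.integrable.bdd_mul (c := m⁻¹) ((continuous_waveKer hm s).comp (Continuous.prodMk_right t)).aestronglyMeasurable
    (ae_of_all _ fun p => norm_waveKer_le hm s t p)

lemma norm_wave_le (hm : 0 < m) (s t : ℝ) (ψ : 𝓢(Mink d, ℂ)) : ‖wave m s ψ t‖ ≤ m⁻¹ * ∫ p, ‖ψ p‖ := by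
  rw [← integral_const_mul]
  refine norm_integral_le_of_norm_le (ψ.integrable.norm.const_mul _) (ae_of_all _ fun p => ?_)
  rw [norm_mul]
  exact mul_le_mul_of_nonneg_right (norm_waveKer_le hm s t p) (norm_nonneg _)

lemma continuous_wave (hm : 0 < m) (s : ℝ) (ψ : 𝓢(Mink d, ℂ)) : Continuous (wave m s ψ) := by
  refine continuous_of_dominated (bound := fun p => m⁻¹ * ‖ψ p‖) (fun t => (integrable_waveKer_mul hm s t ψ).1)
    (fun t => ae_of_all _ fun p => ?_) (ψ.integrable.norm.const_mul _) (ae_of_all _ fun p => ?_)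
  · rw [norm_mul]
    exact mul_le_mul_of_nonneg_right (norm_waveKer_le hm s t p) (norm_nonneg _)
  · exact ((continuous_waveKer hm s).comp (Continuous.prodMk_left p)).mul continuous_const

lemma wave_add (hm : 0 < m) (s t : ℝ) (ψ χ : 𝓢(Mink d, ℂ)) : wave m s (ψ + χ) t = wave m s ψ t + wave m s χ t := by
  rw [wave, wave, wave, ← integral_add (integrable_waveKer_mul hm s t ψ) (integrable_waveKer_mul hm s t χ)]
  simp only [add_apply, mul_add]

lemma wave_smul (s t : ℝ) (c : ℂ) (ψ : 𝓢(Mink d, ℂ)) : wave m s (c • ψ) t = c * wave m s ψ t := by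
  rw [wave, wave, ← integral_const_mul]
  refine integral_congr_ae (ae_of_all _ fun p => ?_)
  simp only [smul_apply, smul_eq_mul]; ring

/-- The Laplace transform of sin(ωt)/ω is 1/(ω² + z²), evaluated at z = η - isp⁰, where z² = -(p⁰ +
isη)². -/
lemma integral_exp_waveKer (hm : 0 < m) {s : ℝ} (hs : s = 1 ∨ s = -1) {η : ℝ} (hη : 0 < η) (p : Mink d) :
    ∫ t in Set.Ioi (0 : ℝ), (Real.exp (-(η * t)) : ℂ) * waveKer m s t p = 1 / shiftDen m s η p := by
  set w := energy m p with hw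
  have hw0 : 0 < w := hm.trans_le (le_energy p)
  set a : ℂ := -η + (s * p 0 : ℝ) * Complex.I with ha
  have har : a.re = -η := by simp [ha]
  have h1 : ∀ c : ℝ, (a + (c : ℝ) * Complex.I).re < 0 := fun c => by simp [har, hη]
  have h2 : ∀ t : ℝ, (Real.exp (-(η * t)) : ℂ) * waveKer m s t p = (2 * Complex.I * w)⁻¹ *
      (Complex.exp ((a + (w : ℝ) * Complex.I) * t) - Complex.exp ((a + ((-w : ℝ) : ℂ) * Complex.I) * t)) := fun t => by
    rw [waveKer, ← hw]
    push_cast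
    rw [Complex.sin, show (a + (w : ℝ) * Complex.I) * t = -(η * t) + Complex.I * (s * t * p 0) + (w * t) * Complex.I by
      rw [ha]; push_cast; ring, show (a + -(w : ℂ) * Complex.I) * t = -(η * t) + Complex.I * (s * t * p 0) + -(w * t) * Complex.I by
      rw [ha]; push_cast; ring]
    simp only [Complex.exp_add]
    have : (w : ℂ) ≠ 0 := by exact_mod_cast hw0.ne'
    have hI := Complex.I_ne_zero
    field_simp
    rw [Complex.I_sq]
    ring
  simp only [h2]
  have n1 : ∀ c : ℝ, a + (c : ℝ) * Complex.I ≠ 0 := fun c h => by have := h1 c; rw [h] at this; simp at this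
  rw [integral_const_mul, integral_sub (integrableOn_exp_mul_complex_Ioi (h1 w) 0) (integrableOn_exp_mul_complex_Ioi (h1 (-w)) 0),
    integral_exp_mul_complex_Ioi (h1 w), integral_exp_mul_complex_Ioi (h1 (-w))]
  have h3 : shiftDen m s η p = (a + (w : ℝ) * Complex.I) * (a + ((-w : ℝ) : ℂ) * Complex.I) := by
    have e1 : (w : ℂ) ^ 2 = (m : ℂ) ^ 2 + (rsq p : ℂ) := by exact_mod_cast energy_sq p
    have e2 : (s : ℂ) ^ 2 = 1 := by exact_mod_cast sq_abs_one hs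
    rw [shiftDen, sq_eq, ha]
    push_cast
    linear_combination (-((w : ℂ) ^ 2) + s ^ 2 * (p 0 : ℂ) ^ 2) * (-Complex.I_sq) - e1 + (p 0 : ℂ) ^ 2 * e2
  have e1 := n1 w
  have e2 := n1 (-w)
  have e3 : 2 * Complex.I * w = (a + (w : ℝ) * Complex.I) - (a + ((-w : ℝ) : ℂ) * Complex.I) := by push_cast; ring
  have e4 : 2 * Complex.I * (w : ℂ) ≠ 0 := by
    have : (w : ℂ) ≠ 0 := by exact_mod_cast hw0.ne'
    simpa using this
  rw [h3]
  simp only [Complex.ofReal_zero, mul_zero, Complex.exp_zero]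
  rw [e3] at e4 ⊢
  generalize a + (w : ℝ) * Complex.I = A at *
  generalize a + ((-w : ℝ) : ℂ) * Complex.I = B at *
  field_simp
  ring

lemma integral_div_shiftDen (hm : 0 < m) {s : ℝ} (hs : s = 1 ∨ s = -1) {η : ℝ} (hη : 0 < η) (ψ : 𝓢(Mink d, ℂ)) :
    ∫ p, 1 / shiftDen m s η p * ψ p = ∫ t in Set.Ioi (0 : ℝ), (Real.exp (-(η * t)) : ℂ) * wave m s ψ t := by
  have hint : Integrable (Function.uncurry fun (p : Mink d) (t : ℝ) => (Real.exp (-(η * t)) : ℂ) * waveKer m s t p * ψ p)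
      (volume.prod (volume.restrict (Set.Ioi (0 : ℝ)))) := by
    have h1 : Integrable (fun t : ℝ => Real.exp (-(η * t))) (volume.restrict (Set.Ioi (0 : ℝ))) := by
      have := exp_neg_integrableOn_Ioi 0 hη
      simp only [neg_mul] at this
      exact this
    refine ((ψ.integrable.norm.const_mul m⁻¹).mul_prod h1).mono' ?_ (ae_of_all _ fun q => ?_)
    · have h2 := (continuous_waveKer (d := d) hm s).comp continuous_swap
      have h3 := ψ.continuous
      have : Continuous (Function.uncurry fun (p : Mink d) (t : ℝ) => (Real.exp (-(η * t)) : ℂ) * waveKer m s t p * ψ p) := by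
        refine (Continuous.mul (by fun_prop) ?_).mul (by fun_prop)
        exact h2
      exact this.aestronglyMeasurable
    · simp only [Function.uncurry]
      rw [norm_mul, norm_mul, Complex.norm_real, Real.norm_of_nonneg (Real.exp_pos _).le]
      have := norm_waveKer_le hm s q.2 q.1
      calc _ ≤ Real.exp (-(η * q.2)) * m⁻¹ * ‖ψ q.1‖ := by gcongr
        _ = _ := by ring
  calc _ = ∫ p, ∫ t in Set.Ioi (0 : ℝ), (Real.exp (-(η * t)) : ℂ) * waveKer m s t p * ψ p := by
        refine integral_congr_ae (ae_of_all _ fun p => ?_)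
        simp only
        rw [integral_mul_const, integral_exp_waveKer hm hs hη]
    _ = _ := by
        rw [integral_integral_swap hint]
        simp only [wave, ← integral_const_mul, mul_assoc]

end

/-! ### The time support of the Fourier integral -/

section
open LineDeriv

variable {d : ℕ} [NeZero d] {m : ℝ}

lemma rsq_add_time (p : Mink d) (r : ℝ) : rsq (p + r • EuclideanSpace.single (0 : Fin d) (1 : ℝ)) = rsq p := by
  rw [rsq, rsq]
  refine Finset.sum_congr rfl fun i hi => ?_
  simp [Finset.ne_of_mem_erase hi]

lemma integral_mul_lineDeriv {d : ℕ} {f f' g g' : Mink d → ℂ} {v : Mink d} (h1 : Integrable fun x => f' x * g x)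
    (h2 : Integrable fun x => f x * g' x) (h3 : Integrable fun x => f x * g x) (hf : ∀ x, HasLineDerivAt ℝ f (f' x) x v)
    (hg : ∀ x, HasLineDerivAt ℝ g (g' x) x v) : ∫ x, f x * g' x = -∫ x, f' x * g x :=
  integral_bilinear_hasLineDerivAt_right_eq_neg_left_of_integrable (μ := volume) (B := ContinuousLinearMap.mul ℝ ℂ)
    h1 h2 h3 (fun x _ => hf x) (fun x _ => hg x)

lemma hasLineDerivAt_waveKer (s t : ℝ) (p : Mink d) : HasLineDerivAt ℝ (waveKer m s t)
    ((Complex.I * ((s * t : ℝ) : ℂ)) * waveKer m s t p) p (EuclideanSpace.single (0 : Fin d) (1 : ℝ)) := by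
  have e : (fun r : ℝ => waveKer m s t (p + r • EuclideanSpace.single (0 : Fin d) (1 : ℝ))) =
      fun r : ℝ => Complex.exp (Complex.I * (s * t * (p 0 + r) : ℝ)) * ((Real.sin (energy m p * t) / energy m p : ℝ) : ℂ) := by
    funext r
    rw [waveKer, energy, rsq_add_time, ← energy]
    simp
  rw [HasLineDerivAt, e]
  have h3 : HasDerivAt (fun r : ℝ => s * t * (p 0 + r)) (s * t) 0 := by
    simpa using ((hasDerivAt_id (0 : ℝ)).const_add (p 0)).const_mul (s * t)
  refine ((h3.ofReal_comp.const_mul Complex.I).cexp.mul_const _).congr_deriv ?_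
  rw [waveKer, add_zero]; ring

/-- Multiplication by x⁰ is a p⁰-derivative of the Fourier transform; integrated by parts it hits
e^(isp⁰t), as ω does not depend on p⁰. So the functional at parameter t only sees the time slice x⁰
= st. -/
lemma wave_mulTime (hm : 0 < m) (s t : ℝ) (φ : 𝓢(Mink d, ℂ)) :
    wave m s (ft d (mulTime d φ)) t = ((s * t : ℝ) : ℂ) * wave m s (ft d φ) t := by
  have h1 : ft d (mulTime d φ) = Complex.I • ∂_{EuclideanSpace.single (0 : Fin d) (1 : ℝ)} (ft d φ) := by
    rw [lineDeriv_ft, smul_smul]; simp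
  set ψ := ft d φ
  set v := EuclideanSpace.single (0 : Fin d) (1 : ℝ) with hv
  have i1 := integrable_waveKer_mul hm s t (∂_{v} ψ)
  have i2 := integrable_waveKer_mul hm s t ψ
  have i3 : Integrable fun p => (Complex.I * ((s * t : ℝ) : ℂ)) * waveKer m s t p * ψ p := by
    simpa only [mul_assoc] using i2.const_mul (Complex.I * ((s * t : ℝ) : ℂ))
  have h2 := integral_mul_lineDeriv i3 i1 i2 (hasLineDerivAt_waveKer s t) fun p => (ψ.hasFDerivAt p).hasLineDerivAt v
  rw [h1, wave_smul, wave, h2, wave, ← integral_neg, ← integral_const_mul, ← integral_const_mul]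
  refine integral_congr_ae (ae_of_all _ fun p => ?_)
  simp only
  linear_combination (-((s * t : ℝ) : ℂ) * waveKer m s t p * ψ p) * Complex.I_sq

/-- Replacing φ by (1 + (x⁰)²) φ multiplies the functional by 1 + t², while it stays bounded. -/
lemma exists_norm_wave_le (hm : 0 < m) {s : ℝ} (hs : s = 1 ∨ s = -1) (φ : 𝓢(Mink d, ℂ)) :
    ∃ C, ∀ t, ‖wave m s (ft d φ) t‖ ≤ C * (1 + t ^ 2)⁻¹ := by
  refine ⟨m⁻¹ * ∫ p, ‖(ft d φ + ft d (mulTime d (mulTime d φ))) p‖, fun t => ?_⟩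
  have h := norm_wave_le hm s t (ft d φ + ft d (mulTime d (mulTime d φ)))
  have h1 : wave m s (ft d φ + ft d (mulTime d (mulTime d φ))) t = ((1 + t ^ 2 : ℝ) : ℂ) * wave m s (ft d φ) t := by
    have hs1 : (s : ℂ) ^ 2 = 1 := by exact_mod_cast sq_abs_one hs
    rw [wave_add hm, wave_mulTime hm, wave_mulTime hm]
    push_cast
    linear_combination ((t : ℂ) ^ 2 * wave m s (ft d φ) t) * hs1
  rw [h1, norm_mul, Complex.norm_real, Real.norm_of_nonneg (by positivity)] at h
  rw [← div_eq_mul_inv, le_div_iff₀ (by positivity)]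
  linarith

/-- Multiplication by a function of the time coordinate. -/
def timeMul (d : ℕ) [NeZero d] (g : ℝ → ℂ) : 𝓢(Mink d, ℂ) →L[ℂ] 𝓢(Mink d, ℂ) :=
  SchwartzMap.smulLeftCLM ℂ fun x : Mink d => g (x 0)

lemma timeMul_apply {g : ℝ → ℂ} (hg : g.HasTemperateGrowth) (φ : 𝓢(Mink d, ℂ)) (x : Mink d) :
    timeMul d g φ x = g (x 0) * φ x := by
  have : (fun x : Mink d => g (x 0)).HasTemperateGrowth :=
    hg.comp (EuclideanSpace.proj 0 : Mink d →L[ℝ] ℝ).hasTemperateGrowth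
  exact SchwartzMap.smulLeftCLM_apply_apply this _ _

/-- By Hadamard's lemma g(x⁰) = g(st) + (x⁰ - st) q(x⁰), and the factor x⁰ - st is annihilated.
Hence g(x⁰) acts as its value on the slice. -/
lemma wave_timeMul (hm : 0 < m) (s t : ℝ) {g : ℝ → ℂ} (hg : g.HasTemperateGrowth) (φ : 𝓢(Mink d, ℂ)) :
    wave m s (ft d (timeMul d g φ)) t = g (s * t) * wave m s (ft d φ) t := by
  obtain ⟨q, hq, hgq⟩ := exists_hadamard hg (s * t)
  have h : timeMul d g φ = g (s * t) • φ + (mulTime d (timeMul d q φ) + (-((s * t : ℝ) : ℂ)) • timeMul d q φ) := by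
    ext x
    simp only [add_apply, smul_apply, smul_eq_mul, mulTime_apply, timeMul_apply hg, timeMul_apply hq]
    rw [hgq (x 0)]
    push_cast; ring
  rw [h, map_add, map_add, map_smul, map_smul, wave_add hm, wave_add hm, wave_smul, wave_smul, wave_mulTime hm]
  ring

lemma integrable_one_add_sq_inv_Ioi : Integrable (fun t : ℝ => (1 + t ^ 2)⁻¹) (volume.restrict (Set.Ioi 0)) :=
  integrable_inv_one_add_sq.restrict

/-- The limit of `∫ ψ / (m² + p² - s i ε sgn p⁰)`. -/
def propLim (m s : ℝ) (ψ : 𝓢(Mink d, ℂ)) : ℂ :=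
  1 / ((m ^ 2 : ℝ) : ℂ) * ((∫ p, ψ p) + 1 / 2 * ∫ p, signLog m s p * (eulerOp Finset.univ ψ + (d : ℂ) • ψ) p)

lemma tendsto_signDen (hm : 0 < m) {s : ℝ} (hs : s = 1 ∨ s = -1) (ψ : 𝓢(Mink d, ℂ)) :
    Tendsto (fun ε => ∫ p, 1 / signDen m s ε p * ψ p) (𝓝[>] 0) (𝓝 (propLim m s ψ)) :=
  (isReg_signDen hm hs).tendsto (by positivity) ψ

/-- The sign regularization may be replaced by the shifted one, since both have the same limit; the
shifted integral is a Laplace transform in t, and η ↘ 0 by the decay in t. -/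
lemma propLim_ft (hm : 0 < m) {s : ℝ} (hs : s = 1 ∨ s = -1) (φ : 𝓢(Mink d, ℂ)) :
    propLim m s (ft d φ) = ∫ t in Set.Ioi (0 : ℝ), wave m s (ft d φ) t := by
  obtain ⟨C, hC⟩ := exists_norm_wave_le hm hs φ
  refine tendsto_nhds_unique ((isReg_shiftDen hm hs).tendsto (by positivity) (ft d φ)) ?_
  refine Tendsto.congr' (f₁ := fun η => ∫ t in Set.Ioi (0 : ℝ), (Real.exp (-(η * t)) : ℂ) * wave m s (ft d φ) t) ?_ ?_
  · filter_upwards [self_mem_nhdsWithin] with η hη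
    rw [integral_div_shiftDen hm hs hη]
  · refine tendsto_integral_filter_of_dominated_convergence (fun t => C * (1 + t ^ 2)⁻¹) ?_ ?_
      (integrable_one_add_sq_inv_Ioi.const_mul C) (ae_of_all _ fun t => ?_)
    · refine Eventually.of_forall fun η => ?_
      have := continuous_wave hm s (ft d φ)
      exact (by fun_prop : Continuous fun t : ℝ => (Real.exp (-(η * t)) : ℂ) * wave m s (ft d φ) t).aestronglyMeasurable
    · filter_upwards [self_mem_nhdsWithin] with η (hη : 0 < η)
      filter_upwards [ae_restrict_mem measurableSet_Ioi] with t (ht : 0 < t)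
      rw [norm_mul, Complex.norm_real, Real.norm_of_nonneg (Real.exp_pos _).le]
      refine (mul_le_of_le_one_left (norm_nonneg _) (Real.exp_le_one_iff.2 ?_)).trans (hC t)
      nlinarith
    · have : Continuous fun η : ℝ => (Real.exp (-(η * t)) : ℂ) * wave m s (ft d φ) t := by fun_prop
      simpa using (this.tendsto 0).mono_left nhdsWithin_le_nhds

lemma hasTemperateGrowth_cutoff_mul {χ : ℝ → ℝ} (h : ContDiff ℝ ∞ χ) (h0 : ∀ t ≤ -1, χ t = 0)
    (h1 : ∀ t, 1 ≤ t → χ t = 1) (r s : ℝ) : (fun u : ℝ => ((χ (r * (s * u)) : ℝ) : ℂ)).HasTemperateGrowth := by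
  have := (Function.Complex.hasTemperateGrowth_ofReal.comp (hasTemperateGrowth_cutoff h h0 h1)).comp
    ((r * s) • ContinuousLinearMap.id ℝ ℝ).hasTemperateGrowth
  have h2 : (fun u : ℝ => ((χ (r * (s * u)) : ℝ) : ℂ)) = (Complex.ofReal ∘ χ) ∘ ((r * s) • ContinuousLinearMap.id ℝ ℝ) := by
    funext x; simp [mul_assoc]
  rw [h2]
  exact this

/-- The time support of the Fourier integral. -/
lemma tendsto_propLim_cutoff (hm : 0 < m) {s σ : ℝ} (hs : s = 1 ∨ s = -1) (hσ : σ = 1 ∨ σ = -1) {χ : ℝ → ℝ}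
    (h : ContDiff ℝ ∞ χ) (h0 : ∀ t ≤ -1, χ t = 0) (h1 : ∀ t, 1 ≤ t → χ t = 1) (φ : 𝓢(Mink d, ℂ)) :
    Tendsto (fun R : ℝ => propLim m σ (ft d (timeMul d (fun u => ((χ (R * (s * u)) : ℝ) : ℂ)) φ))) atTop
      (𝓝 (if σ = s then propLim m s (ft d φ) else 0)) := by
  obtain ⟨C, hC⟩ := exists_norm_wave_le hm hσ φ
  obtain ⟨B, hB⟩ := bounded_cutoff h.continuous h0 h1
  have hw := continuous_wave hm σ (ft d φ)
  have e : (if σ = s then propLim m s (ft d φ) else 0) =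
      ∫ t in Set.Ioi (0 : ℝ), (if σ = s then 1 else 0) * wave m σ (ft d φ) t := by
    split_ifs with hc
    · subst hc; rw [propLim_ft hm hs]; simp
    · simp
  rw [e]
  simp only [propLim_ft hm hσ, wave_timeMul hm σ _ (hasTemperateGrowth_cutoff_mul h h0 h1 _ s)]
  refine tendsto_integral_filter_of_dominated_convergence (fun t => B * (C * (1 + t ^ 2)⁻¹)) ?_ ?_
    ((integrable_one_add_sq_inv_Ioi.const_mul C).const_mul B) ?_
  · refine Eventually.of_forall fun R => ?_
    have := h.continuous
    exact (by fun_prop : Continuous fun t : ℝ => ((χ (R * (s * (σ * t))) : ℝ) : ℂ) * wave m σ (ft d φ) t).aestronglyMeasurable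
  · refine Eventually.of_forall fun R => ae_of_all _ fun t => ?_
    rw [norm_mul, Complex.norm_real, Real.norm_eq_abs]
    exact mul_le_mul (hB _) (hC t) (norm_nonneg _) ((abs_nonneg _).trans (hB 0))
  · filter_upwards [ae_restrict_mem measurableSet_Ioi] with t (ht : 0 < t)
    refine Tendsto.mul_const _ (tendsto_const_nhds.congr' ?_)
    -- The argument of χ is R t for σ = s and -R t for σ = -s; beyond R = 1/t the cutoff is exactly
    -- 1 or 0.
    filter_upwards [eventually_ge_atTop t⁻¹] with R hR
    have hRt : 1 ≤ R * t := by
      have := mul_le_mul_of_nonneg_right hR ht.le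
      rwa [inv_mul_cancel₀ ht.ne'] at this
    have hs2 := sq_abs_one hs
    split_ifs with hc
    · rw [hc, h1 _ (by rw [← mul_assoc s, ← pow_two, hs2, one_mul]; exact hRt), Complex.ofReal_one]
    · have : s * σ = -1 := by
        rcases hs with rfl | rfl <;> rcases hσ with rfl | rfl <;> simp_all
      rw [← mul_assoc s, this, h0 _ (by linarith), Complex.ofReal_zero]

end

section
variable {d : ℕ} [NeZero d] {m : ℝ}

/-! ### Gaussian integrals -/

/-- The Lorentzian signature. -/
def signature {d : ℕ} [NeZero d] (i : Fin d) : ℝ := if i = 0 then -1 else 1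

lemma signature_sq (i : Fin d) : signature i ^ 2 = 1 := by unfold signature; split_ifs <;> norm_num

lemma lorentz_eq_sum (p x : Mink d) : lorentz p x = ∑ i, signature i * (p i * x i) := by
  rw [lorentz, ← Finset.add_sum_erase _ _ (Finset.mem_univ (0 : Fin d))]
  congr 1
  · simp [signature]
  · refine Finset.sum_congr rfl fun i hi => ?_
    simp [signature, (Finset.mem_erase.1 hi).1]

lemma continuous_lorentz : Continuous fun q : Mink d × Mink d => lorentz q.1 q.2 := by
  unfold lorentz
  fun_prop

/-- Fubini and the one-dimensional Gaussian integrals. The Lorentzian signs disappear from the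
exponent because they are squared. -/
lemma integral_ft_mul_gaussian {b : Fin d → ℂ} (hb : ∀ i, 0 < (b i).re) (φ : 𝓢(Mink d, ℂ)) :
    ∫ p : Mink d, Complex.exp (-∑ i, b i * (p i : ℂ) ^ 2) * ft d φ p =
      (∏ i, ((Real.pi : ℂ) / b i) ^ (1 / 2 : ℂ)) * ∫ x : Mink d, Complex.exp (-∑ i, (x i : ℂ) ^ 2 / (4 * b i)) * φ x := by
  have hE : ∀ c : Fin d → ℂ, ∫ v : Mink d, Complex.exp (-∑ i, b i * (v i : ℂ) ^ 2 + ∑ i, c i * v i)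
      = ∏ i, ((Real.pi : ℂ) / b i) ^ (1 / 2 : ℂ) * Complex.exp (c i ^ 2 / (4 * b i)) := fun c => by
    rw [← GaussianFourier.integral_cexp_neg_sum_mul_add hb c, ← (PiLp.volume_preserving_toLp (Fin d)).integral_comp
      (MeasurableEquiv.toLp 2 _).measurableEmbedding]
  have hI : Integrable fun v : Mink d => Complex.exp (-∑ i, b i * (v i : ℂ) ^ 2) := by
    rw [← (PiLp.volume_preserving_toLp (Fin d)).integrable_comp_emb (MeasurableEquiv.toLp 2 _).measurableEmbedding]
    simpa [Function.comp_def] using GaussianFourier.integrable_cexp_neg_sum_mul_add hb 0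
  have hl : Continuous fun q : Mink d × Mink d => Complex.exp (Complex.I * (lorentz q.1 q.2 : ℂ)) := by
    have := continuous_lorentz (d := d); fun_prop
  have hprod : Integrable (Function.uncurry fun p x : Mink d =>
      Complex.exp (-∑ i, b i * (p i : ℂ) ^ 2) * (Complex.exp (Complex.I * (lorentz p x : ℂ)) * φ x))
      (volume.prod volume) := by
    refine (hI.mul_prod φ.integrable).mono ?_ (ae_of_all _ fun q => ?_)
    · have := φ.continuous
      exact Continuous.aestronglyMeasurable (by simp only [Function.uncurry_def]; fun_prop)
    · simp [Function.uncurry, mul_comm Complex.I, Complex.norm_exp_ofReal_mul_I]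
  calc _ = ∫ p : Mink d, ∫ x : Mink d,
        Complex.exp (-∑ i, b i * (p i : ℂ) ^ 2) * (Complex.exp (Complex.I * (lorentz p x : ℂ)) * φ x) := by
        refine integral_congr_ae (ae_of_all _ fun p => ?_)
        simp only [ft_apply, integral_const_mul]
    _ = ∫ x : Mink d, ∫ p : Mink d,
        Complex.exp (-∑ i, b i * (p i : ℂ) ^ 2) * (Complex.exp (Complex.I * (lorentz p x : ℂ)) * φ x) :=
        integral_integral_swap hprod
    _ = _ := by
        rw [← integral_const_mul]
        refine integral_congr_ae (ae_of_all _ fun x => ?_)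
        have h1 : ∀ p : Mink d, Complex.exp (-∑ i, b i * (p i : ℂ) ^ 2) * (Complex.exp (Complex.I * (lorentz p x : ℂ)) * φ x)
            = Complex.exp (-∑ i, b i * (p i : ℂ) ^ 2 + ∑ i, (Complex.I * (signature i * x i : ℝ)) * p i) * φ x := fun p => by
          rw [Complex.exp_add, mul_assoc, lorentz_eq_sum]
          congr 3
          push_cast
          rw [Finset.mul_sum]
          exact Finset.sum_congr rfl fun i _ => by ring
        simp only [h1]
        rw [integral_mul_const, hE, Finset.prod_mul_distrib, ← Complex.exp_sum, ← Finset.sum_neg_distrib, mul_assoc]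
        congr 3
        refine Finset.sum_congr rfl fun i _ => ?_
        rw [mul_pow, Complex.I_sq, ← Complex.ofReal_pow, mul_pow, signature_sq]
        push_cast; ring

/-- The time coordinate contributes (ir)^(1/2), each of the d - 1 spatial ones (ir)^(-1/2), in total
(ir)^(1-d/2). The principal branch is harmless as ir is off the cut. -/
lemma prod_cpow_signature {r τ : ℝ} (hr : r = 1 ∨ r = -1) (hτ : 0 < τ) :
    ∏ i : Fin d, ((Real.pi : ℂ) / (Complex.I * (r * τ * signature i : ℝ))) ^ (1 / 2 : ℂ) =
      (Complex.I * r) ^ ((1 - d / 2 : ℝ) : ℂ) * (((Real.pi / τ) ^ ((d : ℝ) / 2) : ℝ) : ℂ) := by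
  have hz : (Complex.I * r) ≠ 0 := by rcases hr with rfl | rfl <;> simp
  have harg : (Complex.I * r).arg ≠ Real.pi := by
    rcases hr with rfl | rfl
    · rw [Complex.ofReal_one, mul_one, Complex.arg_I]; linarith [Real.pi_pos]
    · rw [Complex.ofReal_neg, Complex.ofReal_one, mul_neg, mul_one, Complex.arg_neg_I]; linarith [Real.pi_pos]
  have hq : 0 < Real.pi / τ := by positivity
  have key : ∀ i : Fin d, ((Real.pi : ℂ) / (Complex.I * (r * τ * signature i : ℝ))) ^ (1 / 2 : ℂ) =
      (((Real.pi / τ) ^ (1 / 2 : ℝ) : ℝ) : ℂ) * (Complex.I * r) ^ (-(signature i) / 2 : ℂ) := fun i => by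
    have e1 : (Real.pi : ℂ) / (Complex.I * (r * τ * signature i : ℝ)) =
        ((Real.pi / τ : ℝ) : ℂ) * (Complex.I * r) ^ (-(signature i : ℂ)) := by
      have hτ' : (τ : ℂ) ≠ 0 := by exact_mod_cast hτ.ne'
      unfold signature
      split_ifs
      · push_cast; rw [neg_neg, Complex.cpow_one]
        rcases hr with rfl | rfl <;> push_cast <;> field_simp <;> simp
      · push_cast; rw [Complex.cpow_neg, Complex.cpow_one]
        field_simp
    have h2 : (Complex.I * r) ^ (-(signature i : ℂ)) ≠ 0 := by simp [Complex.cpow_eq_zero_iff, hz]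
    have hq' : ((Real.pi / τ : ℝ) : ℂ) ≠ 0 := by exact_mod_cast hq.ne'
    rw [e1, Complex.cpow_def_of_ne_zero (mul_ne_zero hq' h2), Complex.log_ofReal_mul hq h2, add_mul, Complex.exp_add,
      Complex.ofReal_cpow hq.le, Complex.cpow_def_of_ne_zero hq', ← Complex.ofReal_log hq.le]
    congr 1
    · norm_num
    rw [Complex.cpow_def_of_ne_zero hz (-(signature i) / 2 : ℂ)]
    congr 1
    unfold signature
    split_ifs
    · push_cast; rw [neg_neg, Complex.cpow_one]
    · push_cast; rw [Complex.cpow_neg, Complex.cpow_one, Complex.log_inv _ harg]; ring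
  rw [Finset.prod_congr rfl fun i _ => key i, Finset.prod_mul_distrib, mul_comm]
  have hd : ((d - 1 : ℕ) : ℂ) = d - 1 := by rw [Nat.cast_sub (Nat.one_le_iff_ne_zero.2 (NeZero.ne d))]; simp
  congr 1
  · rw [← Finset.mul_prod_erase _ _ (Finset.mem_univ (0 : Fin d)),
      Finset.prod_congr rfl (g := fun _ => (Complex.I * r) ^ (-(1 / 2) : ℂ)) fun i hi => by
        simp [signature, (Finset.mem_erase.1 hi).1, neg_div],
      Finset.prod_const, Finset.card_erase_of_mem (Finset.mem_univ _), Finset.card_univ, Fintype.card_fin, ← Complex.cpow_nat_mul,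
      ← Complex.cpow_add _ _ hz, hd]
    congr 1
    simp [signature]; ring
  · rw [Finset.prod_const, Finset.card_univ, Fintype.card_fin]
    norm_cast
    rw [← Real.rpow_natCast, ← Real.rpow_mul hq.le]
    congr 1; ring

/-- `∫ e^{-irτp²} φˇ(p) dp`. -/
def gaussWave (r : ℝ) (φ : 𝓢(Mink d, ℂ)) (τ : ℝ) : ℂ :=
  ∫ p : Mink d, Complex.exp (-(Complex.I * (r * τ * sq p : ℝ))) * ft d φ p

lemma norm_exp_neg_I (t : ℝ) : ‖Complex.exp (-(Complex.I * (t : ℂ)))‖ = 1 := by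
  rw [show -(Complex.I * (t : ℂ)) = ((-t : ℝ) : ℂ) * Complex.I by push_cast; ring, Complex.norm_exp_ofReal_mul_I]

lemma norm_gaussWave_le (r : ℝ) (φ : 𝓢(Mink d, ℂ)) (τ : ℝ) : ‖gaussWave r φ τ‖ ≤ ∫ p, ‖ft d φ p‖ :=
  norm_integral_le_of_norm_le (ft d φ).integrable.norm (ae_of_all _ fun p => by rw [norm_mul, norm_exp_neg_I, one_mul])

lemma continuous_gaussWave (r : ℝ) (φ : 𝓢(Mink d, ℂ)) : Continuous (gaussWave r φ) := by
  have h1 := continuous_sq (d := d)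
  have h2 := (ft d φ).continuous
  refine continuous_of_dominated (bound := fun p => ‖ft d φ p‖) (fun τ => ?_)
    (fun τ => ae_of_all _ fun p => by rw [norm_mul, norm_exp_neg_I, one_mul]) (ft d φ).integrable.norm
    (ae_of_all _ fun p => by fun_prop)
  exact Continuous.aestronglyMeasurable (by fun_prop)

/-- The oscillatory exponents are damped by a real part l > 0, where the Gaussian formula holds, and
l ↘ 0 on both sides by dominated convergence. -/
theorem gaussWave_eq {r τ : ℝ} (hr : r = 1 ∨ r = -1) (hτ : 0 < τ) (φ : 𝓢(Mink d, ℂ)) :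
    gaussWave r φ τ = (Complex.I * r) ^ ((1 - d / 2 : ℝ) : ℂ) * (((Real.pi / τ) ^ ((d : ℝ) / 2) : ℝ) : ℂ) *
      ∫ x : Mink d, Complex.exp (Complex.I * (r * sq x / (4 * τ) : ℝ)) * φ x := by
  set b : ℝ → Fin d → ℂ := fun l i => (l : ℂ) + Complex.I * (r * τ * signature i : ℝ) with hb
  have hcb : ∀ i, Continuous fun l => b l i := fun i => by simp only [hb]; fun_prop
  have hre : ∀ l i, (b l i).re = l := fun l i => by
    simp only [hb, Complex.add_re, Complex.ofReal_re, mul_comm Complex.I, Complex.re_ofReal_mul, Complex.I_re, mul_zero, add_zero]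
  have hrn : r ≠ 0 := by rcases hr with rfl | rfl <;> norm_num
  have hsg : ∀ i : Fin d, signature i ≠ 0 := fun i h => by simpa [h] using signature_sq i
  have hb0 : ∀ i, b 0 i ≠ 0 := fun i => by
    simp only [hb, Complex.ofReal_zero, zero_add]
    exact mul_ne_zero Complex.I_ne_zero (by exact_mod_cast mul_ne_zero (mul_ne_zero hrn hτ.ne') (hsg i))
  have htb : ∀ i, Tendsto (fun l => b l i) (𝓝[>] 0) (𝓝 (b 0 i)) := fun i =>
    ((hcb i).tendsto 0).mono_left nhdsWithin_le_nhds
  have h1 : Tendsto (fun l : ℝ => ∫ p : Mink d, Complex.exp (-∑ i, b l i * (p i : ℂ) ^ 2) * ft d φ p) (𝓝[>] 0)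
      (𝓝 (gaussWave r φ τ)) := by
    have hs := (ft d φ).continuous
    refine tendsto_integral_filter_of_dominated_convergence (fun p => ‖ft d φ p‖) (Eventually.of_forall fun l => ?_) ?_
      (ft d φ).integrable.norm (ae_of_all _ fun p => ?_)
    · exact Continuous.aestronglyMeasurable (by fun_prop)
    · filter_upwards [self_mem_nhdsWithin] with l hl
      refine ae_of_all _ fun p => ?_
      rw [norm_mul, Complex.norm_exp, Complex.neg_re, Complex.re_sum]
      refine mul_le_of_le_one_left (norm_nonneg _) (Real.exp_le_one_iff.2 (neg_nonpos.2 (Finset.sum_nonneg fun i _ => ?_)))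
      rw [← Complex.ofReal_pow, Complex.re_mul_ofReal, hre]
      exact mul_nonneg (le_of_lt hl) (sq_nonneg _)
    · refine Tendsto.mul_const _ ((Complex.continuous_exp.tendsto _).comp ?_)
      have h2 : -∑ i, b 0 i * (p i : ℂ) ^ 2 = -(Complex.I * (r * τ * sq p : ℝ)) := by
        rw [sq, lorentz_eq_sum]; push_cast
        rw [Finset.mul_sum, Finset.mul_sum]
        congr 1
        exact Finset.sum_congr rfl fun i _ => by simp only [hb]; push_cast; ring
      rw [← h2]
      exact (tendsto_finsetSum _ fun i _ => (htb i).mul_const _).neg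
  have h3 : Tendsto (fun l : ℝ => (∏ i, ((Real.pi : ℂ) / b l i) ^ (1 / 2 : ℂ)) *
      ∫ x : Mink d, Complex.exp (-∑ i, (x i : ℂ) ^ 2 / (4 * b l i)) * φ x) (𝓝[>] 0)
      (𝓝 ((∏ i, ((Real.pi : ℂ) / b 0 i) ^ (1 / 2 : ℂ)) *
        ∫ x : Mink d, Complex.exp (Complex.I * (r * sq x / (4 * τ) : ℝ)) * φ x)) := by
    refine Tendsto.mul (tendsto_finsetProd _ fun i _ => ?_) ?_
    · have hsp : (Real.pi : ℂ) / b 0 i ∈ Complex.slitPlane := by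
        refine Or.inr ?_
        have : (Real.pi : ℂ) / b 0 i = ((-(Real.pi / (r * τ * signature i)) : ℝ) : ℂ) * Complex.I := by
          simp only [hb, Complex.ofReal_zero, zero_add]
          have := hsg i
          push_cast; field_simp; rw [Complex.I_sq]; ring
        rw [this, Complex.im_ofReal_mul, Complex.I_im, mul_one]
        exact neg_ne_zero.2 (div_ne_zero Real.pi_pos.ne' (mul_ne_zero (mul_ne_zero hrn hτ.ne') (hsg i)))
      exact (tendsto_const_nhds.div (htb i) (hb0 i)).cpow tendsto_const_nhds hsp
    · have hs := φ.continuous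
      refine tendsto_integral_filter_of_dominated_convergence (fun p => ‖φ p‖) (Eventually.of_forall fun l => ?_) ?_
        φ.integrable.norm (ae_of_all _ fun x => ?_)
      · exact Continuous.aestronglyMeasurable (by fun_prop)
      · filter_upwards [self_mem_nhdsWithin] with l hl
        refine ae_of_all _ fun x => ?_
        rw [norm_mul, Complex.norm_exp, Complex.neg_re, Complex.re_sum]
        refine mul_le_of_le_one_left (norm_nonneg _) (Real.exp_le_one_iff.2 (neg_nonpos.2 (Finset.sum_nonneg fun i _ => ?_)))
        rw [div_eq_mul_inv, ← Complex.ofReal_pow, Complex.re_ofReal_mul, Complex.inv_re]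
        refine mul_nonneg (sq_nonneg _) (div_nonneg ?_ (Complex.normSq_nonneg _))
        have : (4 * b l i).re = 4 * l := by simp [hre]
        rw [this]; linarith [show (0 : ℝ) < l from hl]
      · refine Tendsto.mul_const _ ((Complex.continuous_exp.tendsto _).comp ?_)
        have h2 : -∑ i, (x i : ℂ) ^ 2 / (4 * b 0 i) = Complex.I * (r * sq x / (4 * τ) : ℝ) := by
          rw [sq, lorentz_eq_sum]; push_cast
          rw [Finset.mul_sum, Finset.sum_div, Finset.mul_sum, ← Finset.sum_neg_distrib]
          refine Finset.sum_congr rfl fun i _ => ?_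
          simp only [hb]
          have h4 : (signature i : ℂ) ≠ 0 := by exact_mod_cast hsg i
          have h5 : (r : ℂ) ≠ 0 := by exact_mod_cast hrn
          have h6 : (τ : ℂ) ≠ 0 := by exact_mod_cast hτ.ne'
          have h7 : (signature i : ℂ) ^ 2 = 1 := by exact_mod_cast signature_sq i
          have h8 : (r : ℂ) ^ 2 = 1 := by exact_mod_cast sq_abs_one hr
          push_cast
          rw [zero_add]
          field_simp
          rw [Complex.I_sq, h7, h8]; ring
        rw [← h2]
        exact (tendsto_finsetSum _ fun i _ => tendsto_const_nhds.div ((htb i).const_mul 4) (mul_ne_zero (by norm_num) (hb0 i))).neg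
  have h4 := tendsto_nhds_unique (h1.congr' (by
    filter_upwards [self_mem_nhdsWithin] with l hl
    exact integral_ft_mul_gaussian (fun i => by rw [hre]; exact hl) φ)) h3
  rw [h4, ← prod_cpow_signature hr hτ]
  simp only [hb, Complex.ofReal_zero, zero_add]

lemma norm_gaussWave_le_rpow {r τ : ℝ} (hr : r = 1 ∨ r = -1) (hτ : 0 < τ) (φ : 𝓢(Mink d, ℂ)) :
    ‖gaussWave r φ τ‖ ≤ (Real.pi / τ) ^ ((d : ℝ) / 2) * ∫ x, ‖φ x‖ := by
  have h0 : ‖(Complex.I * r) ^ ((1 - d / 2 : ℝ) : ℂ)‖ = 1 := by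
    rw [Complex.norm_cpow_real]
    rcases hr with rfl | rfl <;> simp
  rw [gaussWave_eq hr hτ, norm_mul, norm_mul, h0, one_mul, Complex.norm_real, Real.norm_of_nonneg (by positivity)]
  gcongr
  refine norm_integral_le_of_norm_le φ.integrable.norm (ae_of_all _ fun p => ?_)
  rw [norm_mul, mul_comm Complex.I, Complex.norm_exp_ofReal_mul_I, one_mul]

end

section
/-! ### The Feynman propagator -/

/-- Since K_α(a,b) = √π a^α U_α(ab), the operator a∂_a - b∂_b multiplies it by α; the two
derivatives are K_{α∓1} up to sign. -/
lemma mul_besselK (α : ℝ) {a b : ℂ} (ha : 0 < a.re) (hb : 0 < b.re) :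
    a * besselK (α - 1) a b = b * besselK (α + 1) a b - α * besselK α a b := by
  have ha0 : a ∈ Complex.slitPlane := Or.inl ha
  have hane : a ≠ 0 := Complex.slitPlane_ne_zero ha0
  obtain ⟨u, hu⟩ : ∃ u, HasDerivAt (besselU α) u (a * b) :=
    ⟨_, (differentiableAt_besselU α (mul_mem_slitPlane ha hb)).hasDerivAt⟩
  have hopen : IsOpen {z : ℂ | 0 < z.re} := isOpen_lt continuous_const Complex.continuous_re
  have h1 : HasDerivAt (fun a => besselK α a b) ((√Real.pi : ℂ) * (α * a ^ ((α : ℂ) - 1) * 1) * besselU α (a * b) +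
      (√Real.pi : ℂ) * a ^ (α : ℂ) * (u * (1 * b))) a := by
    have hu' : HasDerivAt (fun a => besselU α (a * b)) (u * (1 * b)) a :=
      HasDerivAt.comp (h₂ := besselU α) a hu ((hasDerivAt_id a).mul_const b)
    refine ((((hasDerivAt_id a).cpow_const ha0).const_mul _).fun_mul hu').congr_of_eventuallyEq ?_
    filter_upwards [hopen.mem_nhds ha] with z hz using besselK_eq α hz hb
  have h2 : HasDerivAt (fun b => besselK α a b) ((√Real.pi : ℂ) * a ^ (α : ℂ) * (u * (a * 1))) b := by
    have hu' : HasDerivAt (fun b => besselU α (a * b)) (u * (a * 1)) b :=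
      HasDerivAt.comp (h₂ := besselU α) b hu ((hasDerivAt_id b).const_mul a)
    refine (hu'.const_mul _).congr_of_eventuallyEq ?_
    filter_upwards [hopen.mem_nhds hb] with z hz using besselK_eq α ha hz
  have e1 := h1.unique (hasDerivAt_besselK_left α ha hb)
  have e2 := h2.unique (hasDerivAt_besselK_right α ha hb)
  have e3 := besselK_eq α ha hb
  have e4 : a ^ ((α : ℂ) - 1) * a = a ^ (α : ℂ) := by rw [Complex.cpow_sub _ _ hane, Complex.cpow_one]; field_simp
  linear_combination a * e1 - b * e2 + α * e3 - α * (√Real.pi : ℂ) * besselU α (a * b) * e4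

lemma norm_besselK_le {α : ℝ} (hα : 0 < α) {a b : ℂ} (ha : 0 < a.re) (hb : 0 < b.re) :
    ‖besselK α a b‖ ≤ ∫ σ in Set.Ioi (0 : ℝ), Real.exp (-(b.re / σ)) * σ ^ (-α - 1) := by
  refine norm_integral_le_of_norm_le (integrableOn_exp_neg_div_rpow hb (by linarith)) ?_
  filter_upwards [ae_restrict_mem measurableSet_Ioi] with σ hσ
  have hσ0 : (0 : ℝ) < σ := hσ
  rw [norm_mul, Complex.norm_real, Real.norm_of_nonneg (by positivity), Complex.norm_exp]
  refine mul_le_mul_of_nonneg_right (Real.exp_le_exp.2 ?_) (by positivity)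
  rw [Complex.sub_re, Complex.neg_re, Complex.re_mul_ofReal, Complex.div_ofReal_re]
  nlinarith

/-- For `α > -1` the function `K_α(a,b)` grows at most linearly in `b`, uniformly in `a` bounded
away from `0`. -/
lemma exists_norm_besselK_le {α e M : ℝ} (hα : -1 < α) (he : 0 < e) (hM : 0 < M) : ∃ C, ∀ a b : ℂ, 0 < a.re → b.re = e →
    M ≤ ‖a‖ → ‖besselK α a b‖ ≤ C * (1 + ‖b‖) := by
  obtain ⟨C, hC⟩ : ∃ C : ℝ → ℝ, C = fun β => ∫ σ in Set.Ioi (0 : ℝ), Real.exp (-(e / σ)) * σ ^ (-β - 1) := ⟨_, rfl⟩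
  have hC0 : ∀ β, 0 ≤ C β := fun β => by
    rw [hC]
    exact setIntegral_nonneg measurableSet_Ioi fun σ hσ => mul_nonneg (Real.exp_pos _).le (Real.rpow_nonneg (le_of_lt hσ) _)
  have hK : ∀ β > 0, ∀ a b : ℂ, 0 < a.re → b.re = e → ‖besselK β a b‖ ≤ C β := fun β hβ a b ha hb => by
    have h := norm_besselK_le hβ ha (hb ▸ he)
    rw [hb] at h
    rw [hC]; exact h
  refine ⟨M⁻¹ * (C (α + 2) + (α + 1) * C (α + 1)), fun a b ha hb hMa => ?_⟩
  -- The recurrence expresses a K_α through K_{α+1} and K_{α+2}. Their indices are positive, so they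
  -- are bounded on Re b = e uniformly in a, even as Re a → 0; this covers d = 1 and d = 2, where α
  -- ≤ 0.
  have h1 := mul_besselK (α + 1) ha (by rw [hb]; exact he)
  rw [add_sub_cancel_right, add_assoc, one_add_one_eq_two] at h1
  have h2 : M * ‖besselK α a b‖ ≤ ‖b‖ * C (α + 2) + (α + 1) * C (α + 1) := by
    calc _ ≤ ‖a * besselK α a b‖ := by rw [norm_mul]; gcongr
      _ ≤ ‖b * besselK (α + 2) a b‖ + ‖((α + 1 : ℝ) : ℂ) * besselK (α + 1) a b‖ := by rw [h1]; exact norm_sub_le _ _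
      _ ≤ _ := by
        rw [norm_mul, norm_mul, Complex.norm_real, Real.norm_of_nonneg (by linarith)]
        have := hK (α + 2) (by linarith) a b ha hb
        have := hK (α + 1) (by linarith) a b ha hb
        have : 0 ≤ α + 1 := by linarith
        gcongr
  rw [mul_assoc, ← div_eq_inv_mul, le_div_iff₀ hM]
  have := hC0 (α + 2)
  have := mul_nonneg (by linarith : (0 : ℝ) ≤ α + 1) (hC0 (α + 1))
  nlinarith [norm_nonneg b]

variable {d : ℕ} [NeZero d] {m : ℝ}

/-- `m² + p² - irδ`. -/
def feynDen (m r δ : ℝ) (p : Mink d) : ℂ := (m : ℂ) ^ 2 + (sq p : ℂ) - (r * δ : ℝ) * Complex.I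

/-- The Laplace transform of `gaussWave`, with the cutoff `e^{-e/τ}` near `τ = 0`. -/
def gaussLaplace (r : ℝ) (φ : 𝓢(Mink d, ℂ)) (a : ℂ) (e : ℝ) : ℂ :=
  ∫ τ in Set.Ioi (0 : ℝ), Complex.exp (-(a * τ)) * (Real.exp (-(e / τ)) : ℂ) * gaussWave r φ τ

/-- Schwinger parametrization: ir (m² + p² - irδ) = δ + ir(m² + p²) has positive real part δ, so its
inverse is a convergent exponential integral in τ. -/
lemma integral_div_feynDen {r : ℝ} (hr : r = 1 ∨ r = -1) {δ : ℝ} (hδ : 0 < δ) (φ : 𝓢(Mink d, ℂ)) :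
    ∫ p, 1 / feynDen m r δ p * ft d φ p =
      Complex.I * r * ∫ τ in Set.Ioi (0 : ℝ), Complex.exp (-((δ + Complex.I * (r * m ^ 2 : ℝ)) * τ)) * gaussWave r φ τ := by
  have h2 := continuous_sq (d := d)
  have h3 := (ft d φ).continuous
  have hr2 : (r : ℂ) ^ 2 = 1 := by exact_mod_cast sq_abs_one hr
  set a : Mink d → ℂ := fun p => δ + Complex.I * (r * (m ^ 2 + sq p) : ℝ) with ha
  have hare : ∀ p, (a p).re = δ := fun p => by
    simp only [ha, Complex.add_re, Complex.ofReal_re, mul_comm Complex.I, Complex.re_ofReal_mul, Complex.I_re, mul_zero, add_zero]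
  have hcexp : ∀ (τ : ℝ) (p : Mink d), Complex.exp (-((δ + Complex.I * (r * m ^ 2 : ℝ)) * τ)) *
      Complex.exp (-(Complex.I * (r * τ * sq p : ℝ))) = Complex.exp (-(a p) * τ) := fun τ p => by
    rw [← Complex.exp_add]; congr 1; simp only [ha]; push_cast; ring
  have hint : Integrable (Function.uncurry fun (τ : ℝ) (p : Mink d) => Complex.exp (-(a p) * τ) * ft d φ p)
      ((volume.restrict (Set.Ioi (0 : ℝ))).prod volume) := by
    have h1 : Integrable (fun t : ℝ => Real.exp (-(δ * t))) (volume.restrict (Set.Ioi (0 : ℝ))) := by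
      have := exp_neg_integrableOn_Ioi 0 hδ
      simp only [neg_mul] at this
      exact this
    refine (h1.mul_prod (ft d φ).integrable.norm).mono ?_ (ae_of_all _ fun q => ?_)
    · exact Continuous.aestronglyMeasurable (by simp only [Function.uncurry_def, ha]; fun_prop)
    · rw [Function.uncurry, norm_mul, norm_mul, Complex.norm_exp, Complex.re_mul_ofReal, Complex.neg_re, hare, neg_mul,
        Real.norm_of_nonneg (Real.exp_pos _).le, norm_norm]
  simp only [gaussWave, ← integral_const_mul, ← mul_assoc, hcexp]
  simp only [mul_assoc, integral_const_mul]
  rw [integral_integral_swap hint, ← mul_assoc, ← integral_const_mul]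
  refine integral_congr_ae (ae_of_all _ fun p => ?_)
  have ha0 : a p ≠ 0 := fun h => by have := hare p; rw [h] at this; simp at this; linarith
  have hfa : feynDen m r δ p * (Complex.I * r) = a p := by
    simp only [feynDen, ha]; push_cast
    linear_combination (-(r : ℂ) ^ 2 * δ) * Complex.I_sq + δ * hr2
  have hf0 : feynDen m r δ p ≠ 0 := fun h => ha0 (by rw [← hfa, h, zero_mul])
  simp only
  rw [integral_mul_const, integral_exp_mul_complex_Ioi (by rw [Complex.neg_re, hare]; linarith)]
  simp only [Complex.ofReal_zero, mul_zero, Complex.exp_zero]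
  rw [neg_div_neg_eq, ← hfa]
  have := right_ne_zero_of_mul (hfa ▸ ha0 : feynDen m r δ p * (Complex.I * r) ≠ 0)
  have hr0 : (r : ℂ) ≠ 0 := right_ne_zero_of_mul this
  rw [← mul_assoc]
  congr 1
  field_simp

/-- Inserting the position space form of the Gaussian wave leaves τ^(-d/2), the power occurring in
K_{d/2-1}. The cutoff e^(-e/τ) tames it at τ = 0 and thereby justifies Fubini. -/
lemma gaussLaplace_eq {r : ℝ} (hr : r = 1 ∨ r = -1) (φ : 𝓢(Mink d, ℂ)) {a : ℂ} (ha : 0 < a.re) {e : ℝ} (he : 0 < e) :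
    gaussLaplace r φ a e = (Complex.I * r) ^ ((1 - d / 2 : ℝ) : ℂ) * ((Real.pi ^ ((d : ℝ) / 2) : ℝ) : ℂ) *
      ∫ x : Mink d, besselK (d / 2 - 1) a (e - Complex.I * (r * sq x / 4 : ℝ)) * φ x := by
  have h2 := (continuous_sq (d := d)).measurable
  have h3 := φ.continuous.measurable
  set b : Mink d → ℂ := fun x => e - Complex.I * (r * sq x / 4 : ℝ) with hb
  have hbre : ∀ x, (b x).re = e := fun x => by
    simp only [hb, Complex.sub_re, Complex.ofReal_re, mul_comm Complex.I, Complex.re_ofReal_mul, Complex.I_re, mul_zero, sub_zero]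
  have hint : Integrable (Function.uncurry fun (τ : ℝ) (x : Mink d) =>
      Complex.exp (-(a * τ) - b x / τ) * ((τ ^ (-(d / 2 - 1 : ℝ) - 1) : ℝ) : ℂ) * φ x)
      ((volume.restrict (Set.Ioi (0 : ℝ))).prod volume) := by
    refine (((integrableOn_exp_exp_rpow ha he (-(d / 2 - 1 : ℝ) - 1))).mul_prod φ.integrable.norm).mono ?_ (ae_of_all _ fun q => ?_)
    · exact Measurable.aestronglyMeasurable (by simp only [Function.uncurry_def, hb]; fun_prop)
    · rw [Function.uncurry, norm_mul, norm_mul, norm_mul, Complex.norm_exp, Complex.sub_re, Complex.neg_re, Complex.re_mul_ofReal,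
        Complex.div_ofReal_re, hbre, Complex.norm_real, norm_norm, norm_mul, Real.norm_of_nonneg (Real.exp_pos _).le]
  have h4 : ∀ x : Mink d, besselK (d / 2 - 1) a (b x) * φ x = ∫ τ in Set.Ioi (0 : ℝ),
      Complex.exp (-(a * τ) - b x / τ) * ((τ ^ (-(d / 2 - 1 : ℝ) - 1) : ℝ) : ℂ) * φ x := fun x => by
    rw [besselK, integral_mul_const]
  change _ = _ * ∫ x : Mink d, besselK (d / 2 - 1) a (b x) * φ x
  simp only [h4]
  rw [← integral_integral_swap hint, ← integral_const_mul, gaussLaplace]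
  refine setIntegral_congr_fun measurableSet_Ioi fun τ hτ => ?_
  have hτ0 : 0 < τ := hτ
  have hτc : (τ : ℂ) ≠ 0 := by exact_mod_cast hτ0.ne'
  rw [gaussWave_eq hr hτ0, Real.div_rpow Real.pi_pos.le hτ0.le]
  have h5 : ∀ x, Complex.exp (-(a * τ) - b x / τ) * ((τ ^ (-(d / 2 - 1 : ℝ) - 1) : ℝ) : ℂ) * φ x =
      (Complex.exp (-(a * τ)) * (Real.exp (-(e / τ)) : ℂ) * ((τ ^ (-(d / 2 - 1 : ℝ) - 1) : ℝ) : ℂ)) *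
        (Complex.exp (Complex.I * (r * sq x / (4 * τ) : ℝ)) * φ x) := fun x => by
    have : -(a * τ) - b x / τ = -(a * τ) + ((-(e / τ) : ℝ) : ℂ) + Complex.I * (r * sq x / (4 * τ) : ℝ) := by
      simp only [hb]; push_cast; field_simp; ring
    rw [this]
    simp only [Complex.exp_add, Complex.ofReal_exp]
    ring
  simp only [h5]
  rw [integral_const_mul, show -((d : ℝ) / 2 - 1) - 1 = -((d : ℝ) / 2) by ring, Real.rpow_neg hτ0.le]
  push_cast
  ring

/-- As the damping of the large times is removed, only the boundary value of `U_α` remains. -/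
lemma tendsto_gaussLaplace (hm : 0 < m) {r : ℝ} (hr : r = 1 ∨ r = -1) (φ : 𝓢(Mink d, ℂ)) {e : ℝ} (he : 0 < e) :
    Tendsto (fun δ : ℝ => gaussLaplace r φ (δ + Complex.I * (r * m ^ 2 : ℝ)) e) (𝓝[>] 0)
      (𝓝 (((√Real.pi * Real.pi ^ ((d : ℝ) / 2) * m ^ ((d : ℝ) - 2) : ℝ) : ℂ) *
        ∫ x : Mink d, besselU ((d : ℂ) / 2 - 1) (((m ^ 2 * sq x : ℝ) + (r * (4 * m ^ 2 * e) : ℝ) * Complex.I) / 4) * φ x)) := by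
  have h2 := continuous_sq (d := d)
  have h3 := φ.continuous
  have hr2 : (r : ℂ) ^ 2 = 1 := by exact_mod_cast sq_abs_one hr
  have hz : (Complex.I * r) ≠ 0 := by rcases hr with rfl | rfl <;> simp
  set a : ℝ → ℂ := fun δ => δ + Complex.I * (r * m ^ 2 : ℝ) with ha
  have hare : ∀ δ, (a δ).re = δ := fun δ => by
    simp only [ha, Complex.add_re, Complex.ofReal_re, mul_comm Complex.I, Complex.re_ofReal_mul, Complex.I_re, mul_zero, add_zero]
  have haim : ∀ δ, (a δ).im = r * m ^ 2 := fun δ => by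
    simp only [ha, Complex.add_im, Complex.ofReal_im, mul_comm Complex.I, Complex.im_ofReal_mul, Complex.I_im, mul_one, zero_add]
  have hanorm : ∀ δ, m ^ 2 ≤ ‖a δ‖ := fun δ => by
    have := Complex.abs_im_le_norm (a δ)
    rw [haim, abs_mul, abs_of_pos (by positivity : 0 < m ^ 2)] at this
    rcases hr with rfl | rfl <;> simpa using this
  have ha0 : Tendsto a (𝓝[>] 0) (𝓝 (a 0)) := by
    have : Continuous a := by simp only [ha]; fun_prop
    exact (this.tendsto 0).mono_left nhdsWithin_le_nhds
  have ham : a 0 ∈ Complex.slitPlane := Or.inr (by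
    rw [haim]; exact mul_ne_zero (by rcases hr with rfl | rfl <;> norm_num) (by positivity))
  have hm2 : (0 : ℝ) < m ^ 2 := by positivity
  have ha0' : (a 0) ^ (((d : ℝ) / 2 - 1 : ℝ) : ℂ) = ((m ^ ((d : ℝ) - 2) : ℝ) : ℂ) * ((Complex.I * r) ^ ((1 - d / 2 : ℝ) : ℂ))⁻¹ := by
    have : a 0 = ((m ^ 2 : ℝ) : ℂ) * (Complex.I * r) := by simp only [ha]; push_cast; ring
    rw [this, Complex.cpow_def_of_ne_zero (mul_ne_zero (by exact_mod_cast hm2.ne') hz), Complex.log_ofReal_mul hm2 hz, add_mul,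
      Complex.exp_add, ← Complex.cpow_neg, Complex.cpow_def_of_ne_zero hz, Real.rpow_def_of_pos hm, Real.log_pow, Complex.ofReal_exp]
    congr 2 <;> push_cast <;> ring
  set b : Mink d → ℂ := fun x => e - Complex.I * (r * sq x / 4 : ℝ) with hb
  have hbre : ∀ x, (b x).re = e := fun x => by
    simp only [hb, Complex.sub_re, Complex.ofReal_re, mul_comm Complex.I, Complex.re_ofReal_mul, Complex.I_re, mul_zero, sub_zero]
  -- In the limit a = irm², the product ab is (m²x² + 4irm²e)/4. Thus the cutoff parameter e becomes
  -- the i0 prescription, with ε = 4m²e.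
  have hab : ∀ x, a 0 * b x = bdryArg m r (4 * m ^ 2 * e) (sq x) := fun x => by
    simp only [ha, hb, bdryArg]; push_cast
    linear_combination (-(r : ℂ) ^ 2 * m ^ 2 * sq x / 4) * Complex.I_sq + (m : ℂ) ^ 2 * sq x / 4 * hr2
  have hd : ((((d : ℝ) / 2 - 1 : ℝ)) : ℂ) = (d : ℂ) / 2 - 1 := by push_cast; ring
  have hpt : ∀ x, Tendsto (fun δ => besselK (d / 2 - 1) (a δ) (b x)) (𝓝[>] 0) (𝓝 ((√Real.pi : ℂ) *
      (a 0) ^ (((d : ℝ) / 2 - 1 : ℝ) : ℂ) * besselU (((d : ℝ) / 2 - 1 : ℝ) : ℂ) (bdryArg m r (4 * m ^ 2 * e) (sq x)))) := fun x => by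
    have h5 : Tendsto (fun δ => (√Real.pi : ℂ) * (a δ) ^ (((d : ℝ) / 2 - 1 : ℝ) : ℂ) * besselU (((d : ℝ) / 2 - 1 : ℝ) : ℂ) (a δ * b x))
        (𝓝[>] 0) (𝓝 ((√Real.pi : ℂ) * (a 0) ^ (((d : ℝ) / 2 - 1 : ℝ) : ℂ) *
          besselU (((d : ℝ) / 2 - 1 : ℝ) : ℂ) (bdryArg m r (4 * m ^ 2 * e) (sq x)))) := by
      refine ((ha0.cpow tendsto_const_nhds ham).const_mul _).mul ?_
      have := (differentiableAt_besselU ((d : ℝ) / 2 - 1) (bdryArg_mem (m := m) (w := sq x) hr (by positivity : 0 < 4 * m ^ 2 * e))).continuousAt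
      exact this.tendsto.comp (by rw [← hab]; exact ha0.mul_const _)
    refine h5.congr' ?_
    filter_upwards [self_mem_nhdsWithin] with δ hδ
    rw [besselK_eq _ (by rw [hare]; exact hδ) (by rw [hbre]; exact he)]
  have hdpos : (0 : ℝ) < d := by exact_mod_cast NeZero.pos d
  obtain ⟨C, hC⟩ := exists_norm_besselK_le (α := d / 2 - 1) (by linarith) he hm2
  have hI : Integrable fun x : Mink d => C * (1 + ‖b x‖) * ‖φ x‖ := by
    have hT := (tame_one_add_norm_pow (d := d) 2).integrable_mul φ
    have hcb : Continuous b := by simp only [hb]; fun_prop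
    refine (hT.norm.const_mul (|C| * (1 + |e|))).mono' (Continuous.aestronglyMeasurable (by fun_prop)) (ae_of_all _ fun x => ?_)
    have h6 : ‖b x‖ ≤ |e| + ‖x‖ ^ 2 := by
      refine (norm_sub_le _ _).trans ?_
      rw [norm_mul, Complex.norm_I, one_mul, Complex.norm_real, Complex.norm_real, Real.norm_eq_abs, Real.norm_eq_abs, abs_div, abs_mul]
      have : |r| = 1 := by rcases hr with rfl | rfl <;> simp
      rw [this, one_mul, abs_of_pos (by norm_num : (0 : ℝ) < 4)]
      linarith [abs_sq_le x, abs_nonneg (sq x)]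
    rw [norm_mul, norm_mul, norm_norm, Real.norm_eq_abs, Real.norm_of_nonneg (by positivity), norm_mul, Complex.norm_real,
      Real.norm_of_nonneg (by positivity)]
    have h7 : 1 + ‖b x‖ ≤ (1 + |e|) * (1 + ‖x‖) ^ 2 := by
      nlinarith [norm_nonneg x, abs_nonneg e, mul_nonneg (abs_nonneg e) (norm_nonneg x), mul_nonneg (abs_nonneg e) (sq_nonneg ‖x‖)]
    calc _ ≤ |C| * ((1 + |e|) * (1 + ‖x‖) ^ 2) * ‖φ x‖ := by gcongr
      _ = _ := by ring
  have hlim : Tendsto (fun δ => ∫ x : Mink d, besselK (d / 2 - 1) (a δ) (b x) * φ x) (𝓝[>] 0)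
      (𝓝 (∫ x : Mink d, (√Real.pi : ℂ) * (a 0) ^ (((d : ℝ) / 2 - 1 : ℝ) : ℂ) *
        besselU (((d : ℝ) / 2 - 1 : ℝ) : ℂ) (bdryArg m r (4 * m ^ 2 * e) (sq x)) * φ x)) := by
    refine tendsto_integral_filter_of_dominated_convergence _ ?_ ?_ hI (ae_of_all _ fun x => (hpt x).mul_const _)
    · filter_upwards [self_mem_nhdsWithin] with δ hδ
      refine Continuous.aestronglyMeasurable (Continuous.mul ?_ h3)
      refine continuous_iff_continuousAt.2 fun x => ?_
      have h7 := (hasDerivAt_besselK_right (d / 2 - 1) (a := a δ) (b := b x) (by rw [hare]; exact hδ) (by rw [hbre]; exact he)).continuousAt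
      exact ContinuousAt.comp (g := fun b => besselK (d / 2 - 1) (a δ) b) (f := b) h7 (by simp only [hb]; fun_prop)
    · filter_upwards [self_mem_nhdsWithin] with δ hδ
      refine ae_of_all _ fun x => ?_
      rw [norm_mul]
      gcongr
      exact hC _ _ (by rw [hare]; exact hδ) (hbre x) (hanorm δ)
  have h8 := (hlim.const_mul ((Complex.I * r) ^ ((1 - d / 2 : ℝ) : ℂ) * ((Real.pi ^ ((d : ℝ) / 2) : ℝ) : ℂ))).congr' (by
    filter_upwards [self_mem_nhdsWithin] with δ hδ
    exact (gaussLaplace_eq hr φ (a := a δ) (by rw [hare]; exact hδ) he).symm)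
  convert h8 using 2
  simp only [mul_assoc, integral_const_mul]
  rw [ha0', hd]
  have h9 : (Complex.I * r) ^ ((1 - d / 2 : ℝ) : ℂ) ≠ 0 := by simp [Complex.cpow_eq_zero_iff, hz]
  simp only [bdryArg]
  generalize (Complex.I * r) ^ ((1 - d / 2 : ℝ) : ℂ) = κ at h9 ⊢
  rw [Complex.ofReal_mul, Complex.ofReal_mul]
  field_simp

end

/-! ### From the Feynman propagators to the Green functions -/

section
variable {d : ℕ} [NeZero d] {m : ℝ}

/-- Interchange of the limits δ ↘ 0 and e ↘ 0: the error made by the cutoff is bounded uniformly in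
δ. -/
lemma tendsto_of_approx {X Y₀ : ℝ → ℂ} {Y : ℝ → ℝ → ℂ} {D : ℝ → ℝ} {L : ℂ} (hD : Tendsto D (𝓝[>] 0) (𝓝 0))
    (hY₀ : Tendsto Y₀ (𝓝[>] 0) (𝓝 L)) (hY : ∀ e > 0, Tendsto (fun δ => Y δ e) (𝓝[>] 0) (𝓝 (Y₀ e)))
    (h : ∀ e > 0, ∀ δ > 0, ‖Y δ e - X δ‖ ≤ D e) : Tendsto X (𝓝[>] 0) (𝓝 L) := by
  rw [Metric.tendsto_nhds]
  intro η hη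
  have h1 := (Metric.tendsto_nhds.1 hD (η / 3) (by positivity)).and
    ((Metric.tendsto_nhds.1 hY₀ (η / 3) (by positivity)).and self_mem_nhdsWithin)
  obtain ⟨e, he1, he2, he⟩ := h1.exists
  filter_upwards [Metric.tendsto_nhds.1 (hY e he) (η / 3) (by positivity), self_mem_nhdsWithin] with δ h2 hδ
  have h3 := h e he δ hδ
  rw [Real.dist_eq, sub_zero] at he1
  have h4 : dist (X δ) (Y δ e) ≤ D e := by rw [dist_comm, dist_eq_norm]; exact h3
  have h5 := dist_triangle4 (X δ) (Y δ e) (Y₀ e) L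
  linarith [le_abs_self (D e)]

lemma one_sub_exp_nonneg {x : ℝ} (hx : 0 ≤ x) : 0 ≤ 1 - Real.exp (-x) :=
  sub_nonneg.2 (Real.exp_le_one_iff.2 (by linarith))

/-- The Gaussian wave is bounded for small τ and O(τ^(-d/2)) for large τ, while 1 - e^(-e/τ) ≤ e/τ.
The product is therefore integrable even for d = 1, 2, where the wave's decay bound alone is not. -/
lemma tendsto_integral_gaussWave {r : ℝ} (hr : r = 1 ∨ r = -1) (φ : 𝓢(Mink d, ℂ)) :
    (∀ e > 0, IntegrableOn (fun τ : ℝ => (1 - Real.exp (-(e / τ))) * ‖gaussWave r φ τ‖) (Set.Ioi 0)) ∧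
    Tendsto (fun e : ℝ => ∫ τ in Set.Ioi (0 : ℝ), (1 - Real.exp (-(e / τ))) * ‖gaussWave r φ τ‖) (𝓝[>] 0) (𝓝 0) := by
  have hc := (continuous_gaussWave r φ).measurable
  have hd : (0 : ℝ) < d := by exact_mod_cast NeZero.pos d
  have hI : ∀ e > 0, IntegrableOn (fun τ : ℝ => (1 - Real.exp (-(e / τ))) * ‖gaussWave r φ τ‖) (Set.Ioi 0) := fun e he => by
    rw [← Set.Ioc_union_Ioi_eq_Ioi (zero_le_one' ℝ)]
    refine IntegrableOn.union ?_ ?_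
    · refine (integrableOn_const (C := ∫ p, ‖ft d φ p‖) (by simp)).mono' (by fun_prop) ?_
      filter_upwards [ae_restrict_mem measurableSet_Ioc] with τ hτ
      have hτ0 : 0 < τ := hτ.1
      have h1 := one_sub_exp_nonneg (div_nonneg he.le hτ0.le)
      rw [norm_mul, norm_norm, Real.norm_of_nonneg h1]
      calc _ ≤ 1 * ‖gaussWave r φ τ‖ := by gcongr; linarith [Real.exp_pos (-(e / τ))]
        _ ≤ _ := by rw [one_mul]; exact norm_gaussWave_le _ _ _
    · refine ((integrableOn_Ioi_rpow_of_lt (a := -((d : ℝ) / 2) - 1) (by linarith) one_pos).const_mul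
        (e * (Real.pi ^ ((d : ℝ) / 2) * ∫ x, ‖φ x‖))).mono' (by fun_prop) ?_
      filter_upwards [ae_restrict_mem measurableSet_Ioi] with τ hτ
      have hτ0 : 0 < τ := one_pos.trans hτ
      have h1 := one_sub_exp_nonneg (div_nonneg he.le hτ0.le)
      rw [norm_mul, norm_norm, Real.norm_of_nonneg h1]
      calc _ ≤ e / τ * ((Real.pi / τ) ^ ((d : ℝ) / 2) * ∫ x, ‖φ x‖) := by
            gcongr
            · linarith [Real.one_sub_le_exp_neg (e / τ)]
            · exact norm_gaussWave_le_rpow hr hτ0 φ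
        _ = _ := by
          rw [Real.div_rpow Real.pi_pos.le hτ0.le, Real.rpow_sub hτ0, Real.rpow_neg hτ0.le, Real.rpow_one]
          ring
  refine ⟨hI, ?_⟩
  have h0 : ∫ τ in Set.Ioi (0 : ℝ), (1 - Real.exp (-((0 : ℝ) / τ))) * ‖gaussWave r φ τ‖ = 0 := by simp
  suffices h : Tendsto (fun e : ℝ => ∫ τ in Set.Ioi (0 : ℝ), (1 - Real.exp (-(e / τ))) * ‖gaussWave r φ τ‖) (𝓝[>] 0)
      (𝓝 (∫ τ in Set.Ioi (0 : ℝ), (1 - Real.exp (-((0 : ℝ) / τ))) * ‖gaussWave r φ τ‖)) by rwa [h0] at h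
  refine tendsto_integral_filter_of_dominated_convergence _ (Eventually.of_forall fun e => by fun_prop) ?_ (hI 1 one_pos)
    (ae_of_all _ fun τ => ?_)
  · filter_upwards [Ioc_mem_nhdsGT (zero_lt_one' ℝ)] with e he
    filter_upwards [ae_restrict_mem measurableSet_Ioi] with τ hτ
    have hτ0 : (0 : ℝ) < τ := hτ
    rw [norm_mul, norm_norm, Real.norm_of_nonneg (one_sub_exp_nonneg (div_nonneg he.1.le hτ0.le))]
    have := he.2
    gcongr
  · have : Continuous fun e : ℝ => (1 - Real.exp (-(e / τ))) * ‖gaussWave r φ τ‖ := by fun_prop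
    exact (this.tendsto 0).mono_left nhdsWithin_le_nhds

/-- The Feynman and anti-Feynman propagators are multiples of the boundary values of `U_{d/2-1}`. -/
theorem tendsto_feynDen (hm : 0 < m) {r : ℝ} (hr : r = 1 ∨ r = -1) (φ : 𝓢(Mink d, ℂ)) :
    Tendsto (fun δ => ∫ p, 1 / feynDen m r δ p * ft d φ p) (𝓝[>] 0)
      (𝓝 (Complex.I * r * (((√Real.pi * Real.pi ^ ((d : ℝ) / 2) * m ^ ((d : ℝ) - 2) : ℝ) : ℂ) * Wdist d m r φ))) := by
  obtain ⟨hI, hD⟩ := tendsto_integral_gaussWave hr φ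
  have hmul : Tendsto (fun e : ℝ => 4 * m ^ 2 * e) (𝓝[>] 0) (𝓝[>] 0) := by
    refine tendsto_nhdsWithin_iff.2 ⟨?_, ?_⟩
    · have : Continuous fun e : ℝ => 4 * m ^ 2 * e := by fun_prop
      simpa using (this.tendsto 0).mono_left nhdsWithin_le_nhds
    · filter_upwards [self_mem_nhdsWithin] with e he
      have he0 : (0 : ℝ) < e := he
      exact (by positivity : (0 : ℝ) < 4 * m ^ 2 * e)
  have hY := ((((isUBoundaryValue_Wdist hm hr φ).2.comp hmul).const_mul
    ((√Real.pi * Real.pi ^ ((d : ℝ) / 2) * m ^ ((d : ℝ) - 2) : ℝ) : ℂ)).const_mul (Complex.I * r))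
  -- Here X is the Feynman integral, Y δ e its version with cutoff, and Y₀ e the approximant of the
  -- boundary value of U_{d/2-1} with ε = 4m²e.
  refine tendsto_of_approx (Y := fun (δ e : ℝ) => Complex.I * r * gaussLaplace r φ (δ + Complex.I * (r * m ^ 2 : ℝ)) e) hD hY
    (fun e he => (tendsto_gaussLaplace hm hr φ he).const_mul _) fun e he δ hδ => ?_
  have hnr : ‖Complex.I * (r : ℂ)‖ = 1 := by rcases hr with rfl | rfl <;> simp
  have hg := continuous_gaussWave r φ
  set a : ℂ := δ + Complex.I * (r * m ^ 2 : ℝ) with ha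
  have hare : a.re = δ := by
    simp only [ha, Complex.add_re, Complex.ofReal_re, mul_comm Complex.I, Complex.re_ofReal_mul, Complex.I_re, mul_zero, add_zero]
  have hexp : ∀ τ : ℝ, ‖Complex.exp (-(a * τ))‖ = Real.exp (-(δ * τ)) := fun τ => by
    rw [Complex.norm_exp, Complex.neg_re, Complex.re_mul_ofReal, hare]
  have hint : ∀ c : ℝ → ℝ, Measurable c → (∀ τ > 0, ‖c τ‖ ≤ 1) →
      IntegrableOn (fun τ : ℝ => Complex.exp (-(a * τ)) * (c τ : ℂ) * gaussWave r φ τ) (Set.Ioi 0) := fun c hc hc1 => by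
    have h1 := (exp_neg_integrableOn_Ioi 0 hδ).mul_const (∫ p, ‖ft d φ p‖)
    refine h1.mono' ?_ ?_
    · have := hg.measurable
      fun_prop
    · filter_upwards [ae_restrict_mem measurableSet_Ioi] with τ hτ
      rw [norm_mul, norm_mul, hexp, Complex.norm_real, neg_mul]
      calc _ ≤ Real.exp (-(δ * τ)) * 1 * ∫ p, ‖ft d φ p‖ := by
            gcongr
            · exact hc1 τ hτ
            · exact norm_gaussWave_le _ _ _
        _ = _ := by rw [mul_one]
  have h1 := hint (fun τ => Real.exp (-(e / τ))) (by fun_prop) fun τ hτ => by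
    rw [Real.norm_of_nonneg (Real.exp_pos _).le, Real.exp_le_one_iff, neg_nonpos]
    exact div_nonneg he.le (le_of_lt hτ)
  have h2 := hint (fun _ => 1) measurable_const fun τ _ => by simp
  simp only [Complex.ofReal_one, mul_one] at h2
  rw [integral_div_feynDen hr hδ, ← mul_sub, norm_mul, hnr, one_mul, gaussLaplace, ← integral_sub h1 h2]
  refine norm_integral_le_of_norm_le (hI e he) ?_
  filter_upwards [ae_restrict_mem measurableSet_Ioi] with τ hτ
  have hτ0 : (0 : ℝ) < τ := hτ
  have h3 : Complex.exp (-(a * τ)) * (Real.exp (-(e / τ)) : ℂ) * gaussWave r φ τ - Complex.exp (-(a * τ)) * gaussWave r φ τ =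
      -(Complex.exp (-(a * τ)) * ((1 - Real.exp (-(e / τ)) : ℝ) : ℂ) * gaussWave r φ τ) := by push_cast; ring
  rw [h3, norm_neg, norm_mul, norm_mul, hexp, Complex.norm_real,
    Real.norm_of_nonneg (one_sub_exp_nonneg (div_nonneg he.le hτ0.le))]
  gcongr
  refine mul_le_of_le_one_left (one_sub_exp_nonneg (div_nonneg he.le hτ0.le)) (Real.exp_le_one_iff.2 ?_)
  nlinarith [show (0 : ℝ) < δ from hδ]

lemma integrable_div_feynDen {r : ℝ} (hr : r = 1 ∨ r = -1) {δ : ℝ} (hδ : 0 < δ) (ψ : 𝓢(Mink d, ℂ)) :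
    Integrable fun p => 1 / feynDen m r δ p * ψ p := by
  have h1 := (continuous_sq (d := d)).measurable
  refine ψ.integrable.bdd_mul (c := δ⁻¹) (Measurable.aestronglyMeasurable (by unfold feynDen; fun_prop)) (ae_of_all _ fun p => ?_)
  rw [norm_div, norm_one, one_div]
  refine inv_anti₀ hδ ?_
  have h2 : (feynDen m r δ p).im = -(r * δ) := by rw [feynDen]; simp [← Complex.ofReal_pow]
  have h3 := Complex.abs_im_le_norm (feynDen m r δ p)
  rw [h2, abs_neg, abs_mul, abs_of_pos hδ] at h3
  rcases hr with rfl | rfl <;> simpa using h3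

/-- The sum of the retarded and the advanced Fourier integrals equals the sum of the Feynman and the
anti-Feynman ones. -/
lemma propLim_add (hm : 0 < m) {s : ℝ} (hs : s = 1 ∨ s = -1) (φ : 𝓢(Mink d, ℂ)) :
    propLim m s (ft d φ) + propLim m (-s) (ft d φ) = (2 * (Real.pi : ℂ)) ^ d * Tdist d m φ := by
  have hs' : -s = 1 ∨ -s = -1 := by rcases hs with rfl | rfl <;> simp
  have h1 := (tendsto_signDen hm hs (ft d φ)).add (tendsto_signDen hm hs' (ft d φ))
  have h2 := (tendsto_feynDen hm (Or.inl rfl) φ).add (tendsto_feynDen hm (Or.inr rfl) φ)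
  refine (tendsto_nhds_unique (h1.congr' ?_) h2).trans ?_
  · filter_upwards [self_mem_nhdsWithin] with ε hε
    rw [← integral_add ((isReg_signDen hm hs).integrable hε _) ((isReg_signDen hm hs').integrable hε _),
      ← integral_add (integrable_div_feynDen (Or.inl rfl) hε _) (integrable_div_feynDen (Or.inr rfl) hε _)]
    refine integral_congr_ae ?_
    filter_upwards [ae_time_ne_zero] with p hp
    -- For p⁰ ≠ 0 the two signs ±s sgn p⁰ are +1 and -1 in some order, so the sums of the two
    -- denominators' inverses agree pointwise.
    have h3 : s * ε * Real.sign (p 0) = 1 * ε ∨ s * ε * Real.sign (p 0) = -1 * ε := by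
      rcases hs with rfl | rfl <;> rcases lt_or_gt_of_ne hp with h | h
      · right; rw [Real.sign_of_neg h]; ring
      · left; rw [Real.sign_of_pos h]; ring
      · left; rw [Real.sign_of_neg h]; ring
      · right; rw [Real.sign_of_pos h]; ring
    simp only [signDen, feynDen, ← add_mul, neg_mul s]
    rcases h3 with h3 | h3
    · rw [neg_mul, h3, ← neg_mul]
    · rw [neg_mul (s * ε), h3, add_comm]; simp
  · rw [← smul_Wdist_sub hm]
    simp only [smul_apply, sub_apply, smul_eq_mul]
    have h4 : Real.pi ^ ((d : ℝ) / 2) * (4 * Real.pi) ^ ((d : ℝ) / 2) = (2 * Real.pi) ^ d := by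
      rw [← Real.mul_rpow Real.pi_pos.le (by positivity), show Real.pi * (4 * Real.pi) = (2 * Real.pi) ^ (2 : ℝ) by
        rw [Real.rpow_two]; ring, ← Real.rpow_mul (by positivity), mul_div_cancel₀ _ two_ne_zero, Real.rpow_natCast]
    have h5 : (4 * Real.pi) ^ ((d : ℝ) / 2) ≠ 0 := by positivity
    have h6 : √Real.pi * Real.pi ^ ((d : ℝ) / 2) * m ^ ((d : ℝ) - 2) =
        (2 * Real.pi) ^ d * (√Real.pi * m ^ ((d : ℝ) - 2) / (4 * Real.pi) ^ ((d : ℝ) / 2)) := by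
      rw [← h4]; field_simp
    rw [h6]
    push_cast
    ring

lemma exists_cutoff : ∃ χ : ℝ → ℝ, ContDiff ℝ ∞ χ ∧ (∀ t ≤ -1, χ t = 0) ∧ ∀ t, 1 ≤ t → χ t = 1 :=
  ⟨fun t => Real.smoothTransition ((t + 1) / 2), Real.smoothTransition.contDiff.comp (by fun_prop),
    fun t ht => Real.smoothTransition.zero_of_nonpos (by linarith), fun t ht => Real.smoothTransition.one_of_one_le (by linarith)⟩

/-- Multiply the identity for the sum of both propagators by χ(R s x⁰) and let R → ∞. On the left
the summand supported at s x⁰ ≤ 0 disappears and the other is unchanged; on the right `Tdist`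
becomes `Gdist`. -/
theorem propLim_eq_Gdist (hm : 0 < m) {s : ℝ} (hs : s = 1 ∨ s = -1) (φ : 𝓢(Mink d, ℂ)) :
    propLim m s (ft d φ) = (2 * (Real.pi : ℂ)) ^ d * Gdist d m s φ := by
  obtain ⟨χ, h, h0, h1⟩ := exists_cutoff
  have hs' : -s = 1 ∨ -s = -1 := by rcases hs with rfl | rfl <;> simp
  have hs0 : s ≠ 0 := by rcases hs with rfl | rfl <;> norm_num
  have hne : -s ≠ s := by rcases hs with rfl | rfl <;> norm_num
  have h2 := (tendsto_propLim_cutoff hm hs hs h h0 h1 φ).add (tendsto_propLim_cutoff hm hs hs' h h0 h1 φ)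
  rw [if_pos rfl, if_neg hne, add_zero] at h2
  simp only [propLim_add hm hs] at h2
  exact tendsto_nhds_unique h2 ((isThetaMul_Tdist hm hs0 χ h h0 h1 φ).const_mul _)

theorem isFourierPropagator_Gdist (hm : 0 < m) {s : ℝ} (hs : s = 1 ∨ s = -1) : IsFourierPropagator m s (Gdist d m s) := fun φ => by
  simp only [← ft_apply]
  refine ⟨fun ε hε => (isReg_signDen hm hs).integrable hε (ft d φ), ?_⟩
  have h := (tendsto_signDen hm hs (ft d φ)).const_mul (1 / (2 * (Real.pi : ℂ)) ^ d)
  have hpi : (2 * (Real.pi : ℂ)) ^ d ≠ 0 := pow_ne_zero _ (mul_ne_zero two_ne_zero (by exact_mod_cast Real.pi_ne_zero))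
  rw [propLim_eq_Gdist hm hs, ← mul_assoc, one_div_mul_cancel hpi, one_mul] at h
  exact h

/-- The distribution `Gdist` is a Green function. -/
theorem kg_Gdist (hm : 0 < m) {s : ℝ} (hs : s = 1 ∨ s = -1) :
    (m : ℂ) ^ 2 • Gdist d m s - box (Gdist d m s) = TemperedDistribution.delta (0 : Mink d) := by
  ext φ
  have hpi : (2 * (Real.pi : ℂ)) ^ d ≠ 0 := pow_ne_zero _ (mul_ne_zero two_ne_zero (by exact_mod_cast Real.pi_ne_zero))
  rw [kg_apply, TemperedDistribution.delta_apply]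
  refine mul_left_cancel₀ hpi ?_
  rw [← propLim_eq_Gdist hm hs, ← integral_ft]
  refine tendsto_nhds_unique (tendsto_signDen hm hs (ft d (kgOp m φ))) ?_
  have hr := isReg_signDen (d := d) hm hs
  -- The operator multiplies the transform by m² + p², whose quotient by the regularized denominator
  -- has modulus at most 1 and tends to 1 off the mass shell. The limit is the integral of the
  -- transform, (2π)^d φ(0).
  refine tendsto_integral_filter_of_dominated_convergence (fun p => ‖ft d φ p‖) ?_ ?_ (ft d φ).integrable.norm ?_
  · filter_upwards [self_mem_nhdsWithin] with ε hε
    exact (hr.integrable hε _).aestronglyMeasurable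
  · filter_upwards [self_mem_nhdsWithin] with ε hε
    filter_upwards [ae_time_ne_zero] with p hp
    obtain ⟨δ, hδ, h⟩ := hr.lower ε hε
    have h1 := hr.le_norm ε hε p
    rw [ft_kgOp, ← mul_assoc, norm_mul, ← Complex.ofReal_pow, ← Complex.ofReal_add, norm_mul, norm_div, norm_one, Complex.norm_real,
      Real.norm_eq_abs, one_div_mul_eq_div]
    exact mul_le_of_le_one_left (norm_nonneg _) (div_le_one_of_le₀ h1 (norm_nonneg _))
  · filter_upwards [ae_add_sq_ne_zero (d := d) (m ^ 2)] with p hp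
    have h1 : ((m : ℂ) ^ 2 + (sq p : ℂ)) ≠ 0 := by exact_mod_cast hp
    have h2 : Tendsto (fun ε => signDen m s ε p) (𝓝[>] 0) (𝓝 ((m : ℂ) ^ 2 + (sq p : ℂ))) := by
      have : Continuous fun ε => signDen m s ε p := by unfold signDen; fun_prop
      have h3 := (this.tendsto 0).mono_left (nhdsWithin_le_nhds (s := Set.Ioi 0))
      simpa [signDen] using h3
    have h4 := (((tendsto_const_nhds (x := (1 : ℂ))).div h2 h1).mul_const (ft d (kgOp m φ) p))
    rwa [ft_kgOp, ← mul_assoc, one_div_mul_cancel h1, one_mul, ← ft_kgOp] at h4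

end

section
section Cutoff
variable {E : Type*} [NormedAddCommGroup E] [NormedSpace ℝ E]

/-! ### Density of the compactly supported test functions -/

/-- Multiplication by `κ(c x)` converges to the identity as `c ↘ 0`, for a cutoff `κ`. -/
theorem tendsto_smul_cutoff {κ : E → ℂ} (hκ : ContDiff ℝ ∞ κ) (hs : HasCompactSupport κ) (h1 : ∀ x, ‖x‖ ≤ 1 → κ x = 1)
    (f : 𝓢(E, ℂ)) : Tendsto (fun n : ℕ => SchwartzMap.smulLeftCLM ℂ (fun x => κ (((n : ℝ) + 1)⁻¹ • x)) f) atTop (𝓝 f) := by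
  have hB : ∀ i, ∃ B, 0 ≤ B ∧ ∀ y, ‖iteratedFDeriv ℝ i (fun x => κ x - 1) y‖ ≤ B := fun i => by
    set K := hs.toSchwartzMap hκ
    have hK : ∀ y, ‖iteratedFDeriv ℝ i κ y‖ ≤ SchwartzMap.seminorm ℝ 0 i K := fun y => by
      have h := SchwartzMap.le_seminorm ℝ 0 i K y
      rwa [pow_zero, one_mul] at h
    refine ⟨SchwartzMap.seminorm ℝ 0 i K + 1, by positivity, fun y => ?_⟩
    rw [show (fun x => κ x - 1) = κ - fun _ => 1 from rfl,
      iteratedFDeriv_sub_apply (hκ.of_le (by exact_mod_cast le_top)).contDiffAt contDiff_const.contDiffAt]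
    refine (norm_sub_le _ _).trans (add_le_add (hK y) ?_)
    rcases eq_or_ne i 0 with rfl | hi
    · rw [norm_iteratedFDeriv_zero]; simp
    · rw [iteratedFDeriv_const_of_ne hi]; simp
  choose B hB0 hB using hB
  -- κ(cx) - 1 vanishes near every x with c|x| < 1; elsewhere c|x| ≥ 1 may be inserted for free.
  -- This trades one power of |x|, harmless for Schwartz functions, for a factor c.
  have hg : ∀ c : ℝ, 0 < c → c ≤ 1 → ∀ i x, ‖iteratedFDeriv ℝ i (fun x => κ (c • x) - 1) x‖ ≤ B i * (c * ‖x‖) := fun c hc hc1 i x => by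
    rcases lt_or_ge (c * ‖x‖) 1 with h | h
    · have h2 : (fun x => κ (c • x) - 1) =ᶠ[𝓝 x] fun _ => 0 := by
        have : ∀ᶠ y in 𝓝 x, c * ‖y‖ < 1 := by
          have hc : Continuous fun y : E => c * ‖y‖ := by fun_prop
          exact hc.continuousAt.eventually_lt continuousAt_const h
        filter_upwards [this] with y hy
        rw [h1 _ (by rw [norm_smul, Real.norm_of_nonneg hc.le]; exact hy.le), sub_self]
      rw [(h2.iteratedFDeriv ℝ i).eq_of_nhds]
      have := hB0 i
      have h3 : iteratedFDeriv ℝ i (fun _ : E => (0 : ℂ)) x = 0 := by simp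
      rw [h3, norm_zero]; positivity
    · rw [iteratedFDeriv_comp_const_smul (f := fun x => κ x - 1) c ((hκ.sub contDiff_const).of_le (by exact_mod_cast le_top)), norm_smul, norm_pow,
        Real.norm_of_nonneg hc.le]
      calc _ ≤ 1 * B i := by gcongr; exacts [pow_le_one₀ hc.le hc1, hB _ _]
        _ ≤ _ := by nlinarith [hB0 i]
  have htg : ∀ c : ℝ, 0 < c → (fun x => κ (c • x)).HasTemperateGrowth := fun c hc =>
    (hs.hasTemperateGrowth hκ).comp (f := fun x => c • x) (c • ContinuousLinearMap.id ℝ E).hasTemperateGrowth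
  rw [(schwartz_withSeminorms ℝ E ℂ).tendsto_nhds]
  rintro ⟨k, l⟩ ε hε
  set S := ∑ i ∈ Finset.range (l + 1), (l.choose i : ℝ) * B i * SchwartzMap.seminorm ℝ (k + 1) (l - i) f with hS
  have hS0 : 0 ≤ S := Finset.sum_nonneg fun i _ => mul_nonneg (mul_nonneg (Nat.cast_nonneg _) (hB0 i)) (apply_nonneg _ _)
  have hlim : Tendsto (fun n : ℕ => ((n : ℝ) + 1)⁻¹ * S) atTop (𝓝 0) := by
    have := (tendsto_one_div_add_atTop_nhds_zero_nat (𝕜 := ℝ)).mul_const S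
    simpa [one_div] using this
  filter_upwards [hlim.eventually (gt_mem_nhds hε)] with n hn
  refine lt_of_le_of_lt ?_ hn
  set c : ℝ := ((n : ℝ) + 1)⁻¹ with hc
  have hc0 : 0 < c := by positivity
  have hc1 : c ≤ 1 := inv_le_one_of_one_le₀ (by linarith [(Nat.cast_nonneg n : (0 : ℝ) ≤ n)])
  refine SchwartzMap.seminorm_le_bound ℝ k l _ (by positivity) fun x => ?_
  have hfe : ((SchwartzMap.smulLeftCLM ℂ (fun x => κ (c • x)) f - f : 𝓢(E, ℂ)) : E → ℂ) = fun x => (κ (c • x) - 1) * f x := by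
    ext x
    rw [sub_apply, SchwartzMap.smulLeftCLM_apply_apply (htg c hc0), smul_eq_mul]; ring
  have hcd : ContDiff ℝ ∞ fun x => κ (c • x) - 1 := (hκ.comp (contDiff_const_smul c)).sub contDiff_const
  rw [hfe]
  calc _ ≤ ‖x‖ ^ k * ∑ i ∈ Finset.range (l + 1), (l.choose i : ℝ) * ‖iteratedFDeriv ℝ i (fun x => κ (c • x) - 1) x‖ *
        ‖iteratedFDeriv ℝ (l - i) f x‖ := by
        gcongr
        exact norm_iteratedFDeriv_mul_le hcd (f.smooth ⊤) x (by exact_mod_cast le_top)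
    _ ≤ ‖x‖ ^ k * ∑ i ∈ Finset.range (l + 1), (l.choose i : ℝ) * (B i * (c * ‖x‖)) * ‖iteratedFDeriv ℝ (l - i) f x‖ := by
        gcongr with i hi
        exact hg c hc0 hc1 i x
    _ = c * ∑ i ∈ Finset.range (l + 1), (l.choose i : ℝ) * B i * (‖x‖ ^ (k + 1) * ‖iteratedFDeriv ℝ (l - i) f x‖) := by
        rw [Finset.mul_sum, Finset.mul_sum]
        exact Finset.sum_congr rfl fun i _ => by ring
    _ ≤ _ := by
        refine mul_le_mul_of_nonneg_left (Finset.sum_le_sum fun i _ => ?_) hc0.le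
        exact mul_le_mul_of_nonneg_left (SchwartzMap.le_seminorm ℝ (k + 1) (l - i) f x) (mul_nonneg (Nat.cast_nonneg _) (hB0 i))

end Cutoff

variable {d : ℕ}

/-- A tempered distribution is determined by its values on compactly supported test functions obtained by
cutting off. -/
lemma apply_eq_zero_of_cutoff (D : 𝓢'(Mink d, ℂ)) (f : 𝓢(Mink d, ℂ))
    (h : ∀ g : 𝓢(Mink d, ℂ), HasCompactSupport g → (∀ x, f x = 0 → g x = 0) → D g = 0) : D f = 0 := by
  set b : ContDiffBump (0 : Mink d) := ⟨1, 2, one_pos, one_lt_two⟩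
  set κ : Mink d → ℂ := fun x => (b x : ℂ) with hκdef
  have hκ : ContDiff ℝ ∞ κ := Complex.ofRealCLM.contDiff.comp b.contDiff
  have hs : HasCompactSupport κ := b.hasCompactSupport.comp_left (g := fun t : ℝ => (t : ℂ)) Complex.ofReal_zero
  have hlim := tendsto_smul_cutoff hκ hs (fun x hx => by
    rw [hκdef]; simp [b.one_of_mem_closedBall (mem_closedBall_zero_iff.2 hx)]) f
  have h1 := (D.continuous.tendsto f).comp hlim
  refine tendsto_nhds_unique h1 (tendsto_const_nhds.congr fun n => ?_)
  set c : ℝ := ((n : ℝ) + 1)⁻¹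
  have hc : c ≠ 0 := by positivity
  have hcs : HasCompactSupport fun x => κ (c • x) := hs.comp_homeomorph (Homeomorph.smulOfNeZero c hc)
  have htg : (fun x => κ (c • x)).HasTemperateGrowth := hcs.hasTemperateGrowth (hκ.comp (contDiff_const_smul c))
  have he : ∀ x, SchwartzMap.smulLeftCLM ℂ (fun x => κ (c • x)) f x = κ (c • x) * f x := fun x => by
    rw [SchwartzMap.smulLeftCLM_apply_apply htg, smul_eq_mul]
  refine (h _ ?_ fun x hx => by rw [he, hx, mul_zero]).symm
  rw [show (SchwartzMap.smulLeftCLM ℂ (fun x => κ (c • x)) f : Mink d → ℂ) = fun x => κ (c • x) * f x from funext he]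
  exact hcs.mul_right

/-- A distribution vanishes on the test functions whose support is disjoint from its support. -/
theorem apply_eq_zero_of_disjoint (D : 𝓢'(Mink d, ℂ)) (f : 𝓢(Mink d, ℂ)) (h : Disjoint (tsupport f) (Distribution.dsupport D)) :
    D f = 0 := by
  refine apply_eq_zero_of_cutoff D f fun g hg hgf => ?_
  have hsub : tsupport g ⊆ tsupport f := closure_mono fun x hx hfx => hx (hgf x hfx)
  have hloc : ∀ x ∈ tsupport g, ∃ b : ContDiffBump x, Distribution.IsVanishingOn D (Metric.closedBall x b.rOut) := fun x hx => by
    obtain ⟨U, hU, hUo, hxU⟩ := (Distribution.notMem_dsupport_iff (f := D) x).1 fun hD => Set.disjoint_left.1 h (hsub hx) hD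
    obtain ⟨r, hr, hrU⟩ := Metric.nhds_basis_closedBall.mem_iff.1 (hUo.mem_nhds hxU)
    exact ⟨⟨r / 2, r, by positivity, by linarith⟩, hU.mono hrU⟩
  choose! b hb using fun x : tsupport g => hloc x x.2
  obtain ⟨t, ht⟩ := (IsCompact.elim_finite_subcover (s := tsupport g) hg (fun x : tsupport g => Metric.ball (x : Mink d) (b x).rIn)
    (fun _ => Metric.isOpen_ball) fun x hx => Set.mem_iUnion.2 ⟨⟨x, hx⟩, Metric.mem_ball_self (b ⟨x, hx⟩).rIn_pos⟩)
  have htg : ∀ x : tsupport g, (fun y => ((b x y : ℝ) : ℂ)).HasTemperateGrowth := fun x =>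
    ((b x).hasCompactSupport.comp_left (g := fun t : ℝ => (t : ℂ)) Complex.ofReal_zero).hasTemperateGrowth
      (Complex.ofRealCLM.contDiff.comp (b x).contDiff)
  -- Multiplying by 1 - b_x does not change the value of D, since b_x is supported where D vanishes.
  -- After finitely many such factors the function vanishes on all of the support of g.
  have key : ∀ t : Finset (tsupport g), ∃ k : 𝓢(Mink d, ℂ), D k = D g ∧ ∀ y, k y = (∏ x ∈ t, (1 - ((b x y : ℝ) : ℂ))) * g y := fun t => by
    classical
    induction t using Finset.induction_on with
    | empty => exact ⟨g, rfl, fun y => by simp⟩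
    | insert x t hx ih =>
      obtain ⟨k, hk, hky⟩ := ih
      have he : ∀ y, SchwartzMap.smulLeftCLM ℂ (fun y => ((b x y : ℝ) : ℂ)) k y = ((b x y : ℝ) : ℂ) * k y := fun y => by
        rw [SchwartzMap.smulLeftCLM_apply_apply (htg x), smul_eq_mul]
      refine ⟨k - SchwartzMap.smulLeftCLM ℂ (fun y => ((b x y : ℝ) : ℂ)) k, ?_, fun y => ?_⟩
      · rw [map_sub, hb x (SchwartzMap.smulLeftCLM ℂ (fun y => ((b x y : ℝ) : ℂ)) k) ?_, hk, sub_zero]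
        rw [← (b x).tsupport_eq]
        refine closure_mono fun y hy hby => hy ?_
        rw [he, show b x y = 0 from hby, Complex.ofReal_zero, zero_mul]
      · rw [sub_apply, he, Finset.prod_insert hx, hky]; ring
  obtain ⟨k, hk, hky⟩ := key t
  rw [← hk, show k = 0 from ?_, map_zero]
  ext y
  rw [hky, zero_apply]
  by_cases hy : y ∈ tsupport g
  · obtain ⟨x, hx, hyx⟩ : ∃ x ∈ t, y ∈ Metric.ball (x : Mink d) (b x).rIn := by simpa using ht hy
    rw [Finset.prod_eq_zero hx, zero_mul]
    rw [(b x).one_of_mem_closedBall (Metric.ball_subset_closedBall hyx), Complex.ofReal_one, sub_self]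
  · rw [image_eq_zero_of_notMem_tsupport hy, mul_zero]

end

section
open LineDeriv FourierTransform

variable {d : ℕ} [NeZero d] {m : ℝ}

/-! ### The retarded support -/

lemma dsupport_Gdist (hm : 0 < m) (s : ℝ) : Distribution.dsupport (Gdist d m s) ⊆ cone d s := by
  have hcl : IsClosed (cone d s) := by
    have h1 := continuous_sq (d := d)
    have h2 : Continuous fun x : Mink d => s * x 0 := by fun_prop
    exact (isClosed_le h1 continuous_const).inter (isClosed_le continuous_const h2)
  intro x hx
  refine (Distribution.mem_dsupport_iff x).1 hx _ (fun φ hφ => ?_) hcl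
  rw [Gdist, smul_apply, IDist_apply le_rfl (bddMeas_theta s) (adm_cutPow_jser hm 0)]
  have h0 : ∀ y ∈ (tsupport φ)ᶜ, φ y = 0 := fun y hy => image_eq_zero_of_notMem_tsupport hy
  have hB := eventuallyEq_zero_Bop (isClosed_tsupport φ).isOpen_compl h0
  have : ∀ y : Mink d, kerI ((d - 2) / 2) (fun t => theta (s * t)) (cutPow d m (jser (bet d) 0)) y *
      Bop d ((d - 2) / 2) φ y = 0 := fun y => by
    by_cases hy : y ∈ cone d s
    · rw [hB _ y fun h => hφ h hy, mul_zero]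
    · rw [kerI]
      rcases not_and_or.1 hy with h | h
      · rw [cutPow, if_neg (fun h' => h h'.le)]; simp
      · rw [theta, if_neg (fun h' => h h'.le)]; simp
  simp [this]

/-! ### Uniqueness -/

/-- Division by the polynomial `m² + p² + 1 - 2isp⁰`, which has no real zeros. -/
lemma exists_div_shiftDen (hm : 0 < m) {s : ℝ} (hs : s = 1 ∨ s = -1) (g : 𝓢(Mink d, ℂ)) :
    ∃ h : 𝓢(Mink d, ℂ), ∀ p, shiftDen m s 1 p * h p = g p := by
  set C : ℝ := 1 + 2 * m ^ 2 with hC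
  have hC0 : 0 < C := by positivity
  set L : Mink d →L[ℝ] WithLp 2 (ℝ × Mink d) :=
    ((WithLp.prodContinuousLinearEquiv 2 ℝ ℝ (Mink d)).symm : (ℝ × Mink d) →L[ℝ] WithLp 2 (ℝ × Mink d)) ∘L
      ContinuousLinearMap.inr ℝ ℝ (Mink d) with hL
  -- The squared modulus of the symbol is C + (m² + p²)² + 2‖p‖², with C = 1 + 2m². The vector y is
  -- built so that this equals C (1 + ‖y‖²), whence the reciprocal has temperate growth.
  set y : Mink d → WithLp 2 (ℝ × Mink d) := fun p =>
    ((√C)⁻¹ * (m ^ 2 + sq p)) • WithLp.toLp 2 ((1 : ℝ), (0 : Mink d)) + (√2 * (√C)⁻¹) • L p with hy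
  have hsq : (fun p : Mink d => sq p).HasTemperateGrowth := by
    have h1 := Complex.reCLM.hasTemperateGrowth.comp (hasTemperateGrowth_sq (d := d))
    exact h1
  have hyt : y.HasTemperateGrowth := by
    refine Function.HasTemperateGrowth.add ?_ ((√2 * (√C)⁻¹) • L).hasTemperateGrowth
    exact ((Function.HasTemperateGrowth.const _).mul ((Function.HasTemperateGrowth.const _).add hsq)).smul
      (Function.HasTemperateGrowth.const _)
  have hny : ∀ p, C * (1 + ‖y p‖ ^ 2) = C + (m ^ 2 + sq p) ^ 2 + 2 * ‖p‖ ^ 2 := fun p => by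
    rw [WithLp.prod_norm_sq_eq_of_L2]
    have e1 : (y p).fst = (√C)⁻¹ * (m ^ 2 + sq p) := by simp [hy, hL]
    have e2 : (y p).snd = (√2 * (√C)⁻¹) • p := by simp [hy, hL]
    rw [e1, e2, norm_smul, Real.norm_eq_abs, Real.norm_eq_abs, sq_abs, mul_pow, mul_pow, sq_abs, mul_pow, inv_pow, Real.sq_sqrt hC0.le,
      Real.sq_sqrt zero_le_two]
    field_simp
    ring
  set Q : Mink d → ℂ := fun p => ((C⁻¹ : ℝ) : ℂ) * (((1 + ‖y p‖ ^ 2) ^ (-1 : ℝ) : ℝ) : ℂ) *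
    (((m ^ 2 + 1 : ℝ) : ℂ) + (sq p : ℂ) + (2 * s * Complex.I) * (p 0 : ℂ)) with hQ
  have hQt : Q.HasTemperateGrowth := by
    refine Function.HasTemperateGrowth.mul ((Function.HasTemperateGrowth.const _).mul ?_)
      (((Function.HasTemperateGrowth.const _).add hasTemperateGrowth_sq).add
        ((Function.HasTemperateGrowth.const _).mul (hasTemperateGrowth_coord 0)))
    exact Complex.ofRealCLM.hasTemperateGrowth.comp ((Function.hasTemperateGrowth_one_add_norm_sq_rpow _ (-1)).comp hyt)
  refine ⟨SchwartzMap.smulLeftCLM ℂ Q g, fun p => ?_⟩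
  rw [SchwartzMap.smulLeftCLM_apply_apply hQt, smul_eq_mul, ← mul_assoc]
  have hn : (1 + ‖y p‖ ^ 2 : ℝ) ≠ 0 := by positivity
  have key : shiftDen m s 1 p * (((m ^ 2 + 1 : ℝ) : ℂ) + (sq p : ℂ) + (2 * s * Complex.I) * (p 0 : ℂ)) =
      ((C * (1 + ‖y p‖ ^ 2) : ℝ) : ℂ) := by
    have h1 : ‖p‖ ^ 2 = sq p + 2 * (p 0) ^ 2 := by rw [norm_sq_eq, sq_eq]; ring
    have h2 : (s : ℂ) ^ 2 = 1 := by exact_mod_cast sq_abs_one hs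
    rw [hny, h1, hC, shiftDen]
    push_cast
    linear_combination (-(4 * (s : ℂ) ^ 2 * (p 0 : ℂ) ^ 2)) * Complex.I_sq + (4 * (p 0 : ℂ) ^ 2) * h2
  have : shiftDen m s 1 p * Q p = 1 := by
    rw [hQ, mul_left_comm, key, Real.rpow_neg_one]
    have h3 : (C : ℂ) ≠ 0 := by exact_mod_cast hC0.ne'
    have h4 : ((1 + ‖y p‖ ^ 2 : ℝ) : ℂ) ≠ 0 := by exact_mod_cast hn
    push_cast at h4 ⊢
    field_simp
  rw [this, one_mul]

/-- The operator `e^{sx⁰}(m² - □)e^{-sx⁰}` is surjective on test functions. -/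
lemma exists_twisted (hm : 0 < m) {s : ℝ} (hs : s = 1 ∨ s = -1) (φ : 𝓢(Mink d, ℂ)) : ∃ ψ : 𝓢(Mink d, ℂ),
    kgOp m ψ - (2 * s : ℂ) • ∂_{EuclideanSpace.single (0 : Fin d) (1 : ℝ)} ψ + ψ = φ := by
  obtain ⟨h, hh⟩ := exists_div_shiftDen hm hs (ft d φ)
  set ψ : 𝓢(Mink d, ℂ) := 𝓕⁻ (SchwartzMap.compCLMOfContinuousLinearEquiv ℂ (lorentzEquiv d).symm h) with hψ
  have h1 : ft d ψ = h := by
    ext p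
    rw [ft_eq, hψ, FourierInvPair.fourier_fourierInv_eq]
    simp [SchwartzMap.compCLMOfContinuousLinearEquiv_apply]
  have hinj : Function.Injective (ft d) := fun f g hfg => by
    have h2 : 𝓕 f = 𝓕 g := by
      ext q
      have := DFunLike.congr_fun hfg ((lorentzEquiv d).symm q)
      rwa [ft_eq, ft_eq, ContinuousLinearEquiv.apply_symm_apply] at this
    have e := fun φ : 𝓢(Mink d, ℂ) => FourierPair.fourierInv_fourier_eq (F := 𝓢(Mink d, ℂ)) φ
    rw [← e f, h2, e]
  refine ⟨ψ, hinj ?_⟩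
  ext p
  have h3 : lorentz p (EuclideanSpace.single (0 : Fin d) (1 : ℝ)) = -p 0 := by
    rw [lorentz_eq]; simp [EuclideanSpace.inner_single_left]; ring
  rw [map_add, map_sub, map_smul, add_apply, sub_apply, smul_apply, ft_kgOp, ft_lineDeriv, h3, h1, ← hh, shiftDen, smul_eq_mul]
  push_cast
  ring

lemma lineDeriv_of_eq_exp_mul {s : ℝ} {f u : 𝓢(Mink d, ℂ)} (h : ∀ x : Mink d, -1 < s * x 0 → f x = Complex.exp (-(s * x 0 : ℝ)) * u x)
    (v : Mink d) : ∀ x : Mink d, -1 < s * x 0 → (∂_{v} f) x = Complex.exp (-(s * x 0 : ℝ)) * (∂_{v} u - ((s * v 0 : ℝ) : ℂ) • u) x := by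
  intro x hx
  have ho : ∀ᶠ t : ℝ in 𝓝 0, -1 < s * (x + t • v) 0 := by
    have hc : Continuous fun t : ℝ => s * (x + t • v) 0 := by fun_prop
    exact continuousAt_const.eventually_lt hc.continuousAt (by simpa using hx)
  have h1 : HasDerivAt (fun t : ℝ => f (x + t • v)) (Complex.exp (-(s * x 0 : ℝ)) * (∂_{v} u - ((s * v 0 : ℝ) : ℂ) • u) x) 0 := by
    have hu : HasDerivAt (fun t : ℝ => u (x + t • v)) ((∂_{v} u) x) 0 := by
      rw [SchwartzMap.lineDerivOp_apply]
      exact (u.differentiableAt.lineDifferentiableAt (v := v)).hasLineDerivAt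
    have he : HasDerivAt (fun t : ℝ => Complex.exp (-(s * (x + t • v) 0 : ℝ))) (Complex.exp (-(s * x 0 : ℝ)) * (-(s * v 0 : ℝ))) 0 := by
      have h2 : HasDerivAt (fun t : ℝ => -(s * (x + t • v) 0)) (-(s * v 0)) 0 := by
        have : (fun t : ℝ => -(s * (x + t • v) 0)) = fun t => -(s * x 0) + t * (-(s * v 0)) := by ext t; simp; ring
        rw [this]
        simpa using ((hasDerivAt_id (0 : ℝ)).mul_const (-(s * v 0))).const_add (-(s * x 0))
      have h3 := h2.ofReal_comp.cexp
      simpa using h3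
    refine ((he.fun_mul hu).congr_of_eventuallyEq (ho.mono fun t ht => h _ ht)).congr_deriv ?_
    simp only [sub_apply, smul_apply, smul_eq_mul, zero_smul, add_zero]
    push_cast; ring
  rw [SchwartzMap.lineDerivOp_apply]
  exact HasLineDerivAt.lineDeriv h1

/-- Conjugation by e^(-s x⁰) replaces ∂₀ by ∂₀ - s, and s² = 1. The identity is local, so it only
needs the relation between f and u on the open half space s x⁰ > -1. -/
lemma kgOp_of_eq_exp_mul {s : ℝ} (hs : s = 1 ∨ s = -1) {f u : 𝓢(Mink d, ℂ)}
    (h : ∀ x : Mink d, -1 < s * x 0 → f x = Complex.exp (-(s * x 0 : ℝ)) * u x) : ∀ x : Mink d, -1 < s * x 0 →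
      kgOp m f x = Complex.exp (-(s * x 0 : ℝ)) *
        (kgOp m u - (2 * s : ℂ) • ∂_{EuclideanSpace.single (0 : Fin d) (1 : ℝ)} u + u) x := by
  intro x hx
  have h2 : ∀ v : Mink d, (∂_{v} (∂_{v} f) : 𝓢(Mink d, ℂ)) x = Complex.exp (-(s * x 0 : ℝ)) *
      ((∂_{v} (∂_{v} u) : 𝓢(Mink d, ℂ)) x - 2 * ((s * v 0 : ℝ) : ℂ) * (∂_{v} u : 𝓢(Mink d, ℂ)) x + ((s * v 0 : ℝ) : ℂ) ^ 2 * u x) := fun v => by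
    rw [lineDeriv_of_eq_exp_mul (lineDeriv_of_eq_exp_mul h v) v x hx, sub_eq_add_neg (∂_{v} u), lineDerivOp_add, lineDerivOp_neg,
      lineDerivOp_smul]
    simp only [sub_apply, add_apply, neg_apply, smul_apply, smul_eq_mul]
    ring
  have h3 : ∀ i ∈ Finset.univ.erase (0 : Fin d), (∂_{EuclideanSpace.single i (1 : ℝ)} (∂_{EuclideanSpace.single i (1 : ℝ)} f) : 𝓢(Mink d, ℂ)) x =
      Complex.exp (-(s * x 0 : ℝ)) * (∂_{EuclideanSpace.single i (1 : ℝ)} (∂_{EuclideanSpace.single i (1 : ℝ)} u) : 𝓢(Mink d, ℂ)) x := fun i hi => by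
    rw [h2]; simp [(Finset.ne_of_mem_erase hi).symm]
  have h4 : (s : ℂ) ^ 2 = 1 := by exact_mod_cast sq_abs_one hs
  simp only [kgOp, sub_apply, add_apply, neg_apply, sum_apply, smul_apply, smul_eq_mul]
  rw [Finset.sum_congr rfl h3, ← Finset.mul_sum, h2, h x hx]
  simp only [PiLp.single_apply, if_true, mul_one]
  linear_combination Complex.exp (-(s * x 0 : ℝ)) * u x * h4

end

/-! ### Homogeneous solutions supported in a half space -/

section
-- The cutoff χ(2u+3) is 0 for u ≤ -2 and 1 for u ≥ -1, so the growing part of e^(-u) is removed and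
-- all derivatives of the exponential are at most e² on the rest.
lemma hasTemperateGrowth_cutoff_mul_exp {χ : ℝ → ℝ} (h : ContDiff ℝ ∞ χ) (h0 : ∀ t ≤ -1, χ t = 0) (h1 : ∀ t, 1 ≤ t → χ t = 1) :
    (fun u : ℝ => χ (2 * u + 3) * Real.exp (-u)).HasTemperateGrowth := by
  have hκ : (fun u : ℝ => χ (2 * u + 3)).HasTemperateGrowth :=
    (hasTemperateGrowth_cutoff h h0 h1).comp (((Function.HasTemperateGrowth.const 2).mul Function.HasTemperateGrowth.id').add
      (Function.HasTemperateGrowth.const 3))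
  have hexp : ContDiff ℝ ∞ fun u : ℝ => Real.exp (-u) := by fun_prop
  refine ⟨hκ.1.mul hexp, fun n => ?_⟩
  obtain ⟨k, C, hC, hb⟩ := hκ.norm_iteratedFDeriv_le_uniform n
  have hnexp : ∀ i (u : ℝ), ‖iteratedFDeriv ℝ i (fun u : ℝ => Real.exp (-u)) u‖ = Real.exp (-u) := fun i u => by
    have h2 := congrFun (iteratedDeriv_exp_const_mul i (-1)) u
    simp only [neg_one_mul] at h2
    rw [norm_iteratedFDeriv_eq_norm_iteratedDeriv, h2, norm_mul, norm_pow, norm_neg, norm_one, one_pow, one_mul,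
      Real.norm_of_nonneg (Real.exp_pos _).le]
  refine ⟨k, ∑ i ∈ Finset.range (n + 1), (n.choose i : ℝ) * C * Real.exp 2, fun u => ?_⟩
  rcases lt_or_ge u (-2) with hu | hu
  · have h2 : (fun u : ℝ => χ (2 * u + 3) * Real.exp (-u)) =ᶠ[𝓝 u] fun _ => 0 := by
      filter_upwards [Iio_mem_nhds hu] with v hv
      rw [h0 _ (by linarith [show v < -2 from hv]), zero_mul]
    rw [(h2.iteratedFDeriv ℝ n).eq_of_nhds]
    have h3 : iteratedFDeriv ℝ n (fun _ : ℝ => (0 : ℝ)) u = 0 := by simp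
    rw [h3, norm_zero]
    positivity
  · refine (norm_iteratedFDeriv_mul_le hκ.1 hexp u (by exact_mod_cast le_top)).trans ?_
    rw [Finset.sum_mul]
    refine Finset.sum_le_sum fun i hi => ?_
    rw [hnexp]
    calc _ ≤ (n.choose i : ℝ) * (C * (1 + ‖u‖) ^ k) * Real.exp 2 := by
          gcongr
          · exact hb i (Finset.mem_range_succ_iff.1 hi) u
          · linarith
      _ = _ := by ring

variable {d : ℕ} [NeZero d] {m : ℝ}

/-- A solution of the homogeneous Klein-Gordon equation supported in a half space `s x⁰ ≥ 0`
vanishes. -/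
theorem eq_zero_of_kg_eq_zero (hm : 0 < m) {s : ℝ} (hs : s = 1 ∨ s = -1) {D : 𝓢'(Mink d, ℂ)}
    (hD : ∀ φ, D (kgOp m φ) = 0) (hsupp : ∀ x ∈ Distribution.dsupport D, 0 ≤ s * x 0) : D = 0 := by
  obtain ⟨χ, h, h0, h1⟩ := exists_cutoff
  set e : ℝ → ℝ := fun u => χ (2 * u + 3) * Real.exp (-u) with he
  set g : ℝ → ℂ := fun t => (e (s * t) : ℂ) with hg
  have hexp : ∀ t : ℝ, -1 < s * t → g t = Complex.exp (-(s * t : ℝ)) := fun t ht => by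
    simp only [hg, he]
    rw [h1 _ (by linarith), one_mul, Complex.ofReal_exp, Complex.ofReal_neg]
  have hgt : g.HasTemperateGrowth :=
    Complex.ofRealCLM.hasTemperateGrowth.comp ((hasTemperateGrowth_cutoff_mul_exp h h0 h1).comp
      ((Function.HasTemperateGrowth.const s).mul Function.HasTemperateGrowth.id'))
  -- D is supported in s x⁰ ≥ 0, hence blind to functions that vanish for s x⁰ > -1; the gap keeps
  -- the two closed sets disjoint.
  have hpast : ∀ f : 𝓢(Mink d, ℂ), (∀ x : Mink d, -1 < s * x 0 → f x = 0) → D f = 0 := fun f hf => by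
    refine apply_eq_zero_of_disjoint D f (Set.disjoint_left.2 fun x hx hxD => ?_)
    have hcl : IsClosed {x : Mink d | s * x 0 ≤ -1} := isClosed_le (by fun_prop) continuous_const
    have hsub : tsupport f ⊆ {x : Mink d | s * x 0 ≤ -1} := closure_minimal (fun x hx => by
      by_contra hc
      exact hx (hf x (not_le.1 hc))) hcl
    have h2 : s * x 0 ≤ -1 := hsub hx
    linarith [hsupp x hxD]
  -- Solve the twisted equation for ψ. Then m² - □ applied to the weighted ψ agrees with the
  -- weighted φ for s x⁰ > -1, and D annihilates the former.
  have hweight : ∀ φ : 𝓢(Mink d, ℂ), D (timeMul d g φ) = 0 := fun φ => by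
    obtain ⟨ψ, hψ⟩ := exists_twisted hm hs φ
    have h2 : D (kgOp m (timeMul d g ψ) - timeMul d g φ) = 0 := hpast _ fun x hx => by
      rw [sub_apply, kgOp_of_eq_exp_mul hs (f := timeMul d g ψ) (u := ψ) (fun x hx => by rw [timeMul_apply hgt, hexp _ hx]) x hx,
        hψ, timeMul_apply hgt, hexp _ hx, sub_self]
    rwa [map_sub, hD, zero_sub, neg_eq_zero] at h2
  ext f
  refine apply_eq_zero_of_cutoff D f fun k hk _ => ?_
  -- A compactly supported k equals, for s x⁰ > -1, the weight times e^(s x⁰) k, which is again a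
  -- test function; density then gives D = 0.
  have hc : HasCompactSupport fun x : Mink d => Complex.exp ((s * x 0 : ℝ)) * k x := hk.mul_left
  have hcd : ContDiff ℝ ∞ fun x : Mink d => Complex.exp ((s * x 0 : ℝ)) * k x := by
    refine ContDiff.mul (ContDiff.cexp ?_) (k.smooth ⊤)
    exact Complex.ofRealCLM.contDiff.comp (contDiff_const.mul (EuclideanSpace.proj (0 : Fin d) : Mink d →L[ℝ] ℝ).contDiff)
  have h2 : D (k - timeMul d g (hc.toSchwartzMap hcd)) = 0 := hpast _ fun x hx => by
    rw [sub_apply, timeMul_apply hgt, hexp _ hx, HasCompactSupport.toSchwartzMap_toFun, ← mul_assoc, ← Complex.exp_add]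
    simp
  rwa [map_sub, hweight, sub_zero] at h2

/-- The difference of two Green functions solves the homogeneous equation and lives in the cone, in
particular in s x⁰ ≥ 0. -/
theorem isGreen_iff (hm : 0 < m) {s : ℝ} (hs : s = 1 ∨ s = -1) (T : 𝓢'(Mink d, ℂ)) : IsGreen m s T ↔ T = Gdist d m s := by
  refine ⟨fun hT => ?_, fun hT => hT ▸ ⟨kg_Gdist hm hs, dsupport_Gdist hm s⟩⟩
  rw [← sub_eq_zero]
  refine eq_zero_of_kg_eq_zero hm hs (fun φ => ?_) fun x hx => ?_
  · rw [sub_apply, ← kg_apply, ← kg_apply, hT.1, kg_Gdist hm hs, sub_self]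
  · by_contra hc
    have hx1 : x ∉ Distribution.dsupport T := fun h => hc (hT.2 h).2
    have hx2 : x ∉ Distribution.dsupport (Gdist d m s) := fun h => hc (dsupport_Gdist hm s h).2
    obtain ⟨U, hU, hUo, hxU⟩ := (Distribution.notMem_dsupport_iff (f := T) x).1 hx1
    obtain ⟨V, hV, hVo, hxV⟩ := (Distribution.notMem_dsupport_iff (f := Gdist d m s) x).1 hx2
    refine (Distribution.notMem_dsupport_iff (f := T - Gdist d m s) x).2 ⟨U ∩ V, fun φ hφ => ?_, hUo.inter hVo, hxU, hxV⟩ hx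
    rw [sub_apply, hU φ (hφ.trans Set.inter_subset_left), hV φ (hφ.trans Set.inter_subset_right), sub_self]

end

end KleinGordon

end

/-! ### The theorem -/

open KleinGordon in
theorem mainTheorem10 (d : ℕ) [NeZero d] (m : ℝ) (hm : 0 < m) (s : ℝ) (hs : s = 1 ∨ s = -1) :
    ∃ G : 𝓢'(Mink d, ℂ),
      -- `G` is the retarded / advanced Green function
      (∀ T : 𝓢'(Mink d, ℂ), IsGreen m s T ↔ T = G) ∧
      -- it is the Fourier integral with the `i0 sgn p⁰` prescription
      IsFourierPropagator m s G ∧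
      -- the formula in terms of the boundary values of `U_{d/2-1}`
      (∃ Wp Wm : 𝓢'(Mink d, ℂ), IsUBoundaryValue m 1 Wp ∧ IsUBoundaryValue m (-1) Wm ∧
        IsThetaMul s
          ((-Complex.I * ((Real.sqrt Real.pi * m ^ ((d : ℝ) - 2) /
            (4 * Real.pi) ^ ((d : ℝ) / 2) : ℝ) : ℂ)) • (Wm - Wp)) G) ∧
      -- the formula in terms of `𝐅_{1-d/2}`
      (∃ P : 𝓢'(Mink d, ℂ), IsMinusPowF m P ∧
        IsThetaMul s
          (((2 * Real.pi / (4 * Real.pi) ^ ((d : ℝ) / 2) : ℝ) : ℂ) • P) G) ∧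
      -- the decomposition into a singular and a regular part
      (Odd d → ∃ S R : 𝓢'(Mink d, ℂ), G = S + R ∧ IsOddSing m s S ∧ IsOddReg m s R) ∧
      (Even d → ∃ S R : 𝓢'(Mink d, ℂ), G = S + R ∧ IsEvenSing m s S ∧ IsEvenReg m s R) := by
  have hs0 : s ≠ 0 := by rcases hs with rfl | rfl <;> norm_num
  -- Both position space formulas are θ(s x⁰) times the same distribution `Tdist`.
  obtain ⟨P, hP, hPT⟩ := exists_isMinusPowF (d := d) hm
  refine ⟨Gdist d m s, isGreen_iff hm hs, isFourierPropagator_Gdist hm hs,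
    ⟨Wdist d m 1, Wdist d m (-1), isUBoundaryValue_Wdist hm (Or.inl rfl), isUBoundaryValue_Wdist hm (Or.inr rfl), ?_⟩,
    ⟨P, hP, ?_⟩,
    fun hd => ⟨singDist d m s, regDist d m s, Gdist_eq_add hm s, isOddSing_singDist hm hs0 hd, isOddReg_regDist hm s hd⟩,
    fun hd => ⟨singDist d m s, regDist d m s, Gdist_eq_add hm s, isEvenSing_singDist hm hs0 hd, isEvenReg_regDist hm s hd⟩⟩
  · rw [smul_Wdist_sub hm]
    exact isThetaMul_Tdist hm hs0
  · rw [hPT]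
    exact isThetaMul_Tdist hm hs0
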